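/- All knots are oriented and are considered up to isotopy in three-space. An \emph{espalier} is a tree $T$ with vertex set $\{1,\dots,n\}$, $n\ge 1$, which can be embedded in the lower half-plane $\{y\le 0\}\subset\mathbb{R}^2$ such that the vertex $j$ is mapped to $(j,0)$ and the interiors of the $n-1$ edges are mapped disjointly to $\{y<0\}$. For $1\le i<j\le n$ let $$a_{i,j}=(\sigma_i\sigma_{i+1}\cdots\sigma_{j-2})\,\sigma_{j-1}\,(\sigma_i\sigma_{i+1}\cdots\sigma_{j-2})^{-1}\in B_n ,$$ where $\sigma_1,\dots,\sigma_{n-1}$ are the Artin generators of the braid group $B_n$. The \emph{$T$-generators} are the $a_{i,j}$ for which $i<j$ are joined by an edge of $T$. A braid in $B_n$ is \emph{$T$-homogeneous} if it is represented by a word in the $T$-generators and their inverses in which each $T$-generator appears at least once and only with exponents of one sign (the sign may depend on the generator); it is \emph{$T$-positive} if it is represented by such a word in which all exponents are positive. Let $T_1$ and $T_2$ be espaliers with $n_1$ and $n_2$ vertices. Let $T_1*T_2$ be the graph on $\{1,\dots,n_1+n_2-1\}$ obtained by placing $T_2$ to the right of $T_1$ and identifying the last (right-most) vertex of $T_1$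 with the first (left-most) vertex of $T_2$. \textbf{Proposition.} The graph $T_1*T_2$ is an espalier, and for all knots $K_1$ and $K_2$: \begin{enumerate} \item If $K_1$ is the closure of a $T_1$-homogeneous braid and $K_2$ is the closure of a $T_2$-homogeneous braid, then the connected sum $K_1\# K_2$ is the closure of a $(T_1*T_2)$-homogeneous braid. \item If $K_1$ is the closure of a $T_1$-positive braid and $K_2$ is the closure of a $T_2$-positive braid, then the connected sum $K_1\# K_2$ is the closure of a $(T_1*T_2)$-positive braid. \end{enumerate} -/

import Mathlib

/-! ### Oriented polygonal links in three-space and their isotopy classes -/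

/-- Three-dimensional space (only its affine structure is used). -/
abbrev Space : Type := Fin 3 → ℝ

/-- An oriented polygonal link in `ℝ³`: a finite set of directed straight edges, in which every
vertex is the source of one edge and the target of one edge, and in which two different edges
meet at most in common end points. -/
@[ext]
structure PolygonalLink where
  edges : Set (Space × Space)
  finite : edges.Finite
  nondegenerate : ∀ e ∈ edges, e.1 ≠ e.2
  source_unique : ∀ e ∈ edges, ∀ f ∈ edges, e.1 = f.1 → e = f
  target_unique : ∀ e ∈ edges, ∀ f ∈ edges, e.2 = f.2 → e = f
  closed : ∀ e ∈ edges, ∃ f ∈ edges, f.1 = e.2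
  embedded : ∀ e ∈ edges, ∀ f ∈ edges, e ≠ f →
    segment ℝ e.1 e.2 ∩ segment ℝ f.1 f.2 ⊆ {e.1, e.2} ∩ {f.1, f.2}

namespace PolygonalLink

/-- The underlying point set of a link. -/
def carrier (L : PolygonalLink) : Set Space := ⋃ e ∈ L.edges, segment ℝ e.1 e.2

/-- A knot is a link with exactly one component: it is nonempty, and following the orientation
one gets from every edge to every other edge. -/
def IsKnot (L : PolygonalLink) : Prop :=
  L.edges.Nonempty ∧ ∀ e ∈ L.edges, ∀ f ∈ L.edges,
    Relation.ReflTransGen (fun a b => a ∈ L.edges ∧ b ∈ L.edges ∧ a.2 = b.1) e f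

/-- The elementary move (Δ-move) across a triangle `p q r` that meets the link exactly in its
edge `p q`: that edge is replaced by the two other sides. The case where `r` lies on the open
segment `p q` is the subdivision of an edge. -/
def DeltaMove (L L' : PolygonalLink) : Prop :=
  ∃ p q r : Space, (p, q) ∈ L.edges ∧
    convexHull ℝ {p, q, r} ∩ L.carrier = segment ℝ p q ∧
    L'.edges = (L.edges \ {(p, q)}) ∪ {(p, r), (r, q)}

/-- Isotopy of oriented polygonal links: the equivalence relation generated by Δ-moves. -/
def Isotopic : PolygonalLink → PolygonalLink → Prop := Relation.EqvGen DeltaMove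

/-- `K` is a connected sum of `K₁` and `K₂`: up to isotopy, `K₁` and `K₂` lie on the two sides of
a plane, each of them meets the plane exactly in one and the same edge, which the two traverse in
opposite directions, and `K` arises from their union by deleting that edge. -/
def IsConnectedSum (K₁ K₂ K : PolygonalLink) : Prop :=
  ∃ L₁ L₂ L : PolygonalLink, Isotopic K₁ L₁ ∧ Isotopic K₂ L₂ ∧ Isotopic K L ∧
    ∃ (f : Space →ₗ[ℝ] ℝ) (c : ℝ) (p q : Space), f ≠ 0 ∧
      (p, q) ∈ L₁.edges ∧ (q, p) ∈ L₂.edges ∧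
      (∀ v ∈ L₁.carrier, f v ≤ c) ∧ (∀ v ∈ L₂.carrier, c ≤ f v) ∧
      L₁.carrier ∩ {v | f v = c} = segment ℝ p q ∧
      L₂.carrier ∩ {v | f v = c} = segment ℝ p q ∧
      L.edges = (L₁.edges \ {(p, q)}) ∪ (L₂.edges \ {(q, p)})

end PolygonalLink

/-! ### Braid groups -/

/-- The Artin relations between `σ_0, …, σ_{m-1}`. -/
inductive ArtinRel (m : ℕ) : FreeGroup (Fin m) → Prop
  | far (i j : Fin m) (h : (i : ℕ) + 2 ≤ j) :
      ArtinRel m (.of i * .of j * (.of j * .of i)⁻¹)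
  | braid (i j : Fin m) (h : (i : ℕ) + 1 = j) :
      ArtinRel m (.of i * .of j * .of i * (.of j * .of i * .of j)⁻¹)

/-- `Braid m` is the braid group on `m + 1` strands. The strands are numbered `0, …, m`, and the
Artin generator `σ i` exchanges the strands in positions `i` and `i + 1`. -/
abbrev Braid (m : ℕ) : Type := PresentedGroup {x | ArtinRel m x}

namespace Braid

/-- The Artin generators. -/
def σ {m : ℕ} (i : Fin m) : Braid m := PresentedGroup.of i

/-- The band generator (Birman–Ko–Lee generator) for `i < j`,
`a i j = (σ_i σ_{i+1} ⋯ σ_{j-2}) σ_{j-1} (σ_i σ_{i+1} ⋯ σ_{j-2})⁻¹`. -/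
def band {m : ℕ} (i j : Fin (m + 1)) (h : i < j) : Braid m :=
  let c : Braid m :=
    (((List.finRange m).filter fun k : Fin m => (i : ℕ) ≤ k ∧ (k : ℕ) + 2 ≤ j).map σ).prod
  c * σ ⟨(j : ℕ) - 1, by have := j.isLt; have : (i : ℕ) < j := h; omega⟩ * c⁻¹

/-- A word in the Artin generators and their inverses; `(i, true)` stands for `σ i` and
`(i, false)` for its inverse. -/
abbrev ArtinWord (m : ℕ) : Type := List (Fin m × Bool)

/-- The braid represented by an Artin word. -/
def ofArtinWord {m : ℕ} (w : ArtinWord m) : Braid m :=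
  (w.map fun a => if a.2 then σ a.1 else (σ a.1)⁻¹).prod

/-- A letter `a_{i,j}` (if `positive`) or its inverse (otherwise), where `i < j`. -/
structure BandLetter (m : ℕ) where
  i : Fin (m + 1)
  j : Fin (m + 1)
  lt : i < j
  positive : Bool

/-- The braid represented by a word in the band generators and their inverses. -/
def ofBandWord {m : ℕ} (w : List (BandLetter m)) : Braid m :=
  (w.map fun a => if a.positive then band a.i a.j a.lt else (band a.i a.j a.lt)⁻¹).prod

/-! ### The closure of a braid -/

/-- The point with the given coordinates. -/
def pt (x y z : ℝ) : Space := ![x, y, z]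

/-- The directed edges of the polygonal closure of an Artin word of length `ℓ`. The strand in
position `j` runs at `x = j`, the `k`-th letter is realised in `k ≤ y ≤ k + 1`, and `z` is the
height. At a letter `σ i` the strand from position `i` to position `i + 1` passes above the strand
from `i + 1` to `i`; at an inverse letter the strand from `i + 1` to `i` is the upper one. Seen
from above, a letter `σ i` gives a positive crossing. The strand ending at `(j, ℓ, 0)` is closed
up with the strand starting at `(j, 0, 0)` below the braid, inside the plane `x = j`. -/
inductive ClosureEdge {m : ℕ} (w : ArtinWord m) : Space → Space → Prop
  | straight (k : ℕ) (hk : k < w.length) (j : Fin (m + 1))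
      (h₁ : j ≠ w[k].1.castSucc) (h₂ : j ≠ w[k].1.succ) :
      ClosureEdge w (pt (j : ℕ) k 0) (pt (j : ℕ) (k + 1) 0)
  | overIn (k : ℕ) (hk : k < w.length) :
      ClosureEdge w (pt ((w[k].1 : ℕ) + if w[k].2 then 0 else 1) k 0)
        (pt ((w[k].1 : ℕ) + 1 / 2) (k + 1 / 2) 1)
  | overOut (k : ℕ) (hk : k < w.length) :
      ClosureEdge w (pt ((w[k].1 : ℕ) + 1 / 2) (k + 1 / 2) 1)
        (pt ((w[k].1 : ℕ) + if w[k].2 then 1 else 0) (k + 1) 0)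
  | under (k : ℕ) (hk : k < w.length) :
      ClosureEdge w (pt ((w[k].1 : ℕ) + if w[k].2 then 1 else 0) k 0)
        (pt ((w[k].1 : ℕ) + if w[k].2 then 0 else 1) (k + 1) 0)
  | down (j : Fin (m + 1)) :
      ClosureEdge w (pt (j : ℕ) w.length 0) (pt (j : ℕ) (w.length + 1) (-1))
  | back (j : Fin (m + 1)) :
      ClosureEdge w (pt (j : ℕ) (w.length + 1) (-1)) (pt (j : ℕ) (-1) (-1))
  | up (j : Fin (m + 1)) :
      ClosureEdge w (pt (j : ℕ) (-1) (-1)) (pt (j : ℕ) 0 0)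

theorem pt_inj {x y z x' y' z' : ℝ} : pt x y z = pt x' y' z' ↔ x = x' ∧ y = y' ∧ z = z' := by
  simp [pt]

theorem closureEdge_finite {m : ℕ} (w : ArtinWord m) :
    {e : Space × Space | ClosureEdge w e.1 e.2}.Finite := by
  have hfin : (⋃ k : Fin w.length,
      ((Set.range fun j : Fin (m + 1) =>
          ((pt (j : ℕ) (k : ℕ) 0, pt (j : ℕ) ((k : ℕ) + 1) 0) : Space × Space)) ∪
        {(pt ((w[k].1 : ℕ) + if w[k].2 then 0 else 1) (k : ℕ) 0,
          pt ((w[k].1 : ℕ) + 1 / 2) ((k : ℕ) + 1 / 2) 1),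
         (pt ((w[k].1 : ℕ) + 1 / 2) ((k : ℕ) + 1 / 2) 1,
          pt ((w[k].1 : ℕ) + if w[k].2 then 1 else 0) ((k : ℕ) + 1) 0),
         (pt ((w[k].1 : ℕ) + if w[k].2 then 1 else 0) (k : ℕ) 0,
          pt ((w[k].1 : ℕ) + if w[k].2 then 0 else 1) ((k : ℕ) + 1) 0)})).Finite :=
    Set.finite_iUnion fun k => (Set.finite_range _).union (Set.toFinite _)
  have hfin' : (⋃ j : Fin (m + 1),
      ({(pt (j : ℕ) w.length 0, pt (j : ℕ) (w.length + 1) (-1)),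
        (pt (j : ℕ) (w.length + 1) (-1), pt (j : ℕ) (-1) (-1)),
        (pt (j : ℕ) (-1) (-1), pt (j : ℕ) 0 0)} : Set (Space × Space))).Finite :=
    Set.finite_iUnion fun j => Set.toFinite _
  refine (hfin.union hfin').subset ?_
  rintro ⟨p, q⟩ h
  simp only [Set.mem_ofPred_eq] at h
  cases h with
  | straight k hk j h₁ h₂ =>
    exact Or.inl (Set.mem_iUnion.2 ⟨⟨k, hk⟩, Or.inl ⟨j, rfl⟩⟩)
  | overIn k hk => exact Or.inl (Set.mem_iUnion.2 ⟨⟨k, hk⟩, Or.inr (Or.inl rfl)⟩)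
  | overOut k hk => exact Or.inl (Set.mem_iUnion.2 ⟨⟨k, hk⟩, Or.inr (Or.inr (Or.inl rfl))⟩)
  | under k hk => exact Or.inl (Set.mem_iUnion.2 ⟨⟨k, hk⟩, Or.inr (Or.inr (Or.inr rfl))⟩)
  | down j => exact Or.inr (Set.mem_iUnion.2 ⟨j, Or.inl rfl⟩)
  | back j => exact Or.inr (Set.mem_iUnion.2 ⟨j, Or.inr (Or.inl rfl)⟩)
  | up j => exact Or.inr (Set.mem_iUnion.2 ⟨j, Or.inr (Or.inr rfl)⟩)

/-- Every point `(j, k, 0)` with `k ≤ ℓ` is the source of an edge. -/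
theorem exists_closureEdge {m : ℕ} (w : ArtinWord m) (k : ℕ) (hk : k ≤ w.length)
    (j : Fin (m + 1)) : ∃ q, ClosureEdge w (pt (j : ℕ) k 0) q := by
  rcases hk.eq_or_lt with rfl | hk
  · exact ⟨_, .down j⟩
  by_cases h₁ : j = w[k].1.castSucc
  · cases hb : w[k].2 with
    | true => have := ClosureEdge.overIn (w := w) k hk; simp only [hb] at this
              exact ⟨_, by simpa [h₁] using this⟩
    | false => have := ClosureEdge.under (w := w) k hk; simp only [hb] at this
               exact ⟨_, by simpa [h₁] using this⟩
  by_cases h₂ : j = w[k].1.succ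
  · cases hb : w[k].2 with
    | true => have := ClosureEdge.under (w := w) k hk; simp only [hb] at this
              exact ⟨_, by simpa [h₂] using this⟩
    | false => have := ClosureEdge.overIn (w := w) k hk; simp only [hb] at this
               exact ⟨_, by simpa [h₂] using this⟩
  exact ⟨_, .straight k hk j h₁ h₂⟩

/-- The position of the points `(x, y, z)` of the open edges of the closure. -/
inductive OpenEdge {m : ℕ} (w : ArtinWord m) (x y z : ℝ) : Space → Space → Prop
  | straight (k : ℕ) (hk : k < w.length) (j : Fin (m + 1))
      (h₁ : j ≠ w[k].1.castSucc) (h₂ : j ≠ w[k].1.succ)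
      (hx : x = (j : ℕ)) (hy : k < y) (hy' : y < k + 1) (hz : z = 0) :
      OpenEdge w x y z (pt (j : ℕ) k 0) (pt (j : ℕ) (k + 1) 0)
  | overIn (k : ℕ) (hk : k < w.length)
      (hy : k < y) (hy' : y < k + 1 / 2) (hz : 0 < z) (hz' : z < 1) :
      OpenEdge w x y z (pt ((w[k].1 : ℕ) + if w[k].2 then 0 else 1) k 0)
        (pt ((w[k].1 : ℕ) + 1 / 2) (k + 1 / 2) 1)
  | overOut (k : ℕ) (hk : k < w.length)
      (hy : k + 1 / 2 < y) (hy' : y < k + 1) (hz : 0 < z) (hz' : z < 1) :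
      OpenEdge w x y z (pt ((w[k].1 : ℕ) + 1 / 2) (k + 1 / 2) 1)
        (pt ((w[k].1 : ℕ) + if w[k].2 then 1 else 0) (k + 1) 0)
  | under (k : ℕ) (hk : k < w.length)
      (hx : (w[k].1 : ℕ) < x) (hx' : x < (w[k].1 : ℕ) + 1)
      (hy : k < y) (hy' : y < k + 1) (hz : z = 0) :
      OpenEdge w x y z (pt ((w[k].1 : ℕ) + if w[k].2 then 1 else 0) k 0)
        (pt ((w[k].1 : ℕ) + if w[k].2 then 0 else 1) (k + 1) 0)
  | down (j : Fin (m + 1)) (hx : x = (j : ℕ)) (hy : w.length < y) (hz : -1 < z) (hz' : z < 0) :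
      OpenEdge w x y z (pt (j : ℕ) w.length 0) (pt (j : ℕ) (w.length + 1) (-1))
  | back (j : Fin (m + 1)) (hx : x = (j : ℕ)) (hy : -1 < y) (hy' : y < w.length + 1)
      (hz : z = -1) :
      OpenEdge w x y z (pt (j : ℕ) (w.length + 1) (-1)) (pt (j : ℕ) (-1) (-1))
  | up (j : Fin (m + 1)) (hx : x = (j : ℕ)) (hy : y < 0) (hz : -1 < z) (hz' : z < 0) :
      OpenEdge w x y z (pt (j : ℕ) (-1) (-1)) (pt (j : ℕ) 0 0)

theorem ClosureEdge.openEdge {m : ℕ} {w : ArtinWord m} {p q v : Space} (h : ClosureEdge w p q)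
    (hv : v ∈ openSegment ℝ p q) : OpenEdge w (v 0) (v 1) (v 2) p q := by
  obtain ⟨a, b, ha, hb, hab, rfl⟩ := hv
  obtain rfl : a = 1 - b := by linarith
  have hl : (0 : ℝ) ≤ w.length := Nat.cast_nonneg _
  have hlb : (0 : ℝ) ≤ w.length * b := mul_nonneg hl hb.le
  have hla : (0 : ℝ) ≤ w.length * (1 - b) := mul_nonneg hl ha.le
  cases h with
  | straight k hk j h₁ h₂ =>
    refine .straight k hk j h₁ h₂ ?_ ?_ ?_ ?_ <;> simp [pt] <;> linarith
  | overIn k hk => refine .overIn k hk ?_ ?_ ?_ ?_ <;> simp [pt] <;> linarith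
  | overOut k hk => refine .overOut k hk ?_ ?_ ?_ ?_ <;> simp [pt] <;> linarith
  | under k hk =>
    refine .under k hk ?_ ?_ ?_ ?_ ?_ <;> simp [pt] <;> (try split_ifs) <;> linarith
  | down j => refine .down j ?_ ?_ ?_ ?_ <;> simp [pt] <;> linarith
  | back j => refine .back j ?_ ?_ ?_ ?_ <;> simp [pt] <;> linarith
  | up j => refine .up j ?_ ?_ ?_ ?_ <;> simp [pt] <;> linarith

theorem level_unique {k l : ℕ} {y : ℝ} (h₁ : k < y) (h₂ : y < k + 1) (h₃ : l < y)
    (h₄ : y < l + 1) : k = l := by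
  have h : (k : ℝ) < l + 1 := by linarith
  have h' : (l : ℝ) < k + 1 := by linarith
  norm_cast at h h'
  omega

theorem OpenEdge.unique {m : ℕ} {w : ArtinWord m} {x y z : ℝ} {p q p' q' : Space}
    (h : OpenEdge w x y z p q) (h' : OpenEdge w x y z p' q') : p = p' ∧ q = q' := by
  have key : ∀ {k : ℕ} (_ : k < w.length), (0 : ℝ) ≤ k ∧ (k : ℝ) + 1 ≤ w.length := fun hk =>
    ⟨Nat.cast_nonneg _, by exact_mod_cast hk⟩
  cases h with
  | straight k hk j h₁ h₂ hx hy hy' hz =>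
    cases h' with
    | straight l hl i g₁ g₂ gx gy gy' gz =>
      obtain rfl := level_unique hy hy' gy gy'
      obtain rfl : j = i := by rw [hx] at gx; exact Fin.ext (by exact_mod_cast gx)
      exact ⟨rfl, rfl⟩
    | under l hl gx gx' gy gy' gz =>
      rw [hx] at gx gx'
      norm_cast at gx gx'
      omega
    | _ => exfalso; linarith
  | under k hk hx hx' hy hy' hz =>
    cases h' with
    | straight l hl i g₁ g₂ gx gy gy' gz =>
      rw [gx] at hx hx'
      norm_cast at hx hx'
      omega
    | under l hl gx gx' gy gy' gz =>
      obtain rfl := level_unique hy hy' gy gy'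
      exact ⟨rfl, rfl⟩
    | _ => exfalso; linarith
  | overIn k hk hy hy' hz hz' =>
    cases h' with
    | overIn l hl gy gy' gz gz' =>
      obtain rfl := level_unique hy (by linarith) gy (by linarith)
      exact ⟨rfl, rfl⟩
    | overOut l hl gy gy' gz gz' =>
      obtain rfl := level_unique hy (by linarith) (by linarith) gy'
      exfalso; linarith
    | _ => exfalso; linarith
  | overOut k hk hy hy' hz hz' =>
    cases h' with
    | overIn l hl gy gy' gz gz' =>
      obtain rfl := level_unique (by linarith) hy' gy (by linarith)
      exfalso; linarith
    | overOut l hl gy gy' gz gz' =>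
      obtain rfl := level_unique (by linarith) hy' (by linarith) gy'
      exact ⟨rfl, rfl⟩
    | _ => exfalso; linarith
  | down j hx hy hz hz' =>
    cases h' with
    | down i gx gy gz gz' =>
      obtain rfl : j = i := by rw [hx] at gx; exact Fin.ext (by exact_mod_cast gx)
      exact ⟨rfl, rfl⟩
    | up i gx gy gz gz' =>
      have : (0 : ℝ) ≤ w.length := Nat.cast_nonneg _
      exfalso; linarith
    | _ => exfalso; linarith
  | back j hx hy hy' hz =>
    cases h' with
    | back i gx gy gy' gz =>
      obtain rfl : j = i := by rw [hx] at gx; exact Fin.ext (by exact_mod_cast gx)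
      exact ⟨rfl, rfl⟩
    | _ => exfalso; linarith
  | up j hx hy hz hz' =>
    cases h' with
    | up i gx gy gz gz' =>
      obtain rfl : j = i := by rw [hx] at gx; exact Fin.ext (by exact_mod_cast gx)
      exact ⟨rfl, rfl⟩
    | down i gx gy gz gz' =>
      have : (0 : ℝ) ≤ w.length := Nat.cast_nonneg _
      exfalso; linarith
    | _ => exfalso; linarith

/-- The vertices of the closure. -/
inductive IsVertex {m : ℕ} (w : ArtinWord m) : Space → Prop
  | level (x : ℝ) (k : ℕ) : IsVertex w (pt x k 0)
  | top (x y : ℝ) : IsVertex w (pt x y 1)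
  | low₁ (x : ℝ) : IsVertex w (pt x (w.length + 1) (-1))
  | low₂ (x : ℝ) : IsVertex w (pt x (-1) (-1))

theorem ClosureEdge.isVertex {m : ℕ} {w : ArtinWord m} {p q : Space} (h : ClosureEdge w p q) :
    IsVertex w p ∧ IsVertex w q := by
  have hz (x : ℝ) : IsVertex w (pt x 0 0) := by simpa using IsVertex.level (w := w) x 0
  have hs (x : ℝ) (k : ℕ) : IsVertex w (pt x (k + 1) 0) := by
    simpa using IsVertex.level (w := w) x (k + 1)
  cases h <;> constructor <;> first | exact hz _ | exact hs _ _ | constructor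

theorem IsVertex.not_openEdge {m : ℕ} {w : ArtinWord m} {v p q : Space} (h : IsVertex w v) :
    ¬ OpenEdge w (v 0) (v 1) (v 2) p q := by
  intro h'
  have hl : (0 : ℝ) ≤ w.length := Nat.cast_nonneg _
  cases h <;> cases h' <;> simp only [pt, Matrix.cons_val] at * <;> try linarith
  all_goals
    rename_i hy hy' _
    norm_cast at hy hy'
    omega

theorem ne_of_straight {m : ℕ} {w : ArtinWord m} {k : ℕ} {hk : k < w.length} {j : Fin (m + 1)}
    (h₁ : j ≠ w[k].1.castSucc) (h₂ : j ≠ w[k].1.succ) :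
    ((j : ℕ) : ℝ) ≠ (w[k].1 : ℕ) + (if w[k].2 then 0 else 1) ∧
      ((j : ℕ) : ℝ) ≠ (w[k].1 : ℕ) + (if w[k].2 then 1 else 0) := by
  have g₁ : (j : ℕ) ≠ w[k].1 := fun h => h₁ (Fin.ext h)
  have g₂ : (j : ℕ) ≠ w[k].1 + 1 := fun h => h₂ (Fin.ext h)
  cases w[k].2 <;> simp <;> constructor <;> norm_cast

theorem ite_ne {n : ℕ} {b : Bool} :
    ((n : ℝ) + if b then 0 else 1) ≠ n + if b then 1 else 0 := by
  cases b <;> simp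

theorem ClosureEdge.source_unique {m : ℕ} {w : ArtinWord m} {p q q' : Space}
    (h : ClosureEdge w p q) (h' : ClosureEdge w p q') : q = q' := by
  have hl : (0 : ℝ) ≤ w.length := Nat.cast_nonneg _
  generalize hp : p = p' at h'
  cases h <;> cases h' <;> simp only [pt_inj] at hp ⊢ <;> obtain ⟨hx, hy, hz⟩ := hp
  all_goals try (exfalso; linarith)
  all_goals try norm_cast at hy
  all_goals try omega
  all_goals try subst hy
  all_goals try (exact absurd hx (ne_of_straight ‹_› ‹_›).1)
  all_goals try (exact absurd hx (ne_of_straight ‹_› ‹_›).2)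
  all_goals try (exact absurd hx.symm (ne_of_straight ‹_› ‹_›).1)
  all_goals try (exact absurd hx.symm (ne_of_straight ‹_› ‹_›).2)
  all_goals try (exact absurd hx ite_ne)
  all_goals try (exact absurd hx.symm ite_ne)
  all_goals try simp [hx]
  obtain rfl := Nat.cast_injective (R := ℝ) (add_right_cancel hy)
  simp

theorem ClosureEdge.target_unique {m : ℕ} {w : ArtinWord m} {p p' q : Space}
    (h : ClosureEdge w p q) (h' : ClosureEdge w p' q) : p = p' := by
  have hl : (0 : ℝ) ≤ w.length := Nat.cast_nonneg _
  generalize hq : q = q' at h'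
  cases h <;> cases h' <;> simp only [pt_inj] at hq ⊢ <;> obtain ⟨hx, hy, hz⟩ := hq
  all_goals try (exfalso; linarith)
  all_goals try norm_cast at hy
  all_goals try (obtain rfl := Nat.succ_injective hy)
  all_goals try (exact absurd hx (ne_of_straight ‹_› ‹_›).1)
  all_goals try (exact absurd hx (ne_of_straight ‹_› ‹_›).2)
  all_goals try (exact absurd hx.symm (ne_of_straight ‹_› ‹_›).1)
  all_goals try (exact absurd hx.symm (ne_of_straight ‹_› ‹_›).2)
  all_goals try (exact absurd hx ite_ne)
  all_goals try (exact absurd hx.symm ite_ne)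
  all_goals try simp [hx]
  obtain rfl := Nat.cast_injective (R := ℝ) (add_right_cancel hy)
  simp

/-- The closure of (the geometric braid described by) an Artin word. -/
def closure {m : ℕ} (w : ArtinWord m) : PolygonalLink where
  edges := {e | ClosureEdge w e.1 e.2}
  finite := closureEdge_finite w
  nondegenerate := by
    rintro ⟨p, q⟩ h
    simp only [Set.mem_ofPred_eq] at h
    have hl : (0 : ℝ) ≤ w.length := Nat.cast_nonneg _
    cases h <;> simp only [ne_eq, pt_inj] <;> rintro ⟨-, h₁, h₂⟩ <;> linarith
  source_unique := by
    rintro ⟨p, q⟩ h ⟨p', q'⟩ h' rfl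
    exact congrArg _ (ClosureEdge.source_unique h h')
  target_unique := by
    rintro ⟨p, q⟩ h ⟨p', q'⟩ h' rfl
    exact congrArg (·, _) (ClosureEdge.target_unique h h')
  closed := by
    rintro ⟨p, q⟩ h
    simp only [Set.mem_ofPred_eq] at h
    have hE (k : ℕ) (hk : k ≤ w.length) (j : Fin (m + 1)) (v : Space)
        (hv : pt (j : ℕ) k 0 = v) : ∃ f ∈ {e : Space × Space | ClosureEdge w e.1 e.2}, f.1 = v := by
      obtain ⟨r, hr⟩ := exists_closureEdge w k hk j
      exact ⟨(_, r), hr, hv⟩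
    cases h with
    | straight k hk j h₁ h₂ => exact hE (k + 1) hk j _ (by simp)
    | overIn k hk => exact ⟨(_, _), .overOut k hk, rfl⟩
    | overOut k hk =>
      cases hb : w[k].2 with
      | true => exact hE (k + 1) hk w[k].1.succ _ (by simp)
      | false => exact hE (k + 1) hk w[k].1.castSucc _ (by simp)
    | under k hk =>
      cases hb : w[k].2 with
      | true => exact hE (k + 1) hk w[k].1.castSucc _ (by simp)
      | false => exact hE (k + 1) hk w[k].1.succ _ (by simp)
    | down j => exact ⟨(_, _), .back j, rfl⟩
    | back j => exact ⟨(_, _), .up j, rfl⟩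
    | up j => exact hE 0 (Nat.zero_le _) j _ (by simp)
  embedded := by
    rintro ⟨p, q⟩ h ⟨p', q'⟩ h' hne v ⟨hv, hv'⟩
    simp only [Set.mem_ofPred_eq] at h h' hv hv'
    rw [← insert_endpoints_openSegment] at hv hv'
    have hvert {a b u : Space} (hab : ClosureEdge w a b) (hu : u = a ∨ u = b) : IsVertex w u := by
      rcases hu with rfl | rfl
      exacts [hab.isVertex.1, hab.isVertex.2]
    simp only [Set.mem_insert_iff, ← or_assoc] at hv hv'
    simp only [Set.mem_inter_iff, Set.mem_insert_iff, Set.mem_singleton_iff]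
    rcases hv with hv | hv <;> rcases hv' with hv' | hv'
    · exact ⟨hv, hv'⟩
    · exact ((hvert h hv).not_openEdge (h'.openEdge hv')).elim
    · exact ((hvert h' hv').not_openEdge (h.openEdge hv)).elim
    · obtain ⟨rfl, rfl⟩ := (h.openEdge hv).unique (h'.openEdge hv')
      exact (hne rfl).elim

/-- The link `L` is (isotopic to) the closure of the braid `β`. -/
def IsClosure {m : ℕ} (β : Braid m) (L : PolygonalLink) : Prop :=
  ∃ w : ArtinWord m, ofArtinWord w = β ∧ PolygonalLink.Isotopic L (closure w)

end Braid

/-! ### Espaliers -/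

/-- An espalier with `m + 1` vertices, given by its graph on the vertices `0, …, m`: it is a tree
which can be drawn in the lower half-plane such that the vertices are placed in order at the
points `(1, 0), …, (m + 1, 0)` and the interiors of the edges are disjoint arcs in `{y < 0}`. The
edge between `i < j` is drawn by the arc `γ i j`. -/
def IsEspalier {m : ℕ} (T : SimpleGraph (Fin (m + 1))) : Prop :=
  T.IsTree ∧ ∃ γ : Fin (m + 1) → Fin (m + 1) → ℝ → ℝ × ℝ,
    (∀ i j, i < j → T.Adj i j →
      ContinuousOn (γ i j) (Set.Icc 0 1) ∧ Set.InjOn (γ i j) (Set.Icc 0 1) ∧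
      γ i j 0 = (((i : ℕ) : ℝ) + 1, 0) ∧ γ i j 1 = (((j : ℕ) : ℝ) + 1, 0) ∧
      ∀ t ∈ Set.Ioo (0 : ℝ) 1, (γ i j t).2 < 0) ∧
    ∀ i j k l, i < j → T.Adj i j → k < l → T.Adj k l → (i, j) ≠ (k, l) →
      Disjoint (γ i j '' Set.Ioo 0 1) (γ k l '' Set.Ioo 0 1)

/-- The vertex sum `T₁ * T₂`: the graphs are placed next to each other and the last vertex of `T₁`
is identified with the first vertex of `T₂`. -/
def vertexSum {m₁ m₂ : ℕ} (T₁ : SimpleGraph (Fin (m₁ + 1))) (T₂ : SimpleGraph (Fin (m₂ + 1))) :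
    SimpleGraph (Fin (m₁ + m₂ + 1)) :=
  T₁.map (Fin.castLEEmb (by omega)) ⊔ T₂.map (Fin.natAddEmb m₁ : Fin (m₂ + 1) ↪ Fin (m₁ + m₂ + 1))

namespace Braid

/-- A `T`-homogeneous word: a word in the `T`-generators and their inverses in which every
`T`-generator appears, and each only with one sign. -/
def IsHomogeneousWord {m : ℕ} (T : SimpleGraph (Fin (m + 1))) (w : List (BandLetter m)) : Prop :=
  (∀ a ∈ w, T.Adj a.i a.j) ∧
  (∀ i j, i < j → T.Adj i j → ∃ a ∈ w, a.i = i ∧ a.j = j) ∧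
  ∀ a ∈ w, ∀ b ∈ w, a.i = b.i → a.j = b.j → a.positive = b.positive

/-- A braid is `T`-homogeneous if it is represented by a `T`-homogeneous word. -/
def IsHomogeneous {m : ℕ} (T : SimpleGraph (Fin (m + 1))) (β : Braid m) : Prop :=
  ∃ w, IsHomogeneousWord T w ∧ ofBandWord w = β

/-- A braid is `T`-positive if it is represented by a `T`-homogeneous word all of whose letters
are positive. -/
def IsPositive {m : ℕ} (T : SimpleGraph (Fin (m + 1))) (β : Braid m) : Prop :=
  ∃ w, IsHomogeneousWord T w ∧ (∀ a ∈ w, a.positive = true) ∧ ofBandWord w = β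

end Braid

section

open Set

/-! ### Basic facts on polygonal links -/

/-! Shift the word for `K₂` by `m₁` strands and append it to the word for `K₁`. The new word uses
exactly the generators of the vertex sum, each with the sign it had before
(`IsHomogeneousWord.sumWord`), and its closure is a connected sum of the two closures, since the two
blocks share only the strand in position `m₁`. It remains to draw the vertex sum, to see the
connected sum geometrically, and to show that every other connected sum of the two knots is isotopic
to this one.

The drawing: the two given drawings are squeezed into the open half-planes to the left and to the
right of the common vertex, with the vertices kept in place up to translation
(`IsEspalier.vertexSum`).

The connected sum (`IsSplit.isConnectedSum`): a vertical plane `D x + y = const` with `D` large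
leaves all strands left of `m₁` on one side and all strands right of `m₁` on the other. It meets
strand `m₁` once between the two blocks and once on its way back below the braid. Cutting there
gives two links. The left one is the closure of the first word with some trivial pieces of strand
attached, and these are pushed in by the explicit map `shorten`. The right one is the left one of
the picture after a half-turn and a reversal of orientation.

Uniqueness (`IsConnectedSum.isotopic`) takes most of the work. One summand is regarded as a
`LocalKnot` that is inserted, in a small affine copy, into an edge of the other. The isotopy class
of the result does not depend on: - the placement along the edge, because the matrices of positive
determinant with a prescribed image ray are path connected (`joinedIn_ray`) and insertions vary
locally constantly (`IsPlacement.eventually_isotopic`); - the edge, because a small knot slides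
around a corner (`insertionEquiv_succ`) and a knot has one component; - the host up to isotopy,
because a Δ-move can be followed by the inserted copy (`insertionEquiv_deltaMove`,
`insertionEquiv_deltaMove_self`). A sum along a plane is such an insertion once its common edge has
been prolonged at both ends (`IsPlaneSum.exists_isInsertion`). Two plane sums of the same knots are
compared through a hybrid sum: an affine copy of the second summand of one is attached to the first
summand of the other. Each of the two comparisons changes only one summand, which is then taken as
the host (`IsPlaneSum.isotopic`).

All isotopies that are not single Δ-moves come from one principle: a small displacement of the
vertices does not change the isotopy class (`eventually_isotopic_perturbation`), so the class is
constant along a continuous motion through links (`isotopic_of_motion`). -/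

theorem segment_inter_subset {a b c : Space} (h₁ : a ∉ segment ℝ b c) (h₂ : c ∉ segment ℝ a b) :
    segment ℝ a b ∩ segment ℝ b c ⊆ {b} := by
  rintro x ⟨⟨a₁, b₁, ha₁, hb₁, hab₁, rfl⟩, ⟨a₂, b₂, ha₂, hb₂, hab₂, hx⟩⟩
  rcases ha₁.eq_or_lt with rfl | ha₁'
  · simp [show b₁ = 1 by linarith]
  rcases hb₂.eq_or_lt with rfl | hb₂'
  · rw [← hx]; simp [show a₂ = 1 by linarith]
  exfalso
  -- A common point other than `b` makes both segments leave `b` in the same direction. The far end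
  -- of the shorter one then lies on the other.
  rcases le_total a₁ b₂ with h | h
  · refine h₂ ⟨a₁ / b₂, (b₁ - a₂) / b₂, by positivity, div_nonneg (by linarith) hb₂, ?_, ?_⟩
    · field_simp; linarith
    · have : b₂ • c = a₁ • a + (b₁ - a₂) • b := by
        rw [sub_smul]; linear_combination (exp := 1) hx
      rw [← inv_smul_smul₀ hb₂'.ne' c, this]; simp only [smul_add, smul_smul]
      congr 2 <;> ring
  · refine h₁ ⟨(a₂ - b₁) / a₁, b₂ / a₁, div_nonneg (by linarith) ha₁, by positivity, ?_, ?_⟩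
    · field_simp; linarith
    · have : a₁ • a = (a₂ - b₁) • b + b₂ • c := by
        rw [sub_smul]; linear_combination (exp := 1) -hx
      rw [← inv_smul_smul₀ ha₁'.ne' a, this]; simp only [smul_add, smul_smul]
      congr 2 <;> ring

theorem convexHull_triple_eq (p q r : Space) :
    convexHull ℝ {p, q, r} = {x | ∃ y ∈ segment ℝ q r, x ∈ segment ℝ p y} := by
  rw [convexHull_insert (by simp), convexHull_pair]
  ext x; simp

theorem segment_subset_hull_left (p q r : Space) :
    segment ℝ p q ⊆ convexHull ℝ {p, q, r} :=
  segment_subset_convexHull (by simp) (by simp)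

theorem segment_subset_hull_mid (p q r : Space) :
    segment ℝ p r ⊆ convexHull ℝ {p, q, r} :=
  segment_subset_convexHull (by simp) (by simp)

theorem segment_subset_hull_right (p q r : Space) :
    segment ℝ r q ⊆ convexHull ℝ {p, q, r} :=
  segment_subset_convexHull (by simp) (by simp)

namespace PolygonalLink

variable {L L' X Y Z : PolygonalLink}

/-- The vertices of a link. -/
def verts (L : PolygonalLink) : Set Space := Prod.fst '' L.edges

theorem Isotopic.refl (L : PolygonalLink) : Isotopic L L := Relation.EqvGen.refl L

theorem Isotopic.symm (h : Isotopic X Y) : Isotopic Y X := Relation.EqvGen.symm _ _ h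

theorem Isotopic.trans (h : Isotopic X Y) (h' : Isotopic Y Z) : Isotopic X Z :=
  Relation.EqvGen.trans _ _ _ h h'

theorem DeltaMove.isotopic (h : DeltaMove X Y) : Isotopic X Y := Relation.EqvGen.rel _ _ h

theorem Isotopic.of_edges_eq (h : X.edges = Y.edges) : Isotopic X Y := by
  rw [PolygonalLink.ext h]; exact .refl _

theorem verts_finite (L : PolygonalLink) : L.verts.Finite := L.finite.image _

theorem left_mem_verts {e : Space × Space} (he : e ∈ L.edges) : e.1 ∈ L.verts := ⟨e, he, rfl⟩

theorem right_mem_verts {e : Space × Space} (he : e ∈ L.edges) : e.2 ∈ L.verts := by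
  obtain ⟨f, hf, hfe⟩ := L.closed e he
  exact ⟨f, hf, hfe⟩

theorem exists_succ {v : Space} (hv : v ∈ L.verts) : ∃ w, (v, w) ∈ L.edges := by
  obtain ⟨⟨a, b⟩, he, rfl⟩ := hv
  exact ⟨b, he⟩

/-- The successor map on the finite set of edges is injective because targets are unique, hence it
is surjective. -/
theorem exists_pred {v : Space} (hv : v ∈ L.verts) : ∃ u, (u, v) ∈ L.edges := by
  have : Finite L.edges := L.finite
  choose nx hnx hnx' using fun e : L.edges => L.closed e.1 e.2
  have hinj : Function.Injective fun e : L.edges => (⟨nx e, hnx e⟩ : L.edges) := by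
    intro e f hef
    have h : nx e = nx f := congrArg Subtype.val hef
    exact Subtype.ext (L.target_unique _ e.2 _ f.2 (by rw [← hnx' e, ← hnx' f, h]))
  obtain ⟨e, he, rfl⟩ := hv
  obtain ⟨f, hf⟩ := (Finite.injective_iff_surjective.1 hinj) ⟨e, he⟩
  refine ⟨f.1.1, ?_⟩
  have h1 := hnx' f
  rw [show nx f = e from congrArg Subtype.val hf] at h1
  simp [h1]

theorem segment_subset_carrier {e : Space × Space} (he : e ∈ L.edges) :
    segment ℝ e.1 e.2 ⊆ L.carrier := subset_iUnion₂_of_subset e he subset_rfl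

theorem mem_carrier {x : Space} : x ∈ L.carrier ↔ ∃ e ∈ L.edges, x ∈ segment ℝ e.1 e.2 := by
  simp [carrier]

theorem verts_subset_carrier : L.verts ⊆ L.carrier := by
  rintro _ ⟨e, he, rfl⟩
  exact segment_subset_carrier he (left_mem_segment ℝ _ _)

theorem isCompact_segment (a b : Space) : IsCompact (segment ℝ a b) := by
  rw [← convexHull_pair]; exact (Set.toFinite _).isCompact_convexHull ℝ

theorem not_two_gon {u v : Space} (h : (u, v) ∈ L.edges) : (v, u) ∉ L.edges := by
  intro h'
  have hne : u ≠ v := L.nondegenerate _ h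
  have hm : midpoint ℝ u v ∈ segment ℝ u v := midpoint_mem_segment u v
  have := L.embedded _ h _ h' (by simp [hne]) ⟨hm, by rw [segment_symm]; exact hm⟩
  simp only [mem_inter_iff, mem_insert_iff, mem_singleton_iff] at this
  rcases this.1 with h | h
  · exact hne (by simpa using h)
  · exact hne (by simpa using h)

theorem vertex_mem_edge {v : Space} (hv : v ∈ L.verts) {e : Space × Space} (he : e ∈ L.edges)
    (h : v ∈ segment ℝ e.1 e.2) : v = e.1 ∨ v = e.2 := by
  obtain ⟨f, hf, rfl⟩ := hv
  by_cases hef : e = f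
  · exact Or.inl (by rw [hef])
  · have := L.embedded _ he _ hf hef ⟨h, left_mem_segment ℝ _ _⟩
    simpa using this.1

theorem left_not_mem {u v w : Space} (h : (u, v) ∈ L.edges) (h' : (v, w) ∈ L.edges) :
    u ∉ segment ℝ v w := by
  intro hu
  rcases vertex_mem_edge (left_mem_verts h) h' hu with h1 | h1
  · exact L.nondegenerate _ h h1
  · simp only at h1; subst h1; exact not_two_gon h h'

theorem right_not_mem {u v w : Space} (h : (u, v) ∈ L.edges) (h' : (v, w) ∈ L.edges) :
    w ∉ segment ℝ u v := by
  intro hu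
  rcases vertex_mem_edge (right_mem_verts h') h hu with h1 | h1
  · simp only at h1; subst h1; exact not_two_gon h h'
  · exact L.nondegenerate _ h' h1.symm

theorem disjoint_segments {e f : Space × Space} (he : e ∈ L.edges) (hf : f ∈ L.edges)
    (hne : e ≠ f) (h₁ : e.2 ≠ f.1) (h₂ : f.2 ≠ e.1) :
    Disjoint (segment ℝ e.1 e.2) (segment ℝ f.1 f.2) := by
  rw [Set.disjoint_iff]
  intro x hx
  obtain ⟨h, h'⟩ := L.embedded _ he _ hf hne hx
  simp only [mem_insert_iff, mem_singleton_iff] at h h'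
  rcases h with rfl | rfl <;> rcases h' with h' | h'
  · exact hne (L.source_unique _ he _ hf h')
  · exact h₂ h'.symm
  · exact h₁ h'
  · exact hne (L.target_unique _ he _ hf h')

theorem eq_of_mem_segments {e f : Space × Space} (he : e ∈ L.edges) (hf : f ∈ L.edges)
    (hne : e ≠ f) {x : Space} (hx : x ∈ segment ℝ e.1 e.2) (hx' : x ∈ segment ℝ f.1 f.2) :
    (x = e.1 ∨ x = e.2) ∧ (x = f.1 ∨ x = f.2) := by
  simpa using L.embedded _ he _ hf hne ⟨hx, hx'⟩

/-- A criterion for a set of edges to form a link. -/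
theorem exists_of_disjoint {E : Set (Space × Space)} (hfin : E.Finite)
    (hnd : ∀ e ∈ E, e.1 ≠ e.2) (hs : ∀ e ∈ E, ∀ f ∈ E, e.1 = f.1 → e = f)
    (ht : ∀ e ∈ E, ∀ f ∈ E, e.2 = f.2 → e = f) (hc : ∀ e ∈ E, ∃ f ∈ E, f.1 = e.2)
    (hadj : ∀ e ∈ E, ∀ f ∈ E, e.2 = f.1 → e.1 ∉ segment ℝ f.1 f.2 ∧ f.2 ∉ segment ℝ e.1 e.2)
    (hdis : ∀ e ∈ E, ∀ f ∈ E, e ≠ f → e.2 ≠ f.1 → f.2 ≠ e.1 →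
      Disjoint (segment ℝ e.1 e.2) (segment ℝ f.1 f.2)) : ∃ L : PolygonalLink, L.edges = E := by
  have key : ∀ e ∈ E, ∀ f ∈ E, e.2 = f.1 →
      segment ℝ e.1 e.2 ∩ segment ℝ f.1 f.2 ⊆ {e.2} := by
    intro e he f hf h
    obtain ⟨h₁, h₂⟩ := hadj e he f hf h
    rw [← h] at h₁ ⊢
    exact segment_inter_subset h₁ h₂
  refine ⟨⟨E, hfin, hnd, hs, ht, hc, ?_⟩, rfl⟩
  intro e he f hf hne x hx
  by_cases h₁ : e.2 = f.1
  · have := key e he f hf h₁ hx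
    simp only [mem_singleton_iff] at this
    simp [this, h₁]
  by_cases h₂ : f.2 = e.1
  · have := key f hf e he h₂ hx.symm
    simp only [mem_singleton_iff] at this
    simp [this, h₂]
  · exact ((hdis e he f hf hne h₁ h₂).le_bot hx).elim

/-- A triangle that meets the link at most in its edge `p q` defines a Δ-move. -/
theorem exists_deltaMove {p q r : Space} (hpq : (p, q) ∈ L.edges)
    (hT : convexHull ℝ {p, q, r} ∩ L.carrier ⊆ segment ℝ p q)
    (hp : p ∉ segment ℝ r q) (hq : q ∉ segment ℝ p r) :
    ∃ L' : PolygonalLink, L'.edges = (L.edges \ {(p, q)}) ∪ {(p, r), (r, q)} ∧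
      DeltaMove L L' := by
  have hrp : p ≠ r := fun h => hp (h ▸ left_mem_segment ℝ _ _)
  have hrq : r ≠ q := fun h => hq (h ▸ right_mem_segment ℝ _ _)
  have hr : r ∉ L.verts := by
    intro h
    have h1 := hT ⟨subset_convexHull _ _ (by simp), verts_subset_carrier h⟩
    rcases vertex_mem_edge h hpq h1 with h | h
    · exact hrp h.symm
    · exact hrq h
  have hv : ∀ e ∈ L.edges, e.1 ≠ r ∧ e.2 ≠ r := fun e he =>
    ⟨fun h => hr (h ▸ left_mem_verts he), fun h => hr (h ▸ right_mem_verts he)⟩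
  have h1 : ∀ e ∈ L.edges, e ≠ (p, q) → ∀ x ∈ segment ℝ e.1 e.2, x ∈ segment ℝ p r →
      x = p ∧ (x = e.1 ∨ x = e.2) := by
    intro e he hne x hx hx'
    have h2 := hT ⟨segment_subset_hull_mid _ _ _ hx', segment_subset_carrier he hx⟩
    obtain ⟨h3, h4⟩ := eq_of_mem_segments he hpq hne hx h2
    rcases h4 with rfl | rfl
    · exact ⟨rfl, h3⟩
    · exact (hq hx').elim
  have h2 : ∀ e ∈ L.edges, e ≠ (p, q) → ∀ x ∈ segment ℝ e.1 e.2, x ∈ segment ℝ r q →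
      x = q ∧ (x = e.1 ∨ x = e.2) := by
    intro e he hne x hx hx'
    have h2 := hT ⟨segment_subset_hull_right _ _ _ hx', segment_subset_carrier he hx⟩
    obtain ⟨h3, h4⟩ := eq_of_mem_segments he hpq hne hx h2
    rcases h4 with rfl | rfl
    · exact (hp hx').elim
    · exact ⟨rfl, h3⟩
  have h3 := segment_inter_subset hp hq
  have hnpq : p ≠ q := L.nondegenerate _ hpq
  have hL : ∃ L' : PolygonalLink, L'.edges = (L.edges \ {(p, q)}) ∪ {(p, r), (r, q)} := by
    refine ⟨⟨_, (L.finite.sdiff).union (by simp), ?_, ?_, ?_, ?_, ?_⟩, rfl⟩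
    · rintro e (he | rfl | rfl)
      exacts [L.nondegenerate e he.1, hrp, hrq]
    · rintro e (⟨he, hne⟩ | rfl | rfl) f (⟨hf, hnf⟩ | rfl | rfl) h <;> try simp only at h
      · exact L.source_unique e he f hf h
      · exact (hne (L.source_unique _ he _ hpq h)).elim
      · exact ((hv e he).1 h).elim
      · exact (hnf (L.source_unique _ hf _ hpq h.symm)).elim
      · rfl
      · exact (hrp h).elim
      · exact ((hv f hf).1 h.symm).elim
      · exact (hrp h.symm).elim
      · rfl
    · rintro e (⟨he, hne⟩ | rfl | rfl) f (⟨hf, hnf⟩ | rfl | rfl) h <;> try simp only at h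
      · exact L.target_unique e he f hf h
      · exact ((hv e he).2 h).elim
      · exact (hne (L.target_unique _ he _ hpq h)).elim
      · exact ((hv f hf).2 h.symm).elim
      · rfl
      · exact (hrq h).elim
      · exact (hnf (L.target_unique _ hf _ hpq h.symm)).elim
      · exact (hrq h.symm).elim
      · rfl
    · have hE : ∀ v ∈ L.verts, ∃ f ∈ (L.edges \ {(p, q)}) ∪ {(p, r), (r, q)}, f.1 = v := by
        intro v hv
        obtain ⟨w, hw⟩ := exists_succ hv
        by_cases h : (v, w) = (p, q)
        · exact ⟨(p, r), by simp, by simpa using (Prod.ext_iff.1 h).1.symm⟩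
        · exact ⟨(v, w), Or.inl ⟨hw, h⟩, rfl⟩
      rintro e (⟨he, hne⟩ | rfl | rfl)
      · exact hE _ (right_mem_verts he)
      · exact ⟨(r, q), by simp, rfl⟩
      · exact hE q (right_mem_verts hpq)
    · rintro e (⟨he, hne⟩ | rfl | rfl) f (⟨hf, hnf⟩ | rfl | rfl) hef x ⟨hx, hx'⟩ <;>
        simp only [mem_inter_iff, mem_insert_iff, mem_singleton_iff] at hx hx' ⊢
      · exact eq_of_mem_segments he hf hef hx hx'
      · obtain ⟨h4, h5⟩ := h1 e he hne x hx hx'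
        exact ⟨h5, Or.inl h4⟩
      · obtain ⟨h4, h5⟩ := h2 e he hne x hx hx'
        exact ⟨h5, Or.inr h4⟩
      · obtain ⟨h4, h5⟩ := h1 f hf hnf x hx' hx
        exact ⟨Or.inl h4, h5⟩
      · exact (hef rfl).elim
      · have := h3 ⟨hx, hx'⟩
        simp only [mem_singleton_iff] at this
        simp [this]
      · obtain ⟨h4, h5⟩ := h2 f hf hnf x hx' hx
        exact ⟨Or.inr h4, h5⟩
      · have := h3 ⟨hx', hx⟩
        simp only [mem_singleton_iff] at this
        simp [this]
      · exact (hef rfl).elim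
  obtain ⟨L', hL'⟩ := hL
  refine ⟨L', hL', p, q, r, hpq, hT.antisymm fun x hx => ⟨segment_subset_hull_left _ _ _ hx, ?_⟩, hL'⟩
  exact segment_subset_carrier hpq hx

/-- Removal of the vertex `y` when the triangle `x y z` meets the link only in the edges
`x y` and `y z`. -/
theorem exists_removal {x y z : Space} (hxy : (x, y) ∈ X.edges) (hyz : (y, z) ∈ X.edges)
    (hT : convexHull ℝ {x, z, y} ∩ X.carrier ⊆ segment ℝ x y ∪ segment ℝ y z) :
    ∃ X' : PolygonalLink, X'.edges = (X.edges \ {(x, y), (y, z)}) ∪ {(x, z)} ∧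
      DeltaMove X' X := by
  have hxny : x ≠ y := X.nondegenerate _ hxy
  have hynz : y ≠ z := X.nondegenerate _ hyz
  have hxz : x ≠ z := by rintro rfl; exact not_two_gon hxy hyz
  have hsrc : ∀ e ∈ X.edges, e ∉ ({(x, y), (y, z)} : Set (Space × Space)) →
      e.1 ≠ x ∧ e.1 ≠ y ∧ e.2 ≠ y ∧ e.2 ≠ z := by
    intro e he hne
    simp only [mem_insert_iff, mem_singleton_iff, not_or] at hne
    refine ⟨fun h => hne.1 (X.source_unique _ he _ hxy h),
      fun h => hne.2 (X.source_unique _ he _ hyz h),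
      fun h => hne.1 (X.target_unique _ he _ hxy h),
      fun h => hne.2 (X.target_unique _ he _ hyz h)⟩
  have h1 : ∀ e ∈ X.edges, e ∉ ({(x, y), (y, z)} : Set (Space × Space)) →
      ∀ v ∈ segment ℝ e.1 e.2, v ∈ convexHull ℝ {x, z, y} →
      (v = x ∨ v = z) ∧ (v = e.1 ∨ v = e.2) := by
    intro e he hne v hv hv'
    obtain ⟨h2, h3, h4, h5⟩ := hsrc e he hne
    simp only [mem_insert_iff, mem_singleton_iff, not_or] at hne
    rcases hT ⟨hv', segment_subset_carrier he hv⟩ with h | h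
    · obtain ⟨h6, h7⟩ := eq_of_mem_segments he hxy hne.1 hv h
      refine ⟨Or.inl (h7.resolve_right ?_), h6⟩
      rintro rfl
      rcases h6 with h6 | h6
      exacts [h3 h6.symm, h4 h6.symm]
    · obtain ⟨h6, h7⟩ := eq_of_mem_segments he hyz hne.2 hv h
      refine ⟨Or.inr (h7.resolve_left ?_), h6⟩
      rintro rfl
      rcases h6 with h6 | h6
      exacts [h3 h6.symm, h4 h6.symm]
  have hL : ∃ X' : PolygonalLink, X'.edges = (X.edges \ {(x, y), (y, z)}) ∪ {(x, z)} := by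
    refine ⟨⟨_, (X.finite.sdiff).union (by simp), ?_, ?_, ?_, ?_, ?_⟩, rfl⟩
    · rintro e (he | rfl)
      exacts [X.nondegenerate e he.1, hxz]
    · rintro e (⟨he, hne⟩ | rfl) f (⟨hf, hnf⟩ | rfl) h <;> try simp only at h
      · exact X.source_unique e he f hf h
      · exact ((hsrc e he hne).1 h).elim
      · exact ((hsrc f hf hnf).1 h.symm).elim
      · rfl
    · rintro e (⟨he, hne⟩ | rfl) f (⟨hf, hnf⟩ | rfl) h <;> try simp only at h
      · exact X.target_unique e he f hf h
      · exact ((hsrc e he hne).2.2.2 h).elim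
      · exact ((hsrc f hf hnf).2.2.2 h.symm).elim
      · rfl
    · have hE : ∀ v ∈ X.verts, v ≠ y →
          ∃ f ∈ (X.edges \ {(x, y), (y, z)}) ∪ {(x, z)}, f.1 = v := by
        intro v hv hvy
        obtain ⟨w, hw⟩ := exists_succ hv
        by_cases h : v = x
        · exact ⟨(x, z), by simp, h.symm⟩
        · exact ⟨(v, w), Or.inl ⟨hw, by simp [h, hvy]⟩, rfl⟩
      rintro e (⟨he, hne⟩ | rfl)
      · exact hE _ (right_mem_verts he) (hsrc e he hne).2.2.1
      · exact hE z (right_mem_verts hyz) hynz.symm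
    · rintro e (⟨he, hne⟩ | rfl) f (⟨hf, hnf⟩ | rfl) hef v ⟨hv, hv'⟩ <;>
        simp only [mem_inter_iff, mem_insert_iff, mem_singleton_iff] at hv hv' ⊢
      · exact eq_of_mem_segments he hf hef hv hv'
      · exact (h1 e he hne v hv (segment_subset_hull_left _ _ _ hv')).symm
      · exact h1 f hf hnf v hv' (segment_subset_hull_left _ _ _ hv)
      · exact (hef rfl).elim
  obtain ⟨X', hX'⟩ := hL
  refine ⟨X', hX', x, z, y, by simp [hX'], Subset.antisymm ?_ ?_, ?_⟩
  · rintro v ⟨hv, hv'⟩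
    obtain ⟨e, he, hve⟩ := mem_carrier.1 hv'
    rw [hX'] at he
    rcases he with he | rfl
    · rcases (h1 e he.1 he.2 v hve hv).1 with rfl | rfl
      exacts [left_mem_segment ℝ _ _, right_mem_segment ℝ _ _]
    · exact hve
  · intro v hv
    exact ⟨segment_subset_hull_left _ _ _ hv, segment_subset_carrier (e := (x, z)) (by simp [hX']) hv⟩
  · rw [hX']
    ext e
    simp only [mem_union, mem_sdiff, mem_insert_iff, mem_singleton_iff]
    constructor
    · intro he
      by_cases h : e = (x, y) ∨ e = (y, z)
      · exact Or.inr h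
      · refine Or.inl ⟨Or.inl ⟨he, h⟩, ?_⟩
        rintro rfl
        exact (hsrc _ he h).1 rfl
    · rintro (⟨h | h, h'⟩ | rfl | rfl)
      exacts [h.1, (h' h).elim, hxy, hyz]

theorem hull_eq_of_openSegment {p q r : Space} (hr : r ∈ openSegment ℝ p q) :
    convexHull ℝ {p, q, r} = segment ℝ p q := by
  refine Subset.antisymm (convexHull_min ?_ (convex_segment _ _)) (segment_subset_hull_left _ _ _)
  rintro x (rfl | rfl | rfl)
  exacts [left_mem_segment ℝ _ _, right_mem_segment ℝ _ _, openSegment_subset_segment _ _ _ hr]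

theorem not_mem_of_openSegment {p q r : Space} (hpq : p ≠ q) (hr : r ∈ openSegment ℝ p q) :
    p ∉ segment ℝ r q := by
  obtain ⟨a, b, ha, hb, hab, rfl⟩ := hr
  rintro ⟨c, d, hc, hd, hcd, h⟩
  have : (c * b + d) • (q - p) = 0 := by
    obtain rfl : a = 1 - b := by linarith
    obtain rfl : c = 1 - d := by linarith
    rw [← sub_eq_zero] at h
    rw [← h]; module
  rcases smul_eq_zero.1 this with h | h
  · nlinarith [mul_nonneg hc hb.le]
  · exact hpq (sub_eq_zero.1 h).symm

theorem not_mem_of_openSegment' {p q r : Space} (hpq : p ≠ q) (hr : r ∈ openSegment ℝ p q) :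
    q ∉ segment ℝ p r := by
  rw [openSegment_symm] at hr
  rw [segment_symm]
  exact not_mem_of_openSegment hpq.symm hr

theorem exists_subdivision {p q r : Space} (hpq : (p, q) ∈ L.edges)
    (hr : r ∈ openSegment ℝ p q) :
    ∃ L' : PolygonalLink, L'.edges = (L.edges \ {(p, q)}) ∪ {(p, r), (r, q)} ∧
      DeltaMove L L' :=
  exists_deltaMove hpq (by rw [hull_eq_of_openSegment hr]; exact inter_subset_left)
    (not_mem_of_openSegment (L.nondegenerate _ hpq) hr)
    (not_mem_of_openSegment' (L.nondegenerate _ hpq) hr)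

theorem segment_union_of_mem {p q r : Space} (hr : r ∈ segment ℝ p q) :
    segment ℝ p q = segment ℝ p r ∪ segment ℝ r q := by
  refine Subset.antisymm ?_ (union_subset ?_ ?_)
  · obtain ⟨a, b, ha, hb, hab, rfl⟩ := hr
    rintro _ ⟨c, d, hc, hd, hcd, rfl⟩
    obtain rfl : a = 1 - b := by linarith
    obtain rfl : c = 1 - d := by linarith
    rcases le_total d b with h | h
    · left
      rcases hb.eq_or_lt with rfl | hb'
      · obtain rfl : d = 0 := by linarith
        simp
      · refine ⟨1 - d / b, d / b, by rw [sub_nonneg, div_le_one hb']; exact h, by positivity,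
          by ring, ?_⟩
        rw [← sub_eq_zero]
        have : (d / b) * b = d := by field_simp
        calc _ = (d / b * b - d) • (q - p) := by module
          _ = 0 := by rw [this]; simp
    · right
      rcases hb.eq_or_lt with rfl | hb'
      · simp only [sub_zero, one_smul, zero_smul, add_zero]; exact ⟨1 - d, d, hc, hd, by ring, rfl⟩
      rcases ha.eq_or_lt with h1 | ha'
      · obtain rfl : b = 1 := by linarith
        obtain rfl : d = 1 := by linarith
        simp
      · refine ⟨(1 - d) / (1 - b), 1 - (1 - d) / (1 - b), by positivity,
          by rw [sub_nonneg, div_le_one ha']; linarith, by ring, ?_⟩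
        rw [← sub_eq_zero]
        have : ((1 - d) / (1 - b)) * (1 - b) = 1 - d := by field_simp
        calc _ = ((1 - d) / (1 - b) * (1 - b) - (1 - d)) • (p - q) := by module
          _ = 0 := by rw [this]; simp
  · exact (convex_segment p q).segment_subset (left_mem_segment ℝ _ _) hr
  · exact (convex_segment p q).segment_subset hr (right_mem_segment ℝ _ _)

theorem exists_merge {p q r : Space} (hpr : (p, r) ∈ X.edges) (hrq : (r, q) ∈ X.edges)
    (hr : r ∈ openSegment ℝ p q) :
    ∃ X' : PolygonalLink, X'.edges = (X.edges \ {(p, r), (r, q)}) ∪ {(p, q)} ∧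
      DeltaMove X' X := by
  refine exists_removal hpr hrq ?_
  rw [hull_eq_of_openSegment hr, segment_union_of_mem (openSegment_subset_segment _ _ _ hr)]
  exact inter_subset_left

theorem carrier_eq_of_subdivision {p q r : Space} (hpq : (p, q) ∈ L.edges)
    (hr : r ∈ segment ℝ p q)
    (hL' : L'.edges = (L.edges \ {(p, q)}) ∪ {(p, r), (r, q)}) : L'.carrier = L.carrier := by
  ext x
  simp only [mem_carrier, hL', mem_union, mem_sdiff, mem_insert_iff, mem_singleton_iff]
  have hu := segment_union_of_mem hr
  constructor
  · rintro ⟨e, (he | rfl | rfl), hx⟩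
    · exact ⟨e, he.1, hx⟩
    · exact ⟨(p, q), hpq, by simp only [hu]; exact Or.inl hx⟩
    · exact ⟨(p, q), hpq, by simp only [hu]; exact Or.inr hx⟩
  · rintro ⟨e, he, hx⟩
    by_cases h : e = (p, q)
    · subst h
      simp only [hu] at hx
      rcases hx with hx | hx
      · exact ⟨(p, r), by simp, hx⟩
      · exact ⟨(r, q), by simp, hx⟩
    · exact ⟨e, Or.inl ⟨he, h⟩, hx⟩

/-- Two links that meet only along an edge, which they traverse in opposite directions, can be
joined by deleting that edge. -/
theorem exists_glue {L₁ L₂ : PolygonalLink} {p q : Space} (h₁ : (p, q) ∈ L₁.edges)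
    (h₂ : (q, p) ∈ L₂.edges) (h : L₁.carrier ∩ L₂.carrier ⊆ segment ℝ p q) :
    ∃ L : PolygonalLink, L.edges = (L₁.edges \ {(p, q)}) ∪ (L₂.edges \ {(q, p)}) := by
  have hpq : p ≠ q := L₁.nondegenerate _ h₁
  -- A point common to both remainders lies on `p q`, so it is `p` or `q`. Deleting `(p, q)` leaves
  -- `p` only as a target and `q` only as a source in `L₁`, and it is the other way round in `L₂`.
  -- This yields uniqueness of sources and targets as well as embeddedness.
  have key : ∀ e ∈ L₁.edges, e ≠ (p, q) → ∀ f ∈ L₂.edges, f ≠ (q, p) →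
      ∀ x ∈ segment ℝ e.1 e.2, x ∈ segment ℝ f.1 f.2 →
      ((x = p ∧ x = e.2) ∨ (x = q ∧ x = e.1)) ∧ ((x = p ∧ x = f.1) ∨ (x = q ∧ x = f.2)) := by
    intro e he hne f hf hnf x hx hx'
    have hm := h ⟨segment_subset_carrier he hx, segment_subset_carrier hf hx'⟩
    obtain ⟨h3, h4⟩ := eq_of_mem_segments he h₁ hne hx hm
    obtain ⟨h5, h6⟩ := eq_of_mem_segments hf h₂ hnf hx' (by rwa [segment_symm])
    simp only at h4 h6
    constructor
    · rcases h4 with rfl | rfl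
      · exact Or.inl ⟨rfl, h3.resolve_left fun h => hne (L₁.source_unique _ he _ h₁ h.symm)⟩
      · exact Or.inr ⟨rfl, h3.resolve_right fun h => hne (L₁.target_unique _ he _ h₁ h.symm)⟩
    · rcases h4 with rfl | rfl
      · exact Or.inl ⟨rfl, h5.resolve_right fun h => hnf (L₂.target_unique _ hf _ h₂ h.symm)⟩
      · exact Or.inr ⟨rfl, h5.resolve_left fun h => hnf (L₂.source_unique _ hf _ h₂ h.symm)⟩
  refine ⟨⟨_, (L₁.finite.sdiff).union L₂.finite.sdiff, ?_, ?_, ?_, ?_, ?_⟩, rfl⟩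
  · rintro e (he | he)
    exacts [L₁.nondegenerate e he.1, L₂.nondegenerate e he.1]
  · have : ∀ e ∈ L₁.edges \ {(p, q)}, ∀ f ∈ L₂.edges \ {(q, p)}, e.1 ≠ f.1 := by
      intro e he f hf hef
      obtain ⟨h3, h4⟩ := key e he.1 he.2 f hf.1 hf.2 e.1 (left_mem_segment ℝ _ _)
        (hef ▸ left_mem_segment ℝ _ _)
      rcases h3 with h3 | h3
      · exact L₁.nondegenerate _ he.1 h3.2
      · rcases h4 with h4 | h4
        · exact hpq (h4.1.symm.trans h3.1)
        · exact L₂.nondegenerate _ hf.1 (hef.symm.trans h4.2)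
    rintro e (he | he) f (hf | hf) hef
    exacts [L₁.source_unique _ he.1 _ hf.1 hef, (this e he f hf hef).elim,
      (this f hf e he hef.symm).elim, L₂.source_unique _ he.1 _ hf.1 hef]
  · have : ∀ e ∈ L₁.edges \ {(p, q)}, ∀ f ∈ L₂.edges \ {(q, p)}, e.2 ≠ f.2 := by
      intro e he f hf hef
      obtain ⟨h3, h4⟩ := key e he.1 he.2 f hf.1 hf.2 e.2 (right_mem_segment ℝ _ _)
        (hef ▸ right_mem_segment ℝ _ _)
      rcases h3 with h3 | h3
      · rcases h4 with h4 | h4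
        · exact L₂.nondegenerate _ hf.1 (h4.2.symm.trans hef)
        · exact hpq (h3.1.symm.trans h4.1)
      · exact L₁.nondegenerate _ he.1 h3.2.symm
    rintro e (he | he) f (hf | hf) hef
    exacts [L₁.target_unique _ he.1 _ hf.1 hef, (this e he f hf hef).elim,
      (this f hf e he hef.symm).elim, L₂.target_unique _ he.1 _ hf.1 hef]
  · have hp : ∃ f ∈ (L₁.edges \ {(p, q)}) ∪ (L₂.edges \ {(q, p)}), f.1 = p := by
      obtain ⟨f, hf, hfp⟩ := L₂.closed _ h₂
      exact ⟨f, Or.inr ⟨hf, by rintro rfl; exact hpq hfp.symm⟩, hfp⟩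
    have hq : ∃ f ∈ (L₁.edges \ {(p, q)}) ∪ (L₂.edges \ {(q, p)}), f.1 = q := by
      obtain ⟨f, hf, hfp⟩ := L₁.closed _ h₁
      exact ⟨f, Or.inl ⟨hf, by rintro rfl; exact hpq hfp⟩, hfp⟩
    rintro e (he | he)
    · obtain ⟨f, hf, hfe⟩ := L₁.closed e he.1
      by_cases hfp : f = (p, q)
      · rw [← hfe, hfp]; exact hp
      · exact ⟨f, Or.inl ⟨hf, hfp⟩, hfe⟩
    · obtain ⟨f, hf, hfe⟩ := L₂.closed e he.1
      by_cases hfp : f = (q, p)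
      · rw [← hfe, hfp]; exact hq
      · exact ⟨f, Or.inr ⟨hf, hfp⟩, hfe⟩
  · rintro e (he | he) f (hf | hf) hef x ⟨hx, hx'⟩
    · exact L₁.embedded _ he.1 _ hf.1 hef ⟨hx, hx'⟩
    · obtain ⟨h3, h4⟩ := key e he.1 he.2 f hf.1 hf.2 x hx hx'
      simp only [mem_inter_iff, mem_insert_iff, mem_singleton_iff]
      tauto
    · obtain ⟨h3, h4⟩ := key f hf.1 hf.2 e he.1 he.2 x hx' hx
      simp only [mem_inter_iff, mem_insert_iff, mem_singleton_iff]
      tauto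
    · exact L₂.embedded _ he.1 _ hf.1 hef ⟨hx, hx'⟩

/-- The image of a link under a map that is injective on the link and affine on each edge. -/
theorem exists_map (L : PolygonalLink) (g : Space → Space) (hinj : InjOn g L.carrier)
    (haff : ∀ e ∈ L.edges, g '' segment ℝ e.1 e.2 = segment ℝ (g e.1) (g e.2)) :
    ∃ L' : PolygonalLink, L'.edges = Prod.map g g '' L.edges ∧ L'.carrier = g '' L.carrier := by
  have hl : ∀ e ∈ L.edges, e.1 ∈ L.carrier := fun e he => verts_subset_carrier (left_mem_verts he)
  have hr : ∀ e ∈ L.edges, e.2 ∈ L.carrier := fun e he => verts_subset_carrier (right_mem_verts he)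
  refine ⟨⟨Prod.map g g '' L.edges, L.finite.image _, ?_, ?_, ?_, ?_, ?_⟩, rfl, ?_⟩
  · rintro _ ⟨e, he, rfl⟩ h
    exact L.nondegenerate e he (hinj (hl e he) (hr e he) h)
  · rintro _ ⟨e, he, rfl⟩ _ ⟨f, hf, rfl⟩ h
    rw [L.source_unique e he f hf (hinj (hl e he) (hl f hf) h)]
  · rintro _ ⟨e, he, rfl⟩ _ ⟨f, hf, rfl⟩ h
    rw [L.target_unique e he f hf (hinj (hr e he) (hr f hf) h)]
  · rintro _ ⟨e, he, rfl⟩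
    obtain ⟨f, hf, h⟩ := L.closed e he
    exact ⟨_, mem_image_of_mem _ hf, congrArg g h⟩
  · rintro _ ⟨e, he, rfl⟩ _ ⟨f, hf, rfl⟩ hef x ⟨hx, hx'⟩
    simp only [Prod.map_fst, Prod.map_snd] at hx hx' ⊢
    rw [← haff e he] at hx
    rw [← haff f hf] at hx'
    obtain ⟨y, hy, rfl⟩ := hx
    obtain ⟨z, hz, hzy⟩ := hx'
    obtain rfl := hinj (segment_subset_carrier hf hz) (segment_subset_carrier he hy) hzy
    obtain ⟨h1, h2⟩ := eq_of_mem_segments he hf (fun h => hef (h ▸ rfl)) hy hz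
    simp only [mem_inter_iff, mem_insert_iff, mem_singleton_iff]
    exact ⟨h1.imp (congrArg g) (congrArg g), h2.imp (congrArg g) (congrArg g)⟩
  · simp only [carrier, biUnion_image, image_iUnion₂]
    exact iUnion₂_congr fun e he => (haff e he).symm

/-! ### Reversal of the orientation -/

theorem exists_reverse (L : PolygonalLink) :
    ∃ L' : PolygonalLink, L'.edges = Prod.swap '' L.edges := by
  refine ⟨⟨Prod.swap '' L.edges, L.finite.image _, ?_, ?_, ?_, ?_, ?_⟩, rfl⟩
  · rintro _ ⟨e, he, rfl⟩ h
    exact L.nondegenerate e he h.symm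
  · rintro _ ⟨e, he, rfl⟩ _ ⟨f, hf, rfl⟩ h
    rw [L.target_unique e he f hf h]
  · rintro _ ⟨e, he, rfl⟩ _ ⟨f, hf, rfl⟩ h
    rw [L.source_unique e he f hf h]
  · rintro _ ⟨e, he, rfl⟩
    obtain ⟨u, hu⟩ := exists_pred (left_mem_verts he)
    exact ⟨_, mem_image_of_mem _ hu, rfl⟩
  · rintro _ ⟨e, he, rfl⟩ _ ⟨f, hf, rfl⟩ hef x ⟨hx, hx'⟩
    simp only [Prod.fst_swap, Prod.snd_swap] at hx hx' ⊢
    rw [segment_symm] at hx hx'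
    obtain ⟨h1, h2⟩ := eq_of_mem_segments he hf (fun h => hef (h ▸ rfl)) hx hx'
    simp only [mem_inter_iff, mem_insert_iff, mem_singleton_iff]
    exact ⟨h1.symm, h2.symm⟩

/-- The link with the opposite orientation. -/
noncomputable def reverse (L : PolygonalLink) : PolygonalLink := (exists_reverse L).choose

theorem reverse_edges (L : PolygonalLink) : L.reverse.edges = Prod.swap '' L.edges :=
  (exists_reverse L).choose_spec

theorem mem_reverse_edges {a b : Space} : (a, b) ∈ L.reverse.edges ↔ (b, a) ∈ L.edges := by
  rw [reverse_edges]
  constructor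
  · rintro ⟨e, he, h⟩
    obtain ⟨rfl, rfl⟩ := Prod.ext_iff.1 h
    exact he
  · exact fun h => ⟨(b, a), h, rfl⟩

theorem reverse_reverse (L : PolygonalLink) : L.reverse.reverse = L := by
  ext ⟨a, b⟩
  rw [mem_reverse_edges, mem_reverse_edges]

theorem reverse_carrier (L : PolygonalLink) : L.reverse.carrier = L.carrier := by
  ext x
  simp only [mem_carrier, Prod.exists, mem_reverse_edges]
  constructor
  · rintro ⟨a, b, h, hx⟩
    exact ⟨b, a, h, by rwa [segment_symm]⟩
  · rintro ⟨a, b, h, hx⟩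
    exact ⟨b, a, h, by rwa [segment_symm]⟩

theorem DeltaMove.reverse (h : DeltaMove X Y) : DeltaMove X.reverse Y.reverse := by
  obtain ⟨p, q, r, hpq, hT, hY⟩ := h
  refine ⟨q, p, r, mem_reverse_edges.2 hpq, ?_, ?_⟩
  · rw [reverse_carrier, Set.insert_comm, hT, segment_symm]
  · ext ⟨a, b⟩
    simp only [mem_reverse_edges, hY, mem_union, mem_sdiff, mem_insert_iff, mem_singleton_iff,
      Prod.mk.injEq]
    tauto

theorem Isotopic.reverse (h : Isotopic X Y) : Isotopic X.reverse Y.reverse := by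
  induction h with
  | rel x y h => exact h.reverse.isotopic
  | refl x => exact .refl _
  | symm x y _ ih => exact ih.symm
  | trans x y z _ _ ih₁ ih₂ => exact ih₁.trans ih₂

end PolygonalLink

end

section

open Set

namespace PolygonalLink

variable {L L' X Y Z : PolygonalLink}

/-! ### Small perturbations of the vertices -/

/-- Disjoint compact sets have disjoint thickenings, and the thickening of a convex set is convex,
so it contains the hull of the displaced points. -/
theorem eventually_disjoint_hull {V : Type*} {x : V → Space} {A B : Set V} (hA : A.Finite)
    (hB : B.Finite) (h : Disjoint (convexHull ℝ (x '' A)) (convexHull ℝ (x '' B))) :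
    ∀ᶠ ε in nhdsWithin (0 : ℝ) (Ioi 0), ∀ y : V → Space,
      (∀ v ∈ A, dist (y v) (x v) < ε) → (∀ v ∈ B, dist (y v) (x v) < ε) →
      Disjoint (convexHull ℝ (y '' A)) (convexHull ℝ (y '' B)) := by
  obtain ⟨δ, hδ, hd⟩ := h.exists_thickenings ((hA.image x).isCompact_convexHull ℝ)
    ((hB.image x).isCompact_convexHull ℝ).isClosed
  have key : ∀ (C : Set V) (ε : ℝ) (y : V → Space), ε ≤ δ → (∀ v ∈ C, dist (y v) (x v) < ε) →
      convexHull ℝ (y '' C) ⊆ Metric.thickening δ (convexHull ℝ (x '' C)) := by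
    intro C ε y hε hy
    refine convexHull_min ?_ ((convex_convexHull ℝ _).thickening δ)
    rintro _ ⟨v, hv, rfl⟩
    exact Metric.mem_thickening_iff.2
      ⟨x v, subset_convexHull ℝ _ (mem_image_of_mem x hv), (hy v hv).trans_le hε⟩
  filter_upwards [Ioo_mem_nhdsGT hδ] with ε hε y hyA hyB
  exact hd.mono (key A ε y hε.2.le hyA) (key B ε y hε.2.le hyB)

/-- Being a link amounts, by `exists_of_disjoint`, to finitely many disjointness conditions between
hulls of vertices, each of them open. The bound `ε` serves all displacements `ψ` at once, which
allows the vertices to be moved one at a time later. -/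
theorem eventually_exists_perturbation (L : PolygonalLink) :
    ∀ᶠ ε in nhdsWithin (0 : ℝ) (Ioi 0), ∀ ψ : Space → Space,
      (∀ v ∈ L.verts, dist (ψ v) v < ε) →
      InjOn ψ L.verts ∧ ∃ L' : PolygonalLink, L'.edges = Prod.map ψ ψ '' L.edges := by
  have h1 : ∀ᶠ ε in nhdsWithin (0 : ℝ) (Ioi 0), ∀ e ∈ L.edges, ∀ f ∈ L.edges,
      e ≠ f → e.2 ≠ f.1 → f.2 ≠ e.1 → ∀ ψ : Space → Space, (∀ v ∈ L.verts, dist (ψ v) v < ε) →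
      Disjoint (segment ℝ (ψ e.1) (ψ e.2)) (segment ℝ (ψ f.1) (ψ f.2)) := by
    simp only [Filter.eventually_all_finite L.finite, Filter.eventually_all]
    intro e he f hf hef h₁ h₂
    have := eventually_disjoint_hull (x := id) (A := {e.1, e.2}) (B := {f.1, f.2})
      (toFinite _) (toFinite _) (by simpa using disjoint_segments he hf hef h₁ h₂)
    filter_upwards [this] with ε hε ψ hψ
    have := hε ψ (by simpa using ⟨hψ _ (left_mem_verts he), hψ _ (right_mem_verts he)⟩)
      (by simpa using ⟨hψ _ (left_mem_verts hf), hψ _ (right_mem_verts hf)⟩)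
    simpa [image_insert_eq] using this
  have h2 : ∀ᶠ ε in nhdsWithin (0 : ℝ) (Ioi 0), ∀ e ∈ L.edges, ∀ f ∈ L.edges,
      e.2 = f.1 → ∀ ψ : Space → Space, (∀ v ∈ L.verts, dist (ψ v) v < ε) →
      ψ e.1 ∉ segment ℝ (ψ f.1) (ψ f.2) ∧ ψ f.2 ∉ segment ℝ (ψ e.1) (ψ e.2) := by
    simp only [Filter.eventually_all_finite L.finite, Filter.eventually_all]
    rintro ⟨u, v⟩ he ⟨v', w⟩ hf hef
    simp only at hef
    subst hef
    have h1 := eventually_disjoint_hull (x := id) (A := {u}) (B := {v, w})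
      (toFinite _) (toFinite _) (by simpa using left_not_mem he hf)
    have h2 := eventually_disjoint_hull (x := id) (A := {w}) (B := {u, v})
      (toFinite _) (toFinite _) (by simpa using right_not_mem he hf)
    have hu := left_mem_verts he
    have hv := right_mem_verts he
    have hw := right_mem_verts hf
    filter_upwards [h1, h2] with ε hε hε' ψ hψ
    have h3 := hε ψ (by simpa using hψ _ hu) (by simpa using ⟨hψ _ hv, hψ _ hw⟩)
    have h4 := hε' ψ (by simpa using hψ _ hw) (by simpa using ⟨hψ _ hu, hψ _ hv⟩)
    simp only [image_singleton, image_insert_eq, convexHull_singleton, convexHull_pair,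
      disjoint_singleton_left] at h3 h4
    exact ⟨h3, h4⟩
  filter_upwards [h1, h2] with ε h1 h2 ψ hψ
  have hinj : InjOn ψ L.verts := by
    rintro _ ⟨e, he, rfl⟩ _ ⟨f, hf, rfl⟩ hef
    by_contra hne
    have hne' : e ≠ f := fun h => hne (h ▸ rfl)
    by_cases h₁ : e.2 = f.1
    · exact (h2 e he f hf h₁ ψ hψ).1 (hef ▸ left_mem_segment ℝ _ _)
    by_cases h₂ : f.2 = e.1
    · exact (h2 f hf e he h₂ ψ hψ).1 (hef ▸ left_mem_segment ℝ _ _)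
    exact (disjoint_left.1 (h1 e he f hf hne' h₁ h₂ ψ hψ)) (left_mem_segment ℝ _ _)
      (hef ▸ left_mem_segment ℝ _ _)
  have hl := fun e he => left_mem_verts (L := L) (e := e) he
  have hr := fun e he => right_mem_verts (L := L) (e := e) he
  refine ⟨hinj, exists_of_disjoint (L.finite.image _) ?_ ?_ ?_ ?_ ?_ ?_⟩
  · rintro _ ⟨e, he, rfl⟩ h
    exact L.nondegenerate e he (hinj (hl e he) (hr e he) h)
  · rintro _ ⟨e, he, rfl⟩ _ ⟨f, hf, rfl⟩ h
    rw [L.source_unique e he f hf (hinj (hl e he) (hl f hf) h)]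
  · rintro _ ⟨e, he, rfl⟩ _ ⟨f, hf, rfl⟩ h
    rw [L.target_unique e he f hf (hinj (hr e he) (hr f hf) h)]
  · rintro _ ⟨e, he, rfl⟩
    obtain ⟨f, hf, h⟩ := L.closed e he
    exact ⟨_, mem_image_of_mem _ hf, congrArg ψ h⟩
  · rintro _ ⟨e, he, rfl⟩ _ ⟨f, hf, rfl⟩ h
    exact h2 e he f hf (hinj (hr e he) (hl f hf) h) ψ hψ
  · rintro _ ⟨e, he, rfl⟩ _ ⟨f, hf, rfl⟩ h h₁ h₂
    exact h1 e he f hf (fun h' => h (h' ▸ rfl)) (fun h' => h₁ (congrArg ψ h'))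
      (fun h' => h₂ (congrArg ψ h')) ψ hψ

/-! ### Moving one vertex -/

/-- The level sets of `g` separate `z` from the plane containing `u`, `x`, `w`. Both links are
related by one Δ-move to the link that runs `u`, `z`, `x`, `w`. The triangles are swept out by
segments from `u` or `w` to points of `B`, and such segments belong to links, so they avoid the
edges in `E`; the values of `g` control the remaining edge at `x` or `z`. -/
theorem isotopic_move_generic {E : Set (Space × Space)} {u w x z : Space} {B : Set Space}
    (hB : Convex ℝ B) (hx : x ∈ B) (hz : z ∈ B) {F : Space → PolygonalLink}
    (hF : ∀ y ∈ B, (F y).edges = E ∪ {(u, y), (y, w)})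
    (hE : ∀ y ∈ B, (u, y) ∉ E ∧ (y, w) ∉ E) (g : Space →ₗ[ℝ] ℝ) (hu : g u = g x)
    (hw : g w = g x) (hgz : g z ≠ g x) : Isotopic (F x) (F z) := by
  have hmem : ∀ y ∈ B, (u, y) ∈ (F y).edges ∧ (y, w) ∈ (F y).edges := fun y hy => by
    simp [hF y hy]
  have hux : u ≠ x := (F x).nondegenerate _ (hmem x hx).1
  have huw : u ≠ w := by rintro rfl; exact not_two_gon (hmem x hx).1 (hmem x hx).2
  have key : ∀ y ∈ B, ∀ e ∈ E, ∀ v ∈ segment ℝ e.1 e.2,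
      (v ∈ segment ℝ u y → v = u) ∧ (v ∈ segment ℝ y w → v = w) := by
    intro y hy e he v hv
    have heF : e ∈ (F y).edges := by rw [hF y hy]; exact Or.inl he
    have hy' : v = y → v ≠ e.1 ∧ v ≠ e.2 := by
      rintro rfl
      refine ⟨fun h => (hE v hy).2 ?_, fun h => (hE v hy).1 ?_⟩
      · rwa [← (F v).source_unique _ heF _ (hmem v hy).2 h.symm]
      · rwa [← (F v).target_unique _ heF _ (hmem v hy).1 h.symm]
    constructor
    · intro hv'
      obtain ⟨h1, h2⟩ := eq_of_mem_segments heF (hmem y hy).1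
        (fun h => (hE y hy).1 (h ▸ he)) hv hv'
      refine h2.resolve_right fun h => ?_
      rcases h1 with h1 | h1
      exacts [(hy' h).1 h1, (hy' h).2 h1]
    · intro hv'
      obtain ⟨h1, h2⟩ := eq_of_mem_segments heF (hmem y hy).2
        (fun h => (hE y hy).2 (h ▸ he)) hv hv'
      refine h2.resolve_left fun h => ?_
      rcases h1 with h1 | h1
      exacts [(hy' h).1 h1, (hy' h).2 h1]
  have hgz' : g z - g x ≠ 0 := sub_ne_zero.2 hgz
  -- first triangle
  obtain ⟨Y, hY, hΔ⟩ := exists_deltaMove (L := F x) (p := u) (q := x) (r := z) (hmem x hx).1 (by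
    rintro v ⟨hv, hv'⟩
    rw [convexHull_triple_eq] at hv
    obtain ⟨y, hy, hvy⟩ := hv
    have hyB : y ∈ B := hB.segment_subset hx hz hy
    obtain ⟨e, he, hve⟩ := mem_carrier.1 hv'
    rw [hF x hx] at he
    rcases he with he | rfl | rfl
    · rw [(key y hyB e he v hve).1 hvy]; exact left_mem_segment ℝ _ _
    · exact hve
    · obtain ⟨a, b, ha, hb, hab, rfl⟩ := hy
      obtain ⟨c, d, hc, hd, hcd, rfl⟩ := hvy
      obtain ⟨a', b', ha', hb', hab', h⟩ := hve
      have h1 := congrArg g h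
      simp only [map_add, map_smul, smul_eq_mul, hu, hw] at h1
      have h2 : d * b * (g z - g x) = 0 := by
        obtain rfl : a' = 1 - b' := by linarith
        obtain rfl : c = 1 - d := by linarith
        obtain rfl : a = 1 - b := by linarith
        linear_combination -h1
      rcases mul_eq_zero.1 ((mul_eq_zero.1 h2).resolve_right hgz') with rfl | rfl
      · rw [show c = 1 by linarith]; simp [left_mem_segment]
      · rw [show a = 1 by linarith]; exact ⟨c, d, hc, hd, hcd, by simp⟩)
    (by
      rintro ⟨a, b, ha, hb, hab, h⟩
      have h1 := congrArg g h
      simp only [map_add, map_smul, smul_eq_mul, hu] at h1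
      have h2 : a * (g z - g x) = 0 := by
        obtain rfl : b = 1 - a := by linarith
        linear_combination h1
      obtain rfl := (mul_eq_zero.1 h2).resolve_right hgz'
      rw [show b = 1 by linarith] at h
      exact hux (by simpa using h.symm))
    (by
      rintro ⟨a, b, ha, hb, hab, h⟩
      have h1 := congrArg g h
      simp only [map_add, map_smul, smul_eq_mul, hu] at h1
      have h2 : b * (g z - g x) = 0 := by
        obtain rfl : a = 1 - b := by linarith
        linear_combination h1
      obtain rfl := (mul_eq_zero.1 h2).resolve_right hgz'
      rw [show a = 1 by linarith] at h
      exact hux (by simpa using h))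
  have hxw : x ≠ w := (F x).nondegenerate _ (hmem x hx).2
  have hzw : z ≠ w := (F z).nondegenerate _ (hmem z hz).2
  have hxz : x ≠ z := by rintro rfl; exact hgz rfl
  -- second triangle
  obtain ⟨Y', hY', hΔ'⟩ := exists_deltaMove (L := F z) (p := z) (q := w) (r := x) (hmem z hz).2 (by
    rintro v ⟨hv, hv'⟩
    rw [Set.insert_comm, convexHull_triple_eq] at hv
    obtain ⟨y, hy, hvy⟩ := hv
    have hyB : y ∈ B := hB.segment_subset hz hx hy
    obtain ⟨e, he, hve⟩ := mem_carrier.1 hv'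
    rw [hF z hz] at he
    rcases he with he | rfl | rfl
    · rw [(key y hyB e he v hve).2 (by rwa [segment_symm])]; exact right_mem_segment ℝ _ _
    · obtain ⟨a, b, ha, hb, hab, rfl⟩ := hy
      obtain ⟨c, d, hc, hd, hcd, rfl⟩ := hvy
      obtain ⟨a', b', ha', hb', hab', h⟩ := hve
      have h1 := congrArg g h
      simp only [map_add, map_smul, smul_eq_mul, hu, hw] at h1
      have h2 : (b' - d * a) * (g z - g x) = 0 := by
        obtain rfl : a' = 1 - b' := by linarith
        obtain rfl : c = 1 - d := by linarith
        obtain rfl : b = 1 - a := by linarith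
        linear_combination h1
      have h3 : b' = d * a := sub_eq_zero.1 ((mul_eq_zero.1 h2).resolve_right hgz')
      -- Comparing levels eliminates `z`. The remaining relation puts `u` on the segment `x w`,
      -- unless the common point is `z` itself.
      have h4 : a' • u = c • w + (d * b) • x := by
        rw [h3] at h
        simp only [smul_add, smul_smul] at h
        linear_combination (exp := 1) h
      by_cases ha'0 : a' = 0
      · have h5 : d * a = 1 := by linarith
        have : c = 0 := by nlinarith
        have hd1 : d = 1 := by linarith
        have : a = 1 := by rw [hd1] at h5; linarith
        have : b = 0 := by linarith
        subst_vars
        simp [left_mem_segment]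
      · exfalso
        have hpos : 0 < a' := lt_of_le_of_ne ha' (Ne.symm ha'0)
        apply left_not_mem (hmem x hx).1 (hmem x hx).2
        refine ⟨d * b / a', c / a', by positivity, by positivity, ?_, ?_⟩
        · field_simp
          obtain rfl : b = 1 - a := by linarith
          linarith
        · rw [← inv_smul_smul₀ ha'0 u, h4]
          simp only [smul_add, smul_smul]
          rw [add_comm]; congr 2 <;> ring
    · exact hve)
    (by
      rintro ⟨a, b, ha, hb, hab, h⟩
      have h1 := congrArg g h
      simp only [map_add, map_smul, smul_eq_mul, hw] at h1
      exact hgz (by rw [← h1, ← add_mul, hab, one_mul]))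
    (by
      rintro ⟨a, b, ha, hb, hab, h⟩
      have h1 := congrArg g h
      simp only [map_add, map_smul, smul_eq_mul, hw] at h1
      have h2 : a * (g z - g x) = 0 := by
        obtain rfl : b = 1 - a := by linarith
        linear_combination h1
      obtain rfl := (mul_eq_zero.1 h2).resolve_right hgz'
      rw [show b = 1 by linarith] at h
      exact hxw (by simpa using h))
  have hYY : Y.edges = Y'.edges := by
    rw [hY, hY', hF x hx, hF z hz]
    have h1 := hE x hx
    have h2 := hE z hz
    ext e
    simp only [mem_union, mem_sdiff, mem_insert_iff, mem_singleton_iff]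
    constructor
    · rintro (⟨h | rfl | rfl, h'⟩ | rfl | rfl)
      · exact Or.inl ⟨Or.inl h, fun h'' => h2.2 (h'' ▸ h)⟩
      · exact (h' rfl).elim
      · exact Or.inr (Or.inr rfl)
      · refine Or.inl ⟨Or.inr (Or.inl rfl), fun h => ?_⟩
        exact hzw (Prod.ext_iff.1 h).2
      · exact Or.inr (Or.inl rfl)
    · rintro (⟨h | rfl | rfl, h'⟩ | rfl | rfl)
      · exact Or.inl ⟨Or.inl h, fun h'' => h1.1 (h'' ▸ h)⟩
      · exact Or.inr (Or.inl rfl)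
      · exact (h' rfl).elim
      · exact Or.inr (Or.inr rfl)
      · refine Or.inl ⟨Or.inr (Or.inr rfl), fun h => ?_⟩
        exact hux (Prod.ext_iff.1 h).1.symm
  exact hΔ.isotopic.trans ((Isotopic.of_edges_eq hYY).trans hΔ'.isotopic.symm)

theorem exists_functional (a b : Space) : ∃ g : Space →ₗ[ℝ] ℝ, g ≠ 0 ∧ g a = 0 ∧ g b = 0 := by
  have hlt : Submodule.span ℝ {a, b} < ⊤ := by
    refine lt_top_iff_ne_top.2 fun h => ?_
    have h1 : Module.finrank ℝ (Submodule.span ℝ ({a, b} : Set Space)) = 3 := by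
      rw [h]; simp
    have h2 := finrank_span_finset_le_card (R := ℝ) ({a, b} : Finset Space)
    have h3 := Finset.card_le_two (a := a) (b := b)
    rw [Finset.coe_pair, Set.finrank] at h2
    omega
  obtain ⟨g, hg, hle⟩ := Submodule.exists_le_ker_of_lt_top _ hlt
  exact ⟨g, hg, hle (Submodule.subset_span (by simp)), hle (Submodule.subset_span (by simp))⟩

theorem exists_ne_zero_of_functionals {g₁ g₂ : Space →ₗ[ℝ] ℝ} (h₁ : g₁ ≠ 0) (h₂ : g₂ ≠ 0) :
    ∃ v, g₁ v ≠ 0 ∧ g₂ v ≠ 0 := by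
  obtain ⟨a, ha⟩ := DFunLike.ne_iff.1 h₁
  obtain ⟨b, hb⟩ := DFunLike.ne_iff.1 h₂
  simp only [LinearMap.zero_apply] at ha hb
  by_cases h : g₂ a = 0
  · by_cases h' : g₁ b = 0
    · exact ⟨a + b, by simpa [h'] using ha, by simpa [h] using hb⟩
    · exact ⟨b, h', hb⟩
  · exact ⟨a, ha, h⟩

/-- The position of `z` may be special, so the vertex travels through an auxiliary point `x + s • v`
of `B` that avoids both the plane chosen for `x` and the plane chosen for `z`. Only one value of `s`
is forbidden by the second plane, and small positive `s` are fine for the first. -/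
theorem isotopic_move {E : Set (Space × Space)} {u w x z : Space} {B : Set Space}
    (hB : Convex ℝ B) (hBo : IsOpen B) (hx : x ∈ B) (hz : z ∈ B) {F : Space → PolygonalLink}
    (hF : ∀ y ∈ B, (F y).edges = E ∪ {(u, y), (y, w)})
    (hE : ∀ y ∈ B, (u, y) ∉ E ∧ (y, w) ∉ E) : Isotopic (F x) (F z) := by
  obtain ⟨g₁, hg₁, h1, h2⟩ := exists_functional (u - x) (w - x)
  obtain ⟨g₂, hg₂, h3, h4⟩ := exists_functional (u - z) (w - z)
  rw [map_sub, sub_eq_zero] at h1 h2 h3 h4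
  obtain ⟨v, hv₁, hv₂⟩ := exists_ne_zero_of_functionals hg₁ hg₂
  have hev : ∀ᶠ s in nhdsWithin (0 : ℝ) (Ioi 0), x + s • v ∈ B := by
    have hc : Continuous fun s : ℝ => x + s • v := by fun_prop
    exact (hc.continuousAt.eventually_mem (by simpa using hBo.mem_nhds hx)).filter_mono
      nhdsWithin_le_nhds
  have hev' : ∀ᶠ s in nhdsWithin (0 : ℝ) (Ioi 0), s ≠ (g₂ z - g₂ x) / g₂ v := by
    rcases le_or_gt ((g₂ z - g₂ x) / g₂ v) 0 with h | h
    · filter_upwards [self_mem_nhdsWithin] with s hs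
      exact (h.trans_lt hs).ne'
    · filter_upwards [Ioo_mem_nhdsGT h] with s hs
      exact hs.2.ne
  obtain ⟨s, hs, hs', hs0⟩ := (hev.and (hev'.and self_mem_nhdsWithin)).exists
  have hs0' : s ≠ 0 := (show (0 : ℝ) < s from hs0).ne'
  refine (isotopic_move_generic hB hx hs hF hE g₁ h1 h2 (by simp [hs0', hv₁])).trans
    (isotopic_move_generic hB hz hs hF hE g₂ h3 h4 ?_).symm
  intro h
  apply hs'
  rw [map_add, map_smul, smul_eq_mul] at h
  field_simp
  linarith

/-- The vertices are moved one after another. Every intermediate configuration is itself a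
displacement by less than `ε`, hence a link, so `isotopic_move` applies with the ball around the
current vertex as the region of admissible positions. -/
theorem eventually_isotopic_perturbation (L : PolygonalLink) :
    ∀ᶠ ε in nhdsWithin (0 : ℝ) (Ioi 0), ∀ ψ : Space → Space,
      (∀ v ∈ L.verts, dist (ψ v) v < ε) →
      InjOn ψ L.verts ∧ ∃ L' : PolygonalLink, L'.edges = Prod.map ψ ψ '' L.edges ∧
        Isotopic L L' := by
  classical
  filter_upwards [eventually_exists_perturbation L, self_mem_nhdsWithin] with ε hε hε0 ψ hψ
  refine ⟨(hε ψ hψ).1, ?_⟩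
  have hfin := L.verts_finite
  suffices ∀ S ⊆ hfin.toFinset, ∃ L' : PolygonalLink,
      L'.edges = Prod.map (S.piecewise ψ id) (S.piecewise ψ id) '' L.edges ∧ Isotopic L L' by
    obtain ⟨L', hL', h⟩ := this hfin.toFinset subset_rfl
    refine ⟨L', hL'.trans (image_congr fun e he => ?_), h⟩
    simp [Prod.map, Finset.piecewise, left_mem_verts he, right_mem_verts he]
  intro S
  induction S using Finset.induction_on with
  | empty => exact fun _ => ⟨L, by simp, .refl _⟩
  | insert v S hvS ih =>
    intro hS
    obtain ⟨L₁, hL₁, hiso⟩ := ih ((Finset.subset_insert _ _).trans hS)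
    have hv : v ∈ L.verts := by simpa using hS (Finset.mem_insert_self v S)
    -- The vertices in `S` have already been moved, `v` is placed at the variable point `x`, and all
    -- others rest.
    set χ : Space → Space → Space := fun x => Function.update (S.piecewise ψ id) v x with hχ
    have hclose : ∀ x ∈ Metric.ball v ε, ∀ a ∈ L.verts, dist (χ x a) a < ε := by
      intro x hx a ha
      by_cases h : a = v
      · subst h; simpa [hχ] using hx
      · simp only [hχ, Function.update_of_ne h]
        by_cases h' : a ∈ S
        · simpa [h'] using hψ a ha
        · simpa [h'] using hε0
    have : Nonempty PolygonalLink := ⟨L⟩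
    choose! F hF using fun x hx => (hε (χ x) (hclose x hx)).2
    have hinj := fun x hx => (hε (χ x) (hclose x hx)).1
    obtain ⟨u, hu⟩ := exists_pred hv
    obtain ⟨w, hw⟩ := exists_succ hv
    have huv : u ≠ v := L.nondegenerate _ hu
    have hwv : w ≠ v := (L.nondegenerate _ hw).symm
    have h0 : ∀ x a, a ≠ v → χ x a = S.piecewise ψ id a := fun x a h => by
      simp only [hχ, Function.update_of_ne h]
    have hvx : ∀ x, χ x v = x := fun x => by simp [hχ]
    set T := L.edges \ {(u, v), (v, w)} with hT
    have hTne : ∀ e ∈ T, e.1 ≠ v ∧ e.2 ≠ v := by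
      rintro e ⟨he, hne⟩
      simp only [mem_insert_iff, mem_singleton_iff, not_or] at hne
      exact ⟨fun h => hne.2 (L.source_unique _ he _ hw h),
        fun h => hne.1 (L.target_unique _ he _ hu h)⟩
    have hLT : L.edges = T ∪ {(u, v), (v, w)} := by
      rw [hT, sdiff_union_of_subset]
      simp [insert_subset_iff, hu, hw]
    set χ₀ : Space → Space := S.piecewise ψ id with hχ₀
    have himg : ∀ x, Prod.map (χ x) (χ x) '' L.edges =
        Prod.map χ₀ χ₀ '' T ∪ {(χ₀ u, x), (x, χ₀ w)} := by
      intro x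
      rw [hLT, image_union, image_insert_eq, image_singleton]
      simp only [Prod.map_apply, hvx, h0 x u huv, h0 x w hwv]
      congr 1
      refine image_congr fun e he => ?_
      rw [Prod.map_apply', Prod.map_apply', h0 x _ (hTne e he).1, h0 x _ (hTne e he).2]
    have hmove : ∀ x ∈ Metric.ball v ε, ∀ z ∈ Metric.ball v ε, Isotopic (F x) (F z) := by
      intro x hx z hz
      refine isotopic_move (convex_ball v ε) Metric.isOpen_ball hx hz
        (fun y hy => (hF y hy).trans (himg y)) fun y hy => ⟨?_, ?_⟩
      · rintro ⟨e, he, h⟩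
        have h2 : χ y e.2 = χ y v := by
          rw [h0 y _ (hTne e he).2, hvx]; exact (Prod.ext_iff.1 h).2
        exact (hTne e he).2 (hinj y hy (right_mem_verts he.1) hv h2)
      · rintro ⟨e, he, h⟩
        have h2 : χ y e.1 = χ y v := by
          rw [h0 y _ (hTne e he).1, hvx]; exact (Prod.ext_iff.1 h).1
        exact (hTne e he).1 (hinj y hy (left_mem_verts he.1) hv h2)
    have hv0 : v ∈ Metric.ball v ε := Metric.mem_ball_self hε0
    have hv1 : ψ v ∈ Metric.ball v ε := hψ v hv
    refine ⟨F (ψ v), ?_, hiso.trans (.trans (.of_edges_eq ?_) (hmove v hv0 _ hv1))⟩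
    · rw [hF _ hv1]
      simp only [hχ, Finset.piecewise_insert, hχ₀]
    · rw [hL₁, hF _ hv0]
      congr 2 <;> simp [hχ, hχ₀, hvS]

/-- Labels for the vertices make it possible to compare nearby configurations in a motion, and later
to treat the vertices of a host and those of an inserted knot as one configuration labelled by a sum
type. -/
theorem eventually_isotopic_indexed {V : Type*} {E : Set (V × V)} {W : Set V} {x : V → Space}
    (hE : ∀ e ∈ E, e.1 ∈ W ∧ e.2 ∈ W) (hx : InjOn x W) (hX : X.edges = Prod.map x x '' E) :
    ∀ᶠ ε in nhdsWithin (0 : ℝ) (Ioi 0), ∀ y : V → Space, (∀ v ∈ W, dist (y v) (x v) < ε) →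
      ∃ Y : PolygonalLink, Y.edges = Prod.map y y '' E ∧ Isotopic X Y := by
  rcases isEmpty_or_nonempty V with hV | hV
  · refine Filter.Eventually.of_forall fun ε y _ => ⟨X, ?_, .refl _⟩
    rw [hX, show y = x from Subsingleton.elim _ _]
  filter_upwards [eventually_isotopic_perturbation X] with ε hε y hy
  have hinv : ∀ v ∈ W, Function.invFunOn x W (x v) = v := fun v hv => hx.leftInvOn_invFunOn hv
  obtain ⟨-, Y, hY, hiso⟩ := hε (y ∘ Function.invFunOn x W) (by
    rintro _ ⟨e, he, rfl⟩
    rw [hX] at he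
    obtain ⟨a, ha, rfl⟩ := he
    simp only [Prod.map_fst, Function.comp_apply, hinv _ (hE a ha).1]
    exact hy _ (hE a ha).1)
  refine ⟨Y, ?_, hiso⟩
  rw [hY, hX, image_image]
  refine image_congr fun e he => ?_
  simp [Prod.map, hinv _ (hE e he).1, hinv _ (hE e he).2]

/-! ### Continuous families of links -/

/-- The isotopy class of `X t` is locally constant in `t`, and the unit interval is connected. -/
theorem isotopic_of_motion {B : PolygonalLink} {x : ℝ → Space → Space}
    (hc : ∀ v ∈ B.verts, ContinuousOn (fun t => x t v) (Icc 0 1))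
    (hinj : ∀ t ∈ Icc (0 : ℝ) 1, InjOn (x t) B.verts) {X : ℝ → PolygonalLink}
    (hX : ∀ t ∈ Icc (0 : ℝ) 1, (X t).edges = Prod.map (x t) (x t) '' B.edges) :
    Isotopic (X 0) (X 1) := by
  refine isPreconnected_Icc.induction₂ (fun s t => Isotopic (X s) (X t)) ?_
    (fun _ _ _ _ _ _ h h' => h.trans h') (fun _ _ _ _ h => h.symm) (left_mem_Icc.2 zero_le_one)
    (right_mem_Icc.2 zero_le_one)
  intro t ht
  obtain ⟨ε, hε, hε0⟩ := ((eventually_isotopic_indexed (E := B.edges) (W := B.verts)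
    (fun e he => ⟨left_mem_verts he, right_mem_verts he⟩) (hinj t ht) (hX t ht)).and
    self_mem_nhdsWithin).exists
  have hev : ∀ᶠ s in nhdsWithin t (Icc 0 1), ∀ v ∈ B.verts, dist (x s v) (x t v) < ε :=
    (Filter.eventually_all_finite B.verts_finite).2 fun v hv =>
      Metric.continuousWithinAt_iff'.1 (hc v hv t ht) ε hε0
  filter_upwards [hev, self_mem_nhdsWithin] with s hs hs'
  obtain ⟨Y, hY, hiso⟩ := hε (x s) hs
  exact hiso.trans (.of_edges_eq (hY.trans (hX s hs').symm))

end PolygonalLink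

end

section

open Set

namespace PolygonalLink

variable {L L' X Y Z : PolygonalLink}

/-! ### Refinements -/

theorem lineMap_mem_segment_lineMap {a b : Space} {r s t : ℝ} (h₁ : r ≤ s) (h₂ : s ≤ t) :
    AffineMap.lineMap a b s ∈
      segment ℝ (AffineMap.lineMap a b r : Space) (AffineMap.lineMap a b t) := by
  rw [← image_segment ℝ (AffineMap.lineMap a b : ℝ →ᵃ[ℝ] Space), segment_eq_Icc (h₁.trans h₂)]
  exact mem_image_of_mem _ ⟨h₁, h₂⟩

theorem lineMap_mem_openSegment {a b : Space} {s : ℝ} (h₁ : 0 < s) (h₂ : s < 1) :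
    (AffineMap.lineMap a b s : Space) ∈ openSegment ℝ a b := by
  rw [openSegment_eq_image_lineMap]
  exact mem_image_of_mem _ ⟨h₁, h₂⟩

/-- If every edge of `R` is a part of an edge of `L` and every vertex of `L` is a vertex of `R`,
then `R` arises from `L` by subdividing edges. -/
theorem isotopic_of_refines {L R : PolygonalLink}
    (h : ∀ e ∈ R.edges, ∃ g ∈ L.edges, ∃ s t : ℝ, 0 ≤ s ∧ s < t ∧ t ≤ 1 ∧
      e.1 = AffineMap.lineMap g.1 g.2 s ∧ e.2 = AffineMap.lineMap g.1 g.2 t)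
    (hv : L.verts ⊆ R.verts) : Isotopic L R := by
  induction hn : (R.verts \ L.verts).ncard generalizing L with
  | zero =>
    -- Without new vertices an edge of `R` inside an edge of `L` must be the whole of it.
    have hsub : R.verts ⊆ L.verts := by
      rw [Set.ncard_eq_zero (R.verts_finite.sdiff)] at hn
      exact sdiff_eq_empty.1 hn
    have hRL : R.edges ⊆ L.edges := by
      intro e he
      obtain ⟨g, hg, s, t, hs, hst, ht, h1, h2⟩ := h e he
      have hne := L.nondegenerate g hg
      have hinj := AffineMap.lineMap_injective ℝ hne
      have hmem : ∀ c : ℝ, 0 ≤ c → c ≤ 1 →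
          (AffineMap.lineMap g.1 g.2 c : Space) ∈ segment ℝ g.1 g.2 := fun c h h' => by
        rw [segment_eq_image_lineMap]; exact mem_image_of_mem _ ⟨h, h'⟩
      have h3 : s = 0 := by
        rcases vertex_mem_edge (hsub (left_mem_verts he)) hg
          (h1 ▸ hmem s hs (hst.le.trans ht)) with h3 | h3
        · exact hinj (by rw [← h1, h3]; simp)
        · have : s = 1 := hinj (by rw [← h1, h3]; simp)
          linarith
      have h4 : t = 1 := by
        rcases vertex_mem_edge (hsub (right_mem_verts he)) hg
          (h2 ▸ hmem t (hs.trans hst.le) ht) with h4 | h4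
        · have : t = 0 := hinj (by rw [← h2, h4]; simp)
          linarith
        · exact hinj (by rw [← h2, h4]; simp)
      subst h3 h4
      rw [show e = g from Prod.ext (by simpa using h1) (by simpa using h2)]
      exact hg
    refine .of_edges_eq (Subset.antisymm (fun g hg => ?_) hRL)
    obtain ⟨w, hw⟩ := exists_succ (hv (left_mem_verts hg))
    rwa [L.source_unique _ hg _ (hRL hw) rfl]
  | succ n ih =>
    obtain ⟨r, hrR, hrL⟩ : (R.verts \ L.verts).Nonempty := by
      rw [← Set.ncard_pos (R.verts_finite.sdiff)]; omega
    obtain ⟨w, hw⟩ := exists_succ hrR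
    obtain ⟨⟨p, q⟩, hg, s, t, hs, hst, ht, h1, h2⟩ := h _ hw
    simp only at h1 h2
    have hpq : p ≠ q := L.nondegenerate _ hg
    have hs0 : 0 < s := by
      refine hs.lt_of_ne ?_
      rintro rfl
      exact hrL (by rw [h1]; simpa using left_mem_verts hg)
    have hs1 : s < 1 := hst.trans_le ht
    obtain ⟨L₁, hL₁, hΔ⟩ := exists_subdivision hg (h1 ▸ lineMap_mem_openSegment hs0 hs1)
    have hverts : L₁.verts = insert r L.verts := by
      ext v
      simp only [verts, hL₁, image_union, mem_union, image_insert_eq, image_singleton,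
        mem_insert_iff, mem_singleton_iff]
      constructor
      · rintro (⟨e, he, rfl⟩ | rfl | rfl)
        exacts [Or.inr ⟨e, he.1, rfl⟩, Or.inr ⟨_, hg, rfl⟩, Or.inl rfl]
      · rintro (rfl | ⟨e, he, rfl⟩)
        · exact Or.inr (Or.inr rfl)
        · by_cases h : e = (p, q)
          · subst h; exact Or.inr (Or.inl rfl)
          · exact Or.inl ⟨e, ⟨he, h⟩, rfl⟩
    refine hΔ.isotopic.trans (ih ?_ ?_ ?_)
    · intro e he
      obtain ⟨g, hg', s', t', hs', hst', ht', h1', h2'⟩ := h e he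
      by_cases hgp : g = (p, q)
      · subst hgp
        simp only at h1' h2'
        rcases le_or_gt t' s with hle | hlt
        · refine ⟨(p, r), by simp [hL₁], s' / s, t' / s, by positivity, by gcongr,
            (div_le_one hs0).2 hle, ?_, ?_⟩
          · rw [h1', h1, AffineMap.lineMap_lineMap_right, div_mul_cancel₀ _ hs0.ne']
          · rw [h2', h1, AffineMap.lineMap_lineMap_right, div_mul_cancel₀ _ hs0.ne']
        -- The new vertex `r` is a vertex of `R`, so it is not interior to an edge of `R`: each such
        -- edge on `p q` lies on one side of `r`.
        have hle : s ≤ s' := by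
          by_contra! hlt'
          have hm : r ∈ segment ℝ e.1 e.2 := by
            rw [h1', h2', h1]; exact lineMap_mem_segment_lineMap hlt'.le hlt.le
          have hinj := AffineMap.lineMap_injective ℝ hpq
          rcases vertex_mem_edge hrR he hm with h3 | h3
          · rw [h1, h1'] at h3; exact hlt'.ne' (hinj h3)
          · rw [h1, h2'] at h3; exact hlt.ne (hinj h3)
        have hs1' : 0 < 1 - s := by linarith
        refine ⟨(r, q), by simp [hL₁], (s' - s) / (1 - s), (t' - s) / (1 - s),
          div_nonneg (by linarith) hs1'.le, by gcongr, (div_le_one hs1').2 (by linarith), ?_, ?_⟩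
        · rw [h1', h1, AffineMap.lineMap_lineMap_left]; congr 1; field_simp; ring
        · rw [h2', h1, AffineMap.lineMap_lineMap_left]; congr 1; field_simp; ring
      · exact ⟨g, by rw [hL₁]; exact Or.inl ⟨hg', hgp⟩, s', t', hs', hst', ht', h1', h2'⟩
    · rw [hverts]; exact insert_subset hrR hv
    · rw [hverts, ← Set.union_singleton, ← Set.sdiff_sdiff,
        Set.ncard_sdiff_singleton_of_mem (show r ∈ R.verts \ L.verts from ⟨hrR, hrL⟩), hn]
      rfl

/-- A continuous family of maps that are injective on a link and affine on its edges gives an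
isotopy. -/
theorem isotopic_of_injective_family {L L' : PolygonalLink} {g : ℝ → Space → Space}
    (hc : ∀ v ∈ L.verts, ContinuousOn (fun t => g t v) (Icc 0 1))
    (hinj : ∀ t ∈ Icc (0 : ℝ) 1, InjOn (g t) L.carrier)
    (haff : ∀ t ∈ Icc (0 : ℝ) 1, ∀ e ∈ L.edges,
      g t '' segment ℝ e.1 e.2 = segment ℝ (g t e.1) (g t e.2))
    (h0 : ∀ v ∈ L.verts, g 0 v = v) (hL' : L'.edges = Prod.map (g 1) (g 1) '' L.edges) :
    Isotopic L L' := by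
  have : Nonempty PolygonalLink := ⟨L⟩
  choose! X hX _ using fun t ht => exists_map L (g t) (hinj t ht) (haff t ht)
  have h := isotopic_of_motion hc (fun t ht => (hinj t ht).mono verts_subset_carrier) hX
  refine Isotopic.trans (.of_edges_eq ?_) (h.trans (.of_edges_eq ?_))
  · rw [hX 0 (left_mem_Icc.2 zero_le_one)]
    ext e
    constructor
    · intro he
      exact ⟨e, he, Prod.ext (h0 _ (left_mem_verts he)) (h0 _ (right_mem_verts he))⟩
    · rintro ⟨e, he, rfl⟩
      rwa [show Prod.map (g 0) (g 0) e = e from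
        Prod.ext (h0 _ (left_mem_verts he)) (h0 _ (right_mem_verts he))]
  · rw [hX 1 (right_mem_Icc.2 zero_le_one), hL']

end PolygonalLink

end

section

open Set Matrix

/-! ### Paths of matrices with positive determinant -/

theorem mulVec_ne_zero_of_det_pos {M : Matrix (Fin 3) (Fin 3) ℝ} (h : 0 < M.det) {v : Space}
    (hv : v ≠ 0) : M *ᵥ v ≠ 0 := fun h' => hv (Matrix.eq_zero_of_mulVec_eq_zero h.ne' h')

/-- A straight path of nonzero vectors lifts to a path of matrices. -/
theorem exists_lift_path {M : Matrix (Fin 3) (Fin 3) ℝ} (hM : 0 < M.det) {v d : Space}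
    (hne : ∀ t ∈ Icc (0 : ℝ) 1, (1 - t) • (M *ᵥ v) + t • d ≠ 0) :
    ∃ χ : ℝ → Matrix (Fin 3) (Fin 3) ℝ, Continuous χ ∧ χ 0 = M ∧
      ∀ t ∈ Icc (0 : ℝ) 1, 0 < (χ t).det ∧ χ t *ᵥ v = (1 - t) • (M *ᵥ v) + t • d := by
  set a := M *ᵥ v with ha
  have ha0 : a ≠ 0 := by simpa using hne 0 (by simp)
  set w := d - a with hw
  have haa : 0 < a ⬝ᵥ a := by
    have h := dotProduct_self_star_pos_iff (v := a)
    simpa using h.2 ha0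
  -- The path of matrices will be `(1 + t w ηᵀ) M`. Since `η ⬝ᵥ a = 1` it moves `a` to `a + t w`,
  -- and its determinant is that of `M` times `1 + t (η ⬝ᵥ w)`. If `a` and `w` are independent, `η`
  -- can be taken orthogonal to `w`. If `w = μ a`, the multiple of `a` is forced up to irrelevant
  -- parts, and the factor `1 + t μ` stays positive because the path of vectors avoids zero.
  obtain ⟨η, hη, hpos⟩ : ∃ η : Space, η ⬝ᵥ a = 1 ∧ ∀ t ∈ Icc (0 : ℝ) 1, 0 < 1 + t * (η ⬝ᵥ w) := by
    set k : Space := (w ⬝ᵥ w) • a - (w ⬝ᵥ a) • w with hk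
    have hkw : k ⬝ᵥ w = 0 := by
      simp only [hk, sub_dotProduct, smul_dotProduct, smul_eq_mul, dotProduct_comm a w]; ring
    by_cases hka : k ⬝ᵥ a = 0
    · have hkk : k ⬝ᵥ k = 0 := by
        nth_rewrite 2 [hk]
        rw [dotProduct_sub, dotProduct_smul, dotProduct_smul, hka, hkw]; simp
      have hk0 : k = 0 := by
        by_contra h
        have h' := dotProduct_self_star_pos_iff (v := k)
        have := h'.2 h
        simp only [star_trivial] at this
        linarith
      obtain ⟨μ, hμ⟩ : ∃ μ : ℝ, w = μ • a := by
        by_cases hww : w ⬝ᵥ w = 0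
        · refine ⟨0, ?_⟩
          by_contra h
          have h' := dotProduct_self_star_pos_iff (v := w)
          have := h'.2 (by simpa using h)
          simp only [star_trivial] at this
          linarith
        · have h1 : (w ⬝ᵥ w) • a = (w ⬝ᵥ a) • w := sub_eq_zero.1 (hk ▸ hk0)
          have hwa : w ⬝ᵥ a ≠ 0 := by
            intro h
            rw [h, zero_smul, smul_eq_zero] at h1
            exact h1.elim hww ha0
          exact ⟨(w ⬝ᵥ w) / (w ⬝ᵥ a), by
            rw [div_eq_inv_mul, mul_smul, h1, inv_smul_smul₀ hwa]⟩
      refine ⟨(a ⬝ᵥ a)⁻¹ • a, by simp [haa.ne'], fun t ht => ?_⟩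
      have h1 : ((a ⬝ᵥ a)⁻¹ • a) ⬝ᵥ w = μ := by
        rw [hμ]; simp only [smul_dotProduct, dotProduct_smul, smul_eq_mul]; field_simp
      rw [h1]
      by_contra! hle
      have hμ0 : μ < 0 := by
        by_contra! h
        nlinarith [mul_nonneg ht.1 h]
      have hμ1 : μ ≤ -1 := by nlinarith [ht.1, ht.2]
      -- At the time `-1/μ` the path would pass through the origin.
      refine hne (-μ⁻¹) ⟨by rw [neg_nonneg, inv_nonpos]; exact hμ0.le, ?_⟩ ?_
      · rw [neg_le, ← inv_neg_one]
        exact (inv_le_inv_of_neg (by norm_num) hμ0).2 hμ1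
      · have : d = (1 + μ) • a := by rw [add_smul, one_smul, ← hμ, hw]; abel
        rw [this, smul_smul, ← add_smul]
        rw [show (1 - -μ⁻¹ + -μ⁻¹ * (1 + μ)) = 0 by
          linear_combination -mul_inv_cancel₀ hμ0.ne, zero_smul]
    · refine ⟨(k ⬝ᵥ a)⁻¹ • k, by simp [hka], fun t ht => ?_⟩
      simp [hkw]
  refine ⟨fun t => (1 + t • vecMulVec w η) * M, by fun_prop, by simp, fun t ht => ⟨?_, ?_⟩⟩
  · rw [det_mul]
    refine mul_pos ?_ hM
    have h := det_one_add_replicateCol_mul_replicateRow (ι := Unit) (t • w) η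
    have h2 : replicateCol Unit (t • w) * replicateRow Unit η = t • vecMulVec w η := by
      rw [← vecMulVec_eq, smul_vecMulVec]
    rw [h2] at h
    rw [h, dotProduct_smul]
    exact hpos t ht
  · rw [← mulVec_mulVec, ← ha, add_mulVec, one_mulVec, smul_mulVec, vecMulVec_mulVec, hη, hw]
    simp only [MulOpposite.op_one, one_smul]
    module

/-- The straight path from `v` to `d` may hit the origin. It is replaced by two straight paths
through a vector `w` outside a plane that contains both, and each of them is lifted to matrices by
`exists_lift_path`. -/
theorem exists_joinedIn_mulVec_eq {v d : Space} (hv : v ≠ 0) (hd : d ≠ 0) :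
    ∃ M : Matrix (Fin 3) (Fin 3) ℝ, 0 < M.det ∧ M *ᵥ v = d ∧
      JoinedIn {M : Matrix (Fin 3) (Fin 3) ℝ | 0 < M.det} 1 M := by
  obtain ⟨g, hg, h1, h2⟩ := PolygonalLink.exists_functional v d
  obtain ⟨w, hw⟩ := DFunLike.ne_iff.1 hg
  simp only [LinearMap.zero_apply] at hw
  obtain ⟨χ, hχ, hχ0, hχ1⟩ := exists_lift_path (M := 1) (v := v) (d := w) (by simp) (by
    intro t ht h
    have h3 := congrArg g h
    simp only [map_add, map_smul, one_mulVec, h1, smul_eq_mul, map_zero, mul_zero, zero_add] at h3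
    obtain rfl := (mul_eq_zero.1 h3).resolve_right hw
    simp [hv] at h)
  have h1' := hχ1 1 (by simp)
  simp only [sub_self, zero_smul, one_smul, zero_add] at h1'
  obtain ⟨χ', hχ', hχ0', hχ1'⟩ := exists_lift_path (M := χ 1) (v := v) (d := d) h1'.1 (by
    intro t ht h
    rw [h1'.2] at h
    have h3 := congrArg g h
    simp only [map_add, map_smul, h2, smul_eq_mul, map_zero, mul_zero, add_zero] at h3
    have := (mul_eq_zero.1 h3).resolve_right hw
    obtain rfl : t = 1 := by linarith
    simp [hd] at h)
  have h2' := hχ1' 1 (by simp)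
  simp only [sub_self, zero_smul, one_smul, zero_add] at h2'
  refine ⟨χ' 1, h2'.1, h2'.2, (JoinedIn.ofLine hχ.continuousOn hχ0 rfl ?_).trans
    (JoinedIn.ofLine hχ'.continuousOn hχ0' rfl ?_)⟩
  · rintro _ ⟨t, ht, rfl⟩; exact (hχ1 t ht).1
  · rintro _ ⟨t, ht, rfl⟩; exact (hχ1' t ht).1

/-- The lower right block is joined by a segment to its sum with its cofactor matrix. This sum has
the form of a nonzero complex number, the determinant stays positive on the way, and the nonzero
complex numbers are path connected. The segments also make the first row what it should be. -/
theorem joinedIn_block {B : Matrix (Fin 3) (Fin 3) ℝ} (h0 : 0 < B 0 0) (h1 : B 1 0 = 0)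
    (h2 : B 2 0 = 0) (h3 : 0 < B 1 1 * B 2 2 - B 1 2 * B 2 1) :
    JoinedIn {B : Matrix (Fin 3) (Fin 3) ℝ | 0 < B 0 0 ∧ B 1 0 = 0 ∧ B 2 0 = 0 ∧
      0 < B 1 1 * B 2 2 - B 1 2 * B 2 1} 1 B := by
  set S := {B : Matrix (Fin 3) (Fin 3) ℝ | 0 < B 0 0 ∧ B 1 0 = 0 ∧ B 2 0 = 0 ∧
      0 < B 1 1 * B 2 2 - B 1 2 * B 2 1}
  let C : ℝ → ℝ → Matrix (Fin 3) (Fin 3) ℝ := fun x y => !![1, 0, 0; 0, x, y; 0, -y, x]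
  have hCC : ∀ x y x' y' : ℝ, (∀ s t : ℝ, 0 ≤ s → 0 ≤ t → s + t = 1 →
      0 < (s * x + t * x') ^ 2 + (s * y + t * y') ^ 2) → JoinedIn S (C x y) (C x' y') := by
    intro x y x' y' h
    refine JoinedIn.of_segment_subset ?_
    rintro _ ⟨s, t, hs, ht, hst, rfl⟩
    have := h s t hs ht hst
    refine ⟨by simpa [C] using by linarith, by simp [C], by simp [C], ?_⟩
    simp [C]; nlinarith
  have hC1 : ∀ x y : ℝ, 0 < x ^ 2 + y ^ 2 → JoinedIn S 1 (C x y) := by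
    intro x y hxy
    have h10 : (1 : Matrix (Fin 3) (Fin 3) ℝ) = C 1 0 := by
      ext i j; fin_cases i <;> fin_cases j <;> simp [C]
    rw [h10]
    -- A real number may be negative, and the segment from `1` to it would then meet zero; the path
    -- goes through the imaginary unit instead.
    by_cases hy : y = 0
    · subst hy
      have hx : x ≠ 0 := by rintro rfl; simp at hxy
      refine (hCC 1 0 0 1 fun s t hs ht hst => ?_).trans (hCC 0 1 x 0 fun s t hs ht hst => ?_)
      · obtain rfl : t = 1 - s := by linarith
        nlinarith [sq_nonneg (2 * s - 1)]
      · simp only [mul_zero, mul_one, zero_add, add_zero]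
        by_cases h : s = 0
        · have : t = 1 := by linarith
          subst this; have := sq_nonneg s; positivity
        · have := sq_nonneg (t * x); positivity
    · refine hCC 1 0 x y fun s t hs ht hst => ?_
      simp only [mul_zero, mul_one, zero_add]
      by_cases h : t = 0
      · subst h; simp only [zero_mul, add_zero] at *; subst hst; norm_num
      · have := sq_nonneg (s + t * x); positivity
  refine (hC1 (B 1 1 + B 2 2) (B 1 2 - B 2 1) ?_).trans (JoinedIn.trans
    (y := !![1, 0, 0; 0, B 1 1, B 1 2; 0, B 2 1, B 2 2]) ?_ ?_)
  · nlinarith [sq_nonneg (B 1 1 - B 2 2), sq_nonneg (B 1 2 + B 2 1)]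
  · refine JoinedIn.of_segment_subset ?_
    rintro _ ⟨s, t, hs, ht, hst, rfl⟩
    refine ⟨by simpa [C] using by linarith, by simp [C], by simp [C], ?_⟩
    simp [C]
    obtain rfl : t = 1 - s := by linarith
    have h4 : 0 ≤ s * (B 1 1 ^ 2 + B 1 2 ^ 2 + B 2 1 ^ 2 + B 2 2 ^ 2) := by positivity
    have h5 : 0 < (1 + s ^ 2) * (B 1 1 * B 2 2 - B 1 2 * B 2 1) := by positivity
    linarith
  · refine JoinedIn.of_segment_subset ?_
    rintro _ ⟨s, t, hs, ht, hst, rfl⟩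
    refine ⟨?_, by simp [h1], by simp [h2], ?_⟩
    · simp
      rcases hs.eq_or_lt with rfl | hs'
      · rw [show t = 1 by linarith]; simpa using h0
      · have := mul_nonneg ht h0.le; linarith
    · obtain rfl : t = 1 - s := by linarith
      simp
      linarith

/-- The matrices with positive determinant which map `v` into the ray of `d` form a path connected
set. -/
theorem joinedIn_ray {v d : Space} (hd : d ≠ 0) {M M' : Matrix (Fin 3) (Fin 3) ℝ}
    (hM : 0 < M.det) (hMv : ∃ c : ℝ, 0 < c ∧ M *ᵥ v = c • d) (hM' : 0 < M'.det)
    (hMv' : ∃ c : ℝ, 0 < c ∧ M' *ᵥ v = c • d) :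
    JoinedIn {M : Matrix (Fin 3) (Fin 3) ℝ | 0 < M.det ∧ ∃ c : ℝ, 0 < c ∧ M *ᵥ v = c • d} M M' := by
  set e : Space := ![1, 0, 0]
  obtain ⟨P, hP, hPe, -⟩ := exists_joinedIn_mulVec_eq (v := e) (d := d)
    (fun h => by simpa [e] using congrFun h 0) hd
  obtain ⟨c, hc, hMv⟩ := hMv
  obtain ⟨c', hc', hMv'⟩ := hMv'
  have hPu : IsUnit P.det := hP.ne'.isUnit
  have hMu : IsUnit M.det := hM.ne'.isUnit
  have hPd : P⁻¹ *ᵥ d = e := by rw [← hPe, mulVec_mulVec, nonsing_inv_mul _ hPu, one_mulVec]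
  have hMd : M⁻¹ *ᵥ d = c⁻¹ • v := by
    rw [← inv_smul_smul₀ hc.ne' d, ← hMv, mulVec_smul, mulVec_mulVec, nonsing_inv_mul _ hMu,
      one_mulVec]
  -- `M' M⁻¹` maps `d` to a positive multiple of itself. After the change of basis by `P` the first
  -- basis vector has this property, so `joinedIn_block` applies, and the path is transported back
  -- by `B ↦ P B P⁻¹ M`.
  set B := P⁻¹ * (M' * M⁻¹) * P with hB
  have hBe : B *ᵥ e = (c' / c) • e := by
    rw [hB, ← mulVec_mulVec, ← mulVec_mulVec, ← mulVec_mulVec, hPe, hMd, mulVec_smul, hMv',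
      mulVec_smul, mulVec_smul, hPd, smul_smul]
    congr 1; field_simp
  have hentry : ∀ (B : Matrix (Fin 3) (Fin 3) ℝ) i, B i 0 = (B *ᵥ e) i := by
    intro B i; simp [e, mulVec, dotProduct, Fin.sum_univ_three]
  have h0 : B 0 0 = c' / c := (hentry B 0).trans (by rw [hBe]; simp [e])
  have h1 : B 1 0 = 0 := (hentry B 1).trans (by rw [hBe]; simp [e])
  have h2 : B 2 0 = 0 := (hentry B 2).trans (by rw [hBe]; simp [e])
  have hdet : ∀ B : Matrix (Fin 3) (Fin 3) ℝ, B 1 0 = 0 → B 2 0 = 0 →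
      B.det = B 0 0 * (B 1 1 * B 2 2 - B 1 2 * B 2 1) := by
    intro B h1 h2; rw [det_fin_three, h1, h2]; ring
  have hBd : 0 < B.det := by
    rw [hB, det_mul, det_mul, det_mul, det_nonsing_inv, det_nonsing_inv]
    simp only [Ring.inverse_eq_inv']
    positivity
  rw [hdet B h1 h2, h0] at hBd
  have hcc : 0 < c' / c := by positivity
  have hj := (joinedIn_block (h0 ▸ hcc) h1 h2 ((mul_pos_iff_of_pos_left hcc).1 hBd)).map
    (f := fun B => P * B * P⁻¹ * M) (by fun_prop)
  have e1 : P * 1 * P⁻¹ * M = M := by rw [mul_one, mul_nonsing_inv _ hPu, one_mul]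
  have e2 : P * B * P⁻¹ * M = M' := by
    rw [hB]
    simp only [Matrix.mul_assoc]
    rw [mul_nonsing_inv_cancel_left _ _ hPu, mul_nonsing_inv_cancel_left _ _ hPu,
      nonsing_inv_mul _ hMu, mul_one]
  rw [e1, e2] at hj
  refine hj.mono ?_
  rintro _ ⟨B, ⟨b0, b1, b2, b3⟩, rfl⟩
  have hBe : B *ᵥ e = B 0 0 • e := by
    funext i
    refine (hentry B i).symm.trans ?_
    fin_cases i <;> simp [e, b1, b2]
  refine ⟨?_, c * B 0 0, by positivity, ?_⟩
  · simp only [det_mul, hdet B b1 b2, det_nonsing_inv, Ring.inverse_eq_inv']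
    positivity
  · simp only [← mulVec_mulVec]
    rw [hMv, mulVec_smul, hPd, mulVec_smul, hBe, mulVec_smul, mulVec_smul, hPe, smul_smul]

/-- A matrix `A` joined to `1` brings the image of the first basis vector back. Then `A * M` fixes
that vector and is joined to `1` by `joinedIn_ray`, while the path of `A` joins it to `M`. -/
theorem joinedIn_det_pos {M : Matrix (Fin 3) (Fin 3) ℝ} (hM : 0 < M.det) :
    JoinedIn {M : Matrix (Fin 3) (Fin 3) ℝ | 0 < M.det} 1 M := by
  set e : Space := ![1, 0, 0]
  have he : e ≠ 0 := fun h => by simpa [e] using congrFun h 0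
  obtain ⟨A, hA, hAe, hj⟩ := exists_joinedIn_mulVec_eq (mulVec_ne_zero_of_det_pos hM he) he
  have h1 : JoinedIn {M : Matrix (Fin 3) (Fin 3) ℝ | 0 < M.det} 1 (A * M) :=
    (joinedIn_ray (v := e) (d := e) he (M := 1) (by simp) ⟨1, one_pos, by simp⟩
      (by rw [det_mul]; positivity) ⟨1, one_pos, by rw [← mulVec_mulVec, hAe, one_smul]⟩).mono
      fun _ h => h.1
  have h2 := hj.map (f := fun B => B * M) (by fun_prop)
  rw [one_mul] at h2
  refine h1.trans (h2.mono ?_).symm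
  rintro _ ⟨B, hB, rfl⟩
  simp only [mem_ofPred_eq, det_mul] at *
  exact mul_pos hB hM

end

section

open Set Matrix

/-! ### Inserting a local knot into an edge -/

/-- A link with a distinguished edge, in which the line through that edge meets the convex hull
of the link only in that edge. -/
structure LocalKnot where
  link : PolygonalLink
  o : Space
  u : Space
  mem : (u, o) ∈ link.edges
  mem_hull : ∀ t : ℝ, AffineMap.lineMap o u t ∈ convexHull ℝ link.verts → t ∈ Icc (0 : ℝ) 1

namespace LocalKnot

open PolygonalLink

variable (N : LocalKnot)

/-- The convex hull of the local knot. -/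
def hull : Set Space := convexHull ℝ N.link.verts

/-- The affine map with linear part `M` that maps the base point to `c`. -/
def place (c : Space) (M : Matrix (Fin 3) (Fin 3) ℝ) : Space →ᵃ[ℝ] Space where
  toFun x := c + M *ᵥ (x - N.o)
  linear := M.mulVecLin
  map_vadd' x v := by
    simp only [vadd_eq_add, mulVecLin_apply, ← mulVec_add, add_sub_assoc, add_left_comm]

theorem place_apply (c : Space) (M : Matrix (Fin 3) (Fin 3) ℝ) (x : Space) :
    N.place c M x = c + M *ᵥ (x - N.o) := rfl

@[simp] theorem place_o (c : Space) (M : Matrix (Fin 3) (Fin 3) ℝ) : N.place c M N.o = c := by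
  simp [place_apply]

theorem place_injective (c : Space) {M : Matrix (Fin 3) (Fin 3) ℝ} (hM : 0 < M.det) :
    Function.Injective (N.place c M) := by
  intro x y h
  rw [place_apply, place_apply, add_right_inj, ← sub_eq_zero, ← mulVec_sub] at h
  have := Matrix.eq_zero_of_mulVec_eq_zero hM.ne' h
  simpa [sub_eq_zero] using this

theorem o_mem : N.o ∈ N.link.verts := right_mem_verts N.mem

theorem u_mem : N.u ∈ N.link.verts := left_mem_verts N.mem

theorem o_ne_u : N.u - N.o ≠ 0 := sub_ne_zero.2 (N.link.nondegenerate _ N.mem)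

theorem verts_subset_hull : N.link.verts ⊆ N.hull := subset_convexHull ℝ _

theorem carrier_subset_hull : N.link.carrier ⊆ N.hull := by
  intro x hx
  obtain ⟨e, he, hx⟩ := mem_carrier.1 hx
  exact (convex_convexHull ℝ _).segment_subset (N.verts_subset_hull (left_mem_verts he))
    (N.verts_subset_hull (right_mem_verts he)) hx

theorem isCompact_hull : IsCompact N.hull := N.link.verts_finite.isCompact_convexHull ℝ

/-- The local knot can be inserted into the edge `p q` of `L` by means of `place c M`. -/
structure IsPlacement (L : PolygonalLink) (p q c : Space) (M : Matrix (Fin 3) (Fin 3) ℝ) :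
    Prop where
  edge : (p, q) ∈ L.edges
  det : 0 < M.det
  pos : ∃ s t : ℝ, 0 < s ∧ s < t ∧ t < 1 ∧ c = AffineMap.lineMap p q s ∧
    N.place c M N.u = AffineMap.lineMap p q t
  inter : L.carrier ∩ N.place c M '' N.hull ⊆ segment ℝ p q

/-- The edges of the link obtained by the insertion of the local knot. -/
def insEdges (L : PolygonalLink) (p q c : Space) (M : Matrix (Fin 3) (Fin 3) ℝ) :
    Set (Space × Space) :=
  (L.edges \ {(p, q)}) ∪ {(p, c), (N.place c M N.u, q)} ∪
    Prod.map (N.place c M) (N.place c M) '' (N.link.edges \ {(N.u, N.o)})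

variable {N} {L L' X Y G G' : PolygonalLink} {p q c : Space} {M : Matrix (Fin 3) (Fin 3) ℝ}

theorem _root_.PolygonalLink.not_mem_verts_of_openSegment {r : Space} (hpq : (p, q) ∈ L.edges)
    (hr : r ∈ openSegment ℝ p q) : r ∉ L.verts := by
  intro h
  have hne : p ≠ q := L.nondegenerate _ hpq
  rcases vertex_mem_edge h hpq (openSegment_subset_segment _ _ _ hr) with rfl | rfl
  · exact not_mem_of_openSegment hne hr (left_mem_segment ℝ _ _)
  · exact not_mem_of_openSegment' hne hr (right_mem_segment ℝ _ _)

/-- The linear part maps the direction `u - o` to the direction of `p q`. As it is injective, a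
point placed on `p q` comes from the line through `o` and `u`, where the condition `mem_hull`
confines it to the distinguished edge. -/
theorem IsPlacement.mem_segment (h : N.IsPlacement L p q c M) {y : Space} (hy : y ∈ N.hull)
    (hyp : N.place c M y ∈ segment ℝ p q) :
    N.place c M y ∈ segment ℝ c (N.place c M N.u) := by
  obtain ⟨s, t, hs, hst, ht, hc, hm⟩ := h.pos
  rw [segment_eq_image_lineMap] at hyp
  obtain ⟨r, hr, hr'⟩ := hyp
  have hts : t - s ≠ 0 := by linarith
  have h1 : M *ᵥ (y - N.o) = (r - s) • (q - p) := by
    have : N.place c M y - c = (r - s) • (q - p) := by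
      rw [← hr', hc, AffineMap.lineMap_apply_module', AffineMap.lineMap_apply_module']; module
    rwa [place_apply, add_sub_cancel_left] at this
  have h2 : M *ᵥ (N.u - N.o) = (t - s) • (q - p) := by
    have : N.place c M N.u - c = (t - s) • (q - p) := by
      rw [hm, hc, AffineMap.lineMap_apply_module', AffineMap.lineMap_apply_module']; module
    rwa [place_apply, add_sub_cancel_left] at this
  have h3 : M *ᵥ ((y - N.o) - ((r - s) / (t - s)) • (N.u - N.o)) = 0 := by
    rw [mulVec_sub, mulVec_smul, h1, h2, smul_smul, div_mul_cancel₀ _ hts, sub_self]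
  have h4 := Matrix.eq_zero_of_mulVec_eq_zero h.det.ne' h3
  have h5 : y = AffineMap.lineMap N.o N.u ((r - s) / (t - s)) := by
    rw [AffineMap.lineMap_apply_module', ← sub_eq_zero, ← h4]; abel
  have h6 := N.mem_hull _ (h5 ▸ hy)
  rw [segment_eq_image_lineMap]
  refine ⟨_, h6, ?_⟩
  conv_rhs => rw [h5, AffineMap.apply_lineMap, place_o]

theorem IsPlacement.c_mem (h : N.IsPlacement L p q c M) : c ∈ openSegment ℝ p q := by
  obtain ⟨s, t, hs, hst, ht, hc, hm⟩ := h.pos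
  exact hc ▸ lineMap_mem_openSegment hs (hst.trans ht)

theorem IsPlacement.m_mem (h : N.IsPlacement L p q c M) :
    N.place c M N.u ∈ openSegment ℝ p q := by
  obtain ⟨s, t, hs, hst, ht, hc, hm⟩ := h.pos
  exact hm ▸ lineMap_mem_openSegment (hs.trans hst) ht

theorem IsPlacement.segment_subset (h : N.IsPlacement L p q c M) :
    segment ℝ c (N.place c M N.u) ⊆ openSegment ℝ p q :=
  (convex_openSegment p q).segment_subset h.c_mem h.m_mem

theorem IsPlacement.not_mem_verts (h : N.IsPlacement L p q c M) {y : Space} (hy : y ∈ N.hull) :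
    N.place c M y ∉ L.verts := fun hv =>
  not_mem_verts_of_openSegment h.edge (h.segment_subset (h.mem_segment hy
    (h.inter ⟨verts_subset_carrier hv, mem_image_of_mem _ hy⟩))) hv

theorem IsPlacement.disjoint (h : N.IsPlacement L p q c M) {e : Space × Space}
    (he : e ∈ L.edges) (hne : e ≠ (p, q)) :
    Disjoint (N.place c M '' N.hull) (segment ℝ e.1 e.2) := by
  rw [Set.disjoint_left]
  rintro _ ⟨y, hy, rfl⟩ hye
  have h1 := h.inter ⟨segment_subset_carrier he hye, mem_image_of_mem _ hy⟩
  have h2 := h.segment_subset (h.mem_segment hy h1)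
  have hpq : p ≠ q := L.nondegenerate _ h.edge
  obtain ⟨-, h3⟩ := eq_of_mem_segments he h.edge hne hye h1
  simp only at h3
  rcases h3 with h3 | h3 <;> rw [h3] at h2
  · exact not_mem_of_openSegment hpq h2 (left_mem_segment ℝ _ _)
  · exact not_mem_of_openSegment' hpq h2 (right_mem_segment ℝ _ _)

theorem image_place_segment (c : Space) (M : Matrix (Fin 3) (Fin 3) ℝ) (a b : Space) :
    N.place c M '' segment ℝ a b = segment ℝ (N.place c M a) (N.place c M b) :=
  image_segment ℝ _ a b

/-- Subdivide `p q` at the two ends of the placed edge, and glue the affine copy of the local knot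
along the middle piece, which the two links traverse in opposite directions. -/
theorem IsPlacement.exists_insertion (h : N.IsPlacement L p q c M) :
    ∃ G : PolygonalLink, G.edges = N.insEdges L p q c M := by
  obtain ⟨L₁, hL₁, -⟩ := exists_subdivision h.edge h.c_mem
  set m := N.place c M N.u with hm
  have hcL := not_mem_verts_of_openSegment h.edge h.c_mem
  have hmL := not_mem_verts_of_openSegment h.edge h.m_mem
  have hcq : (c, q) ∈ L₁.edges := by simp [hL₁]
  have hm_mem : m ∈ openSegment ℝ c q := by
    obtain ⟨s, t, hs, hst, ht, hc, hm'⟩ := h.pos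
    rw [← hm] at hm'
    have : m = AffineMap.lineMap c q ((t - s) / (1 - s)) := by
      have : 1 - s ≠ 0 := by linarith
      rw [hm', hc, AffineMap.lineMap_lineMap_left]; congr 1; field_simp; ring
    rw [this]
    exact lineMap_mem_openSegment (div_pos (by linarith) (by linarith))
      ((div_lt_one (by linarith)).2 (by linarith))
  obtain ⟨L₂, hL₂, -⟩ := exists_subdivision hcq hm_mem
  have hcar : L₂.carrier = L.carrier := by
    rw [carrier_eq_of_subdivision hcq (openSegment_subset_segment _ _ _ hm_mem) hL₂,
      carrier_eq_of_subdivision h.edge (openSegment_subset_segment _ _ _ h.c_mem) hL₁]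
  obtain ⟨N', hN', hN'c⟩ := exists_map N.link (N.place c M) (N.place_injective c h.det).injOn
    fun e _ => image_place_segment c M _ _
  have hcN : (m, c) ∈ N'.edges := by
    rw [hN']; exact ⟨_, N.mem, by simp [hm]⟩
  obtain ⟨G, hG⟩ := exists_glue (L₁ := L₂) (L₂ := N') (p := c) (q := m) (by simp [hL₂]) hcN (by
    rw [hcar, hN'c]
    rintro _ ⟨hx, y, hy, rfl⟩
    have hyh := N.carrier_subset_hull hy
    exact h.mem_segment hyh (h.inter ⟨hx, mem_image_of_mem _ hyh⟩))
  refine ⟨G, hG.trans ?_⟩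
  have h1 : L₂.edges \ {(c, m)} = (L.edges \ {(p, q)}) ∪ {(p, c), (m, q)} := by
    rw [hL₂, hL₁]
    have hpc : p ≠ c := fun h' => hcL (h' ▸ left_mem_verts h.edge)
    have hmc : m ≠ c := N'.nondegenerate _ hcN
    ext e
    simp only [mem_union, mem_sdiff, mem_insert_iff, mem_singleton_iff]
    constructor
    · rintro ⟨⟨h1 | rfl | rfl, h2⟩ | rfl | rfl, h3⟩
      exacts [Or.inl h1, Or.inr (Or.inl rfl), (h2 rfl).elim, (h3 rfl).elim, Or.inr (Or.inr rfl)]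
    · rintro (⟨h1, h2⟩ | rfl | rfl)
      · refine ⟨Or.inl ⟨Or.inl ⟨h1, h2⟩, ?_⟩, ?_⟩ <;> rintro rfl <;> exact hcL (left_mem_verts h1)
      · exact ⟨Or.inl ⟨Or.inr (Or.inl rfl), by simp [hpc]⟩, by simp [hpc]⟩
      · exact ⟨Or.inr (Or.inr rfl), by simp [hmc]⟩
  have h2 : N'.edges \ {(m, c)} =
      Prod.map (N.place c M) (N.place c M) '' (N.link.edges \ {(N.u, N.o)}) := by
    have hi := N.place_injective c h.det
    rw [hN', image_sdiff (hi.prodMap hi)]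
    simp [hm]
  rw [h1, h2]
  rfl

theorem smul_place (c : Space) (M : Matrix (Fin 3) (Fin 3) ℝ) (s : ℝ) (x : Space) :
    N.place c (s • M) x = N.place c M (AffineMap.lineMap N.o x s) := by
  rw [place_apply, place_apply, AffineMap.lineMap_apply_module', add_sub_cancel_right, smul_mulVec,
    mulVec_smul]

theorem det_smul_pos (hM : 0 < M.det) {s : ℝ} (hs : 0 < s) : 0 < (s • M).det := by
  rw [det_smul]; positivity

/-- As `s` tends to zero the copies shrink to the point `c`, uniformly because the hull is compact.
-/
theorem eventually_place_mem {U : Set Space} (hU : U ∈ nhds c) (M : Matrix (Fin 3) (Fin 3) ℝ) :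
    ∀ᶠ s in nhdsWithin (0 : ℝ) (Ioi 0), ∀ y ∈ N.hull, N.place c (s • M) y ∈ U := by
  have h : ∀ᶠ s in nhds (0 : ℝ), ∀ y ∈ N.hull, N.place c (s • M) y ∈ U := by
    refine N.isCompact_hull.eventually_forall_of_forall_eventually fun y _ => ?_
    have hc : Continuous fun z : ℝ × Space => c + (z.1 • M) *ᵥ (z.2 - N.o) := by fun_prop
    refine hc.continuousAt.eventually_mem ?_
    simpa using hU
  exact h.filter_mono nhdsWithin_le_nhds

/-- Sufficiently small copies of the local knot can be inserted. -/
theorem eventually_isPlacement (hpq : (p, q) ∈ L.edges) (hM : 0 < M.det) {r σ : ℝ} (hr : 0 < r)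
    (hMu : M *ᵥ (N.u - N.o) = r • (q - p)) (hσ : σ ∈ Ioo (0 : ℝ) 1)
    (hc : c = AffineMap.lineMap p q σ) :
    ∀ᶠ s in nhdsWithin (0 : ℝ) (Ioi 0), N.IsPlacement L p q c (s • M) := by
  have hcm : c ∈ openSegment ℝ p q := hc ▸ lineMap_mem_openSegment hσ.1 hσ.2
  have hne : p ≠ q := L.nondegenerate _ hpq
  set K := ⋃ e ∈ L.edges \ {(p, q)}, segment ℝ e.1 e.2 with hK
  have hKc : IsClosed K :=
    (L.finite.sdiff.isCompact_biUnion fun e _ => isCompact_segment _ _).isClosed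
  have hcK : c ∈ Kᶜ := by
    intro h
    simp only [hK, mem_iUnion, exists_prop] at h
    obtain ⟨e, he, hce⟩ := h
    obtain ⟨-, h3⟩ := eq_of_mem_segments he.1 hpq he.2 hce (openSegment_subset_segment _ _ _ hcm)
    simp only at h3
    rcases h3 with h3 | h3 <;> rw [h3] at hcm
    · exact not_mem_of_openSegment hne hcm (left_mem_segment ℝ _ _)
    · exact not_mem_of_openSegment' hne hcm (right_mem_segment ℝ _ _)
  have h1 := eventually_place_mem (N := N) (hKc.isOpen_compl.mem_nhds hcK) M
  have h2 : (0 : ℝ) < (1 - σ) / r := div_pos (by linarith [hσ.2]) hr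
  filter_upwards [h1, Ioo_mem_nhdsGT h2] with s hs hs'
  refine ⟨hpq, det_smul_pos hM hs'.1, ⟨σ, σ + s * r, hσ.1, ?_, ?_, hc, ?_⟩, ?_⟩
  · have := mul_pos hs'.1 hr; linarith
  · have := (lt_div_iff₀ hr).1 hs'.2; linarith
  · rw [place_apply, smul_mulVec, hMu, hc, AffineMap.lineMap_apply_module',
      AffineMap.lineMap_apply_module']
    module
  · rintro _ ⟨hx, y, hy, rfl⟩
    obtain ⟨e, he, hxe⟩ := mem_carrier.1 hx
    by_cases h : e = (p, q)
    · subst h; exact hxe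
    · refine (hs y hy ?_).elim
      simp only [hK, mem_iUnion, exists_prop]
      exact ⟨e, ⟨he, h⟩, hxe⟩

/-- Scaling the matrix by `s` amounts to replacing the hull by its homothetic copy with centre `o`,
which is contained in the hull by convexity. -/
theorem IsPlacement.shrink (h : N.IsPlacement L p q c M) {s : ℝ} (hs : s ∈ Ioc (0 : ℝ) 1) :
    N.IsPlacement L p q c (s • M) := by
  obtain ⟨a, b, ha, hab, hb, hc, hm⟩ := h.pos
  refine ⟨h.edge, det_smul_pos h.det hs.1, ⟨a, a + s * (b - a), ha, ?_, ?_, hc, ?_⟩, ?_⟩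
  · have := mul_pos hs.1 (sub_pos.2 hab); linarith
  · nlinarith [hs.2]
  · rw [smul_place, AffineMap.apply_lineMap, place_o, hm, hc,
      AffineMap.lineMap_apply_module', AffineMap.lineMap_apply_module',
      AffineMap.lineMap_apply_module', AffineMap.lineMap_apply_module']
    module
  · refine (inter_subset_inter_right _ ?_).trans h.inter
    rintro _ ⟨y, hy, rfl⟩
    rw [smul_place]
    refine mem_image_of_mem _ ?_
    refine (convex_convexHull ℝ _).segment_subset (N.verts_subset_hull N.o_mem) hy ?_
    rw [segment_eq_image_lineMap]
    exact mem_image_of_mem _ ⟨hs.1.le, hs.2⟩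

/-- Small changes of the host link and of the placement give isotopic insertions. -/
theorem IsPlacement.eventually_isotopic {B : PolygonalLink} {x : Space → Space}
    (hx : InjOn x B.verts) (hX : X.edges = Prod.map x x '' B.edges) (hpq : (p, q) ∈ B.edges)
    (h : N.IsPlacement X (x p) (x q) c M) (hG : G.edges = N.insEdges X (x p) (x q) c M) :
    ∀ᶠ ε in nhdsWithin (0 : ℝ) (Ioi 0), ∀ (y : Space → Space) (c' : Space)
      (M' : Matrix (Fin 3) (Fin 3) ℝ) (Y : PolygonalLink), (∀ v ∈ B.verts, dist (y v) (x v) < ε) →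
      InjOn y B.verts → Y.edges = Prod.map y y '' B.edges →
      (∀ v ∈ N.link.verts, dist (N.place c' M' v) (N.place c M v) < ε) → 0 < M'.det →
      (∃ s t : ℝ, 0 < s ∧ s < t ∧ t < 1 ∧ c' = AffineMap.lineMap (y p) (y q) s ∧
        N.place c' M' N.u = AffineMap.lineMap (y p) (y q) t) →
      N.IsPlacement Y (y p) (y q) c' M' ∧ ∃ G' : PolygonalLink,
        G'.edges = N.insEdges Y (y p) (y q) c' M' ∧ Isotopic G G' := by
  -- The combinatorics of the insertion, with vertices of the host on the left and vertices of the
  -- local knot on the right. It does not depend on the placement, so that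
  -- `eventually_isotopic_indexed` can compare two insertions.
  set E : Set ((Space ⊕ Space) × (Space ⊕ Space)) :=
    Prod.map Sum.inl Sum.inl '' (B.edges \ {(p, q)}) ∪
      {(Sum.inl p, Sum.inr N.o), (Sum.inr N.u, Sum.inl q)} ∪
      Prod.map Sum.inr Sum.inr '' (N.link.edges \ {(N.u, N.o)}) with hE
  set W : Set (Space ⊕ Space) := Sum.inl '' B.verts ∪ Sum.inr '' N.link.verts with hW
  have hlW : ∀ v ∈ B.verts, Sum.inl v ∈ W := fun v hv => Or.inl (mem_image_of_mem _ hv)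
  have hrW : ∀ v ∈ N.link.verts, Sum.inr v ∈ W := fun v hv => Or.inr (mem_image_of_mem _ hv)
  have hEW : ∀ e ∈ E, e.1 ∈ W ∧ e.2 ∈ W := by
    rintro e ((⟨f, hf, rfl⟩ | rfl | rfl) | ⟨f, hf, rfl⟩)
    · exact ⟨hlW _ (left_mem_verts hf.1), hlW _ (right_mem_verts hf.1)⟩
    · exact ⟨hlW _ (left_mem_verts hpq), hrW _ N.o_mem⟩
    · exact ⟨hrW _ N.u_mem, hlW _ (right_mem_verts hpq)⟩
    · exact ⟨hrW _ (left_mem_verts hf.1), hrW _ (right_mem_verts hf.1)⟩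
  have himg : ∀ (y : Space → Space) (c' : Space) (M' : Matrix (Fin 3) (Fin 3) ℝ)
      (Y : PolygonalLink), InjOn y B.verts → Y.edges = Prod.map y y '' B.edges →
      N.insEdges Y (y p) (y q) c' M' =
        Prod.map (Sum.elim y (N.place c' M')) (Sum.elim y (N.place c' M')) '' E := by
    intro y c' M' Y hy hY
    have h1 : Y.edges \ {(y p, y q)} = Prod.map y y '' (B.edges \ {(p, q)}) := by
      rw [hY]
      ext e
      constructor
      · rintro ⟨⟨f, hf, rfl⟩, hne⟩
        exact ⟨f, ⟨hf, by rintro rfl; exact hne rfl⟩, rfl⟩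
      · rintro ⟨f, ⟨hf, hne⟩, rfl⟩
        refine ⟨⟨f, hf, rfl⟩, fun h => hne ?_⟩
        exact B.source_unique _ hf _ hpq
          (hy (left_mem_verts hf) (left_mem_verts hpq) (Prod.ext_iff.1 h).1)
    rw [insEdges, h1, hE]
    simp only [image_union, image_image, image_insert_eq, image_singleton,
      Sum.elim_inl, Sum.elim_inr, place_o, Prod.map_apply']
  have hXv : ∀ v ∈ B.verts, x v ∈ X.verts := by
    rintro _ ⟨e, he, rfl⟩
    exact left_mem_verts (by rw [hX]; exact mem_image_of_mem _ he)
  have hinj : InjOn (Sum.elim x (N.place c M)) W := by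
    rintro _ (⟨v, hv, rfl⟩ | ⟨v, hv, rfl⟩) _ (⟨w, hw, rfl⟩ | ⟨w, hw, rfl⟩) hvw <;>
      simp only [Sum.elim_inl, Sum.elim_inr] at hvw
    · rw [hx hv hw hvw]
    · exact (h.not_mem_verts (N.verts_subset_hull hw) (hvw ▸ hXv v hv)).elim
    · exact (h.not_mem_verts (N.verts_subset_hull hv) (hvw ▸ hXv w hw)).elim
    · rw [N.place_injective c h.det hvw]
  have h1 := eventually_isotopic_indexed hEW hinj (hG.trans (himg x c M X hx hX))
  have hhull : ∀ (c' : Space) (M' : Matrix (Fin 3) (Fin 3) ℝ),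
      convexHull ℝ (N.place c' M' '' N.link.verts) = N.place c' M' '' N.hull := fun c' M' =>
    ((N.place c' M').image_convexHull _).symm
  -- For small displacements the placed hull also stays disjoint from all edges of the host other
  -- than `p q`; this keeps the new data a placement.
  have h2 : ∀ᶠ ε in nhdsWithin (0 : ℝ) (Ioi 0), ∀ e ∈ B.edges, e ≠ (p, q) →
      ∀ z : Space ⊕ Space → Space, (∀ v ∈ W, dist (z v) (Sum.elim x (N.place c M) v) < ε) →
      Disjoint (convexHull ℝ (z '' (Sum.inr '' N.link.verts)))
        (convexHull ℝ (z '' {Sum.inl e.1, Sum.inl e.2})) := by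
    simp only [Filter.eventually_all_finite B.finite, Filter.eventually_all]
    intro e he hne
    have := eventually_disjoint_hull (x := Sum.elim x (N.place c M))
      (A := Sum.inr '' N.link.verts) (B := {Sum.inl e.1, Sum.inl e.2})
      (N.link.verts_finite.image _) (toFinite _) (by
        simp only [image_image, Sum.elim_inr, image_insert_eq, image_singleton, Sum.elim_inl,
          convexHull_pair, hhull]
        refine h.disjoint (e := (x e.1, x e.2)) (by rw [hX]; exact ⟨e, he, rfl⟩) fun h' => hne ?_
        exact B.source_unique _ he _ hpq
          (hx (left_mem_verts he) (left_mem_verts hpq) (Prod.ext_iff.1 h').1))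
    filter_upwards [this] with ε hε z hz
    refine hε z ?_ ?_
    · rintro _ ⟨v, hv, rfl⟩; exact hz _ (hrW v hv)
    · rintro _ (rfl | rfl)
      exacts [hz _ (hlW _ (left_mem_verts he)), hz _ (hlW _ (right_mem_verts he))]
  filter_upwards [h1, h2] with ε h1 h2 y c' M' Y hy hyi hY hv hdet hpos
  have hz : ∀ v ∈ W, dist (Sum.elim y (N.place c' M') v) (Sum.elim x (N.place c M) v) < ε := by
    rintro _ (⟨v, hv', rfl⟩ | ⟨v, hv', rfl⟩)
    exacts [hy v hv', hv v hv']
  refine ⟨⟨by rw [hY]; exact ⟨_, hpq, rfl⟩, hdet, hpos, ?_⟩, ?_⟩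
  · rintro z ⟨hz1, hz2⟩
    obtain ⟨e, he, hze⟩ := mem_carrier.1 hz1
    rw [hY] at he
    obtain ⟨f, hf, rfl⟩ := he
    by_cases hfp : f = (p, q)
    · subst hfp; exact hze
    · have := h2 f hf hfp _ hz
      simp only [image_image, Sum.elim_inr, image_insert_eq, image_singleton, Sum.elim_inl,
        convexHull_pair, hhull] at this
      exact (Set.disjoint_left.1 this hz2 hze).elim
  · obtain ⟨G', hG', hiso⟩ := h1 _ hz
    exact ⟨G', by rw [hG', himg y c' M' Y hyi hY], hiso⟩

/-! ### Independence of the placement -/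

/-- All intermediate scales are placements, so the isotopy class is locally constant on the
connected interval `(0, 1]`. -/
theorem IsPlacement.isotopic_shrink (h : N.IsPlacement L p q c M)
    (hG : G.edges = N.insEdges L p q c M) {s : ℝ} (hs : s ∈ Ioc (0 : ℝ) 1)
    (hG' : G'.edges = N.insEdges L p q c (s • M)) : Isotopic G G' := by
  have : Nonempty PolygonalLink := ⟨L⟩
  choose! F hF using fun (t : ℝ) (ht : t ∈ Ioc (0 : ℝ) 1) => (h.shrink ht).exists_insertion
  have key : Isotopic (F 1) (F s) := by
    refine isPreconnected_Ioc.induction₂ (fun s t => Isotopic (F s) (F t)) ?_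
      (fun _ _ _ _ _ _ h h' => h.trans h') (fun _ _ _ _ h => h.symm)
      (right_mem_Ioc.2 one_pos) hs
    intro t ht
    obtain ⟨ε, hε, hε0⟩ := (((h.shrink ht).eventually_isotopic (x := id) (B := L)
      (injOn_id _) (by simp) h.edge (hF t ht)).and self_mem_nhdsWithin).exists
    have hev : ∀ᶠ r in nhdsWithin t (Ioc 0 1), ∀ v ∈ N.link.verts,
        dist (N.place c (r • M) v) (N.place c (t • M) v) < ε := by
      refine (Filter.eventually_all_finite N.link.verts_finite).2 fun v _ => ?_
      refine Metric.continuousWithinAt_iff'.1 (Continuous.continuousWithinAt ?_) ε hε0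
      change Continuous fun r : ℝ => c + (r • M) *ᵥ (v - N.o)
      fun_prop
    filter_upwards [hev, self_mem_nhdsWithin] with r hr hr'
    obtain ⟨-, G₁, hG₁, hiso⟩ := hε id c (r • M) L (by simpa using fun _ _ => hε0) (injOn_id _)
      (by simp) hr (h.shrink hr').det (h.shrink hr').pos
    exact hiso.trans (.of_edges_eq (hG₁.trans (hF r hr').symm))
  refine Isotopic.trans (.of_edges_eq ?_) (key.trans (.of_edges_eq ?_))
  · rw [hG, hF 1 (right_mem_Ioc.2 one_pos), one_smul]
  · rw [hF s hs, hG']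

theorem isotopic_of_scaling {r s : ℝ} (hr : 0 < r) (hs : 0 < s)
    (h : N.IsPlacement L p q c (r • M)) (hG : G.edges = N.insEdges L p q c (r • M))
    (h' : N.IsPlacement L p q c (s • M)) (hG' : G'.edges = N.insEdges L p q c (s • M)) :
    Isotopic G G' := by
  wlog hle : s ≤ r generalizing r s G G'
  · exact (this hs hr h' hG' h hG (le_of_not_ge hle)).symm
  refine h.isotopic_shrink hG (s := s / r) ⟨by positivity, (div_le_one hr).2 hle⟩ ?_
  rw [hG', smul_smul, div_mul_cancel₀ _ hr.ne']

/-- Moving the host link together with an inserted local knot. -/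
theorem isotopic_of_host_motion {B : PolygonalLink} {x : ℝ → Space → Space}
    (hc : ∀ v ∈ B.verts, ContinuousOn (fun t => x t v) (Icc 0 1))
    (hinj : ∀ t ∈ Icc (0 : ℝ) 1, InjOn (x t) B.verts) {X : ℝ → PolygonalLink}
    (hX : ∀ t ∈ Icc (0 : ℝ) 1, (X t).edges = Prod.map (x t) (x t) '' B.edges)
    (hpq : (p, q) ∈ B.edges) {σ r : ℝ → ℝ} {χ : ℝ → Matrix (Fin 3) (Fin 3) ℝ}
    (hσc : ContinuousOn σ (Icc 0 1)) (hσ : ∀ t ∈ Icc (0 : ℝ) 1, σ t ∈ Ioo (0 : ℝ) 1)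
    (hrc : ContinuousOn r (Icc 0 1)) (hr : ∀ t ∈ Icc (0 : ℝ) 1, 0 < r t)
    (hχc : ContinuousOn χ (Icc 0 1)) (hχ : ∀ t ∈ Icc (0 : ℝ) 1, 0 < (χ t).det)
    (hχu : ∀ t ∈ Icc (0 : ℝ) 1, χ t *ᵥ (N.u - N.o) = r t • (x t q - x t p))
    {c₀ c₁ : Space} (hc₀ : c₀ = AffineMap.lineMap (x 0 p) (x 0 q) (σ 0))
    (hc₁ : c₁ = AffineMap.lineMap (x 1 p) (x 1 q) (σ 1))
    (h₀ : N.IsPlacement (X 0) (x 0 p) (x 0 q) c₀ (χ 0))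
    (hG : G.edges = N.insEdges (X 0) (x 0 p) (x 0 q) c₀ (χ 0))
    (h₁ : N.IsPlacement (X 1) (x 1 p) (x 1 q) c₁ (χ 1))
    (hG' : G'.edges = N.insEdges (X 1) (x 1 p) (x 1 q) c₁ (χ 1)) : Isotopic G G' := by
  set C : ℝ → Space := fun t => AffineMap.lineMap (x t p) (x t q) (σ t) with hC
  have hCe : ∀ t, C t = σ t • (x t q - x t p) + x t p := fun t =>
    AffineMap.lineMap_apply_module' _ _ _
  have hxp := hc p (left_mem_verts hpq)
  have hxq := hc q (right_mem_verts hpq)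
  have hCc : ContinuousOn C (Icc 0 1) := by
    simp only [hC, AffineMap.lineMap_apply_module']
    fun_prop
  -- A copy that fits at one time may be too large at another. The statement carried along the
  -- motion therefore allows an arbitrary scale `s`, on which the isotopy class does not depend by
  -- `isotopic_of_scaling`.
  let P : ℝ → PolygonalLink → Prop := fun t G => ∃ s : ℝ, 0 < s ∧
    N.IsPlacement (X t) (x t p) (x t q) (C t) (s • χ t) ∧
    G.edges = N.insEdges (X t) (x t p) (x t q) (C t) (s • χ t)
  have hA : ∀ t G G', P t G → P t G' → Isotopic G G' := by
    rintro t G G' ⟨s, hs, h, hG⟩ ⟨s', hs', h', hG'⟩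
    exact isotopic_of_scaling hs hs' h hG h' hG'
  have hedge : ∀ t ∈ Icc (0 : ℝ) 1, (x t p, x t q) ∈ (X t).edges := fun t ht => by
    rw [hX t ht]; exact ⟨_, hpq, rfl⟩
  have hB : ∀ t ∈ Icc (0 : ℝ) 1, ∃ G, P t G := by
    intro t ht
    obtain ⟨s, hs, hs0⟩ := ((eventually_isPlacement (N := N) (c := C t) (hedge t ht) (hχ t ht)
      (hr t ht) (hχu t ht) (hσ t ht) rfl).and self_mem_nhdsWithin).exists
    obtain ⟨G, hG⟩ := hs.exists_insertion
    exact ⟨G, s, hs0, hs, hG⟩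
  have key : ∀ G G', P 0 G → P 1 G' → Isotopic G G' := by
    refine isPreconnected_Icc.induction₂ (fun s t => ∀ G G', P s G → P t G' → Isotopic G G') ?_
      ?_ (fun _ _ _ _ h G G' hG hG' => (h _ _ hG' hG).symm) (left_mem_Icc.2 zero_le_one)
      (right_mem_Icc.2 zero_le_one)
    · intro t ht
      obtain ⟨G, hG⟩ := hB t ht
      obtain ⟨s, hs0, hs, hGe⟩ := id hG
      obtain ⟨ε, hε, hε0⟩ := ((hs.eventually_isotopic (hinj t ht) (hX t ht) hpq hGe).and
        self_mem_nhdsWithin).exists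
      have hev1 : ∀ᶠ t' in nhdsWithin t (Icc 0 1), ∀ v ∈ B.verts, dist (x t' v) (x t v) < ε :=
        (Filter.eventually_all_finite B.verts_finite).2 fun v hv =>
          Metric.continuousWithinAt_iff'.1 (hc v hv t ht) ε hε0
      have hev2 : ∀ᶠ t' in nhdsWithin t (Icc 0 1), ∀ v ∈ N.link.verts,
          dist (N.place (C t') (s • χ t') v) (N.place (C t) (s • χ t) v) < ε := by
        refine (Filter.eventually_all_finite N.link.verts_finite).2 fun v _ => ?_
        refine Metric.continuousWithinAt_iff'.1 (ContinuousOn.continuousWithinAt ?_ ht) ε hε0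
        change ContinuousOn (fun t' : ℝ => C t' + (s • χ t') *ᵥ (v - N.o)) (Icc 0 1)
        fun_prop
      -- The ends of the placed edge sit at the parameters `σ t` and `σ t + s * r t` of `p q`. The
      -- strict bound at time `t` persists at nearby times.
      have hst : σ t + s * r t < 1 := by
        obtain ⟨a, b, ha, hab, hb, hc, hm⟩ := hs.pos
        have hinj := AffineMap.lineMap_injective ℝ ((X t).nondegenerate _ (hedge t ht))
        have h1 : σ t = a := hinj hc
        have h2 : σ t + s * r t = b := by
          refine hinj (Eq.trans ?_ hm)
          rw [place_apply, smul_mulVec, hχu t ht, AffineMap.lineMap_apply_module', hCe]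
          module
        linarith
      have hev3 : ∀ᶠ t' in nhdsWithin t (Icc 0 1), σ t' + s * r t' < 1 := by
        have : ContinuousOn (fun t' => σ t' + s * r t') (Icc 0 1) := by fun_prop
        exact (this t ht).eventually_lt_const hst
      filter_upwards [hev1, hev2, hev3, self_mem_nhdsWithin] with t' h1 h2 h3 ht'
      obtain ⟨hp, G₁, hG₁, hiso⟩ := hε (x t') (C t') (s • χ t') (X t') h1 (hinj t' ht') (hX t' ht')
        h2 (det_smul_pos (hχ t' ht') hs0) ⟨σ t', σ t' + s * r t', (hσ t' ht').1, by
          have := mul_pos hs0 (hr t' ht'); linarith, h3, rfl, by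
          rw [place_apply, smul_mulVec, hχu t' ht', hCe, AffineMap.lineMap_apply_module']
          module⟩
      intro G' G'' hG' hG''
      exact (hA t _ _ hG' hG).trans (hiso.trans (hA t' _ _ ⟨s, hs0, hp, hG₁⟩ hG''))
    · intro a b c _ hb _ h h' G G' hG hG'
      obtain ⟨H, hH⟩ := hB b hb
      exact (h _ _ hG hH).trans (h' _ _ hH hG')
  refine key G G' ⟨1, one_pos, ?_, ?_⟩ ⟨1, one_pos, ?_, ?_⟩ <;> rw [one_smul]
  · rw [show C 0 = c₀ from hc₀.symm]; exact h₀
  · rw [show C 0 = c₀ from hc₀.symm]; exact hG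
  · rw [show C 1 = c₁ from hc₁.symm]; exact h₁
  · rw [show C 1 = c₁ from hc₁.symm]; exact hG'

/-- `G` arises from `L` by inserting the local knot into the edge `p q`. -/
def IsInsertion (N : LocalKnot) (L : PolygonalLink) (p q : Space) (G : PolygonalLink) : Prop :=
  ∃ c M, N.IsPlacement L p q c M ∧ G.edges = N.insEdges L p q c M

theorem IsPlacement.exists_mulVec_eq (h : N.IsPlacement L p q c M) :
    ∃ σ ∈ Ioo (0 : ℝ) 1, c = AffineMap.lineMap p q σ ∧
      ∃ r : ℝ, 0 < r ∧ M *ᵥ (N.u - N.o) = r • (q - p) := by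
  obtain ⟨s, t, hs, hst, ht, hc, hm⟩ := h.pos
  refine ⟨s, ⟨hs, hst.trans ht⟩, hc, t - s, by linarith, ?_⟩
  have : N.place c M N.u - c = (t - s) • (q - p) := by
    rw [hm, hc, AffineMap.lineMap_apply_module', AffineMap.lineMap_apply_module']; module
  rwa [place_apply, add_sub_cancel_left] at this

/-- The host rests while the base point slides along the edge and the matrix follows a path from
`joinedIn_ray`, along which the distinguished edge keeps pointing in the direction of `p q`. -/
theorem IsInsertion.isotopic (h : N.IsInsertion L p q G) (h' : N.IsInsertion L p q G') :
    Isotopic G G' := by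
  obtain ⟨c, M, h, hG⟩ := h
  obtain ⟨c', M', h', hG'⟩ := h'
  obtain ⟨σ, hσ, hc, hr⟩ := h.exists_mulVec_eq
  obtain ⟨σ', hσ', hc', hr'⟩ := h'.exists_mulVec_eq
  have hd : q - p ≠ 0 := sub_ne_zero.2 (L.nondegenerate _ h.edge).symm
  have hj := joinedIn_ray hd h.det hr h'.det hr'
  set γ := hj.somePath.extend with hγ
  have hmem : ∀ t ∈ Icc (0 : ℝ) 1, 0 < (γ t).det ∧
      ∃ c : ℝ, 0 < c ∧ γ t *ᵥ (N.u - N.o) = c • (q - p) := by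
    intro t ht
    have := hj.somePath_mem ⟨t, ht⟩
    rwa [← Path.extend_apply _ ht] at this
  have hγc : Continuous γ := hj.somePath.continuous_extend
  have hdd : (q - p) ⬝ᵥ (q - p) ≠ 0 := mt dotProduct_self_eq_zero.1 hd
  have h0 : γ 0 = M := by simp [hγ]
  have h1 : γ 1 = M' := by simp [hγ]
  refine isotopic_of_host_motion (N := N) (B := L) (p := p) (q := q) (x := fun _ => id)
    (X := fun _ => L)
    (σ := fun t => (1 - t) * σ + t * σ') (χ := γ)
    -- The path provides the scaling factor only through existence; the quotient of dot products
    -- exhibits it as a continuous function.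
    (r := fun t => ((γ t *ᵥ (N.u - N.o)) ⬝ᵥ (q - p)) / ((q - p) ⬝ᵥ (q - p)))
    (fun v _ => continuousOn_const) (fun _ _ => injOn_id _) (fun _ _ => by simp) h.edge
    (by fun_prop) (fun t ht => ⟨?_, ?_⟩) (by fun_prop) ?_ hγc.continuousOn
    (fun t ht => (hmem t ht).1) ?_ (c₀ := c) (c₁ := c') (by simpa using hc) (by simpa using hc')
    (h0 ▸ h) (h0 ▸ hG) (h1 ▸ h') (h1 ▸ hG')
  · rcases ht.1.eq_or_lt with rfl | h
    · simpa using hσ.1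
    · have := mul_pos h hσ'.1
      have := mul_nonneg (sub_nonneg.2 ht.2) hσ.1.le
      linarith
  · rcases ht.1.eq_or_lt with rfl | h
    · simpa using hσ.2
    · have := mul_lt_mul_of_pos_left hσ'.2 h
      have := mul_le_mul_of_nonneg_left hσ.2.le (sub_nonneg.2 ht.2)
      linarith
  · intro t ht
    obtain ⟨c, hc, hc'⟩ := (hmem t ht).2
    rw [hc', smul_dotProduct, smul_eq_mul, mul_div_cancel_right₀ _ hdd]
    exact hc
  · intro t ht
    obtain ⟨c, hc, hc'⟩ := (hmem t ht).2
    simp only [id]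
    rw [hc', smul_dotProduct, smul_eq_mul, mul_div_cancel_right₀ _ hdd]

end LocalKnot

end

section

open Set Matrix

/-! ### Insertions into different edges -/

namespace LocalKnot

open PolygonalLink

variable {N : LocalKnot} {L L' L'' X Y G G' : PolygonalLink} {p q c : Space}
  {M : Matrix (Fin 3) (Fin 3) ℝ}

theorem exists_isPlacement_mem (N : LocalKnot) (hpq : (p, q) ∈ L.edges)
    (hc : c ∈ openSegment ℝ p q) {U : Set Space} (hU : U ∈ nhds c) :
    ∃ M, N.IsPlacement L p q c M ∧ ∀ y ∈ N.hull, N.place c M y ∈ U := by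
  obtain ⟨M, hM, hMu, -⟩ := exists_joinedIn_mulVec_eq N.o_ne_u
    (sub_ne_zero.2 (L.nondegenerate _ hpq).symm)
  rw [openSegment_eq_image_lineMap] at hc
  obtain ⟨σ, hσ, rfl⟩ := hc
  obtain ⟨s, hs, hs'⟩ := ((eventually_isPlacement hpq hM one_pos (by simpa using hMu) hσ
    rfl).and (eventually_place_mem hU M)).exists
  exact ⟨s • M, hs, hs'⟩

theorem midpoint_mem_openSegment (p q : Space) : midpoint ℝ p q ∈ openSegment ℝ p q :=
  lineMap_mem_openSegment (by norm_num) (by norm_num)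

theorem exists_isInsertion (N : LocalKnot) (hpq : (p, q) ∈ L.edges) :
    ∃ G, N.IsInsertion L p q G := by
  obtain ⟨M, hM, -⟩ := N.exists_isPlacement_mem hpq (midpoint_mem_openSegment p q) Filter.univ_mem
  obtain ⟨G, hG⟩ := hM.exists_insertion
  exact ⟨G, _, M, hM, hG⟩

/-- Insertions of the local knot into the edge `e` of `L` and into the edge `e'` of `L'` are
isotopic. -/
def InsertionEquiv (N : LocalKnot) (L : PolygonalLink) (e : Space × Space) (L' : PolygonalLink)
    (e' : Space × Space) : Prop :=
  ∀ G G', N.IsInsertion L e.1 e.2 G → N.IsInsertion L' e'.1 e'.2 G' → Isotopic G G'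

theorem InsertionEquiv.symm {e e' : Space × Space} (h : N.InsertionEquiv L e L' e') :
    N.InsertionEquiv L' e' L e := fun _ _ hG hG' => (h _ _ hG' hG).symm

/-- That `e'` is an edge guarantees an insertion in the middle; without one, both relations would
hold vacuously. -/
theorem InsertionEquiv.trans {e e' e'' : Space × Space} (h : N.InsertionEquiv L e L' e')
    (h' : N.InsertionEquiv L' e' L'' e'') (he : e' ∈ L'.edges) : N.InsertionEquiv L e L'' e'' := by
  intro G G'' hG hG''
  obtain ⟨G', hG'⟩ := N.exists_isInsertion he
  exact (h _ _ hG hG').trans (h' _ _ hG' hG'')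

theorem InsertionEquiv.refl (e : Space × Space) : N.InsertionEquiv L e L e :=
  fun _ _ h h' => h.isotopic h'

/-- One pair of insertions suffices, since all insertions into a fixed edge are isotopic. -/
theorem InsertionEquiv.of_placement {e e' : Space × Space} (hG : N.IsInsertion L e.1 e.2 G)
    (hG' : N.IsInsertion L' e'.1 e'.2 G') (h : Isotopic G G') : N.InsertionEquiv L e L' e' :=
  fun _ _ h₁ h₂ => (h₁.isotopic hG).trans (h.trans (hG'.isotopic h₂))

theorem IsPlacement.right_not_mem_image (h : N.IsPlacement L p q c M) (a : Space)
    (E : Set (Space × Space)) (hE : E ⊆ N.link.edges) :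
    (a, q) ∉ Prod.map (N.place c M) (N.place c M) '' E := by
  rintro ⟨e, he, hh⟩
  refine h.not_mem_verts (N.verts_subset_hull (right_mem_verts (hE he))) ?_
  rw [show N.place c M e.2 = q from (Prod.ext_iff.1 hh).2]
  exact right_mem_verts h.edge

theorem IsPlacement.left_not_mem_image (h : N.IsPlacement L p q c M) {v : Space}
    (hv : v ∈ L.verts) (b : Space) (E : Set (Space × Space)) (hE : E ⊆ N.link.edges) :
    (v, b) ∉ Prod.map (N.place c M) (N.place c M) '' E := by
  rintro ⟨e, he, hh⟩
  refine h.not_mem_verts (N.verts_subset_hull (left_mem_verts (hE he))) ?_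
  rw [show N.place c M e.1 = v from (Prod.ext_iff.1 hh).1]
  exact hv

theorem IsPlacement.insEdges_sdiff_right (h : N.IsPlacement L p q c M) :
    N.insEdges L p q c M \ {(N.place c M N.u, q)} = (L.edges \ {(p, q)}) ∪ {(p, c)} ∪
      Prod.map (N.place c M) (N.place c M) '' (N.link.edges \ {(N.u, N.o)}) := by
  have hm := h.not_mem_verts (N.verts_subset_hull N.u_mem)
  have h1 := h.right_not_mem_image (N.place c M N.u) (N.link.edges \ {(N.u, N.o)}) sdiff_subset
  have h2 : p ≠ N.place c M N.u := fun h' => hm (h' ▸ left_mem_verts h.edge)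
  ext e
  simp only [insEdges, mem_sdiff, mem_union, mem_insert_iff, mem_singleton_iff]
  constructor
  · tauto
  · rintro ((⟨h3, h4⟩ | rfl) | h3)
    · exact ⟨by tauto, by rintro rfl; exact hm (left_mem_verts h3)⟩
    · exact ⟨by tauto, by simp [h2]⟩
    · exact ⟨by tauto, by rintro rfl; exact h1 h3⟩

theorem IsPlacement.insEdges_sdiff_left (h : N.IsPlacement L p q c M) :
    N.insEdges L p q c M \ {(p, c)} = (L.edges \ {(p, q)}) ∪ {(N.place c M N.u, q)} ∪
      Prod.map (N.place c M) (N.place c M) '' (N.link.edges \ {(N.u, N.o)}) := by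
  have hc := h.not_mem_verts (N.verts_subset_hull N.o_mem)
  have hm := h.not_mem_verts (N.verts_subset_hull N.u_mem)
  rw [place_o] at hc
  have h1 := h.left_not_mem_image (left_mem_verts h.edge) c (N.link.edges \ {(N.u, N.o)})
    sdiff_subset
  have h2 : p ≠ N.place c M N.u := fun h' => hm (h' ▸ left_mem_verts h.edge)
  ext e
  simp only [insEdges, mem_sdiff, mem_union, mem_insert_iff, mem_singleton_iff]
  constructor
  · tauto
  · rintro ((⟨h3, h4⟩ | rfl) | h3)
    · exact ⟨by tauto, by rintro rfl; exact hc (right_mem_verts h3)⟩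
    · exact ⟨by tauto, by simp [h2.symm]⟩
    · exact ⟨by tauto, by rintro rfl; exact h1 h3⟩

theorem IsPlacement.insEdges_sdiff (h : N.IsPlacement L p q c M) {e : Space × Space}
    (he : e ∈ L.edges) : N.insEdges L p q c M \ {e} = (L.edges \ {(p, q)}) \ {e} ∪
      {(p, c), (N.place c M N.u, q)} ∪
      Prod.map (N.place c M) (N.place c M) '' (N.link.edges \ {(N.u, N.o)}) := by
  have hc := h.not_mem_verts (N.verts_subset_hull N.o_mem)
  have hm := h.not_mem_verts (N.verts_subset_hull N.u_mem)
  rw [place_o] at hc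
  have h1 := h.left_not_mem_image (left_mem_verts he) e.2 (N.link.edges \ {(N.u, N.o)})
    sdiff_subset
  have h2 : (p, c) ≠ e := by rintro rfl; exact hc (right_mem_verts he)
  have h3 : (N.place c M N.u, q) ≠ e := by rintro rfl; exact hm (left_mem_verts he)
  ext f
  simp only [insEdges, mem_sdiff, mem_union, mem_insert_iff, mem_singleton_iff]
  constructor
  · tauto
  · rintro ((h4 | rfl | rfl) | h4)
    · tauto
    · tauto
    · tauto
    · exact ⟨by tauto, by rintro rfl; exact h1 h4⟩

theorem IsPlacement.carrier_subset (h : N.IsPlacement L p q c M)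
    (hG : G.edges = N.insEdges L p q c M) : G.carrier ⊆ L.carrier ∪ N.place c M '' N.hull := by
  intro x hx
  obtain ⟨e, he, hx⟩ := mem_carrier.1 hx
  rw [hG] at he
  rcases he with (he | rfl | rfl) | ⟨e, he, rfl⟩
  · exact Or.inl (segment_subset_carrier he.1 hx)
  · exact Or.inl (segment_subset_carrier h.edge ((convex_segment p q).segment_subset
      (left_mem_segment ℝ _ _) (openSegment_subset_segment _ _ _ h.c_mem) hx))
  · exact Or.inl (segment_subset_carrier h.edge ((convex_segment p q).segment_subset
      (openSegment_subset_segment _ _ _ h.m_mem) (right_mem_segment ℝ _ _) hx))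
  · refine Or.inr (image_mono N.carrier_subset_hull ?_)
    rw [Prod.map_fst, Prod.map_snd, ← image_place_segment] at hx
    exact image_mono (segment_subset_carrier he.1) hx

/-! #### Subdivision -/

/-- A copy that fits into `p r` also fits into `p q`. The two results differ by a subdivision at `r`
of the piece of `p q` that follows the inserted copy. -/
theorem insertionEquiv_subdivision_left {r : Space} (hpq : (p, q) ∈ L.edges)
    (hr : r ∈ openSegment ℝ p q) (hL' : L'.edges = (L.edges \ {(p, q)}) ∪ {(p, r), (r, q)}) :
    N.InsertionEquiv L (p, q) L' (p, r) := by
  have hr' := openSegment_subset_segment _ _ _ hr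
  obtain ⟨M, hM, -⟩ := N.exists_isPlacement_mem (L := L') (p := p) (q := r) (by simp [hL'])
    (midpoint_mem_openSegment p r) Filter.univ_mem
  set c := midpoint ℝ p r
  obtain ⟨s, t, hs, hst, ht, hc, hm⟩ := hM.pos
  rw [openSegment_eq_image_lineMap] at hr
  obtain ⟨a, ha, rfl⟩ := hr
  have hM' : N.IsPlacement L p q c M := by
    refine ⟨hpq, hM.det, ⟨a * s, a * t, mul_pos ha.1 hs, mul_lt_mul_of_pos_left hst ha.1, ?_,
      ?_, ?_⟩, ?_⟩
    · have := mul_lt_mul_of_pos_left ht ha.1; linarith [ha.2]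
    · rw [hc, AffineMap.lineMap_lineMap_right, mul_comm]
    · rw [hm, AffineMap.lineMap_lineMap_right, mul_comm]
    · rw [← carrier_eq_of_subdivision hpq hr' hL']
      exact hM.inter.trans ((convex_segment p q).segment_subset (left_mem_segment ℝ _ _) hr')
  set r : Space := AffineMap.lineMap p q a
  set m := N.place c M N.u with hm'
  obtain ⟨G, hG⟩ := hM'.exists_insertion
  obtain ⟨G', hG'⟩ := hM.exists_insertion
  refine .of_placement ⟨c, M, hM', hG⟩ ⟨c, M, hM, hG'⟩ ?_
  have hrm : r ∈ openSegment ℝ m q := by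
    have ha2 : 0 < 1 - a * t := by nlinarith [ha.1, ha.2]
    have : r = AffineMap.lineMap m q ((a - a * t) / (1 - a * t)) := by
      rw [hm, AffineMap.lineMap_lineMap_right, AffineMap.lineMap_lineMap_left]
      change AffineMap.lineMap p q a = _
      congr 1; field_simp; ring
    rw [this]
    exact lineMap_mem_openSegment (div_pos (by nlinarith [ha.1]) ha2)
      ((div_lt_one ha2).2 (by linarith [ha.2]))
  obtain ⟨G₁, hG₁, hd⟩ := exists_subdivision (L := G) (p := m) (q := q) (r := r)
    (by simp [hG, insEdges, hm']) hrm
  refine hd.isotopic.trans (.of_edges_eq ?_)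
  have hrL := not_mem_verts_of_openSegment hpq (lineMap_mem_openSegment ha.1 ha.2)
  rw [hG₁, hG, hM'.insEdges_sdiff_right, hG', insEdges, hL', ← hm']
  have h1 : (r, q) ≠ (p, r) := by
    intro h
    have h' : r = p := by simpa using congrArg Prod.fst h
    exact hrL (h'.symm.subst (motive := (· ∈ L.verts)) (left_mem_verts hpq))
  ext e
  simp only [mem_sdiff, mem_union, mem_insert_iff, mem_singleton_iff]
  have h2 : e ∈ L.edges → e ≠ (p, r) := by
    rintro h3 rfl; exact hrL (right_mem_verts h3)
  by_cases h3 : e = (r, q)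
  · subst h3; simp [h1]
  · tauto

/-- Here the vertex `r` subdivides the piece of `p q` that precedes the inserted copy. -/
theorem insertionEquiv_subdivision_right {r : Space} (hpq : (p, q) ∈ L.edges)
    (hr : r ∈ openSegment ℝ p q) (hL' : L'.edges = (L.edges \ {(p, q)}) ∪ {(p, r), (r, q)}) :
    N.InsertionEquiv L (p, q) L' (r, q) := by
  have hr' := openSegment_subset_segment _ _ _ hr
  obtain ⟨M, hM, -⟩ := N.exists_isPlacement_mem (L := L') (p := r) (q := q) (by simp [hL'])
    (midpoint_mem_openSegment r q) Filter.univ_mem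
  set c := midpoint ℝ r q
  obtain ⟨s, t, hs, hst, ht, hc, hm⟩ := hM.pos
  rw [openSegment_eq_image_lineMap] at hr
  obtain ⟨a, ha, rfl⟩ := hr
  have hM' : N.IsPlacement L p q c M := by
    refine ⟨hpq, hM.det, ⟨a + s * (1 - a), a + t * (1 - a), ?_, ?_, ?_, ?_, ?_⟩, ?_⟩
    · nlinarith [ha.1, ha.2]
    · nlinarith [ha.2]
    · nlinarith [ha.2]
    · rw [hc, AffineMap.lineMap_lineMap_left]; congr 1; ring
    · rw [hm, AffineMap.lineMap_lineMap_left]; congr 1; ring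
    · rw [← carrier_eq_of_subdivision hpq hr' hL']
      exact hM.inter.trans ((convex_segment p q).segment_subset hr' (right_mem_segment ℝ _ _))
  have hac : a < a + s * (1 - a) := by nlinarith [ha.2]
  have hc' : c = AffineMap.lineMap p q (a + s * (1 - a)) := by
    rw [hc, AffineMap.lineMap_lineMap_left]; congr 1; ring
  set r : Space := AffineMap.lineMap p q a with hra
  obtain ⟨G, hG⟩ := hM'.exists_insertion
  obtain ⟨G', hG'⟩ := hM.exists_insertion
  refine .of_placement ⟨c, M, hM', hG⟩ ⟨c, M, hM, hG'⟩ ?_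
  have hrm : r ∈ openSegment ℝ p c := by
    have ha2 : 0 < a + s * (1 - a) := by linarith [ha.1]
    have : r = AffineMap.lineMap p c (a / (a + s * (1 - a))) := by
      rw [hc', AffineMap.lineMap_lineMap_right, hra]
      congr 1; field_simp
    rw [this]
    exact lineMap_mem_openSegment (div_pos ha.1 ha2) ((div_lt_one ha2).2 hac)
  obtain ⟨G₁, hG₁, hd⟩ := exists_subdivision (L := G) (p := p) (q := c) (r := r)
    (by simp [hG, insEdges]) hrm
  refine hd.isotopic.trans (.of_edges_eq ?_)
  have hrL := not_mem_verts_of_openSegment hpq (lineMap_mem_openSegment ha.1 ha.2)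
  rw [hG₁, hG, hM'.insEdges_sdiff_left, hG', insEdges, hL']
  have h1 : (p, r) ≠ (r, q) := by
    intro h
    have h' : p = r := by simpa using congrArg Prod.fst h
    exact hrL (h'.subst (motive := (· ∈ L.verts)) (left_mem_verts hpq))
  ext e
  simp only [mem_sdiff, mem_union, mem_insert_iff, mem_singleton_iff]
  have h2 : e ∈ L.edges → e ≠ (r, q) := by
    rintro h3 rfl; exact hrL (left_mem_verts h3)
  by_cases h3 : e = (p, r)
  · subst h3; simp [h1]
  · tauto

/-! #### Moves away from the edge -/

/-- The midpoint of `p q` lies outside the triangle, so a small copy inserted there avoids the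
triangle, and the same Δ-move can be performed after the insertion. -/
theorem insertionEquiv_deltaMove {a b r : Space} (hab : (a, b) ∈ L.edges)
    (hT : convexHull ℝ {a, b, r} ∩ L.carrier = segment ℝ a b)
    (hL' : L'.edges = (L.edges \ {(a, b)}) ∪ {(a, r), (r, b)}) (hpq : (p, q) ∈ L.edges)
    (hne : (p, q) ≠ (a, b)) : N.InsertionEquiv L (p, q) L' (p, q) := by
  have hpq' : (p, q) ∈ L'.edges := by rw [hL']; exact Or.inl ⟨hpq, hne⟩
  have hcm := midpoint_mem_openSegment p q
  set c := midpoint ℝ p q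
  have hpne : p ≠ q := L.nondegenerate _ hpq
  have hclosed : IsClosed (convexHull ℝ {a, b, r} : Set Space) :=
    ((toFinite _).isCompact_convexHull ℝ).isClosed
  have hcT : c ∈ (convexHull ℝ {a, b, r} : Set Space)ᶜ := by
    intro h
    have hc := openSegment_subset_segment _ _ _ hcm
    have h1 : c ∈ segment ℝ a b := hT ▸ ⟨h, segment_subset_carrier hpq hc⟩
    obtain ⟨h2, -⟩ := eq_of_mem_segments hpq hab hne hc h1
    simp only at h2
    rcases h2 with h2 | h2 <;> rw [h2] at hcm
    · exact not_mem_of_openSegment hpne hcm (left_mem_segment ℝ _ _)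
    · exact not_mem_of_openSegment' hpne hcm (right_mem_segment ℝ _ _)
  obtain ⟨M, hM, hMT⟩ := N.exists_isPlacement_mem hpq hcm (hclosed.isOpen_compl.mem_nhds hcT)
  have hsub : L'.carrier ⊆ L.carrier ∪ convexHull ℝ {a, b, r} := by
    intro x hx
    obtain ⟨e, he, hx⟩ := mem_carrier.1 hx
    rw [hL'] at he
    rcases he with he | rfl | rfl
    exacts [Or.inl (segment_subset_carrier he.1 hx), Or.inr (segment_subset_hull_mid _ _ _ hx),
      Or.inr (segment_subset_hull_right _ _ _ hx)]
  have hM' : N.IsPlacement L' p q c M := by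
    refine ⟨hpq', hM.det, hM.pos, ?_⟩
    rintro _ ⟨hx, y, hy, rfl⟩
    rcases hsub hx with h | h
    · exact hM.inter ⟨h, mem_image_of_mem _ hy⟩
    · exact (hMT y hy h).elim
  obtain ⟨G, hG⟩ := hM.exists_insertion
  obtain ⟨G', hG'⟩ := hM'.exists_insertion
  refine .of_placement ⟨c, M, hM, hG⟩ ⟨c, M, hM', hG'⟩ (DeltaMove.isotopic ?_)
  have habG : (a, b) ∈ G.edges := by rw [hG]; exact Or.inl (Or.inl ⟨hab, hne.symm⟩)
  refine ⟨a, b, r, habG, ?_, ?_⟩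
  · refine subset_antisymm ?_ fun x hx => ⟨segment_subset_hull_left _ _ _ hx,
      segment_subset_carrier habG hx⟩
    rintro x ⟨hx, hxG⟩
    rcases hM.carrier_subset hG hxG with h | ⟨y, hy, rfl⟩
    · exact hT ▸ ⟨hx, h⟩
    · exact (hMT y hy hx).elim
  · rw [hG, hM.insEdges_sdiff hab, hG', insEdges, hL']
    have h1 : (p, q) ≠ (a, r) := by
      intro h
      have h1 := Prod.ext_iff.1 h
      exact hne (L.source_unique _ hpq _ hab h1.1)
    have h2 : (p, q) ≠ (r, b) := by
      intro h
      have h1 := Prod.ext_iff.1 h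
      exact hne (L.target_unique _ hpq _ hab h1.2)
    ext e
    simp only [mem_sdiff, mem_union, mem_insert_iff, mem_singleton_iff]
    by_cases h3 : e = (p, q)
    · subst h3; simp [h1, h2]
    · tauto

/-! #### Moving the edge -/

/-- As the vertices move linearly in time, the vector from `p` to `q` describes a straight path. It
never vanishes, so `exists_lift_path` supplies matrices that turn the inserted copy along with the
edge. -/
theorem insertionEquiv_of_motion {B : PolygonalLink} {x : ℝ → Space → Space}
    (hx : ∀ v ∈ B.verts, ∀ t ∈ Icc (0 : ℝ) 1, x t v = AffineMap.lineMap (x 0 v) (x 1 v) t)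
    (hinj : ∀ t ∈ Icc (0 : ℝ) 1, InjOn (x t) B.verts) {X : ℝ → PolygonalLink}
    (hX : ∀ t ∈ Icc (0 : ℝ) 1, (X t).edges = Prod.map (x t) (x t) '' B.edges)
    (hpq : (p, q) ∈ B.edges) :
    N.InsertionEquiv (X 0) (x 0 p, x 0 q) (X 1) (x 1 p, x 1 q) := by
  have hp := left_mem_verts hpq
  have hq := right_mem_verts hpq
  have hc : ∀ v ∈ B.verts, ContinuousOn (fun t => x t v) (Icc 0 1) := fun v hv =>
    ContinuousOn.congr (f := fun t => AffineMap.lineMap (x 0 v) (x 1 v) t)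
      (by simp only [AffineMap.lineMap_apply_module']; fun_prop) fun t ht => hx v hv t ht
  have hne : ∀ t ∈ Icc (0 : ℝ) 1, x t q - x t p ≠ 0 := fun t ht h =>
    B.nondegenerate _ hpq (hinj t ht hp hq (sub_eq_zero.1 h).symm)
  have hlin : ∀ t ∈ Icc (0 : ℝ) 1,
      x t q - x t p = (1 - t) • (x 0 q - x 0 p) + t • (x 1 q - x 1 p) := by
    intro t ht
    rw [hx p hp t ht, hx q hq t ht, AffineMap.lineMap_apply_module',
      AffineMap.lineMap_apply_module']
    module
  have h0 : (0 : ℝ) ∈ Icc (0 : ℝ) 1 := left_mem_Icc.2 zero_le_one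
  have h1 : (1 : ℝ) ∈ Icc (0 : ℝ) 1 := right_mem_Icc.2 zero_le_one
  obtain ⟨M, hM, hMu, -⟩ := exists_joinedIn_mulVec_eq N.o_ne_u (hne 0 h0)
  obtain ⟨χ, hχc, hχ0, hχ⟩ := exists_lift_path hM (v := N.u - N.o) (d := x 1 q - x 1 p) (by
    intro t ht
    rw [hMu, ← hlin t ht]
    exact hne t ht)
  have hedge : ∀ t ∈ Icc (0 : ℝ) 1, (x t p, x t q) ∈ (X t).edges := fun t ht => by
    rw [hX t ht]; exact ⟨_, hpq, rfl⟩
  have hχu : ∀ t ∈ Icc (0 : ℝ) 1, χ t *ᵥ (N.u - N.o) = (1 : ℝ) • (x t q - x t p) := fun t ht => by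
    rw [(hχ t ht).2, hMu, ← hlin t ht, one_smul]
  have hh : (1 / 2 : ℝ) ∈ Ioo (0 : ℝ) 1 := by norm_num
  -- One scale that fits at both ends of the motion is enough, since `isotopic_of_host_motion` takes
  -- care of the times in between.
  obtain ⟨s, ⟨hs₁, hs₂⟩, hs⟩ := (((eventually_isPlacement (N := N) (hedge 0 h0) (hχ 0 h0).1 one_pos
    (hχu 0 h0) hh rfl).and (eventually_isPlacement (N := N) (hedge 1 h1) (hχ 1 h1).1 one_pos
    (hχu 1 h1) hh rfl)).and self_mem_nhdsWithin).exists
  obtain ⟨G, hG⟩ := hs₁.exists_insertion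
  obtain ⟨G', hG'⟩ := hs₂.exists_insertion
  have hs0 : 0 < s := hs
  refine .of_placement ⟨_, _, hs₁, hG⟩ ⟨_, _, hs₂, hG'⟩
    (isotopic_of_host_motion (N := N) hc hinj hX hpq (σ := fun _ => 1 / 2) (r := fun _ => s)
      (χ := fun t => s • χ t) continuousOn_const (fun _ _ => hh) continuousOn_const (fun _ _ => hs0)
      (by fun_prop) (fun t ht => det_smul_pos (hχ t ht).1 hs0)
      (fun t ht => by rw [smul_mulVec, hχu t ht, one_smul]) rfl rfl hs₁ hG hs₂ hG')

end LocalKnot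

end

/-! ### Carrying an inserted knot across a Δ-move of its own edge and around a corner. -/

section

open Set Matrix

/-- The moving point is a convex combination of `r` and a point between `p` and `q`. If `p` were on
the segment from it to `q`, then solving for `p` would exhibit `p` as a convex combination of `r`
and `q`. -/
theorem not_mem_segment_lineMap {p q r r₀ : Space} (hpq : p ≠ q) (h : p ∉ segment ℝ r q)
    (hr₀ : r₀ ∈ openSegment ℝ p q) {t : ℝ} (ht : t ∈ Icc (0 : ℝ) 1) :
    p ∉ segment ℝ (AffineMap.lineMap r₀ r t) q := by
  rw [openSegment_eq_image_lineMap] at hr₀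
  obtain ⟨a, ha, rfl⟩ := hr₀
  rintro ⟨u, v, hu, hv, huv, hp⟩
  obtain rfl : v = 1 - u := by linarith
  rw [AffineMap.lineMap_apply_module', AffineMap.lineMap_apply_module'] at hp
  have key : (u * t) • (r - p) + (u * (1 - t) * a + (1 - u)) • (q - p) = 0 := by
    rw [← sub_eq_zero] at hp
    rw [← hp]
    module
  have hk : 0 ≤ u * (1 - t) * a :=
    mul_nonneg (mul_nonneg hu (sub_nonneg.2 ht.2)) ha.1.le
  have hqp : q - p ≠ 0 := sub_ne_zero.2 hpq.symm
  have hut : u * t ≠ 0 := by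
    intro h0
    rw [h0, zero_smul, zero_add] at key
    have h1 := (smul_eq_zero.1 key).resolve_right hqp
    have h2 : u = 1 := by linarith
    subst h2
    have h3 : t = 0 := by linarith
    subst h3
    linarith [ha.1]
  have hut' : 0 < u * t := lt_of_le_of_ne (mul_nonneg hu ht.1) hut.symm
  set w := u * (1 - t) * a + (1 - u) with hw
  refine h ⟨(u * t) / (u * t + w), w / (u * t + w), by positivity, by positivity,
    by rw [← add_div]; exact div_self (by positivity), ?_⟩
  have h4 : (u * t + w) • p = (u * t) • r + w • q := by
    rw [← sub_eq_zero, ← neg_eq_zero, ← key]; module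
  have h5 : u * t + w ≠ 0 := by positivity
  rw [div_eq_inv_mul, div_eq_inv_mul, mul_smul _ (u * t), mul_smul _ w, ← smul_add, ← h4,
    smul_smul, inv_mul_cancel₀ h5, one_smul]

/-- A small triangle at the end point `q` of two segments meets the first of them in its side. -/
theorem corner_inter_subset {p q w y z : Space} (hy : y ∈ segment ℝ q p)
    (hz : z ∈ segment ℝ q w) (hpw : segment ℝ p q ∩ segment ℝ q w ⊆ {q}) :
    convexHull ℝ {y, z, q} ∩ segment ℝ p q ⊆ segment ℝ y q := by
  rw [segment_eq_image_lineMap] at hy hz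
  obtain ⟨α, hα, rfl⟩ := hy
  obtain ⟨β, hβ, rfl⟩ := hz
  rintro x ⟨hx, hxp⟩
  rw [convexHull_triple_eq, mem_ofPred_eq] at hx
  obtain ⟨y', hy', hx⟩ := hx
  rw [segment_eq_image_lineMap] at hx
  rw [segment_symm, segment_eq_image_lineMap] at hy' hxp
  obtain ⟨b, hb, rfl⟩ := hy'
  obtain ⟨s, hs, hsx⟩ := hx
  obtain ⟨k, hk, hkx⟩ := hxp
  rw [segment_symm, segment_eq_image_lineMap]
  simp only [AffineMap.lineMap_apply_module'] at hsx hkx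
  have e1 : x - q = (α * (1 - s)) • (p - q) + (s * b * β) • (w - q) := by
    rw [← hsx]; module
  have e2 : x - q = k • (p - q) := by rw [← hkx]; module
  have hsb : 0 ≤ s * b * β := mul_nonneg (mul_nonneg hs.1 hb.1) hβ.1
  have hle : α * (1 - s) ≤ α := by nlinarith [hα.1, hs.1]
  have hx2 : x = k • (p - q) + q := hkx.symm
  rcases le_or_gt k α with hkα | hkα
  · rcases hα.1.eq_or_lt with h0 | h0
    · have : k = 0 := le_antisymm (h0 ▸ hkα) hk.1
      exact ⟨0, by simp, by rw [hx2, this, AffineMap.lineMap_apply_zero]; simp⟩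
    · refine ⟨k / α, ⟨div_nonneg hk.1 h0.le, (div_le_one h0).2 hkα⟩, ?_⟩
      rw [AffineMap.lineMap_lineMap_right, div_mul_cancel₀ _ h0.ne', hx2,
        AffineMap.lineMap_apply_module']
  -- A point of `q p` beyond the side of the triangle forces equal nonzero multiples, with factors
  -- in `(0, 1]`, of `p - q` and `w - q`: a second common point of the two edges.
  · have e3 : (k - α * (1 - s)) • (p - q) = (s * b * β) • (w - q) := by
      rw [sub_smul, ← e2, e1]; module
    have hγ : 0 < k - α * (1 - s) := by linarith
    by_cases hpq : p = q
    · refine ⟨0, by simp, ?_⟩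
      rw [hx2, hpq]; simp
    exfalso
    have hsb' : 0 < s * b * β := by
      refine lt_of_le_of_ne hsb fun h0 => ?_
      rw [← h0, zero_smul] at e3
      exact (smul_ne_zero hγ.ne' (sub_ne_zero.2 hpq)) e3
    have hk1 : k - α * (1 - s) ≤ 1 := by nlinarith [hk.2, hα.1, hs.2]
    have hb1 : s * b * β ≤ 1 := by
      have : s * b ≤ 1 := mul_le_one₀ hs.2 hb.1 hb.2
      exact mul_le_one₀ this hβ.1 hβ.2
    have := hpw (a := (k - α * (1 - s)) • (p - q) + q) ⟨?_, ?_⟩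
    · rw [mem_singleton_iff, add_eq_right] at this
      exact (smul_ne_zero hγ.ne' (sub_ne_zero.2 hpq)) this
    · rw [segment_symm, segment_eq_image_lineMap]
      exact ⟨_, ⟨hγ.le, hk1⟩, AffineMap.lineMap_apply_module' _ _ _⟩
    · rw [e3, segment_eq_image_lineMap]
      exact ⟨_, ⟨hsb, hb1⟩, AffineMap.lineMap_apply_module' _ _ _⟩

namespace PolygonalLink

variable {L : PolygonalLink}

/-- Cutting the corner between two consecutive edges. -/
theorem exists_corner_cut {p q w : Space} (hpq : (p, q) ∈ L.edges) (hqw : (q, w) ∈ L.edges) :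
    ∃ ε : ℝ, 0 < ε ∧ ε < 1 ∧ ∀ a b : ℝ, 0 < a → a ≤ ε → 0 < b → b ≤ ε → ∃ L' : PolygonalLink,
      L'.edges = (L.edges \ {(p, q), (q, w)}) ∪ {(p, AffineMap.lineMap q p a),
        (AffineMap.lineMap q p a, AffineMap.lineMap q w b), (AffineMap.lineMap q w b, w)} := by
  have hne : p ≠ q := L.nondegenerate _ hpq
  have hne' : q ≠ w := L.nondegenerate _ hqw
  have hpw : segment ℝ p q ∩ segment ℝ q w ⊆ {q} :=
    segment_inter_subset (left_not_mem hpq hqw) (right_not_mem hpq hqw)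
  set K := ⋃ e ∈ L.edges \ {(p, q), (q, w)}, segment ℝ e.1 e.2 with hK
  have hKc : IsClosed K :=
    (L.finite.sdiff.isCompact_biUnion fun e _ => isCompact_segment _ _).isClosed
  have hqK : q ∈ Kᶜ := by
    intro h
    simp only [hK, mem_iUnion, exists_prop] at h
    obtain ⟨e, he, hqe⟩ := h
    simp only [mem_sdiff, mem_insert_iff, mem_singleton_iff, not_or] at he
    rcases vertex_mem_edge (left_mem_verts hqw) he.1 hqe with h | h
    · exact he.2.2 (L.source_unique _ he.1 _ hqw h.symm)
    · exact he.2.1 (L.target_unique _ he.1 _ hpq h.symm)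
  -- Inside this ball only the two edges at `q` are present. The choice of `ε` keeps the cut
  -- triangle in the ball, so it can meet the link only in the two pieces adjacent to `q`.
  obtain ⟨δ, hδ, hball⟩ := Metric.isOpen_iff.1 hKc.isOpen_compl q hqK
  have hcont : ∀ v : Space, ∀ᶠ ε in nhdsWithin (0 : ℝ) (Ioi 0),
      AffineMap.lineMap q v ε ∈ Metric.ball q δ := by
    intro v
    have : Continuous fun ε : ℝ => (AffineMap.lineMap q v ε : Space) := by
      simp only [AffineMap.lineMap_apply_module']; fun_prop
    refine (this.continuousAt.eventually_mem ?_).filter_mono nhdsWithin_le_nhds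
    simpa using Metric.ball_mem_nhds q hδ
  obtain ⟨ε, ⟨h1, h2⟩, hε0, hε1⟩ := (((hcont p).and (hcont w)).and
    (Ioo_mem_nhdsGT (zero_lt_one (α := ℝ)))).exists
  refine ⟨ε, hε0, hε1, fun a b ha haε hb hbε => ?_⟩
  have hqδ := Metric.mem_ball_self (x := q) hδ
  have hin : ∀ v : Space, ∀ a : ℝ, 0 < a → a ≤ ε → AffineMap.lineMap q v ε ∈ Metric.ball q δ →
      AffineMap.lineMap q v a ∈ Metric.ball q δ := by
    intro v a ha haε h
    refine (convex_ball q δ).segment_subset hqδ h ?_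
    simpa using lineMap_mem_segment_lineMap (a := q) (b := v) ha.le haε
  have hy := hin p a ha haε h1
  have hz := hin w b hb hbε h2
  have hym : AffineMap.lineMap q p a ∈ openSegment ℝ p q := by
    rw [openSegment_symm]; exact lineMap_mem_openSegment ha (by linarith)
  have hzm : AffineMap.lineMap q w b ∈ openSegment ℝ q w :=
    lineMap_mem_openSegment hb (by linarith)
  set y : Space := AffineMap.lineMap q p a
  set z : Space := AffineMap.lineMap q w b
  have hyv := not_mem_verts_of_openSegment hpq hym
  have hzv := not_mem_verts_of_openSegment hqw hzm
  have hym' := openSegment_subset_segment _ _ _ hym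
  have hzm' := openSegment_subset_segment _ _ _ hzm
  obtain ⟨L₁, hL₁, -⟩ := exists_subdivision hpq hym
  have hqw₁ : (q, w) ∈ L₁.edges := by
    rw [hL₁]; exact Or.inl ⟨hqw, fun h => hne (congrArg Prod.fst h).symm⟩
  obtain ⟨L₂, hL₂, -⟩ := exists_subdivision hqw₁ hzm
  have hqy : (y, q) ≠ (q, w) := fun h =>
    (hyv ((show y = q from congrArg Prod.fst h) ▸ right_mem_verts hpq)).elim
  have hyq₂ : (y, q) ∈ L₂.edges := by
    rw [hL₂, hL₁]; exact Or.inl ⟨Or.inr (Or.inr rfl), hqy⟩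
  have hqz₂ : (q, z) ∈ L₂.edges := by
    rw [hL₂]; exact Or.inr (Or.inl rfl)
  have hcar : L₂.carrier = L.carrier := by
    rw [carrier_eq_of_subdivision hqw₁ hzm' hL₂, carrier_eq_of_subdivision hpq hym' hL₁]
  obtain ⟨L', hL', -⟩ := exists_removal hyq₂ hqz₂ (by
    rw [hcar]
    rintro x ⟨hx, hxL⟩
    obtain ⟨e, he, hxe⟩ := mem_carrier.1 hxL
    have hxb : x ∈ Metric.ball q δ := convexHull_min (by
      rintro _ (rfl | rfl | rfl)
      exacts [hy, hz, hqδ]) (convex_ball q δ) hx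
    by_cases h1 : e = (p, q)
    · subst h1
      exact Or.inl (corner_inter_subset (segment_symm ℝ p q ▸ hym') hzm' hpw ⟨hx, hxe⟩)
    by_cases h2 : e = (q, w)
    · subst h2
      refine Or.inr (segment_symm ℝ z q ▸ corner_inter_subset (p := w) (w := p) hzm'
        (segment_symm ℝ p q ▸ hym') ?_ ⟨?_, segment_symm ℝ q w ▸ hxe⟩)
      · rw [segment_symm ℝ w q, segment_symm ℝ q p, inter_comm]; exact hpw
      · rwa [insert_comm]
    · refine (hball hxb ?_).elim
      simp only [hK, mem_iUnion, exists_prop]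
      exact ⟨e, ⟨he, by simp [h1, h2]⟩, hxe⟩)
  refine ⟨L', ?_⟩
  have hpz : (p, y) ≠ (q, w) := fun h => hne (congrArg Prod.fst h)
  have hpz' : (p, y) ≠ (q, z) := fun h => hne (congrArg Prod.fst h)
  have hzw : (z, w) ≠ (q, z) := fun h => hzv ((show z = q from congrArg Prod.fst h) ▸ left_mem_verts hqw)
  have hzw' : (z, w) ≠ (y, q) := fun h => hne' (congrArg Prod.snd h).symm
  have hpy : (p, y) ≠ (y, q) := fun h =>
    (hyv ((show p = y from congrArg Prod.fst h) ▸ left_mem_verts hpq)).elim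
  rw [hL', hL₂, hL₁]
  ext e
  simp only [mem_sdiff, mem_union, mem_insert_iff, mem_singleton_iff]
  have k1 : e ∈ L.edges → e ≠ (y, q) := by rintro h rfl; exact hyv (left_mem_verts h)
  have k2 : e ∈ L.edges → e ≠ (q, z) := by rintro h rfl; exact hzv (right_mem_verts h)
  by_cases k3 : e = (p, y)
  · subst k3; simp [hpz, hpy, hpz']
  by_cases k4 : e = (z, w)
  · subst k4; simp [hzw, hzw']
  tauto

end PolygonalLink

namespace LocalKnot

open PolygonalLink

variable {N : LocalKnot} {L L' L'' K X Y G G' : PolygonalLink} {p q c : Space}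
  {M : Matrix (Fin 3) (Fin 3) ℝ}

/-- Subdivide `p q` at its midpoint and move the midpoint straight to `r`. It stays in the triangle,
so all intermediate figures are links, and the inserted copy rides on the first half, which becomes
`p r`. -/
theorem insertionEquiv_deltaMove_self {r : Space} (hpq : (p, q) ∈ L.edges)
    (hT : convexHull ℝ {p, q, r} ∩ L.carrier = segment ℝ p q)
    (hL' : L'.edges = (L.edges \ {(p, q)}) ∪ {(p, r), (r, q)}) :
    N.InsertionEquiv L (p, q) L' (p, r) := by
  have hne : p ≠ q := L.nondegenerate _ hpq
  have hpr' : (p, r) ∈ L'.edges := by simp [hL']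
  have hrq' : (r, q) ∈ L'.edges := by simp [hL']
  have hpr := left_not_mem hpr' hrq'
  have hqr := right_not_mem hpr' hrq'
  have hr₀ := midpoint_mem_openSegment p q
  set r₀ := midpoint ℝ p q
  obtain ⟨B, hB, -⟩ := exists_subdivision hpq hr₀
  have hr₀L := not_mem_verts_of_openSegment hpq hr₀
  set ρ : ℝ → Space := fun t => AffineMap.lineMap r₀ r t with hρ
  have hp : ∀ t ∈ Icc (0 : ℝ) 1, p ∉ segment ℝ (ρ t) q := fun t ht =>
    not_mem_segment_lineMap hne hpr hr₀ ht
  have hq : ∀ t ∈ Icc (0 : ℝ) 1, q ∉ segment ℝ p (ρ t) := fun t ht => by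
    rw [segment_symm]
    refine not_mem_segment_lineMap hne.symm (by rwa [segment_symm]) ?_ ht
    rwa [openSegment_symm]
  have hρT : ∀ t ∈ Icc (0 : ℝ) 1, ρ t ∈ convexHull ℝ {p, q, r} := fun t ht => by
    refine (convex_convexHull ℝ _).segment_subset (segment_subset_hull_left _ _ _
      (openSegment_subset_segment _ _ _ hr₀)) (subset_convexHull ℝ _ (a := r) (by simp)) ?_
    rw [segment_eq_image_lineMap]
    exact mem_image_of_mem _ ht
  have hex : ∀ t ∈ Icc (0 : ℝ) 1, ∃ Xt : PolygonalLink,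
      Xt.edges = (L.edges \ {(p, q)}) ∪ {(p, ρ t), (ρ t, q)} := fun t ht => by
    obtain ⟨Xt, h, -⟩ := exists_deltaMove hpq (r := ρ t) (by
      rw [← hT]
      refine inter_subset_inter_left _ (convexHull_min ?_ (convex_convexHull ℝ _))
      rintro _ (rfl | rfl | rfl)
      exacts [subset_convexHull ℝ _ (by simp), subset_convexHull ℝ _ (by simp), hρT t ht])
      (hp t ht) (hq t ht)
    exact ⟨Xt, h⟩
  have : Nonempty PolygonalLink := ⟨L⟩
  choose! X hX using hex
  have hρv : ∀ t ∈ Icc (0 : ℝ) 1, ρ t ∉ L.verts := by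
    intro t ht h
    have h1 : ρ t ∈ segment ℝ p q := hT ▸ ⟨hρT t ht, verts_subset_carrier h⟩
    rcases vertex_mem_edge h hpq h1 with h2 | h2
    · exact hp t ht (h2 ▸ left_mem_segment ℝ _ _)
    · exact hq t ht (h2 ▸ right_mem_segment ℝ _ _)
  classical
  set x : ℝ → Space → Space := fun t v => if v = r₀ then ρ t else v with hx
  have hxr : ∀ t, x t r₀ = ρ t := fun t => by simp [hx]
  have hxv : ∀ t, ∀ v ∈ L.verts, x t v = v := fun t v hv => by
    have : v ≠ r₀ := fun h => hr₀L (h ▸ hv)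
    simp [hx, this]
  have hBv : ∀ v ∈ B.verts, v = r₀ ∨ v ∈ L.verts := by
    rintro _ ⟨e, he, rfl⟩
    rw [hB] at he
    rcases he with he | rfl | rfl
    exacts [Or.inr (left_mem_verts he.1), Or.inr (left_mem_verts (e := (p, q)) hpq), Or.inl rfl]
  have hpv := left_mem_verts hpq
  have hqv := right_mem_verts hpq
  have key := insertionEquiv_of_motion (N := N) (B := B) (x := x) (p := p) (q := r₀) (X := X) ?_ ?_
    ?_ (by simp [hB])
  · rw [hxr, hxr, hxv _ _ hpv, hxv _ _ hpv] at key
    have h0 : ρ 0 = r₀ := by simp [hρ]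
    have h1 : ρ 1 = r := by simp [hρ]
    rw [h0, h1] at key
    have hX1 : X 1 = L' := PolygonalLink.ext (by
      rw [hX 1 (right_mem_Icc.2 zero_le_one), h1, hL'])
    rw [hX1] at key
    have hX0 := hX 0 (left_mem_Icc.2 zero_le_one)
    rw [h0] at hX0
    exact (insertionEquiv_subdivision_left hpq hr₀ hX0).trans key (by simp [hX0])
  · intro v hv t ht
    rcases hBv v hv with rfl | hv
    · rw [hxr, hxr, hxr]; simp [hρ]
    · rw [hxv _ _ hv, hxv _ _ hv, hxv _ _ hv, AffineMap.lineMap_same]; rfl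
  · intro t ht v hv w hw hvw
    rcases hBv v hv with rfl | hv <;> rcases hBv w hw with rfl | hw
    · rfl
    · rw [hxr, hxv _ _ hw] at hvw; exact (hρv t ht (hvw ▸ hw)).elim
    · rw [hxr, hxv _ _ hv] at hvw; exact (hρv t ht (hvw ▸ hv)).elim
    · rwa [hxv _ _ hv, hxv _ _ hw] at hvw
  · intro t ht
    have h1 : Prod.map (x t) (x t) '' (L.edges \ {(p, q)}) = L.edges \ {(p, q)} := by
      refine (image_congr fun e he => ?_).trans (image_id _)
      exact Prod.ext (hxv t _ (left_mem_verts he.1)) (hxv t _ (right_mem_verts he.1))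
    rw [hX t ht, hB, image_union, h1, image_insert_eq, image_singleton]
    simp only [Prod.map_apply, hxr, hxv t _ hpv, hxv t _ hqv]

/-- A short edge from `y t` on `p q` to `z t` on `q w` carries the knot. It begins as the last piece
of `p q`, cuts the corner at intermediate times, and ends as the first piece of `q w`. Subdivision
transfers the insertion to the full edges at both ends. -/
theorem insertionEquiv_succ {w : Space} (hpq : (p, q) ∈ L.edges) (hqw : (q, w) ∈ L.edges) :
    N.InsertionEquiv L (p, q) L (q, w) := by
  have hne : p ≠ q := L.nondegenerate _ hpq
  have hne' : q ≠ w := L.nondegenerate _ hqw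
  have hpw : segment ℝ p q ∩ segment ℝ q w ⊆ {q} :=
    segment_inter_subset (left_not_mem hpq hqw) (right_not_mem hpq hqw)
  obtain ⟨ε, hε0, hε1, hcut⟩ := exists_corner_cut hpq hqw
  set y : ℝ → Space := fun t => AffineMap.lineMap q p (ε * (1 - t)) with hy
  set z : ℝ → Space := fun t => AffineMap.lineMap q w (ε * t) with hz
  have hy1 : y 1 = q := by simp [hy]
  have hz0 : z 0 = q := by simp [hz]
  have hym : ∀ t, 0 ≤ t → t < 1 → y t ∈ openSegment ℝ p q := by
    intro t h0 h1
    rw [openSegment_symm]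
    exact lineMap_mem_openSegment (by nlinarith) (by nlinarith)
  have hzm : ∀ t, 0 < t → t ≤ 1 → z t ∈ openSegment ℝ q w := fun t h0 h1 =>
    lineMap_mem_openSegment (by nlinarith) (by nlinarith)
  have hy0m := hym 0 le_rfl one_pos
  have hz1m := hzm 1 one_pos le_rfl
  have hyv : ∀ t, 0 ≤ t → t < 1 → y t ∉ L.verts := fun t h0 h1 =>
    not_mem_verts_of_openSegment hpq (hym t h0 h1)
  have hzv : ∀ t, 0 < t → t ≤ 1 → z t ∉ L.verts := fun t h0 h1 =>
    not_mem_verts_of_openSegment hqw (hzm t h0 h1)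
  have hpv := left_mem_verts hpq
  have hqv := left_mem_verts hqw
  have hwv := right_mem_verts hqw
  obtain ⟨L₀, hL₀, -⟩ := exists_subdivision hpq hy0m
  obtain ⟨L₁, hL₁, -⟩ := exists_subdivision hqw hz1m
  have hqwne : (q, w) ≠ (p, q) := fun h => hne (congrArg Prod.fst h).symm
  -- At the two end times one of `y t`, `z t` equals `q`; the corner is then not cut, and the link
  -- is a mere subdivision of `L`.
  have hex : ∀ t ∈ Icc (0 : ℝ) 1, ∃ Xt : PolygonalLink,
      Xt.edges = (L.edges \ {(p, q), (q, w)}) ∪ {(p, y t), (y t, z t), (z t, w)} := by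
    intro t ht
    rcases ht.1.eq_or_lt with rfl | h0
    · refine ⟨L₀, ?_⟩
      rw [hL₀, hz0]
      ext e
      simp only [mem_sdiff, mem_union, mem_insert_iff, mem_singleton_iff]
      by_cases h : e = (q, w)
      · subst h; simp [hqw, hne.symm]
      · tauto
    rcases ht.2.eq_or_lt with rfl | h1
    · refine ⟨L₁, ?_⟩
      rw [hL₁, hy1]
      ext e
      simp only [mem_sdiff, mem_union, mem_insert_iff, mem_singleton_iff]
      by_cases h : e = (p, q)
      · subst h; simp [hpq, hne]
      · tauto
    · exact hcut _ _ (by nlinarith) (by nlinarith) (by nlinarith) (by nlinarith)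
  have : Nonempty PolygonalLink := ⟨L⟩
  choose! X hX using hex
  have h0 : (0 : ℝ) ∈ Icc (0 : ℝ) 1 := left_mem_Icc.2 zero_le_one
  have h1 : (1 : ℝ) ∈ Icc (0 : ℝ) 1 := right_mem_Icc.2 zero_le_one
  have hX0 : X 0 = L₀ := PolygonalLink.ext (by
      rw [hX 0 h0, hL₀, hz0]
      ext e
      simp only [mem_sdiff, mem_union, mem_insert_iff, mem_singleton_iff]
      by_cases h : e = (q, w)
      · subst h; simp [hqw, hne.symm]
      · tauto)
  have hX1 : X 1 = L₁ := PolygonalLink.ext (by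
      rw [hX 1 h1, hL₁, hy1]
      ext e
      simp only [mem_sdiff, mem_union, mem_insert_iff, mem_singleton_iff]
      by_cases h : e = (p, q)
      · subst h; simp [hpq, hne]
      · tauto)
  have hy0v := hyv 0 le_rfl one_pos
  have hy0q : y 0 ≠ q := fun h => hy0v (h ▸ hqv)
  classical
  -- The vertices of the subdivided link `L₀` serve as labels: `y 0` follows `y t`, and the old
  -- corner `q` follows `z t`.
  set x : ℝ → Space → Space := fun t v => if v = y 0 then y t else if v = q then z t else v
    with hx
  have hxy : ∀ t, x t (y 0) = y t := fun t => by simp [hx]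
  have hxq : ∀ t, x t q = z t := fun t => by simp [hx, hy0q.symm]
  have hxv : ∀ t, ∀ v ∈ L.verts, v ≠ q → x t v = v := fun t v hv hvq => by
    have : v ≠ y 0 := fun h => hy0v (h ▸ hv)
    simp [hx, this, hvq]
  have hBv : ∀ v ∈ L₀.verts, v = y 0 ∨ v = q ∨ v ∈ L.verts ∧ v ≠ q := by
    rintro _ ⟨e, he, rfl⟩
    by_cases hq : e.1 = q
    · exact Or.inr (Or.inl hq)
    rw [hL₀] at he
    rcases he with he | rfl | rfl
    exacts [Or.inr (Or.inr ⟨left_mem_verts he.1, hq⟩), Or.inr (Or.inr ⟨hpv, hq⟩), Or.inl rfl]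
  have hyz : ∀ t ∈ Icc (0 : ℝ) 1, y t ≠ z t := by
    intro t ht h
    have hys : y t ∈ segment ℝ p q := by
      rcases ht.2.eq_or_lt with rfl | h'
      · rw [hy1]; exact right_mem_segment ℝ _ _
      · exact openSegment_subset_segment _ _ _ (hym t ht.1 h')
    have hzs : z t ∈ segment ℝ q w := by
      rcases ht.1.eq_or_lt with rfl | h'
      · rw [hz0]; exact left_mem_segment ℝ _ _
      · exact openSegment_subset_segment _ _ _ (hzm t h' ht.2)
    have hyq : y t = q := hpw ⟨hys, h ▸ hzs⟩
    rcases ht.2.eq_or_lt with rfl | h'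
    · exact hzv 1 one_pos le_rfl (h ▸ hyq.symm ▸ hqv)
    · exact hyv t ht.1 h' (hyq ▸ hqv)
  have hyne : ∀ t ∈ Icc (0 : ℝ) 1, ∀ v ∈ L.verts, v ≠ q → y t ≠ v := by
    intro t ht v hv hvq h
    rcases ht.2.eq_or_lt with rfl | h'
    · exact hvq (h ▸ hy1)
    · exact hyv t ht.1 h' (h ▸ hv)
  have hzne : ∀ t ∈ Icc (0 : ℝ) 1, ∀ v ∈ L.verts, v ≠ q → z t ≠ v := by
    intro t ht v hv hvq h
    rcases ht.1.eq_or_lt with rfl | h'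
    · exact hvq (h ▸ hz0)
    · exact hzv t h' ht.2 (h ▸ hv)
  have key := insertionEquiv_of_motion (N := N) (B := L₀) (x := x) (p := y 0) (q := q) (X := X) ?_
    ?_ ?_ (by simp [hL₀])
  · rw [hxy, hxy, hxq, hxq, hX0, hX1, hz0, hy1] at key
    exact (insertionEquiv_subdivision_right hpq hy0m hL₀).trans
      (key.trans (insertionEquiv_subdivision_left hqw hz1m hL₁).symm (by simp [hL₁]))
      (by simp [hL₀])
  · intro v hv t ht
    rcases hBv v hv with rfl | rfl | ⟨hv, hvq⟩
    · rw [hxy, hxy, hxy]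
      simp only [hy, AffineMap.lineMap_apply_module']
      module
    · rw [hxq, hxq, hxq]
      simp only [hz, AffineMap.lineMap_apply_module']
      module
    · rw [hxv _ _ hv hvq, hxv _ _ hv hvq, hxv _ _ hv hvq, AffineMap.lineMap_same]; rfl
  · intro t ht v hv w hw hvw
    rcases hBv v hv with rfl | rfl | ⟨hv, hvq⟩ <;> rcases hBv w hw with rfl | rfl | ⟨hw, hwq⟩
    · rfl
    · rw [hxy, hxq] at hvw; exact (hyz t ht hvw).elim
    · rw [hxy, hxv _ _ hw hwq] at hvw; exact (hyne t ht _ hw hwq hvw).elim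
    · rw [hxy, hxq] at hvw; exact (hyz t ht hvw.symm).elim
    · rfl
    · rw [hxq, hxv _ _ hw hwq] at hvw; exact (hzne t ht _ hw hwq hvw).elim
    · rw [hxy, hxv _ _ hv hvq] at hvw; exact (hyne t ht _ hv hvq hvw.symm).elim
    · rw [hxq, hxv _ _ hv hvq] at hvw; exact (hzne t ht _ hv hvq hvw.symm).elim
    · rwa [hxv _ _ hv hvq, hxv _ _ hw hwq] at hvw
  · intro t ht
    have hL₀' : L₀.edges = (L.edges \ {(p, q), (q, w)}) ∪ {(p, y 0), (y 0, q), (q, w)} := by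
      rw [← hX0, hX 0 h0, hz0]
    have h1 : Prod.map (x t) (x t) '' (L.edges \ {(p, q), (q, w)}) =
        L.edges \ {(p, q), (q, w)} := by
      refine (image_congr fun e he => ?_).trans (image_id _)
      simp only [mem_sdiff, mem_insert_iff, mem_singleton_iff, not_or] at he
      exact Prod.ext (hxv t _ (left_mem_verts he.1) fun h =>
        he.2.2 (L.source_unique _ he.1 _ hqw h)) (hxv t _ (right_mem_verts he.1) fun h =>
        he.2.1 (L.target_unique _ he.1 _ hpq h))
    rw [hX t ht, hL₀', image_union, h1, image_insert_eq, image_insert_eq, image_singleton]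
    simp only [Prod.map_apply, hxy, hxq, hxv t _ hpv hne, hxv t _ hwv hne'.symm]

/-! #### Insertions into knots -/

/-- Here it matters that there is only one component: the copy slides around corners from any edge
to any other. -/
theorem insertionEquiv_of_isKnot (hK : K.IsKnot) {e f : Space × Space} (he : e ∈ K.edges)
    (hf : f ∈ K.edges) : N.InsertionEquiv K e K f := by
  induction hK.2 e he f hf with
  | refl => exact .refl e
  | tail _ h ih =>
    obtain ⟨hb, hc, hbc⟩ := h
    refine (ih hb).trans ?_ hb
    rename_i b c _
    obtain ⟨b1, b2⟩ := b
    obtain ⟨c1, c2⟩ := c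
    obtain rfl : b2 = c1 := hbc
    exact insertionEquiv_succ hb hc

/-- A Δ-move keeps all edges but one, and that one is matched with both of its successors. The claim
is made in both directions so that it passes to the generated equivalence relation. -/
theorem exists_insertionEquiv (h : Isotopic L K) (N : LocalKnot) :
    (∀ e ∈ L.edges, ∃ f ∈ K.edges, N.InsertionEquiv L e K f) ∧
      ∀ f ∈ K.edges, ∃ e ∈ L.edges, N.InsertionEquiv K f L e := by
  induction h with
  | rel X Y h =>
    obtain ⟨a, b, r, hab, hT, hY⟩ := h
    have har : (a, r) ∈ Y.edges := by simp [hY]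
    have hrb : (r, b) ∈ Y.edges := by simp [hY]
    have h1 := insertionEquiv_deltaMove_self (N := N) hab hT hY
    have h2 : N.InsertionEquiv X (a, b) Y (r, b) := h1.trans (insertionEquiv_succ har hrb) har
    have h3 : ∀ e ∈ X.edges, e ≠ (a, b) → N.InsertionEquiv X e Y e := fun e he hne =>
      insertionEquiv_deltaMove hab hT hY he hne
    constructor
    · intro e he
      by_cases hne : e = (a, b)
      · subst hne; exact ⟨_, har, h1⟩
      · exact ⟨e, by rw [hY]; exact Or.inl ⟨he, hne⟩, h3 e he hne⟩
    · intro f hf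
      rw [hY] at hf
      rcases hf with hf | rfl | rfl
      exacts [⟨f, hf.1, (h3 f hf.1 hf.2).symm⟩, ⟨_, hab, h1.symm⟩, ⟨_, hab, h2.symm⟩]
  | refl X => exact ⟨fun e he => ⟨e, he, .refl e⟩, fun e he => ⟨e, he, .refl e⟩⟩
  | symm X Y _ ih => exact ih.symm
  | trans X Y Z _ _ ih₁ ih₂ =>
    constructor
    · intro e he
      obtain ⟨f, hf, h⟩ := ih₁.1 e he
      obtain ⟨g, hg, h'⟩ := ih₂.1 f hf
      exact ⟨g, hg, h.trans h' hf⟩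
    · intro e he
      obtain ⟨f, hf, h⟩ := ih₂.2 e he
      obtain ⟨g, hg, h'⟩ := ih₁.2 f hf
      exact ⟨g, hg, h.trans h' hf⟩

/-- Inserting a local knot into a knot is well defined up to isotopy. -/
theorem IsInsertion.isotopic_of_isKnot {p' q' : Space} (hK : K.IsKnot) (hL : Isotopic L K)
    (hL' : Isotopic L' K) (hG : N.IsInsertion L p q G) (hG' : N.IsInsertion L' p' q' G') :
    Isotopic G G' := by
  have he : (p, q) ∈ L.edges := hG.choose_spec.choose_spec.1.edge
  have he' : (p', q') ∈ L'.edges := hG'.choose_spec.choose_spec.1.edge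
  obtain ⟨f, hf, h⟩ := (exists_insertionEquiv hL N).1 _ he
  obtain ⟨f', hf', h'⟩ := (exists_insertionEquiv hL' N).1 _ he'
  exact ((h.trans (insertionEquiv_of_isKnot hK hf hf') hf).trans h'.symm hf') _ _ hG hG'

end LocalKnot

end

section

open Set Matrix

/-! ### Sums along a plane -/

namespace PolygonalLink

variable {L L' L₁ L₂ Z : PolygonalLink} {p q p₀ q₀ : Space}

/-- Replacing the end of an edge by a detour across a triangle. -/
theorem exists_kink {m r : Space} (hZ : (p₀, p) ∈ Z.edges) (hm : m ∈ openSegment ℝ p₀ p)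
    (hT : convexHull ℝ {m, p, r} ∩ Z.carrier ⊆ segment ℝ m p) (h₁ : m ∉ segment ℝ r p)
    (h₂ : p ∉ segment ℝ m r) : ∃ Z' : PolygonalLink,
      Z'.edges = (Z.edges \ {(p₀, p)}) ∪ {(p₀, m), (m, r), (r, p)} ∧ Isotopic Z Z' ∧
      Z'.carrier ⊆ Z.carrier ∪ convexHull ℝ {m, p, r} := by
  have hmv := not_mem_verts_of_openSegment hZ hm
  obtain ⟨Z₁, hZ₁, hi₁⟩ := exists_subdivision hZ hm
  have hcar := carrier_eq_of_subdivision hZ (openSegment_subset_segment _ _ _ hm) hZ₁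
  obtain ⟨Z₂, hZ₂, hi₂⟩ := exists_deltaMove (L := Z₁) (p := m) (q := p) (r := r) (by simp [hZ₁])
    (hcar ▸ hT) h₁ h₂
  refine ⟨Z₂, ?_, hi₁.isotopic.trans hi₂.isotopic, ?_⟩
  · rw [hZ₂, hZ₁]
    have h3 : (p₀, m) ≠ (m, p) := fun h =>
      hmv ((show p₀ = m from congrArg Prod.fst h) ▸ left_mem_verts hZ)
    ext e
    simp only [mem_sdiff, mem_union, mem_insert_iff, mem_singleton_iff]
    have : e ∈ Z.edges → e ≠ (m, p) := by rintro h rfl; exact hmv (left_mem_verts h)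
    by_cases h4 : e = (p₀, m)
    · subst h4; simp [h3]
    · tauto
  · intro x hx
    obtain ⟨e, he, hx⟩ := mem_carrier.1 hx
    rw [hZ₂] at he
    rcases he with he | rfl | rfl
    · rw [← hcar]; exact Or.inl (segment_subset_carrier he.1 hx)
    · exact Or.inr (segment_subset_hull_mid _ _ _ hx)
    · exact Or.inr (segment_subset_hull_right _ _ _ hx)

theorem exists_kink_start {m r : Space} (hZ : (q, q₀) ∈ Z.edges) (hm : m ∈ openSegment ℝ q₀ q)
    (hT : convexHull ℝ {m, q, r} ∩ Z.carrier ⊆ segment ℝ m q) (h₁ : m ∉ segment ℝ r q)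
    (h₂ : q ∉ segment ℝ m r) : ∃ Z' : PolygonalLink,
      Z'.edges = (Z.edges \ {(q, q₀)}) ∪ {(q, r), (r, m), (m, q₀)} ∧ Isotopic Z Z' ∧
      Z'.carrier ⊆ Z.carrier ∪ convexHull ℝ {m, q, r} := by
  obtain ⟨Z', hZ', hi, hc⟩ := exists_kink (Z := Z.reverse) (mem_reverse_edges.2 hZ) hm
    (by rwa [reverse_carrier]) h₁ h₂
  refine ⟨Z'.reverse, ?_, ?_, ?_⟩
  · ext ⟨a, b⟩
    rw [mem_reverse_edges, hZ']
    simp only [mem_sdiff, mem_union, mem_insert_iff, mem_singleton_iff, mem_reverse_edges,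
      Prod.mk.injEq]
    tauto
  · have := hi.reverse; rwa [reverse_reverse] at this
  · rwa [reverse_carrier, ← reverse_carrier Z]

/-- The two detours do not interfere because their triangles are disjoint. The set `C` may be larger
than the carrier, so that the same triangles serve for a summand and for the sum. -/
theorem exists_two_kinks {m r m' r' : Space} {C : Set Space} (hp : (p₀, p) ∈ Z.edges)
    (hq : (q, q₀) ∈ Z.edges) (hne : (p₀, p) ≠ (q, q₀)) (hC : Z.carrier ⊆ C)
    (hm : m ∈ openSegment ℝ p₀ p)
    (hT : convexHull ℝ {m, p, r} ∩ C ⊆ segment ℝ m p) (h₁ : m ∉ segment ℝ r p)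
    (h₂ : p ∉ segment ℝ m r) (hm' : m' ∈ openSegment ℝ q₀ q)
    (hT' : convexHull ℝ {m', q, r'} ∩ C ⊆ segment ℝ m' q) (h₁' : m' ∉ segment ℝ r' q)
    (h₂' : q ∉ segment ℝ m' r')
    (hd : Disjoint (convexHull ℝ {m, p, r}) (convexHull ℝ {m', q, r'})) :
    ∃ Z' : PolygonalLink, Z'.edges = (Z.edges \ {(p₀, p), (q, q₀)}) ∪
        {(p₀, m), (m, r), (r, p), (q, r'), (r', m'), (m', q₀)} ∧ Isotopic Z Z' ∧
      Z'.carrier ⊆ Z.carrier ∪ convexHull ℝ {m, p, r} ∪ convexHull ℝ {m', q, r'} := by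
  have hmv := not_mem_verts_of_openSegment hp hm
  obtain ⟨Z₁, hZ₁, hi₁, hc₁⟩ := exists_kink hp hm
    ((inter_subset_inter_right _ hC).trans hT) h₁ h₂
  have hq₁ : (q, q₀) ∈ Z₁.edges := by rw [hZ₁]; exact Or.inl ⟨hq, hne.symm⟩
  obtain ⟨Z₂, hZ₂, hi₂, hc₂⟩ := exists_kink_start hq₁ hm' (by
    rintro x ⟨hx, hx'⟩
    rcases hc₁ hx' with h | h
    · exact hT' ⟨hx, hC h⟩
    · exact (Set.disjoint_left.1 hd h hx).elim) h₁' h₂'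
  refine ⟨Z₂, ?_, hi₁.trans hi₂, hc₂.trans (union_subset_union_left _ hc₁)⟩
  rw [hZ₂, hZ₁]
  have k1 : (p₀, m) ≠ (q, q₀) := fun h =>
    hmv ((show m = q₀ from congrArg Prod.snd h) ▸ right_mem_verts hq)
  have k2 : (m, r) ≠ (q, q₀) := fun h =>
    hmv ((show m = q from congrArg Prod.fst h) ▸ left_mem_verts hq)
  have k3 : (r, p) ≠ (q, q₀) := fun h => Set.disjoint_left.1 hd
    (subset_convexHull ℝ _ (a := r) (by simp))
    ((show r = q from congrArg Prod.fst h) ▸ subset_convexHull ℝ _ (by simp))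
  ext e
  simp only [mem_sdiff, mem_union, mem_insert_iff, mem_singleton_iff]
  constructor
  · tauto
  · rintro (h | rfl | rfl | rfl | rfl | rfl | rfl)
    · tauto
    · exact Or.inl ⟨by simp, k1⟩
    · exact Or.inl ⟨by simp, k2⟩
    · exact Or.inl ⟨by simp, k3⟩
    all_goals simp

/-- The links `L₁` and `L₂` lie on the two sides of a plane, which they meet in the edge `p q`, and
`L` is obtained from them by deleting that edge. -/
structure IsPlaneSum (f : Space →ₗ[ℝ] ℝ) (c : ℝ) (p q : Space) (L₁ L₂ L : PolygonalLink) :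
    Prop where
  ne_zero : f ≠ 0
  left : (p, q) ∈ L₁.edges
  right : (q, p) ∈ L₂.edges
  le : ∀ v ∈ L₁.carrier, f v ≤ c
  ge : ∀ v ∈ L₂.carrier, c ≤ f v
  inter_left : L₁.carrier ∩ {v | f v = c} = segment ℝ p q
  inter_right : L₂.carrier ∩ {v | f v = c} = segment ℝ p q
  edges : L.edges = (L₁.edges \ {(p, q)}) ∪ (L₂.edges \ {(q, p)})

theorem isConnectedSum_iff {K₁ K₂ K : PolygonalLink} : IsConnectedSum K₁ K₂ K ↔
    ∃ L₁ L₂ L : PolygonalLink, Isotopic K₁ L₁ ∧ Isotopic K₂ L₂ ∧ Isotopic K L ∧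
      ∃ f c p q, IsPlaneSum f c p q L₁ L₂ L := by
  constructor
  · rintro ⟨L₁, L₂, L, h₁, h₂, h, f, c, p, q, h3, h4, h5, h6, h7, h8, h9, h10⟩
    exact ⟨L₁, L₂, L, h₁, h₂, h, f, c, p, q, h3, h4, h5, h6, h7, h8, h9, h10⟩
  · rintro ⟨L₁, L₂, L, h₁, h₂, h, f, c, p, q, h3, h4, h5, h6, h7, h8, h9, h10⟩
    exact ⟨L₁, L₂, L, h₁, h₂, h, f, c, p, q, h3, h4, h5, h6, h7, h8, h9, h10⟩

namespace IsPlaneSum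

variable {f : Space →ₗ[ℝ] ℝ} {c : ℝ}

theorem swap (h : IsPlaneSum f c p q L₁ L₂ L) : IsPlaneSum (-f) (-c) q p L₂ L₁ L where
  ne_zero := neg_ne_zero.2 h.ne_zero
  left := h.right
  right := h.left
  le v hv := by simpa using h.ge v hv
  ge v hv := by simpa using h.le v hv
  inter_left := by simpa [segment_symm ℝ q p] using h.inter_right
  inter_right := by simpa [segment_symm ℝ q p] using h.inter_left
  edges := by rw [h.edges, union_comm]

theorem reverse (h : IsPlaneSum f c p q L₁ L₂ L) :
    IsPlaneSum f c q p L₁.reverse L₂.reverse L.reverse where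
  ne_zero := h.ne_zero
  left := mem_reverse_edges.2 h.left
  right := mem_reverse_edges.2 h.right
  le := by simpa [reverse_carrier] using h.le
  ge := by simpa [reverse_carrier] using h.ge
  inter_left := by rw [reverse_carrier, h.inter_left, segment_symm]
  inter_right := by rw [reverse_carrier, h.inter_right, segment_symm]
  edges := by
    ext ⟨a, b⟩
    simp only [mem_reverse_edges, h.edges, mem_union, mem_sdiff, mem_singleton_iff, Prod.mk.injEq]
    tauto

theorem ne (h : IsPlaneSum f c p q L₁ L₂ L) : p ≠ q := L₁.nondegenerate _ h.left

theorem map_left (h : IsPlaneSum f c p q L₁ L₂ L) : f p = c :=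
  (h.inter_left ▸ left_mem_segment ℝ p q : p ∈ L₁.carrier ∩ {v | f v = c}).2

theorem map_right (h : IsPlaneSum f c p q L₁ L₂ L) : f q = c :=
  (h.inter_left ▸ right_mem_segment ℝ p q : q ∈ L₁.carrier ∩ {v | f v = c}).2

/-- An open half-space together with a convex piece of its boundary plane is convex. -/
theorem hull_subset (h : IsPlaneSum f c p q L₁ L₂ L) :
    convexHull ℝ L₂.verts ⊆ {x | c < f x} ∪ segment ℝ p q := by
  have hS : ∀ x ∈ segment ℝ p q, f x = c := fun x hx => (h.inter_left ▸ hx :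
    x ∈ L₁.carrier ∩ {v | f v = c}).2
  refine convexHull_min (fun v hv => ?_) ?_
  · rcases (h.ge v (verts_subset_carrier hv)).lt_or_eq with h1 | h1
    · exact Or.inl h1
    · exact Or.inr (h.inter_right ▸ ⟨verts_subset_carrier hv, h1.symm⟩)
  · rw [convex_iff_openSegment_subset]
    have key : ∀ x y : Space, c < f x → c ≤ f y → ∀ z ∈ openSegment ℝ x y, c < f z := by
      rintro x y hx hy _ ⟨a, b, ha, hb, hab, rfl⟩
      rw [map_add, map_smul, map_smul, smul_eq_mul, smul_eq_mul]
      have h1 := mul_lt_mul_of_pos_left hx ha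
      have h2 := mul_le_mul_of_nonneg_left hy hb.le
      have h3 : a * c + b * c = c := by rw [← add_mul, hab, one_mul]
      linarith
    rintro x (hx | hx) y (hy | hy) z hz
    · exact Or.inl (key x y hx (le_of_lt hy) z hz)
    · exact Or.inl (key x y hx (hS y hy).ge z hz)
    · rw [openSegment_symm] at hz
      exact Or.inl (key y x hy (hS x hx).ge z hz)
    · exact Or.inr ((convex_segment p q).openSegment_subset hx hy hz)

/-- The second summand as a local knot. -/
def localKnot (h : IsPlaneSum f c p q L₁ L₂ L) : LocalKnot where
  link := L₂
  o := p
  u := q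
  mem := h.right
  mem_hull t ht := by
    have hf : f (AffineMap.lineMap p q t) = c := by
      rw [AffineMap.lineMap_apply_module', map_add, map_smul, map_sub, h.map_left, h.map_right]
      simp
    rcases h.hull_subset ht with h1 | h1
    · exact (hf.not_gt h1).elim
    · rw [segment_eq_image_lineMap] at h1
      obtain ⟨s, hs, hst⟩ := h1
      rwa [← AffineMap.lineMap_injective ℝ h.ne hst]

/-- The point `m` lies on the edge arriving at `p`, strictly below the plane, and `r` lies on the
prolongation of `p q` beyond `p`. The triangle thus lies on the side of `L₁` and touches the plane
only along the ray from `p` away from `q`. For small `ε` it is also away from the other edges of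
`L₁`, so it meets the two links only in `m p`. -/
theorem eventually_kink (h : IsPlaneSum f c p q L₁ L₂ L) (hp₀ : (p₀, p) ∈ L₁.edges) {U : Set Space}
    (hU : U ∈ nhds p) : ∀ᶠ ε in nhdsWithin (0 : ℝ) (Ioi 0), ∀ m r : Space,
      m = AffineMap.lineMap p p₀ ε → r = AffineMap.lineMap p q (-ε) →
      m ∈ openSegment ℝ p₀ p ∧ convexHull ℝ {m, p, r} ⊆ U ∧
      (∀ x ∈ convexHull ℝ {m, p, r}, f x ≤ c) ∧
      convexHull ℝ {m, p, r} ∩ (L₁.carrier ∪ L₂.carrier) ⊆ segment ℝ m p ∧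
      m ∉ segment ℝ r p ∧ p ∉ segment ℝ m r := by
  have hne := h.ne
  have hp₀q : (p₀, p) ≠ (p, q) := fun h' =>
    L₁.nondegenerate _ hp₀ (congrArg Prod.fst h')
  have hfp := h.map_left
  have hfq := h.map_right
  have hfp₀ : f p₀ < c := by
    have h0 := left_mem_verts hp₀
    refine lt_of_le_of_ne (h.le _ (verts_subset_carrier h0)) fun h1 => ?_
    have h2 : p₀ ∈ segment ℝ p q := h.inter_left ▸ ⟨verts_subset_carrier h0, h1⟩
    rcases vertex_mem_edge h0 h.left h2 with h3 | h3
    · exact L₁.nondegenerate _ hp₀ h3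
    · simp only at h3; subst h3; exact not_two_gon h.left hp₀
  set K := ⋃ e ∈ L₁.edges \ {(p₀, p), (p, q)}, segment ℝ e.1 e.2 with hK
  have hKc : IsClosed K :=
    (L₁.finite.sdiff.isCompact_biUnion fun e _ => isCompact_segment _ _).isClosed
  have hqK : p ∈ Kᶜ := by
    intro h'
    simp only [hK, mem_iUnion, exists_prop] at h'
    obtain ⟨e, he, hqe⟩ := h'
    simp only [mem_sdiff, mem_insert_iff, mem_singleton_iff, not_or] at he
    rcases vertex_mem_edge (left_mem_verts h.left) he.1 hqe with h1 | h1
    · exact he.2.2 (L₁.source_unique _ he.1 _ h.left h1.symm)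
    · exact he.2.1 (L₁.target_unique _ he.1 _ hp₀ h1.symm)
  obtain ⟨δ, hδ, hball⟩ := Metric.mem_nhds_iff.1
    (Filter.inter_mem hU (hKc.isOpen_compl.mem_nhds hqK))
  have hcont : ∀ (v : Space) (a : ℝ), ∀ᶠ ε in nhdsWithin (0 : ℝ) (Ioi 0),
      AffineMap.lineMap p v (a * ε) ∈ Metric.ball p δ := by
    intro v a
    have : Continuous fun ε : ℝ => (AffineMap.lineMap p v (a * ε) : Space) := by
      simp only [AffineMap.lineMap_apply_module']; fun_prop
    refine (this.continuousAt.eventually_mem ?_).filter_mono nhdsWithin_le_nhds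
    simpa using Metric.ball_mem_nhds p hδ
  filter_upwards [hcont p₀ 1, hcont q (-1), Ioo_mem_nhdsGT (zero_lt_one (α := ℝ))] with ε h1 h2
    hε m r hm hr
  rw [one_mul, ← hm] at h1
  rw [neg_one_mul, ← hr] at h2
  have hTb : convexHull ℝ {m, p, r} ⊆ Metric.ball p δ := convexHull_min (by
      rintro _ (rfl | rfl | rfl)
      exacts [h1, Metric.mem_ball_self hδ, h2]) (convex_ball p δ)
  have hm' : m = ε • (p₀ - p) + p := by rw [hm, AffineMap.lineMap_apply_module']
  have hr' : r = (-ε) • (q - p) + p := by rw [hr, AffineMap.lineMap_apply_module']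
  -- Coordinates in the triangle: `a` measures the descent below the plane, and `b` the distance
  -- travelled away from `q`.
  have hT : ∀ x ∈ convexHull ℝ {m, p, r}, ∃ a b : ℝ, 0 ≤ a ∧ a ≤ 1 ∧ 0 ≤ b ∧
      x = (a * ε) • (p₀ - p) - b • (q - p) + p := by
    intro x hx
    rw [convexHull_triple_eq, mem_ofPred_eq] at hx
    obtain ⟨y, hy, hx⟩ := hx
    rw [segment_eq_image_lineMap] at hy hx
    obtain ⟨s, hs, rfl⟩ := hy
    obtain ⟨t, ht, rfl⟩ := hx
    refine ⟨1 - t, t * s * ε, by linarith [ht.2], by linarith [ht.1],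
      mul_nonneg (mul_nonneg ht.1 hs.1) hε.1.le, ?_⟩
    simp only [AffineMap.lineMap_apply_module', hm', hr']
    module
  have hfx : ∀ (a b : ℝ), f ((a * ε) • (p₀ - p) - b • (q - p) + p) = a * (ε * (f p₀ - c)) + c := by
    intro a b
    simp only [map_add, map_sub, map_smul, smul_eq_mul, hfp, hfq]
    ring
  have hneg : ε * (f p₀ - c) < 0 := mul_neg_of_pos_of_neg hε.1 (by linarith)
  have hpq : ∀ x ∈ convexHull ℝ {m, p, r}, x ∈ segment ℝ p q → x = p := by
    intro x hx hxs
    obtain ⟨a, b, ha, ha', hb, rfl⟩ := hT x hx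
    have h3 := (h.inter_left ▸ hxs : _ ∈ L₁.carrier ∩ {v | f v = c}).2
    rw [mem_ofPred_eq, hfx] at h3
    have ha0 : a = 0 := (mul_eq_zero.1 (by linarith : a * (ε * (f p₀ - c)) = 0)).resolve_right hneg.ne
    subst ha0
    rw [segment_eq_image_lineMap] at hxs
    obtain ⟨k, hk, hkx⟩ := hxs
    rw [AffineMap.lineMap_apply_module', add_left_inj] at hkx
    have h4 : (k + b) • (q - p) = 0 := by rw [add_smul, hkx]; module
    have h5 := (smul_eq_zero.1 h4).resolve_right (sub_ne_zero.2 hne.symm)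
    have h6 : b = 0 := by linarith [hk.1]
    rw [h6]; module
  refine ⟨?_, hTb.trans (hball.trans inter_subset_left), ?_, ?_, ?_, ?_⟩
  · rw [openSegment_symm, hm]; exact lineMap_mem_openSegment hε.1 hε.2
  · intro x hx
    obtain ⟨a, b, ha, ha', hb, rfl⟩ := hT x hx
    rw [hfx]
    nlinarith
  · rintro x ⟨hx, hx' | hx'⟩
    · obtain ⟨e, he, hxe⟩ := mem_carrier.1 hx'
      by_cases h3 : e = (p, q)
      · subst h3
        rw [hpq x hx hxe]; exact right_mem_segment ℝ _ _
      by_cases h4 : e = (p₀, p)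
      · subst h4
        obtain ⟨a, b, ha, ha', hb, hxab⟩ := hT x hx
        simp only at hxe
        rw [segment_symm, segment_eq_image_lineMap] at hxe
        obtain ⟨k, hk, hkx⟩ := hxe
        have h5 := congrArg f hxab
        rw [hfx, ← hkx, AffineMap.lineMap_apply_module', map_add, map_smul, map_sub, hfp,
          smul_eq_mul] at h5
        have h6 : k = a * ε := by
          have : (k - a * ε) * (f p₀ - c) = 0 := by linarith
          have := (mul_eq_zero.1 this).resolve_right (by linarith)
          linarith
        rw [segment_symm, segment_eq_image_lineMap]
        refine ⟨a, ⟨ha, ha'⟩, ?_⟩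
        rw [hm, AffineMap.lineMap_lineMap_right, ← h6, hkx]
      · refine ((hball (hTb hx)).2 ?_).elim
        simp only [hK, mem_iUnion, exists_prop]
        exact ⟨e, ⟨he, by simp [h3, h4]⟩, hxe⟩
    · have h3 := h.ge x hx'
      obtain ⟨a, b, ha, ha', hb, hxab⟩ := hT x hx
      have h4 : f x = c := by
        refine le_antisymm ?_ h3
        rw [hxab, hfx]; nlinarith
      rw [hpq x hx (h.inter_right ▸ ⟨hx', h4⟩)]
      exact right_mem_segment ℝ _ _
  · intro h3
    have h4 : f m = c := by
      have : segment ℝ r p ⊆ {x | f x = c} := by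
        refine (convex_hyperplane f.isLinear c).segment_subset ?_ hfp
        change f r = c
        rw [hr', map_add, map_smul, map_sub, hfp, hfq]; simp
      exact this h3
    rw [hm', map_add, map_smul, map_sub, hfp, smul_eq_mul] at h4
    linarith
  · rw [segment_eq_image_lineMap]
    rintro ⟨s, hs, h3⟩
    have h4 : (0 : Space) = ((1 - s) * ε) • (p₀ - p) - (s * ε) • (q - p) := by
      rw [← sub_eq_zero.2 h3, AffineMap.lineMap_apply_module', hm', hr']; module
    have h5 := congrArg f h4
    simp only [map_sub, map_zero, map_smul, smul_eq_mul, hfp, hfq, sub_self, mul_zero,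
      sub_zero] at h5
    have h6 : (1 - s) * (ε * (f p₀ - c)) = 0 := by linarith
    have h7 : s = 1 := by linarith [(mul_eq_zero.1 h6).resolve_right hneg.ne]
    subst h7
    rw [sub_self, zero_mul, zero_smul, zero_sub, eq_comm, neg_eq_zero, one_mul] at h4
    exact smul_ne_zero hε.1.ne' (sub_ne_zero.2 hne.symm) h4

end IsPlaneSum

end PolygonalLink

end

section

open Set Matrix

/-! ### Connected sums are well defined -/

namespace PolygonalLink

variable {L L' L'' L₁ L₂ L₁' L₂' K₁ K₂ A Z G : PolygonalLink} {p q a b : Space} {f : Space →ₗ[ℝ] ℝ}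
  {c : ℝ}

namespace IsPlaneSum

/-- A plane sum in which the edge `p q` is prolonged in both directions is an insertion. -/
theorem isInsertion_of_prolonged (h : IsPlaneSum f c p q L₁ L₂ L) (hap : (a, p) ∈ A.edges)
    (hpq : (p, q) ∈ A.edges) (hqb : (q, b) ∈ A.edges) (hA : ∀ x ∈ A.carrier, f x ≤ c)
    (hG : G.edges = (A.edges \ {(p, q)}) ∪ (L₂.edges \ {(q, p)}))
    {s t : ℝ} (hs : 0 < s) (hst : s < t) (ht : t < 1) (hp : p = AffineMap.lineMap a b s)
    (hq : q = AffineMap.lineMap a b t) :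
    ∃ A', Isotopic A A' ∧ h.localKnot.IsInsertion A' a b G := by
  have hpaq : p ∈ openSegment ℝ a q := by
    have : p = AffineMap.lineMap a q (s / t) := by
      rw [hq, AffineMap.lineMap_lineMap_right, div_mul_cancel₀ _ (hs.trans hst).ne', hp]
    rw [this]
    exact lineMap_mem_openSegment (div_pos hs (hs.trans hst)) ((div_lt_one (hs.trans hst)).2 hst)
  have hqab : q ∈ openSegment ℝ a b := hq ▸ lineMap_mem_openSegment (hs.trans hst) ht
  have hpab : p ∈ openSegment ℝ a b := hp ▸ lineMap_mem_openSegment hs (hst.trans ht)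
  obtain ⟨A₁, hA₁, hi₁⟩ := exists_merge hap hpq hpaq
  have hne := h.ne
  have hqbne : (q, b) ≠ (a, p) ∧ (q, b) ≠ (p, q) := by
    refine ⟨fun h1 => ?_, fun h1 => hne (congrArg Prod.fst h1).symm⟩
    have h2 : q = a := congrArg Prod.fst h1
    subst h2
    exact not_two_gon hap hpq
  obtain ⟨A₂, hA₂, hi₂⟩ := exists_merge (X := A₁) (p := a) (r := q) (q := b) (by simp [hA₁])
    (by rw [hA₁]; exact Or.inl ⟨hqb, by simpa using hqbne⟩) hqab
  have hapA : ∀ w, (a, w) ∈ A.edges → w = p := fun w hw =>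
    congrArg Prod.snd (A.source_unique _ hw _ hap rfl)
  have haq : (a, q) ∉ A.edges := fun h1 => hne (hapA _ h1).symm
  have hab : (a, b) ∉ A.edges := fun h1 => by
    have := hapA _ h1
    subst this
    exact not_two_gon hpq hqb
  have habA : (a, b) ∈ A₂.edges := by simp [hA₂]
  have haqb : (a, q) ≠ (q, b) := fun h1 => by
    have h2 : q = b := congrArg Prod.snd h1
    exact A.nondegenerate _ hqb h2
  have hdiff : A₂.edges \ {(a, b)} = A.edges \ {(a, p), (p, q), (q, b)} := by
    rw [hA₂, hA₁]
    ext e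
    simp only [mem_sdiff, mem_union, mem_insert_iff, mem_singleton_iff]
    have h1 : e ∈ A.edges → e ≠ (a, q) := by rintro h1 rfl; exact haq h1
    have h2 : e ∈ A.edges → e ≠ (a, b) := by rintro h1 rfl; exact hab h1
    tauto
  -- The second summand is already in position, so the placement is the identity with base point
  -- `p`; only the three collinear edges have to be merged into `a b`.
  have hpl : ∀ x, h.localKnot.place p 1 x = x := fun x => by
    rw [LocalKnot.place_apply, one_mulVec]; exact add_sub_cancel p x
  have hplu : h.localKnot.place p 1 h.localKnot.u = q := hpl _
  refine ⟨A₂, (hi₁.isotopic.symm.trans hi₂.isotopic.symm), p, 1, ⟨habA, by simp, ⟨s, t, hs, hst, ht,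
    hp, hplu.trans hq⟩, ?_⟩, ?_⟩
  · have hcar : ∀ x ∈ A₂.carrier, f x ≤ c := by
      intro x hx
      obtain ⟨e, he, hx⟩ := mem_carrier.1 hx
      by_cases h1 : e = (a, b)
      · subst h1
        have : segment ℝ a b ⊆ {x | f x ≤ c} :=
          (convex_halfSpace_le f.isLinear c).segment_subset
            (hA _ (verts_subset_carrier (left_mem_verts hap)))
            (hA _ (verts_subset_carrier (right_mem_verts hqb)))
        exact this hx
      · have h2 : e ∈ A₂.edges \ {(a, b)} := ⟨he, h1⟩
        rw [hdiff] at h2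
        exact hA _ (segment_subset_carrier h2.1 hx)
    rintro _ ⟨hx, y, hy, rfl⟩
    rw [hpl] at hx ⊢
    rcases h.hull_subset hy with h1 | h1
    · exact ((hcar _ hx).not_gt h1).elim
    · exact (convex_segment a b).segment_subset (openSegment_subset_segment _ _ _ hpab)
        (openSegment_subset_segment _ _ _ hqab) h1
  · have hmap : Prod.map (h.localKnot.place p 1) (h.localKnot.place p 1) '' (L₂.edges \ {(q, p)}) =
        L₂.edges \ {(q, p)} := by
      refine (image_congr fun e _ => ?_).trans (image_id _)
      exact Prod.ext (hpl _) (hpl _)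
    rw [LocalKnot.insEdges, hplu, hdiff]
    change _ = _ ∪ Prod.map (h.localKnot.place p 1) (h.localKnot.place p 1) '' (L₂.edges \ {(q, p)})
    rw [hmap, hG]
    congr 1
    have h1 : (a, p) ≠ (p, q) := fun h1 => A.nondegenerate _ hap (congrArg Prod.fst h1)
    ext e
    simp only [mem_sdiff, mem_union, mem_insert_iff, mem_singleton_iff]
    by_cases h2 : e = (a, p)
    · subst h2; simp [hap, h1]
    by_cases h3 : e = (q, b)
    · subst h3; simp [hqb, hqbne.2]
    tauto

set_option maxHeartbeats 800000 in
-- The same detours near `p` and near `q` are made in `L₁` and in the sum. After them the neighbours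
-- of `p q` are collinear with it, as required by `isInsertion_of_prolonged`. The detour at `q`
-- comes from the one at `p` by reversing orientations.
theorem exists_isInsertion (h : IsPlaneSum f c p q L₁ L₂ L) :
    ∃ A G, Isotopic L₁ A ∧ Isotopic L G ∧ ∃ a b, h.localKnot.IsInsertion A a b G := by
  have hne := h.ne
  obtain ⟨p₀, hp₀⟩ := exists_pred (left_mem_verts h.left)
  obtain ⟨q₀, hq₀⟩ := exists_succ (right_mem_verts h.left)
  simp only at hp₀ hq₀
  obtain ⟨U, V, hU, hV, hpU, hqV, hUV⟩ := t2_separation hne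
  obtain ⟨ε, ⟨h1, h2⟩, hε : 0 < ε⟩ := (((h.eventually_kink hp₀ (hU.mem_nhds hpU)).and
    (h.reverse.eventually_kink (mem_reverse_edges.2 hq₀) (hV.mem_nhds hqV))).and
    self_mem_nhdsWithin).exists
  obtain ⟨hm, hTU, hTc, hTC, hn₁, hn₂⟩ := h1 _ _ rfl rfl
  obtain ⟨hm', hTU', hTc', hTC', hn₁', hn₂'⟩ := h2 _ _ rfl rfl
  rw [reverse_carrier, reverse_carrier] at hTC'
  set m : Space := AffineMap.lineMap p p₀ ε
  set m' : Space := AffineMap.lineMap q q₀ ε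
  set r : Space := AffineMap.lineMap p q (-ε) with hr
  set r' : Space := AffineMap.lineMap q p (-ε) with hr'
  have hd := hUV.mono hTU hTU'
  have hpq1 : (p₀, p) ≠ (q, q₀) := fun h1 => by
    have h2 : p₀ = q := congrArg Prod.fst h1
    subst h2; exact not_two_gon h.left hp₀
  have hk1 : (p₀, p) ≠ (p, q) := fun h1 => L₁.nondegenerate _ hp₀ (congrArg Prod.fst h1)
  have hk2 : (q, q₀) ≠ (p, q) := fun h1 => hne (congrArg Prod.fst h1).symm
  have hLp : (p₀, p) ∈ L.edges := by rw [h.edges]; exact Or.inl ⟨hp₀, hk1⟩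
  have hLq : (q, q₀) ∈ L.edges := by rw [h.edges]; exact Or.inl ⟨hq₀, hk2⟩
  have hLC : L.carrier ⊆ L₁.carrier ∪ L₂.carrier := by
    intro x hx
    obtain ⟨e, he, hx⟩ := mem_carrier.1 hx
    rw [h.edges] at he
    rcases he with he | he
    exacts [Or.inl (segment_subset_carrier he.1 hx), Or.inr (segment_subset_carrier he.1 hx)]
  obtain ⟨A, hA, hiA, hcA⟩ := exists_two_kinks hp₀ hq₀ hpq1 subset_union_left hm hTC hn₁ hn₂ hm'
    hTC' hn₁' hn₂' hd
  obtain ⟨G, hG, hiG, -⟩ := exists_two_kinks hLp hLq hpq1 hLC hm hTC hn₁ hn₂ hm'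
    hTC' hn₁' hn₂' hd
  have hrT : r ∈ convexHull ℝ {m, p, r} := subset_convexHull ℝ _ (by simp)
  have hrT' : r' ∈ convexHull ℝ {m', q, r'} := subset_convexHull ℝ _ (by simp)
  have hpT : p ∈ convexHull ℝ {m, p, r} := subset_convexHull ℝ _ (by simp)
  have hqT : q ∈ convexHull ℝ {m', q, r'} := subset_convexHull ℝ _ (by simp)
  have hmv := not_mem_verts_of_openSegment hp₀ hm
  have hrL : ∀ w, (w, p) ∈ L₂.edges → w = q := fun w hw =>
    congrArg Prod.fst (L₂.target_unique _ hw _ h.right rfl)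
  have hqL : ∀ w, (q, w) ∈ L₂.edges → w = p := fun w hw =>
    congrArg Prod.snd (L₂.source_unique _ hw _ h.right rfl)
  obtain ⟨A', hA', hins⟩ := h.isInsertion_of_prolonged (A := A) (G := G) (a := r) (b := r')
    -- The prolonged edge extends `p q` by the fraction `ε` at either end, so its total length is `1
    -- + 2 * ε` times that of `p q`.
    (s := ε / (1 + 2 * ε)) (t := (1 + ε) / (1 + 2 * ε))
    (by simp [hA]) (by rw [hA]; exact Or.inl ⟨h.left, by simp [hk1.symm, hk2.symm]⟩) (by simp [hA])
    (fun x hx => by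
      rcases hcA hx with (hx | hx) | hx
      exacts [h.le x hx, hTc x hx, hTc' x hx])
    (by
      rw [hG, hA, h.edges]
      have k1 : (p, q) ≠ (p₀, m) := fun h1 =>
        hmv ((show q = m from congrArg Prod.snd h1) ▸ right_mem_verts h.left)
      have k2 : (p, q) ≠ (m, r) := fun h1 =>
        hmv ((show p = m from congrArg Prod.fst h1) ▸ left_mem_verts h.left)
      have k3 : (p, q) ≠ (r, p) := fun h1 => hne (congrArg Prod.snd h1).symm
      have k4 : (p, q) ≠ (q, r') := fun h1 => hne (congrArg Prod.fst h1)
      have k5 : (p, q) ≠ (r', m') := fun h1 => Set.disjoint_left.1 hd hpT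
        ((show p = r' from congrArg Prod.fst h1) ▸ hrT')
      have k6 : (p, q) ≠ (m', q₀) := fun h1 => not_mem_verts_of_openSegment
        (L := L₁.reverse) (mem_reverse_edges.2 hq₀) hm' ((show p = m' from congrArg Prod.fst h1) ▸
        left_mem_verts (e := (p, p₀)) (mem_reverse_edges.2 hp₀))
      have k7 : ∀ e ∈ L₂.edges, e ≠ (q, p) → e ∉ ({(p₀, p), (q, q₀)} : Set (Space × Space)) := by
        rintro e h1 h2 (rfl | rfl)
        exacts [h2 (by rw [hrL _ h1]), h2 (by rw [hqL _ h1])]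
      have k8 : (p, q) ∉ ({(p₀, m), (m, r), (r, p), (q, r'), (r', m'), (m', q₀)} :
          Set (Space × Space)) := by
        rintro (h1 | h1 | h1 | h1 | h1 | h1)
        exacts [k1 h1, k2 h1, k3 h1, k4 h1, k5 h1, k6 h1]
      generalize ({(p₀, m), (m, r), (r, p), (q, r'), (r', m'), (m', q₀)} :
          Set (Space × Space)) = S at k8
      generalize ({(p₀, p), (q, q₀)} : Set (Space × Space)) = R at k7
      ext e
      have k9 := k7 e
      have k10 : e ∈ S → e ≠ (p, q) := fun h1 h2 => k8 (h2 ▸ h1)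
      simp only [mem_sdiff, mem_union, mem_singleton_iff]
      clear k1 k2 k3 k4 k5 k6 k7 k8
      tauto)
    (by positivity) (by rw [div_lt_div_iff_of_pos_right (by positivity)]; linarith)
    (by rw [div_lt_one (by positivity)]; linarith) (by
      rw [hr, hr', AffineMap.lineMap_apply_module', AffineMap.lineMap_apply_module',
        AffineMap.lineMap_apply_module', ← sub_eq_zero]
      have h5 : ε - (ε / (1 + 2 * ε)) * (1 + 2 * ε) = 0 := by field_simp; ring
      rw [← zero_smul ℝ (q - p), ← h5]; module) (by
      rw [hr, hr', AffineMap.lineMap_apply_module', AffineMap.lineMap_apply_module',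
        AffineMap.lineMap_apply_module', ← sub_eq_zero]
      have h5 : 1 + ε - ((1 + ε) / (1 + 2 * ε)) * (1 + 2 * ε) = 0 := by field_simp; ring
      rw [← zero_smul ℝ (q - p), ← h5]; module)
  exact ⟨A', G, hiA.trans hA', hiG, r, r', hins⟩

/-- Placing an affine image by `M` is the same as placing the original by `M * Φ`. -/
theorem isInsertion_of_map {φ : Space → Space} {Φ : Matrix (Fin 3) (Fin 3) ℝ}
    {N N' : LocalKnot} (hΦ : 0 < Φ.det) (hφ : ∀ x, φ x = φ N.o + Φ *ᵥ (x - N.o))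
    (hE : N'.link.edges = Prod.map φ φ '' N.link.edges) (ho : N'.o = φ N.o) (hu : N'.u = φ N.u)
    (h : N'.IsInsertion L a b G) : N.IsInsertion L a b G := by
  obtain ⟨c, M, hM, hG⟩ := h
  have hpl : ∀ x, N'.place c M (φ x) = N.place c (M * Φ) x := fun x => by
    rw [LocalKnot.place_apply, LocalKnot.place_apply, ho, hφ x, add_sub_cancel_left,
      mulVec_mulVec]
  have hinj : Function.Injective φ := fun x y hxy => by
    rw [hφ x, hφ y, add_right_inj, ← sub_eq_zero, ← mulVec_sub] at hxy
    have := Matrix.eq_zero_of_mulVec_eq_zero hΦ.ne' hxy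
    simpa [sub_eq_zero] using this
  have hverts : N'.link.verts = φ '' N.link.verts := by
    rw [verts, verts, hE, image_image, image_image]; rfl
  have hhull : N'.place c M '' N'.hull = N.place c (M * Φ) '' N.hull := by
    rw [LocalKnot.hull, LocalKnot.hull, AffineMap.image_convexHull, AffineMap.image_convexHull,
      hverts, image_image]
    simp only [hpl]
  have hplu : N'.place c M N'.u = N.place c (M * Φ) N.u := by rw [hu, hpl]
  refine ⟨c, M * Φ, ⟨hM.edge, by rw [det_mul]; exact mul_pos hM.det hΦ, ?_, ?_⟩, ?_⟩
  · rw [← hplu]; exact hM.pos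
  · rw [← hhull]; exact hM.inter
  · rw [hG, LocalKnot.insEdges, LocalKnot.insEdges, hplu]
    congr 1
    rw [hE, hu, ho, show ({(φ N.u, φ N.o)} : Set (Space × Space)) =
      Prod.map φ φ '' {(N.u, N.o)} by simp, ← image_sdiff (hinj.prodMap hinj), image_image]
    refine image_congr fun e _ => ?_
    simp only [Prod.map_apply', hpl]

/-- Both sums are insertions of the same local knot, up to an affine map of positive determinant,
into links isotopic to the knot `K₁`. -/
theorem isotopic_of_map {f' : Space →ₗ[ℝ] ℝ} {c' : ℝ} {p' q' : Space} {φ : Space → Space}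
    {Φ : Matrix (Fin 3) (Fin 3) ℝ} (h : IsPlaneSum f c p q L₁ L₂ L)
    (h' : IsPlaneSum f' c' p' q' L₁' L₂' L') (hK : K₁.IsKnot) (h₁ : Isotopic L₁ K₁)
    (h₁' : Isotopic L₁' K₁) (hΦ : 0 < Φ.det) (hφ : ∀ x, φ x = φ p + Φ *ᵥ (x - p))
    (hE : L₂'.edges = Prod.map φ φ '' L₂.edges) (hp : p' = φ p) (hq : q' = φ q) :
    Isotopic L L' := by
  obtain ⟨A, G, hA, hG, a, b, hi⟩ := h.exists_isInsertion
  obtain ⟨A', G', hA', hG', a', b', hi'⟩ := h'.exists_isInsertion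
  have hi'' : h.localKnot.IsInsertion A' a' b' G' :=
    isInsertion_of_map hΦ hφ hE hp hq hi'
  exact hG.trans ((hi.isotopic_of_isKnot hK (hA.symm.trans h₁) (hA'.symm.trans h₁') hi'').trans
    hG'.symm)

theorem exists_frame {f : Space →ₗ[ℝ] ℝ} (hf : f ≠ 0) {v : Space} (hv : v ≠ 0) (hfv : f v = 0) :
    ∃ B : Matrix (Fin 3) (Fin 3) ℝ, 0 < B.det ∧ B *ᵥ ![1, 0, 0] = v ∧ ∀ x, f (B *ᵥ x) = x 2 := by
  obtain ⟨k, hk⟩ : ∃ k : Space, ∀ x, f x = k 0 * x 0 + k 1 * x 1 + k 2 * x 2 := by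
    refine ⟨fun i => f (Pi.single i 1), fun x => ?_⟩
    have : x = ∑ i, x i • (Pi.single i 1 : Space) := by
      ext j; simp [Finset.sum_apply, Pi.single_apply]
    conv_lhs => rw [this]
    rw [map_sum, Fin.sum_univ_three]
    simp only [map_smul, smul_eq_mul]
    ring
  have hk0 : 0 < k 0 ^ 2 + k 1 ^ 2 + k 2 ^ 2 := by
    by_contra hneg
    refine hf (LinearMap.ext fun x => ?_)
    have h0 : k 0 = 0 := by nlinarith [sq_nonneg (k 0), sq_nonneg (k 1), sq_nonneg (k 2)]
    have h1 : k 1 = 0 := by nlinarith [sq_nonneg (k 0), sq_nonneg (k 1), sq_nonneg (k 2)]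
    have h2 : k 2 = 0 := by nlinarith [sq_nonneg (k 0), sq_nonneg (k 1), sq_nonneg (k 2)]
    rw [hk, h0, h1, h2]; simp
  have hv0 : 0 < v 0 ^ 2 + v 1 ^ 2 + v 2 ^ 2 := by
    by_contra hneg
    have h0 : v 0 = 0 := by nlinarith [sq_nonneg (v 0), sq_nonneg (v 1), sq_nonneg (v 2)]
    have h1 : v 1 = 0 := by nlinarith [sq_nonneg (v 0), sq_nonneg (v 1), sq_nonneg (v 2)]
    have h2 : v 2 = 0 := by nlinarith [sq_nonneg (v 0), sq_nonneg (v 1), sq_nonneg (v 2)]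
    exact hv (funext fun i => by fin_cases i <;> assumption)
  set n := k 0 ^ 2 + k 1 ^ 2 + k 2 ^ 2 with hn
  rw [hk] at hfv
  -- With `k` the vector representing `f`, the columns are `v`, the cross product of `k` and `v`,
  -- and `k` divided by its squared length. Since `v` is orthogonal to `k`, the determinant is the
  -- squared length of `v`.
  refine ⟨!![v 0, k 1 * v 2 - k 2 * v 1, k 0 / n; v 1, k 2 * v 0 - k 0 * v 2, k 1 / n;
    v 2, k 0 * v 1 - k 1 * v 0, k 2 / n], ?_, ?_, ?_⟩
  · have : (!![v 0, k 1 * v 2 - k 2 * v 1, k 0 / n; v 1, k 2 * v 0 - k 0 * v 2, k 1 / n;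
        v 2, k 0 * v 1 - k 1 * v 0, k 2 / n]).det = v 0 ^ 2 + v 1 ^ 2 + v 2 ^ 2 := by
      rw [det_fin_three]
      simp only [of_apply, cons_val]
      field_simp
      rw [hn]
      linear_combination (-(k 0 * v 0 + k 1 * v 1 + k 2 * v 2)) * hfv
    rw [this]; exact hv0
  · ext i; fin_cases i <;> simp [mulVec, dotProduct, Fin.sum_univ_three]
  · intro x
    rw [hk]
    simp only [mulVec, dotProduct, Fin.sum_univ_three, of_apply, cons_val]
    have e1 : k 0 * (k 0 / n) + k 1 * (k 1 / n) + k 2 * (k 2 / n) = 1 := by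
      field_simp; rw [hn]
    linear_combination (x 0) * hfv + (x 2) * e1

/-- A path of matrices of positive determinant from the identity, combined with a growing
translation, is a family of injective affine maps. -/
theorem isotopic_of_affine {φ : Space → Space} {Φ : Matrix (Fin 3) (Fin 3) ℝ} (hΦ : 0 < Φ.det)
    {w : Space} (hφ : ∀ x, φ x = Φ *ᵥ x + w) (hE : L'.edges = Prod.map φ φ '' L.edges) :
    Isotopic L L' := by
  have hj := joinedIn_det_pos hΦ
  set γ := hj.somePath.extend with hγ
  have hmem : ∀ t ∈ Icc (0 : ℝ) 1, 0 < (γ t).det := by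
    intro t ht
    have := hj.somePath_mem ⟨t, ht⟩
    rwa [← Path.extend_apply _ ht] at this
  have hγc : Continuous γ := hj.somePath.continuous_extend
  have h0 : γ 0 = 1 := by simp [hγ]
  have h1 : γ 1 = Φ := by simp [hγ]
  refine isotopic_of_injective_family (g := fun t x => γ t *ᵥ x + t • w) (fun v _ => by fun_prop)
    ?_ ?_ ?_ ?_
  · intro t ht x _ y _ hxy
    simp only [add_left_inj] at hxy
    rw [← sub_eq_zero, ← mulVec_sub] at hxy
    have := Matrix.eq_zero_of_mulVec_eq_zero (hmem t ht).ne' hxy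
    simpa [sub_eq_zero] using this
  · intro t _ e _
    exact image_segment ℝ ((γ t).mulVecLin.toAffineMap + AffineMap.const ℝ Space (t • w)) e.1 e.2
  · intro v _; simp [h0]
  · rw [hE]
    have : φ = fun x => γ 1 *ᵥ x + (1 : ℝ) • w := funext fun x => by rw [hφ, h1, one_smul]
    rw [this]

/-- The second summand can be replaced by an affine copy placed on the other side of a given
plane. -/
theorem exists_map (h : IsPlaneSum f c p q L₁ L₂ L) {f' : Space →ₗ[ℝ] ℝ} {c' : ℝ} {p' q' : Space}
    (h' : IsPlaneSum f' c' p' q' L₁' L₂' L') :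
    ∃ (φ : Space → Space) (Φ : Matrix (Fin 3) (Fin 3) ℝ) (M₂ L'' : PolygonalLink), 0 < Φ.det ∧
      (∀ x, φ x = φ p + Φ *ᵥ (x - p)) ∧ M₂.edges = Prod.map φ φ '' L₂.edges ∧ p' = φ p ∧
      q' = φ q ∧ Isotopic L₂ M₂ ∧ IsPlaneSum f' c' p' q' L₁' M₂ L'' := by
  obtain ⟨B, hB, hBv, hBf⟩ := exists_frame h.ne_zero (sub_ne_zero.2 h.ne.symm)
    (by rw [map_sub, h.map_left, h.map_right, sub_self])
  obtain ⟨B', hB', hBv', hBf'⟩ := exists_frame h'.ne_zero (sub_ne_zero.2 h'.ne.symm)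
    (by rw [map_sub, h'.map_left, h'.map_right, sub_self])
  have hBu : IsUnit B.det := hB.ne'.isUnit
  -- The frame adapted to the first plane is sent to the one adapted to the second: the common edges
  -- correspond, and so do the two sides of the planes.
  set Φ := B' * B⁻¹ with hΦd
  have hΦ : 0 < Φ.det := by
    have h1 : B.det * B⁻¹.det = 1 := by rw [← det_mul, mul_nonsing_inv _ hBu, det_one]
    rw [hΦd, det_mul]
    exact mul_pos hB' (pos_of_mul_pos_right (h1 ▸ one_pos) hB.le)
  have hΦv : Φ *ᵥ (q - p) = q' - p' := by
    rw [← hBv, ← hBv', hΦd, mulVec_mulVec, Matrix.mul_assoc, nonsing_inv_mul _ hBu, Matrix.mul_one]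
  have hΦf : ∀ x, f' (Φ *ᵥ x) = f x := by
    intro x
    rw [hΦd, ← mulVec_mulVec, hBf', ← hBf (B⁻¹ *ᵥ x), mulVec_mulVec, mul_nonsing_inv _ hBu, one_mulVec]
  set φ : Space → Space := fun x => p' + Φ *ᵥ (x - p) with hφ
  have hφp : φ p = p' := by simp [hφ]
  have hφq : φ q = q' := by simp [hφ, hΦv]
  have hinj : Function.Injective φ := fun x y hxy => by
    simp only [hφ, add_right_inj] at hxy
    rw [← sub_eq_zero, ← mulVec_sub] at hxy
    have := Matrix.eq_zero_of_mulVec_eq_zero hΦ.ne' hxy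
    simpa [sub_eq_zero] using this
  have hφw : ∀ x, φ x = Φ *ᵥ x + (p' - Φ *ᵥ p) := fun x => by
    simp only [hφ, mulVec_sub]; abel
  have hseg : ∀ a b, φ '' segment ℝ a b = segment ℝ (φ a) (φ b) := by
    intro a b
    have : φ = (Φ.mulVecLin.toAffineMap + AffineMap.const ℝ Space (p' - Φ *ᵥ p) :
      Space →ᵃ[ℝ] Space) := funext hφw
    rw [this]
    exact image_segment ℝ _ a b
  have hfφ : ∀ x, f' (φ x) = c' + (f x - c) := fun x => by
    simp only [hφ, map_add, hΦf, map_sub, h.map_left, h'.map_left]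
  obtain ⟨M₂, hM₂, hM₂c⟩ := PolygonalLink.exists_map L₂ φ hinj.injOn fun e _ => hseg _ _
  have hge : ∀ v ∈ M₂.carrier, c' ≤ f' v := by
    rw [hM₂c]
    rintro _ ⟨v, hv, rfl⟩
    rw [hfφ]
    linarith [h.ge v hv]
  have hright : M₂.carrier ∩ {v | f' v = c'} = segment ℝ p' q' := by
    rw [hM₂c, ← hφp, ← hφq, ← hseg, ← h.inter_right]
    ext x
    constructor
    · rintro ⟨⟨v, hv, rfl⟩, hx⟩
      rw [mem_ofPred_eq, hfφ] at hx
      exact ⟨v, ⟨hv, by rw [mem_ofPred_eq]; linarith⟩, rfl⟩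
    · rintro ⟨v, ⟨hv, hv'⟩, rfl⟩
      rw [mem_ofPred_eq] at hv'
      exact ⟨⟨v, hv, rfl⟩, by rw [mem_ofPred_eq, hfφ, hv']; ring⟩
  have hqpM : (q', p') ∈ M₂.edges := by
    rw [hM₂]; exact ⟨_, h.right, by simp [hφp, hφq]⟩
  obtain ⟨L'', hL''⟩ := exists_glue h'.left hqpM (by
    rintro x ⟨hx, hx'⟩
    rw [← hright]
    exact ⟨hx', le_antisymm (h'.le x hx) (hge x hx')⟩)
  exact ⟨φ, Φ, M₂, L'', hΦ, fun x => by rw [hφp], hM₂, hφp.symm, hφq.symm,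
    isotopic_of_affine hΦ hφw hM₂, h'.ne_zero, h'.left, hqpM, h'.le, hge, h'.inter_left, hright,
    hL''⟩

/-- The hybrid sum `L''` joins `L₁'` with an affine copy of `L₂`. Against `L` it has the same local
knot and another host; against `L'`, with the summands interchanged, the local knot is literally the
same `L₁'` and the hosts are both isotopic to `K₂`. -/
theorem isotopic {f' : Space →ₗ[ℝ] ℝ} {c' : ℝ} {p' q' : Space}
    (h : IsPlaneSum f c p q L₁ L₂ L) (h' : IsPlaneSum f' c' p' q' L₁' L₂' L') (hK₁ : K₁.IsKnot)
    (hK₂ : K₂.IsKnot) (h₁ : Isotopic K₁ L₁) (h₂ : Isotopic K₂ L₂) (h₁' : Isotopic K₁ L₁')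
    (h₂' : Isotopic K₂ L₂') : Isotopic L L' := by
  obtain ⟨φ, Φ, M₂, L'', hΦ, hφ, hM₂, hp, hq, hi, hs⟩ := h.exists_map h'
  have k1 : Isotopic L L'' := h.isotopic_of_map hs hK₁ h₁.symm h₁'.symm hΦ hφ hM₂ hp hq
  have k2 : Isotopic L'' L' := hs.swap.isotopic_of_map h'.swap hK₂ (h₂.trans hi).symm h₂'.symm
    (Φ := 1) (φ := id) (by simp) (fun x => by simp) (by simp) rfl rfl
  exact k1.trans k2

end IsPlaneSum

/-- The connected sum of two knots is well defined up to isotopy. -/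
theorem IsConnectedSum.isotopic (hK₁ : K₁.IsKnot) (hK₂ : K₂.IsKnot)
    (h : IsConnectedSum K₁ K₂ L) (h' : IsConnectedSum K₁ K₂ L') : Isotopic L L' := by
  rw [isConnectedSum_iff] at h h'
  obtain ⟨L₁, L₂, G, h₁, h₂, hG, f, c, p, q, hs⟩ := h
  obtain ⟨L₁', L₂', G', h₁', h₂', hG', f', c', p', q', hs'⟩ := h'
  exact hG.trans ((hs.isotopic hs' hK₁ hK₂ h₁ h₂ h₁' h₂').trans hG'.symm)

end PolygonalLink

end

section

open Set

/-! ### Cutting a link along a plane, and shortening trivial strands -/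

namespace PolygonalLink

variable {L L' C R : PolygonalLink} {p q a b a' b' : Space} {f : Space →ₗ[ℝ] ℝ} {c : ℝ}

theorem eq_of_mem_segment_of_le {g : Space →ₗ[ℝ] ℝ} {x y v : Space} (hx : g x ≤ c) (hy : g y ≤ c)
    (hv : v ∈ segment ℝ x y) (hgv : g v = c) :
    (v = x ∨ v = y) ∨ g x = c ∧ g y = c := by
  obtain ⟨s, t, hs, ht, hst, rfl⟩ := hv
  obtain rfl : s = 1 - t := by linarith
  rw [map_add, map_smul, map_smul, smul_eq_mul, smul_eq_mul] at hgv
  rcases hs.eq_or_lt with h | h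
  · left; right; rw [← h, show t = 1 by linarith]; simp
  rcases ht.eq_or_lt with h' | h'
  · left; left; rw [← h']; simp
  · right
    constructor
    · nlinarith
    · nlinarith

/-- The link rises through the plane at `p` and descends at `q`. The edges below it enter the plane
at `p` and leave it at `q`, so the edge from `p` to `q` closes them up, and no other vertex lies on
the plane. -/
theorem exists_half_cut (hap : (a, p) ∈ C.edges) (hpb : (p, b) ∈ C.edges) (haq : (a', q) ∈ C.edges)
    (hqb : (q, b') ∈ C.edges) (ha : f a < c) (hb : c < f b) (ha' : c < f a') (hb' : f b' < c)
    (hp : f p = c) (hq : f q = c) (hv : ∀ v ∈ C.verts, f v = c → v = p ∨ v = q)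
    (hcross : ∀ e ∈ C.edges, (f e.1 ≤ c ∧ f e.2 ≤ c) ∨ (c ≤ f e.1 ∧ c ≤ f e.2)) :
    ∃ L : PolygonalLink, L.edges = {e ∈ C.edges | f e.1 ≤ c ∧ f e.2 ≤ c} ∪ {(p, q)} ∧
      (∀ v ∈ L.carrier, f v ≤ c) ∧ L.carrier ∩ {v | f v = c} = segment ℝ p q := by
  have hpq : p ≠ q := by
    rintro rfl
    have h : a = a' := congrArg Prod.fst (C.target_unique _ hap _ haq rfl)
    subst h; linarith
  have hpo : ∀ e ∈ C.edges, e.1 = p → ¬ f e.2 ≤ c := fun e he h => by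
    have := C.source_unique _ he _ hpb h
    subst this; exact not_le.2 hb
  have hqi : ∀ e ∈ C.edges, e.2 = q → ¬ f e.1 ≤ c := fun e he h => by
    have := C.target_unique _ he _ haq h
    subst this; exact not_le.2 ha'
  have hseg : ∀ x ∈ segment ℝ p q, f x = c := fun x hx =>
    (convex_hyperplane f.isLinear c).segment_subset hp hq hx
  have hplane : ∀ e ∈ C.edges, f e.1 ≤ c → f e.2 ≤ c → ∀ x ∈ segment ℝ e.1 e.2, f x = c →
      (x = p ∨ x = q) ∧ (x = e.1 ∨ x = e.2) := by
    intro e he h1 h2 x hx hfx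
    have h3 : x = e.1 ∨ x = e.2 := by
      rcases eq_of_mem_segment_of_le h1 h2 hx hfx with h | ⟨h, h'⟩
      · exact h
      · exfalso
        rcases hv _ (left_mem_verts he) h with h3 | h3
        · exact hpo e he h3 h2
        · rcases hv _ (right_mem_verts he) h' with h4 | h4
          · have h5 := C.source_unique _ he _ hqb h3
            subst h5; linarith
          · exact C.nondegenerate _ he (h3.trans h4.symm)
    refine ⟨?_, h3⟩
    rcases h3 with rfl | rfl
    exacts [hv _ (left_mem_verts he) hfx, hv _ (right_mem_verts he) hfx]
  have hends : ∀ {x : Space}, x = p ∨ x = q → x ∈ ({p, q} : Set Space) := fun h => h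
  let L : PolygonalLink :=
    { edges := {e ∈ C.edges | f e.1 ≤ c ∧ f e.2 ≤ c} ∪ {(p, q)}
      finite := (C.finite.subset (sep_subset _ _)).union (finite_singleton _)
      nondegenerate := by
        rintro e (he | rfl)
        exacts [C.nondegenerate _ he.1, hpq]
      source_unique := by
        rintro e (he | rfl) e' (he' | rfl) h
        · exact C.source_unique _ he.1 _ he'.1 h
        · exact (hpo e he.1 h he.2.2).elim
        · exact (hpo e' he'.1 h.symm he'.2.2).elim
        · rfl
      target_unique := by
        rintro e (he | rfl) e' (he' | rfl) h
        · exact C.target_unique _ he.1 _ he'.1 h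
        · exact (hqi e he.1 h he.2.1).elim
        · exact (hqi e' he'.1 h.symm he'.2.1).elim
        · rfl
      closed := by
        rintro e (he | rfl)
        · by_cases h : e.2 = p
          · exact ⟨_, Or.inr rfl, h.symm⟩
          obtain ⟨g, hg, hge⟩ := C.closed e he.1
          refine ⟨g, Or.inl ⟨hg, ?_⟩, hge⟩
          rcases hcross g hg with h1 | h1
          · exact h1
          · rcases hv e.2 (right_mem_verts he.1) (le_antisymm he.2.2 (hge ▸ h1.1)) with h2 | h2
            · exact (h h2).elim
            · exact (hqi e he.1 h2 he.2.1).elim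
        · exact ⟨(q, b'), Or.inl ⟨hqb, hq.le, hb'.le⟩, rfl⟩
      embedded := by
        rintro e (he | rfl) e' (he' | rfl) hne x ⟨hx, hx'⟩
        · exact C.embedded _ he.1 _ he'.1 hne ⟨hx, hx'⟩
        · obtain ⟨h1, h2⟩ := hplane e he.1 he.2.1 he.2.2 x hx (hseg x hx')
          exact ⟨h2, h1⟩
        · obtain ⟨h1, h2⟩ := hplane e' he'.1 he'.2.1 he'.2.2 x hx' (hseg x hx)
          exact ⟨h1, h2⟩
        · exact (hne rfl).elim }
  have hle : ∀ v ∈ L.carrier, f v ≤ c := by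
    intro v hv'
    obtain ⟨e, he, hve⟩ := mem_carrier.1 hv'
    rcases he with he | rfl
    · exact (convex_halfSpace_le f.isLinear c).segment_subset he.2.1 he.2.2 hve
    · exact (hseg v hve).le
  refine ⟨L, rfl, hle, subset_antisymm ?_ fun x hx => ⟨segment_subset_carrier
    (L := L) (e := (p, q)) (Or.inr rfl) hx, hseg x hx⟩⟩
  rintro x ⟨hx, hfx⟩
  obtain ⟨e, he, hxe⟩ := mem_carrier.1 hx
  rcases he with he | rfl
  · rcases (hplane e he.1 he.2.1 he.2.2 x hxe hfx).1 with rfl | rfl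
    exacts [left_mem_segment ℝ _ _, right_mem_segment ℝ _ _]
  · exact hxe

/-- A link that meets a plane in two vertices only is a plane sum. -/
theorem exists_cut (hf : f ≠ 0) (hap : (a, p) ∈ C.edges) (hpb : (p, b) ∈ C.edges)
    (haq : (a', q) ∈ C.edges)
    (hqb : (q, b') ∈ C.edges) (ha : f a < c) (hb : c < f b) (ha' : c < f a') (hb' : f b' < c)
    (hp : f p = c) (hq : f q = c) (hv : ∀ v ∈ C.verts, f v = c → v = p ∨ v = q)
    (hcross : ∀ e ∈ C.edges, (f e.1 ≤ c ∧ f e.2 ≤ c) ∨ (c ≤ f e.1 ∧ c ≤ f e.2)) :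
    ∃ L₁ L₂ : PolygonalLink, L₁.edges = {e ∈ C.edges | f e.1 ≤ c ∧ f e.2 ≤ c} ∪ {(p, q)} ∧
      L₂.edges = {e ∈ C.edges | c ≤ f e.1 ∧ c ≤ f e.2} ∪ {(q, p)} ∧
      IsPlaneSum f c p q L₁ L₂ C := by
  obtain ⟨L₁, h₁, h₁', h₁''⟩ := exists_half_cut hap hpb haq hqb ha hb ha' hb' hp hq hv hcross
  obtain ⟨L₂, h₂, h₂', h₂''⟩ := exists_half_cut (f := -f) (c := -c) haq hqb hap hpb (by simpa)
    (by simpa) (by simpa) (by simpa) (by simpa) (by simpa)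
    (by simpa [or_comm] using hv) (by simpa [or_comm] using hcross)
  simp only [LinearMap.neg_apply, neg_le_neg_iff, neg_inj] at h₂ h₂' h₂''
  refine ⟨L₁, L₂, h₁, h₂, hf, by simp [h₁], by simp [h₂], h₁', h₂', h₁'',
    by rw [h₂'', segment_symm], ?_⟩
  have hpq : (p, q) ∉ C.edges := fun h => by
    have h1 : b = q := congrArg Prod.snd (C.source_unique _ hpb _ h rfl)
    subst h1; linarith
  have hqp : (q, p) ∉ C.edges := fun h => by
    have h1 : b' = p := congrArg Prod.snd (C.source_unique _ hqb _ h rfl)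
    subst h1; linarith
  rw [h₁, h₂]
  ext e
  simp only [mem_sdiff, mem_union, mem_singleton_iff, mem_ofPred_eq]
  have k1 := hcross e
  have k2 : e ∈ C.edges → e ≠ (p, q) := by rintro h rfl; exact hpq h
  have k3 : e ∈ C.edges → e ≠ (q, p) := by rintro h rfl; exact hqp h
  tauto

theorem image_segment_of_forall {g : Space → Space} {x y : Space}
    (h : ∀ s ∈ Icc (0 : ℝ) 1,
      g (AffineMap.lineMap x y s) = AffineMap.lineMap (g x) (g y) s) :
    g '' segment ℝ x y = segment ℝ (g x) (g y) := by
  rw [segment_eq_image_lineMap, segment_eq_image_lineMap, image_image]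
  exact image_congr h

end PolygonalLink

/-! ### An explicit isotopy that removes padding strands. -/

namespace Braid

open PolygonalLink

/-- Outside the bottom plane and the part over `ℓ < y` this is the identity; the rest of a closure
padded by trivial strands of length `b - 1` is mapped to the closure without padding. -/
noncomputable def shorten (ℓ b : ℝ) (v : Space) : Space :=
  open Classical in
  if v 2 = -1 then pt (v 0) (-1 + (v 1 + 1) * ((ℓ + 2) / (ℓ + 1 + b))) (-1)
  else if ℓ < v 1 then pt (v 0) (ℓ + (v 1 - ℓ) / b) (-((v 1 - ℓ) / b)) else v

/-- The region above the braid box. -/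
def BoxRegion (ℓ : ℝ) (v : Space) : Prop := v 1 ≤ ℓ ∧ -1 ≤ v 2 ∧ (v 2 = -1 → v 1 = -1)

/-- The region containing the padding. -/
def PadRegion (ℓ b : ℝ) (v : Space) : Prop :=
  ℓ ≤ v 1 ∧ v 1 ≤ ℓ + b ∧ -1 ≤ v 2 ∧ (v 2 = -1 ↔ v 1 = ℓ + b) ∧ (v 1 = ℓ → v 2 = 0)

theorem pt_eta (v : Space) : pt (v 0) (v 1) (v 2) = v := by
  ext i; fin_cases i <;> rfl

theorem lineMap_coord (x y : Space) (s : ℝ) (i : Fin 3) :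
    (AffineMap.lineMap x y s : Space) i = (1 - s) * x i + s * y i := by
  rw [AffineMap.lineMap_apply_module]; simp

theorem lineMap_pt (x y z x' y' z' s : ℝ) : AffineMap.lineMap (pt x y z) (pt x' y' z') s =
    pt ((1 - s) * x + s * x') ((1 - s) * y + s * y') ((1 - s) * z + s * z') := by
  ext i; fin_cases i <;> simp [lineMap_coord, pt]

theorem eq_of_convex_combination {s α β γ : ℝ} (hs : s ∈ Icc (0 : ℝ) 1) (hα : γ ≤ α) (hβ : γ ≤ β)
    (h : (1 - s) * α + s * β = γ) : (s = 0 ∧ α = γ) ∨ (s = 1 ∧ β = γ) ∨ (α = γ ∧ β = γ) := by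
  rcases hs.1.eq_or_lt with rfl | h0
  · left; exact ⟨rfl, by linarith⟩
  rcases hs.2.eq_or_lt with rfl | h1
  · right; left; exact ⟨rfl, by linarith⟩
  · right; right; constructor <;> nlinarith

variable {ℓ b : ℝ} {v w x y : Space}

theorem BoxRegion.lineMap (hx : BoxRegion ℓ x) (hy : BoxRegion ℓ y) {s : ℝ}
    (hs : s ∈ Icc (0 : ℝ) 1) : BoxRegion ℓ (AffineMap.lineMap x y s) := by
  obtain ⟨x1, x2, x3⟩ := hx
  obtain ⟨y1, y2, y3⟩ := hy
  have h0 := hs.1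
  have h1 := sub_nonneg.2 hs.2
  simp only [BoxRegion, lineMap_coord]
  refine ⟨?_, ?_, fun h => ?_⟩
  · nlinarith
  · nlinarith
  · rcases eq_of_convex_combination hs x2 y2 h with ⟨rfl, h'⟩ | ⟨rfl, h'⟩ | ⟨h', h''⟩
    · rw [x3 h']; ring
    · rw [y3 h']; ring
    · rw [x3 h', y3 h'']; ring

theorem PadRegion.lineMap (hx : PadRegion ℓ b x) (hy : PadRegion ℓ b y) {s : ℝ}
    (hs : s ∈ Icc (0 : ℝ) 1) : PadRegion ℓ b (AffineMap.lineMap x y s) := by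
  obtain ⟨x1, x1', x2, x3, x4⟩ := hx
  obtain ⟨y1, y1', y2, y3, y4⟩ := hy
  have h0 := hs.1
  have h1 := sub_nonneg.2 hs.2
  simp only [PadRegion, lineMap_coord]
  refine ⟨?_, ?_, ?_, ⟨fun h => ?_, fun h => ?_⟩, fun h => ?_⟩
  · nlinarith
  · nlinarith
  · nlinarith
  · rcases eq_of_convex_combination hs x2 y2 h with ⟨rfl, h'⟩ | ⟨rfl, h'⟩ | ⟨h', h''⟩
    · rw [x3.1 h']; ring
    · rw [y3.1 h']; ring
    · rw [x3.1 h', y3.1 h'']; ring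
  · rcases eq_of_convex_combination hs (neg_le_neg x1') (neg_le_neg y1') (by linarith)
      with ⟨rfl, h'⟩ | ⟨rfl, h'⟩ | ⟨h', h''⟩
    · rw [x3.2 (neg_inj.1 h')]; ring
    · rw [y3.2 (neg_inj.1 h')]; ring
    · rw [x3.2 (neg_inj.1 h'), y3.2 (neg_inj.1 h'')]; ring
  · rcases eq_of_convex_combination hs x1 y1 h with ⟨rfl, h'⟩ | ⟨rfl, h'⟩ | ⟨h', h''⟩
    · rw [x4 h']; ring
    · rw [y4 h']; ring
    · rw [x4 h', y4 h'']; ring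

theorem shorten_box (hv : BoxRegion ℓ v) : shorten ℓ b v = v := by
  unfold shorten
  split_ifs with h1 h2
  · conv_rhs => rw [← pt_eta v, hv.2.2 h1, h1]
    rw [hv.2.2 h1]; simp
  · linarith [hv.1]
  · rfl

theorem shorten_pad (hb : 0 < b) (hℓ : 0 ≤ ℓ) (hv : PadRegion ℓ b v) :
    shorten ℓ b v = pt (v 0) (ℓ + (v 1 - ℓ) / b) (-((v 1 - ℓ) / b)) := by
  unfold shorten
  split_ifs with h1 h2
  · rw [hv.2.2.2.1.1 h1, pt_inj]
    refine ⟨rfl, ?_, ?_⟩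
    · field_simp; ring
    · field_simp; ring
  · rfl
  · have h3 := le_antisymm (not_lt.1 h2) hv.1
    conv_lhs => rw [← pt_eta v, hv.2.2.2.2 h3, h3]
    rw [h3]; simp

theorem shorten_bottom (hv : v 2 = -1) :
    shorten ℓ b v = pt (v 0) (-1 + (v 1 + 1) * ((ℓ + 2) / (ℓ + 1 + b))) (-1) := by
  simp [shorten, hv]

/-- The isotopy is the straight-line homotopy from the identity to `shorten`. It preserves the first
coordinate and is affine on every edge. It is injective on the link because it is increasing in the
second coordinate both on the bottom plane and on the padding, and because the height of a padding
point is a function `ζ` of its first two coordinates. -/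
theorem isotopic_shorten {R : PolygonalLink} (hb : 0 < b) (hℓ : 0 ≤ ℓ)
    (hE : ∀ e ∈ R.edges, (BoxRegion ℓ e.1 ∧ BoxRegion ℓ e.2) ∨ (PadRegion ℓ b e.1 ∧
      PadRegion ℓ b e.2) ∨ (e.1 2 = -1 ∧ e.2 2 = -1))
    {ζ : ℝ → ℝ → ℝ} (hζ : ∀ v ∈ R.carrier, ℓ < v 1 → -1 < v 2 → v 2 = ζ (v 0) (v 1)) :
    ∃ R' : PolygonalLink, R'.edges = Prod.map (shorten ℓ b) (shorten ℓ b) '' R.edges ∧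
      Isotopic R R' := by
  set κ := (ℓ + 2) / (ℓ + 1 + b) with hκ
  have hκ0 : 0 < κ := by positivity
  have hlin : ∀ e ∈ R.edges, ∀ s ∈ Icc (0 : ℝ) 1, shorten ℓ b (AffineMap.lineMap e.1 e.2 s) =
      AffineMap.lineMap (shorten ℓ b e.1) (shorten ℓ b e.2) s := by
    intro e he s hs
    rcases hE e he with ⟨h1, h2⟩ | ⟨h1, h2⟩ | ⟨h1, h2⟩
    · rw [shorten_box h1, shorten_box h2, shorten_box (h1.lineMap h2 hs)]
    · rw [shorten_pad hb hℓ h1, shorten_pad hb hℓ h2, shorten_pad hb hℓ (h1.lineMap h2 hs),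
        lineMap_pt, pt_inj]
      simp only [lineMap_coord]
      refine ⟨trivial, ?_, ?_⟩ <;> field_simp <;> ring
    · rw [shorten_bottom h1, shorten_bottom h2, shorten_bottom
        (by rw [lineMap_coord, h1, h2]; ring), lineMap_pt, pt_inj]
      simp only [lineMap_coord]
      refine ⟨trivial, ?_, ?_⟩ <;> ring
  have hcar : ∀ v ∈ R.carrier, BoxRegion ℓ v ∨ PadRegion ℓ b v ∨ v 2 = -1 := by
    intro v hv
    obtain ⟨e, he, hv⟩ := mem_carrier.1 hv
    rw [segment_eq_image_lineMap] at hv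
    obtain ⟨s, hs, rfl⟩ := hv
    rcases hE e he with ⟨h1, h2⟩ | ⟨h1, h2⟩ | ⟨h1, h2⟩
    · exact Or.inl (h1.lineMap h2 hs)
    · exact Or.inr (Or.inl (h1.lineMap h2 hs))
    · refine Or.inr (Or.inr ?_)
      rw [lineMap_coord, h1, h2]; ring
  set g : ℝ → Space → Space := fun t v => AffineMap.lineMap v (shorten ℓ b v) t with hg
  have hgbot : ∀ t v, v 2 = -1 →
      g t v = pt (v 0) ((1 - t) * v 1 + t * (-1 + (v 1 + 1) * κ)) (-1) := by
    intro t v hv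
    simp only [hg]
    rw [shorten_bottom hv]
    conv_lhs => rw [← pt_eta v, hv]
    rw [lineMap_pt, pt_inj]
    simp only [pt, Matrix.cons_val, ← hκ]
    exact ⟨by ring, trivial, by ring⟩
  have hgbox : ∀ t v, v ∈ R.carrier → v 2 ≠ -1 → v 1 ≤ ℓ → g t v = v := by
    intro t v hv h2 h1
    simp only [hg, shorten, h2, not_lt.2 h1, if_false]
    exact AffineMap.lineMap_same_apply _ _
  have hgpad : ∀ t v, v ∈ R.carrier → v 2 ≠ -1 → ℓ < v 1 →
      g t v = pt (v 0) ((1 - t) * v 1 + t * (ℓ + (v 1 - ℓ) / b))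
        ((1 - t) * v 2 + t * (-((v 1 - ℓ) / b))) := by
    intro t v hv h2 h1
    simp only [hg, shorten, h2, h1, if_false, if_true]
    conv_lhs => rw [← pt_eta v]
    rw [lineMap_pt, pt_inj]
    simp only [pt, Matrix.cons_val]
    exact ⟨by ring, trivial, trivial⟩
  have hge : ∀ v ∈ R.carrier, -1 ≤ v 2 := by
    intro v hv
    rcases hcar v hv with h | h | h
    exacts [h.2.1, h.2.2.1, h.ge]
  have hlt : ∀ v ∈ R.carrier, ℓ < v 1 → v 2 ≠ -1 → (v 1 - ℓ) / b < 1 := by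
    intro v hv h1 h2
    rcases hcar v hv with h | h | h
    · exact (h1.not_ge h.1).elim
    · rw [div_lt_one hb]
      have := lt_of_le_of_ne h.2.1 (mt h.2.2.2.1.2 h2)
      linarith
    · exact (h2 h).elim
  have hgt : ∀ t ∈ Icc (0 : ℝ) 1, ∀ v ∈ R.carrier, v 2 ≠ -1 → g t v 2 ≠ -1 := by
    intro t ht v hv h2
    rcases le_or_gt (v 1) ℓ with h1 | h1
    · rwa [hgbox t v hv h2 h1]
    · rw [hgpad t v hv h2 h1]
      have h3 := hlt v hv h1 h2
      have h4 := lt_of_le_of_ne (hge v hv) h2.symm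
      refine ne_of_gt ?_
      simp only [pt, Matrix.cons_val]
      rcases ht.1.eq_or_lt with rfl | h0
      · linarith
      · have h5 := mul_nonneg (sub_nonneg.2 ht.2) (by linarith : (0 : ℝ) ≤ v 2 + 1)
        have h6 := mul_pos h0 (by linarith : 0 < 1 - (v 1 - ℓ) / b)
        linarith
  have hpos : ∀ t ∈ Icc (0 : ℝ) 1, ∀ k : ℝ, 0 < k → 0 < (1 - t) + t * k := by
    intro t ht k hk
    rcases ht.1.eq_or_lt with rfl | h0
    · norm_num
    · have := mul_pos h0 hk
      linarith [ht.2]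
  have hinv : 0 < b⁻¹ := inv_pos.2 hb
  -- Written about the fixed level `ℓ`, the motion of the second coordinate is a scaling by a
  -- positive factor, so it is strictly increasing and nothing beyond `ℓ` falls back on the fixed
  -- part.
  have hy : ∀ t ∈ Icc (0 : ℝ) 1, ∀ y, (1 - t) * y + t * (ℓ + (y - ℓ) / b) =
      ℓ + (y - ℓ) * ((1 - t) + t * b⁻¹) := by
    intro t _ y; field_simp; ring
  have hinj : ∀ t ∈ Icc (0 : ℝ) 1, InjOn (g t) R.carrier := by
    intro t ht v hv w hw hvw
    by_cases hv2 : v 2 = -1 <;> by_cases hw2 : w 2 = -1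
    · rw [hgbot t v hv2, hgbot t w hw2, pt_inj] at hvw
      have h1 : (v 1 - w 1) * ((1 - t) + t * κ) = 0 := by linarith [hvw.2.1]
      have h2 := (mul_eq_zero.1 h1).resolve_right (hpos t ht κ hκ0).ne'
      rw [← pt_eta v, ← pt_eta w, pt_inj]
      exact ⟨hvw.1, by linarith, by rw [hv2, hw2]⟩
    · refine (hgt t ht w hw hw2 ?_).elim
      rw [← hvw, hgbot t v hv2]; simp [pt]
    · refine (hgt t ht v hv hv2 ?_).elim
      rw [hvw, hgbot t w hw2]; simp [pt]
    · rcases le_or_gt (v 1) ℓ with hv1 | hv1 <;> rcases le_or_gt (w 1) ℓ with hw1 | hw1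
      · rwa [hgbox t v hv hv2 hv1, hgbox t w hw hw2 hw1] at hvw
      · rw [hgbox t v hv hv2 hv1, hgpad t w hw hw2 hw1, hy t ht, ← pt_eta v, pt_inj] at hvw
        have := mul_pos (sub_pos.2 hw1) (hpos t ht _ hinv)
        linarith [hvw.2.1]
      · rw [hgbox t w hw hw2 hw1, hgpad t v hv hv2 hv1, hy t ht, ← pt_eta w, pt_inj] at hvw
        have := mul_pos (sub_pos.2 hv1) (hpos t ht _ hinv)
        linarith [hvw.2.1]
      -- The homotopy determines only the first two coordinates; the height is recovered from `ζ`.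
      · have hvζ := hζ v hv hv1 (lt_of_le_of_ne (hge v hv) (Ne.symm hv2))
        have hwζ := hζ w hw hw1 (lt_of_le_of_ne (hge w hw) (Ne.symm hw2))
        rw [hgpad t v hv hv2 hv1, hgpad t w hw hw2 hw1, hy t ht, hy t ht, pt_inj] at hvw
        have h1 : (v 1 - w 1) * ((1 - t) + t * b⁻¹) = 0 := by linarith [hvw.2.1]
        have h2 := (mul_eq_zero.1 h1).resolve_right (hpos t ht _ hinv).ne'
        have h3 : v 1 = w 1 := by linarith
        rw [← pt_eta v, ← pt_eta w, pt_inj]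
        exact ⟨hvw.1, h3, by rw [hvζ, hwζ, hvw.1, h3]⟩
  have haff : ∀ t, ∀ e ∈ R.edges, g t '' segment ℝ e.1 e.2 = segment ℝ (g t e.1) (g t e.2) := by
    intro t e he
    refine image_segment_of_forall fun s hs => ?_
    simp only [hg]
    rw [hlin e he s hs]
    simp only [AffineMap.lineMap_apply_module]
    module
  have h1 : ∀ v, g 1 v = shorten ℓ b v := fun v => AffineMap.lineMap_apply_one _ _
  obtain ⟨R', hR', -⟩ := exists_map R (g 1) (hinj 1 (right_mem_Icc.2 zero_le_one)) (haff 1)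
  have h1' : g 1 = shorten ℓ b := funext h1
  refine ⟨R', h1' ▸ hR', isotopic_of_injective_family (g := g) (fun v _ => ?_) hinj
    (fun t _ => haff t) (fun v _ => AffineMap.lineMap_apply_zero _ _) hR'⟩
  simp only [hg, AffineMap.lineMap_apply_module']
  fun_prop

end Braid

end

section

open Set

/-! ### Closures of words that split into two blocks -/

namespace Braid

open PolygonalLink

/-- The word `w` starts with `w₁`, and its further letters do not involve the strands to the left
of the last strand of `w₁`. -/
structure IsSplit {m m₁ : ℕ} (w₁ : ArtinWord m₁) (w : ArtinWord m) : Prop where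
  le : m₁ ≤ m
  length_le : w₁.length ≤ w.length
  left : ∀ (k : ℕ) (hk : k < w₁.length),
    (w[k].1 : ℕ) = w₁[k].1 ∧ w[k].2 = w₁[k].2
  right : ∀ (k : ℕ) (hk : k < w.length), w₁.length ≤ k → m₁ ≤ (w[k].1 : ℕ)

/-- The linear form that defines the plane separating the two blocks. -/
noncomputable def cutForm (D : ℝ) : Space →ₗ[ℝ] ℝ :=
  D • (LinearMap.proj 0 : Space →ₗ[ℝ] ℝ) + (LinearMap.proj 1 : Space →ₗ[ℝ] ℝ)

theorem cutForm_apply (D : ℝ) (v : Space) : cutForm D v = D * v 0 + v 1 := by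
  simp [cutForm]

theorem cutForm_pt (D x y z : ℝ) : cutForm D (pt x y z) = D * x + y := by
  simp [cutForm_apply, pt]

section cutForm

variable {D a ℓ x y z : ℝ}

theorem cutForm_lt (hD : 0 < D) (hx : x ≤ a) (hy : y < ℓ) : cutForm D (pt x y z) < D * a + ℓ := by
  rw [cutForm_pt]; nlinarith

theorem cutForm_lt_of_le_sub_one (hD : 0 < D) (hx : x ≤ a - 1) (hy : y < ℓ + D) :
    cutForm D (pt x y z) < D * a + ℓ := by
  rw [cutForm_pt]; nlinarith

theorem cutForm_le (hD : 0 < D) (hx : x ≤ a) (hy : y ≤ ℓ) : cutForm D (pt x y z) ≤ D * a + ℓ := by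
  rw [cutForm_pt]; nlinarith

theorem lt_cutForm (hD : 0 < D) (hx : a ≤ x) (hy : ℓ < y) : D * a + ℓ < cutForm D (pt x y z) := by
  rw [cutForm_pt]; nlinarith

theorem lt_cutForm' (hD : 0 < D) (hx : a < x) (hy : ℓ ≤ y) : D * a + ℓ < cutForm D (pt x y z) := by
  rw [cutForm_pt]; nlinarith

theorem lt_cutForm_of_add_one_le (hD : 0 < D) (hx : a + 1 ≤ x) (hy : ℓ < y + D) :
    D * a + ℓ < cutForm D (pt x y z) := by
  rw [cutForm_pt]; nlinarith

theorem eq_or_lt_cutForm (hD : 0 < D) (hx : a ≤ x) (hy : ℓ ≤ y) :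
    pt x y z = pt a ℓ z ∨ D * a + ℓ < cutForm D (pt x y z) := by
  rcases hx.eq_or_lt with rfl | hx
  · rcases hy.eq_or_lt with rfl | hy
    · exact Or.inl rfl
    · exact Or.inr (lt_cutForm hD le_rfl hy)
  · exact Or.inr (lt_cutForm' hD hx hy)

end cutForm

theorem ite_bounds (b : Bool) : (0 ≤ (if b then 0 else 1 : ℝ) ∧ (if b then 0 else 1 : ℝ) ≤ 1) ∧
    0 ≤ (if b then 1 else 0 : ℝ) ∧ (if b then 1 else 0 : ℝ) ≤ 1 := by
  cases b <;> simp

variable {m m₁ : ℕ} {w₁ : ArtinWord m₁} {w : ArtinWord m} {p q : Space}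

/-- The separating linear form of a word of length `ℓ`. -/
noncomputable def sideForm (w : ArtinWord m) : Space →ₗ[ℝ] ℝ := cutForm (w.length + 2)

/-- The value of the separating linear form on the separating plane. -/
noncomputable def sideValue (w₁ : ArtinWord m₁) (w : ArtinWord m) : ℝ :=
  (w.length + 2) * m₁ + w₁.length

/-- Over the closure the second coordinate varies between `-1` and `w.length + 1`. With slope
`w.length + 2` one step in the first coordinate outweighs this, so strands to the left or right of
`m₁` never meet the plane. On strand `m₁` the plane is the level where the first block ends: there
it passes through a vertex on the upper level, and below the braid it cuts the excluded returning
edge. -/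
theorem IsSplit.edge_side (h : IsSplit w₁ w) (hpq : ClosureEdge w p q)
    (hne : (p, q) ≠ (pt m₁ (w.length + 1) (-1), pt m₁ (-1) (-1))) :
    (sideForm w p < sideValue w₁ w ∧ sideForm w q ≤ sideValue w₁ w) ∨
      (p = pt m₁ w₁.length 0 ∨ sideValue w₁ w < sideForm w p) ∧
        sideValue w₁ w < sideForm w q := by
  have hl : (0 : ℝ) ≤ w₁.length := Nat.cast_nonneg _
  have hl' : (w₁.length : ℝ) ≤ w.length := Nat.cast_le.2 h.length_le
  have hD : (0 : ℝ) < w.length + 2 := by linarith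
  unfold sideForm sideValue
  have hleft : ∀ k (hk : k < w₁.length),
      (w[k]'(hk.trans_le h.length_le)).1 + (1 : ℝ) ≤ m₁ ∧ (k : ℝ) + 1 ≤ w₁.length := fun k hk => by
    rw [(h.left k hk).1]
    exact ⟨by exact_mod_cast (w₁[k].1).isLt, by exact_mod_cast hk⟩
  have hright : ∀ k (hk : k < w.length), w₁.length ≤ k →
      (m₁ : ℝ) ≤ (w[k].1 : ℕ) ∧ (w₁.length : ℝ) ≤ k ∧ (k : ℝ) + 1 ≤ w.length :=
    fun k hk hk' => ⟨by exact_mod_cast h.right k hk hk', by exact_mod_cast hk', by exact_mod_cast hk⟩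
  have hj : ∀ j : Fin (m + 1), ((j : ℕ) : ℝ) ≤ m₁ - 1 ∨ ((j : ℕ) : ℝ) = m₁ ∨
      (m₁ : ℝ) + 1 ≤ (j : ℕ) := fun j => by
    rcases lt_trichotomy (j : ℕ) m₁ with h | h | h
    · left; have : ((j : ℕ) : ℝ) + 1 ≤ m₁ := by exact_mod_cast h
      linarith
    · right; left; exact_mod_cast h
    · right; right; exact_mod_cast h
  cases hpq with
  | straight k hk j h₁ h₂ =>
    have hk0 : (0 : ℝ) ≤ k := Nat.cast_nonneg _
    have hk1 : (k : ℝ) + 1 ≤ w.length := by exact_mod_cast hk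
    rcases hj j with h3 | h3 | h3
    · exact Or.inl ⟨cutForm_lt_of_le_sub_one hD h3 (by linarith),
        (cutForm_lt_of_le_sub_one hD h3 (by linarith)).le⟩
    · rcases lt_or_ge k w₁.length with h4 | h4
      · have := (hleft k h4).2
        exact Or.inl ⟨cutForm_lt hD h3.le (by linarith), cutForm_le hD h3.le (by linarith)⟩
      · have := hright k hk h4
        exact Or.inr ⟨eq_or_lt_cutForm hD h3.ge (by linarith), lt_cutForm hD h3.ge (by linarith)⟩
    · exact Or.inr ⟨Or.inr (lt_cutForm_of_add_one_le hD h3 (by linarith)),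
        lt_cutForm_of_add_one_le hD h3 (by linarith)⟩
  | overIn k hk =>
    obtain ⟨⟨b1, b2⟩, b3, b4⟩ := ite_bounds w[k].2
    rcases lt_or_ge k w₁.length with h4 | h4
    · obtain ⟨h5, h6⟩ := hleft k h4
      exact Or.inl ⟨cutForm_lt hD (by linarith) (by linarith), cutForm_le hD (by linarith)
        (by linarith)⟩
    · obtain ⟨h5, h6, h7⟩ := hright k hk h4
      exact Or.inr ⟨eq_or_lt_cutForm hD (by linarith) (by linarith), lt_cutForm hD (by linarith)
        (by linarith)⟩
  | overOut k hk =>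
    obtain ⟨⟨b1, b2⟩, b3, b4⟩ := ite_bounds w[k].2
    rcases lt_or_ge k w₁.length with h4 | h4
    · obtain ⟨h5, h6⟩ := hleft k h4
      exact Or.inl ⟨cutForm_lt hD (by linarith) (by linarith), cutForm_le hD (by linarith)
        (by linarith)⟩
    · obtain ⟨h5, h6, h7⟩ := hright k hk h4
      exact Or.inr ⟨Or.inr (lt_cutForm hD (by linarith) (by linarith)), lt_cutForm hD (by linarith)
        (by linarith)⟩
  | under k hk =>
    obtain ⟨⟨b1, b2⟩, b3, b4⟩ := ite_bounds w[k].2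
    rcases lt_or_ge k w₁.length with h4 | h4
    · obtain ⟨h5, h6⟩ := hleft k h4
      exact Or.inl ⟨cutForm_lt hD (by linarith) (by linarith), cutForm_le hD (by linarith)
        (by linarith)⟩
    · obtain ⟨h5, h6, h7⟩ := hright k hk h4
      exact Or.inr ⟨eq_or_lt_cutForm hD (by linarith) (by linarith), lt_cutForm hD (by linarith)
        (by linarith)⟩
  | down j =>
    rcases hj j with h3 | h3 | h3
    · exact Or.inl ⟨cutForm_lt_of_le_sub_one hD h3 (by linarith),
        (cutForm_lt_of_le_sub_one hD h3 (by linarith)).le⟩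
    · exact Or.inr ⟨eq_or_lt_cutForm hD h3.ge (by linarith), lt_cutForm hD h3.ge (by linarith)⟩
    · exact Or.inr ⟨Or.inr (lt_cutForm_of_add_one_le hD h3 (by linarith)),
        lt_cutForm_of_add_one_le hD h3 (by linarith)⟩
  | back j =>
    rcases hj j with h3 | h3 | h3
    · exact Or.inl ⟨cutForm_lt_of_le_sub_one hD h3 (by linarith),
        (cutForm_lt_of_le_sub_one hD h3 (by linarith)).le⟩
    · rw [h3] at hne; exact (hne rfl).elim
    · exact Or.inr ⟨Or.inr (lt_cutForm_of_add_one_le hD h3 (by linarith)),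
        lt_cutForm_of_add_one_le hD h3 (by linarith)⟩
  | up j =>
    rcases hj j with h3 | h3 | h3
    · exact Or.inl ⟨cutForm_lt_of_le_sub_one hD h3 (by linarith),
        (cutForm_lt_of_le_sub_one hD h3 (by linarith)).le⟩
    · exact Or.inl ⟨cutForm_lt hD h3.le (by linarith), cutForm_le hD h3.le hl⟩
    · exact Or.inr ⟨Or.inr (lt_cutForm_of_add_one_le hD h3 (by linarith)),
        lt_cutForm_of_add_one_le hD h3 (by linarith)⟩

/-- Cutting the closure of a split word. -/
theorem IsSplit.exists_cut (h : IsSplit w₁ w) : ∃ C L₁ L₂ : PolygonalLink,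
    Isotopic (closure w) C ∧
    L₁.edges = {e | ClosureEdge w e.1 e.2 ∧
      e ≠ (pt m₁ (w.length + 1) (-1), pt m₁ (-1) (-1)) ∧
      sideForm w e.1 ≤ sideValue w₁ w ∧ sideForm w e.2 ≤ sideValue w₁ w} ∪
      {(pt m₁ w₁.length (-1), pt m₁ (-1) (-1)), (pt m₁ w₁.length 0, pt m₁ w₁.length (-1))} ∧
    L₂.edges = {e | ClosureEdge w e.1 e.2 ∧
      e ≠ (pt m₁ (w.length + 1) (-1), pt m₁ (-1) (-1)) ∧
      sideValue w₁ w ≤ sideForm w e.1 ∧ sideValue w₁ w ≤ sideForm w e.2} ∪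
      {(pt m₁ (w.length + 1) (-1), pt m₁ w₁.length (-1)),
        (pt m₁ w₁.length (-1), pt m₁ w₁.length 0)} ∧
    IsPlaneSum (sideForm w) (sideValue w₁ w) (pt m₁ w₁.length 0) (pt m₁ w₁.length (-1)) L₁ L₂ C := by
  have hl : (0 : ℝ) ≤ w₁.length := Nat.cast_nonneg _
  have hl' : (w₁.length : ℝ) ≤ w.length := Nat.cast_le.2 h.length_le
  have hD : (0 : ℝ) < w.length + 2 := by linarith
  set A := pt m₁ (w.length + 1) (-1) with hA
  set B := pt m₁ (-1) (-1) with hB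
  set P := pt m₁ w₁.length 0 with hP
  set H := pt m₁ w₁.length (-1) with hH
  set f := sideForm w with hf
  set c := sideValue w₁ w with hc
  have hfA : c < f A := lt_cutForm hD le_rfl (by linarith)
  have hfB : f B < c := cutForm_lt hD le_rfl (by linarith)
  have hfP : f P = c := cutForm_pt _ _ _ _
  have hfH : f H = c := cutForm_pt _ _ _ _
  have hAB : (A, B) ∈ (closure w).edges :=
    ClosureEdge.back (w := w) (⟨m₁, by have := h.le; omega⟩ : Fin (m + 1))
  -- The returning edge runs from level `w.length + 1` to level `-1`; the parameter is that of level
  -- `w₁.length`.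
  have hHm : H ∈ openSegment ℝ A B := by
    have : H = AffineMap.lineMap A B ((w.length + 1 - w₁.length) / (w.length + 2) : ℝ) := by
      rw [hA, hB, lineMap_pt, hH, pt_inj]
      refine ⟨by ring, ?_, by ring⟩
      field_simp; ring
    rw [this]
    exact lineMap_mem_openSegment (div_pos (by linarith) hD) ((div_lt_one hD).2 (by linarith))
  obtain ⟨C, hC, hi⟩ := exists_subdivision hAB hHm
  have hCe : ∀ e ∈ C.edges, (ClosureEdge w e.1 e.2 ∧ e ≠ (A, B)) ∨ e = (A, H) ∨ e = (H, B) := by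
    intro e he
    rw [hC] at he
    exact he
  have hPz : P 2 = 0 := rfl
  have hAz : A 2 = -1 := rfl
  have hBz : B 2 = -1 := rfl
  have hHz : H 2 = -1 := rfl
  obtain ⟨b, hPb⟩ := exists_closureEdge w w₁.length h.length_le
    (⟨m₁, by have := h.le; omega⟩ : Fin (m + 1))
  change ClosureEdge w P b at hPb
  obtain ⟨a, haP⟩ := exists_pred (L := closure w) (v := P) (left_mem_verts (e := (P, b)) hPb)
  change ClosureEdge w a P at haP
  have hPbne : (P, b) ≠ (A, B) := fun h1 => by
    have := congrFun (show P = A from congrArg Prod.fst h1) 2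
    rw [hPz, hAz] at this; linarith
  have haPne : (a, P) ≠ (A, B) := fun h1 => by
    have := congrFun (show P = B from congrArg Prod.snd h1) 2
    rw [hPz, hBz] at this; linarith
  have hfb : c < f b := by
    rcases h.edge_side hPb hPbne with h1 | h1
    · exact (hfP.not_lt h1.1).elim
    · exact h1.2
  have hfa : f a < c := by
    rcases h.edge_side haP haPne with h1 | h1
    · exact h1.1
    · exact (hfP.not_gt h1.2).elim
  have hfne : f ≠ 0 := fun h0 => by
    rw [h0] at hfP hfA
    simp only [LinearMap.zero_apply] at hfP hfA
    linarith
  obtain ⟨L₁, L₂, hL₁, hL₂, hs⟩ := PolygonalLink.exists_cut (C := C) hfne (a := a) (p := P) (b := b)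
    (a' := A) (q := H) (b' := B) (c := c)
    (by rw [hC]; exact Or.inl ⟨haP, haPne⟩) (by rw [hC]; exact Or.inl ⟨hPb, hPbne⟩)
    (by simp [hC]) (by simp [hC]) hfa hfb hfA hfB hfP hfH (by
      rintro _ ⟨e, he, rfl⟩ hfe
      rcases hCe e he with ⟨h1, h2⟩ | rfl | rfl
      · rcases h.edge_side h1 h2 with h3 | h3
        · exact (h3.1.ne hfe).elim
        · rcases h3.1 with h4 | h4
          · exact Or.inl h4
          · exact (h4.ne' hfe).elim
      · exact (hfA.ne' hfe).elim
      · exact Or.inr rfl) (by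
      intro e he
      rcases hCe e he with ⟨h1, h2⟩ | rfl | rfl
      · rcases h.edge_side h1 h2 with h3 | h3
        · exact Or.inl ⟨h3.1.le, h3.2⟩
        · refine Or.inr ⟨?_, h3.2.le⟩
          rcases h3.1 with h4 | h4
          · rw [h4]; exact hfP.ge
          · exact h4.le
      · exact Or.inr ⟨hfA.le, hfH.ge⟩
      · exact Or.inl ⟨hfH.le, hfB.le⟩)
  refine ⟨C, L₁, L₂, hi.isotopic, ?_, ?_, hs⟩
  · rw [hL₁, hC]
    ext e
    simp only [mem_union, mem_sdiff, mem_singleton_iff, mem_insert_iff, mem_ofPred_eq]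
    constructor
    · rintro (⟨⟨h1, h2⟩ | rfl | rfl, h3⟩ | rfl)
      · exact Or.inl ⟨h1, h2, h3⟩
      · exact (h3.1.not_gt hfA).elim
      · exact Or.inr (Or.inl rfl)
      · exact Or.inr (Or.inr rfl)
    · rintro (⟨h1, h2, h3⟩ | rfl | rfl)
      · exact Or.inl ⟨Or.inl ⟨h1, h2⟩, h3⟩
      · exact Or.inl ⟨Or.inr (Or.inr rfl), hfH.le, hfB.le⟩
      · exact Or.inr rfl
  · rw [hL₂, hC]
    ext e
    simp only [mem_union, mem_sdiff, mem_singleton_iff, mem_insert_iff, mem_ofPred_eq]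
    constructor
    · rintro (⟨⟨h1, h2⟩ | rfl | rfl, h3⟩ | rfl)
      · exact Or.inl ⟨h1, h2, h3⟩
      · exact Or.inr (Or.inl rfl)
      · exact (h3.2.not_gt hfB).elim
      · exact Or.inr (Or.inr rfl)
    · rintro (⟨h1, h2, h3⟩ | rfl | rfl)
      · exact Or.inl ⟨Or.inl ⟨h1, h2⟩, h3⟩
      · exact Or.inl ⟨Or.inr (Or.inl rfl), hfA.le, hfH.ge⟩
      · exact Or.inr rfl

end Braid

end

section

open Set

/-! ### The left part of the closure of a split word -/

namespace Braid

open PolygonalLink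

variable {m m₁ : ℕ} {w₁ : ArtinWord m₁} {w : ArtinWord m} {p q : Space}

/-- The edges to the left of the separating plane. -/
inductive LeftEdge (w₁ : ArtinWord m₁) (ℓ : ℕ) : Space → Space → Prop
  | core (p q : Space) (h : ClosureEdge w₁ p q) (hp : BoxRegion w₁.length p)
      (hq : BoxRegion w₁.length q) : LeftEdge w₁ ℓ p q
  | straight (j k : ℕ) (hj : j < m₁) (hk : w₁.length ≤ k) (hk' : k < ℓ) :
      LeftEdge w₁ ℓ (pt j k 0) (pt j (k + 1) 0)
  | down (j : ℕ) (hj : j < m₁) : LeftEdge w₁ ℓ (pt j ℓ 0) (pt j (ℓ + 1) (-1))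
  | back (j : ℕ) (hj : j < m₁) : LeftEdge w₁ ℓ (pt j (ℓ + 1) (-1)) (pt j (-1) (-1))

theorem boxRegion_pt {ℓ x y z : ℝ} : BoxRegion ℓ (pt x y z) ↔ y ≤ ℓ ∧ -1 ≤ z ∧ (z = -1 → y = -1) :=
  Iff.rfl

theorem padRegion_pt {ℓ b x y z : ℝ} : PadRegion ℓ b (pt x y z) ↔
    ℓ ≤ y ∧ y ≤ ℓ + b ∧ -1 ≤ z ∧ (z = -1 ↔ y = ℓ + b) ∧ (y = ℓ → z = 0) := Iff.rfl

theorem boxRegion_of_nonneg {ℓ x y z : ℝ} (hy : y ≤ ℓ) (hz : 0 ≤ z) : BoxRegion ℓ (pt x y z) :=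
  boxRegion_pt.2 ⟨hy, by linarith, fun h => by linarith⟩

theorem boxRegion_low {ℓ x : ℝ} (hℓ : 0 ≤ ℓ) : BoxRegion ℓ (pt x (-1) (-1)) :=
  boxRegion_pt.2 ⟨by linarith, le_rfl, fun _ => rfl⟩

theorem IsSplit.leftEdge (h : IsSplit w₁ w) (hpq : ClosureEdge w p q)
    (hne : (p, q) ≠ (pt m₁ (w.length + 1) (-1), pt m₁ (-1) (-1)))
    (hp : sideForm w p ≤ sideValue w₁ w) (hq : sideForm w q ≤ sideValue w₁ w) :
    LeftEdge w₁ w.length p q := by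
  have hl : (0 : ℝ) ≤ w₁.length := Nat.cast_nonneg _
  have hl' : (w₁.length : ℝ) ≤ w.length := Nat.cast_le.2 h.length_le
  have hD : (0 : ℝ) < w.length + 2 := by linarith
  have hright : ∀ k (hk : k < w.length), w₁.length ≤ k →
      (m₁ : ℝ) ≤ (w[k].1 : ℕ) ∧ (w₁.length : ℝ) ≤ k :=
    fun k hk hk' => ⟨by exact_mod_cast h.right k hk hk', by exact_mod_cast hk'⟩
  have hjne : ∀ j : Fin (m + 1), ¬ (j : ℕ) < m₁ → (j : ℕ) ≠ m₁ → (m₁ : ℝ) + 1 ≤ (j : ℕ) :=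
    fun j h1 h2 => by
      have : m₁ + 1 ≤ (j : ℕ) := by omega
      exact_mod_cast this
  cases hpq with
  | straight k hk j h₁ h₂ =>
    have hk0 : (0 : ℝ) ≤ k := Nat.cast_nonneg _
    rcases lt_or_ge k w₁.length with h4 | h4
    · have hk1 : (k : ℝ) + 1 ≤ w₁.length := by exact_mod_cast h4
      have hj : (j : ℕ) < m₁ + 1 := by
        by_contra hj
        exact hp.not_gt (lt_cutForm_of_add_one_le hD (hjne j (by omega) (by omega)) (by linarith))
      refine .core _ _ ?_ (boxRegion_of_nonneg (by linarith) le_rfl)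
        (boxRegion_of_nonneg hk1 le_rfl)
      refine ClosureEdge.straight (w := w₁) k h4 ⟨j, hj⟩ (fun h5 => h₁ ?_) (fun h5 => h₂ ?_)
      · have h6 : (j : ℕ) = w₁[k].1 := congrArg Fin.val h5
        exact Fin.ext (h6.trans (h.left k h4).1.symm)
      · have h6 : (j : ℕ) = w₁[k].1 + 1 := congrArg Fin.val h5
        exact Fin.ext (h6.trans (by rw [Fin.val_succ, (h.left k h4).1]))
    · refine .straight j k ?_ h4 hk
      by_contra hj
      have h5 : (m₁ : ℝ) ≤ (j : ℕ) := by exact_mod_cast not_lt.1 hj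
      have h6 : (w₁.length : ℝ) ≤ k := by exact_mod_cast h4
      exact hq.not_gt (lt_cutForm hD h5 (by linarith))
  | overIn k hk =>
    rcases lt_or_ge k w₁.length with h4 | h4
    · have hk1 : (k : ℝ) + 1 ≤ w₁.length := by exact_mod_cast h4
      rw [(h.left k h4).1, (h.left k h4).2]
      exact .core _ _ (.overIn k h4) (boxRegion_of_nonneg (by linarith) le_rfl)
        (boxRegion_of_nonneg (by linarith) zero_le_one)
    · obtain ⟨h5, h6⟩ := hright k hk h4
      exact (hq.not_gt (lt_cutForm hD (by linarith) (by linarith))).elim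
  | overOut k hk =>
    rcases lt_or_ge k w₁.length with h4 | h4
    · have hk1 : (k : ℝ) + 1 ≤ w₁.length := by exact_mod_cast h4
      rw [(h.left k h4).1, (h.left k h4).2]
      exact .core _ _ (.overOut k h4) (boxRegion_of_nonneg (by linarith) zero_le_one)
        (boxRegion_of_nonneg (by linarith) le_rfl)
    · obtain ⟨h5, h6⟩ := hright k hk h4
      exact (hp.not_gt (lt_cutForm hD (by linarith) (by linarith))).elim
  | under k hk =>
    obtain ⟨⟨b1, b2⟩, b3, b4⟩ := ite_bounds w[k].2
    rcases lt_or_ge k w₁.length with h4 | h4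
    · have hk1 : (k : ℝ) + 1 ≤ w₁.length := by exact_mod_cast h4
      rw [(h.left k h4).1, (h.left k h4).2]
      exact .core _ _ (.under k h4) (boxRegion_of_nonneg (by linarith) le_rfl)
        (boxRegion_of_nonneg (by linarith) le_rfl)
    · obtain ⟨h5, h6⟩ := hright k hk h4
      exact (hq.not_gt (lt_cutForm hD (by linarith) (by linarith))).elim
  | down j =>
    refine .down j ?_
    by_contra hj
    have h5 : (m₁ : ℝ) ≤ (j : ℕ) := by exact_mod_cast not_lt.1 hj
    exact hq.not_gt (lt_cutForm hD h5 (by linarith))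
  | back j =>
    refine .back j ?_
    by_contra hj
    have h5 : (m₁ : ℝ) ≤ (j : ℕ) := by exact_mod_cast not_lt.1 hj
    exact hp.not_gt (lt_cutForm hD h5 (by linarith))
  | up j =>
    have hj : (j : ℕ) < m₁ + 1 := by
      by_contra hj
      exact hp.not_gt (lt_cutForm_of_add_one_le hD (hjne j (by omega) (by omega)) (by linarith))
    exact .core _ _ (ClosureEdge.up (w := w₁) ⟨j, hj⟩) (boxRegion_low hl)
      (boxRegion_of_nonneg hl le_rfl)

/-- The possible sources of the edges of a closure. -/
theorem ClosureEdge.source_cases (h : ClosureEdge w p q) :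
    (∃ (j : Fin (m + 1)) (k : ℕ), k ≤ w.length ∧ p = pt (j : ℕ) k 0) ∨
    (∃ (k : ℕ) (hk : k < w.length), p = pt ((w[k].1 : ℕ) + 1 / 2) (k + 1 / 2) 1) ∨
    (∃ j : Fin (m + 1), p = pt (j : ℕ) (w.length + 1) (-1)) ∨
    ∃ j : Fin (m + 1), p = pt (j : ℕ) (-1) (-1) := by
  cases h with
  | straight k hk j => exact Or.inl ⟨j, k, hk.le, rfl⟩
  | overIn k hk =>
    left
    cases w[k].2
    · exact ⟨w[k].1.succ, k, hk.le, by simp⟩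
    · exact ⟨w[k].1.castSucc, k, hk.le, by simp⟩
  | overOut k hk => exact Or.inr (Or.inl ⟨k, hk, rfl⟩)
  | under k hk =>
    left
    cases w[k].2
    · exact ⟨w[k].1.castSucc, k, hk.le, by simp⟩
    · exact ⟨w[k].1.succ, k, hk.le, by simp⟩
  | down j => exact Or.inl ⟨j, _, le_rfl, rfl⟩
  | back j => exact Or.inr (Or.inr (Or.inl ⟨j, rfl⟩))
  | up j => exact Or.inr (Or.inr (Or.inr ⟨j, rfl⟩))

theorem shorten_pad_pt {ℓ b x y z : ℝ} (hb : 0 < b) (hℓ : 0 ≤ ℓ) (h : PadRegion ℓ b (pt x y z)) :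
    shorten ℓ b (pt x y z) =
      AffineMap.lineMap (pt x ℓ 0) (pt x (ℓ + 1) (-1)) ((y - ℓ) / b) := by
  rw [shorten_pad hb hℓ h, lineMap_pt, pt_inj]
  simp only [pt, Matrix.cons_val]
  refine ⟨?_, ?_, ?_⟩ <;> ring

theorem shorten_bottom_pt {ℓ b x y : ℝ} (hb : 0 < b) (hℓ : 0 ≤ ℓ) :
    shorten ℓ b (pt x y (-1)) =
      AffineMap.lineMap (pt x (ℓ + 1) (-1)) (pt x (-1) (-1)) ((ℓ + b - y) / (ℓ + 1 + b)) := by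
  rw [shorten_bottom rfl, lineMap_pt, pt_inj]
  simp only [pt, Matrix.cons_val]
  refine ⟨by ring, ?_, by ring⟩
  field_simp; ring

/-- The left half is the closure of `w₁` in which the strands before the last run on trivially
through the second block, whereas the last strand turns down at the plane. A Δ-move beyond the plane
makes the last strand also reach the far end `A`. After that `shorten` applies uniformly, and the
image is a subdivision of the closure of `w₁`. -/
theorem IsSplit.isotopic_left (h : IsSplit w₁ w) {L : PolygonalLink}
    (hL : L.edges = {e | ClosureEdge w e.1 e.2 ∧
      e ≠ (pt m₁ (w.length + 1) (-1), pt m₁ (-1) (-1)) ∧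
      sideForm w e.1 ≤ sideValue w₁ w ∧ sideForm w e.2 ≤ sideValue w₁ w} ∪
      {(pt m₁ w₁.length (-1), pt m₁ (-1) (-1)), (pt m₁ w₁.length 0, pt m₁ w₁.length (-1))})
    (hle : ∀ v ∈ L.carrier, sideForm w v ≤ sideValue w₁ w)
    (hLf : L.carrier ∩ {v | sideForm w v = sideValue w₁ w} =
      segment ℝ (pt m₁ w₁.length 0) (pt m₁ w₁.length (-1))) : Isotopic (closure w₁) L := by
  have hl : (0 : ℝ) ≤ w₁.length := Nat.cast_nonneg _
  have hl' : (w₁.length : ℝ) ≤ w.length := Nat.cast_le.2 h.length_le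
  have hD : (0 : ℝ) < w.length + 2 := by linarith
  set A := pt m₁ (w.length + 1) (-1) with hA
  set B := pt m₁ (-1) (-1) with hB
  set P := pt m₁ w₁.length 0 with hP
  set H := pt m₁ w₁.length (-1) with hH
  set f := sideForm w with hf
  set c := sideValue w₁ w with hc
  -- The padding together with the descent occupies the levels from `w₁.length` to `w.length + 1`;
  -- it is compressed to length one, the extent of the descent in the closure of `w₁`.
  set b : ℝ := w.length - w₁.length + 1 with hb
  have hb0 : 0 < b := by rw [hb]; linarith
  have hfA : c < f A := lt_cutForm hD le_rfl (by linarith)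
  have hfP : f P = c := cutForm_pt _ _ _ _
  have hfH : f H = c := cutForm_pt _ _ _ _
  have hPH : (P, H) ∈ L.edges := by rw [hL]; simp
  -- replace the edge from `P` to `H` by a detour
  obtain ⟨R, hR, hLR⟩ := exists_deltaMove hPH (r := A) (by
    rw [← hLf]
    rintro x ⟨hx, hxL⟩
    refine ⟨hxL, le_antisymm (hle x hxL) ?_⟩
    have : convexHull ℝ {P, H, A} ⊆ {x | c ≤ f x} := convexHull_min (by
      rintro _ (rfl | rfl | rfl)
      exacts [hfP.ge, hfH.ge, hfA.le]) (convex_halfSpace_ge f.isLinear c)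
    exact this hx) (by
    rw [segment_eq_image_lineMap]
    rintro ⟨s, hs, h1⟩
    rw [hA, hH, hP, lineMap_pt, pt_inj] at h1
    linarith [h1.2.2]) (by
    rw [segment_eq_image_lineMap]
    rintro ⟨s, hs, h1⟩
    rw [hA, hH, hP, lineMap_pt, pt_inj] at h1
    have h2 : s = 1 := by linarith [h1.2.2]
    subst h2
    linarith [h1.2.1])
  have hRe : ∀ e ∈ R.edges, LeftEdge w₁ w.length e.1 e.2 ∨ e = (H, B) ∨ e = (P, A) ∨ e = (A, H) := by
    intro e he
    rw [hR, hL] at he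
    rcases he with ⟨⟨h1, h2, h3, h4⟩ | rfl | rfl, h5⟩ | rfl | rfl
    · exact Or.inl (h.leftEdge h1 h2 h3 h4)
    · simp
    · exact (h5 rfl).elim
    · simp
    · simp
  have hpad : ∀ j k : ℕ, w₁.length ≤ k → k ≤ w.length →
      PadRegion w₁.length b (pt j k 0) := fun j k hk hk' => by
    have h1 : (w₁.length : ℝ) ≤ k := by exact_mod_cast hk
    have h2 : (k : ℝ) ≤ w.length := by exact_mod_cast hk'
    refine padRegion_pt.2 ⟨h1, by linarith, by norm_num, ⟨by norm_num, fun h3 => ?_⟩, fun _ => rfl⟩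
    linarith
  have hpad' : ∀ j : ℕ, PadRegion w₁.length b (pt j (w.length + 1) (-1)) := fun j => by
    refine padRegion_pt.2 ⟨by linarith, by linarith, le_rfl, ⟨fun _ => by linarith, fun _ => rfl⟩,
      fun h3 => ?_⟩
    linarith
  have hPpad : PadRegion w₁.length b P := hpad m₁ _ le_rfl h.length_le
  have hApad : PadRegion w₁.length b A := hpad' m₁
  have hpad1 : ∀ j k : ℕ, w₁.length ≤ k → k < w.length →
      PadRegion w₁.length b (pt j (k + 1) 0) := fun j k hk hk' => by
    have := hpad j (k + 1) (by omega) (by omega)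
    rwa [Nat.cast_add_one] at this
  -- The strands before the last stay at height zero up to level `w.length` and then descend with
  -- slope `-1`; the last strand descends along a single straight edge from `P` to `A`.
  obtain ⟨ζ, hζ₁, hζ₂⟩ : ∃ ζ : ℝ → ℝ → ℝ,
      (∀ x y : ℝ, x ≠ (m₁ : ℝ) → ζ x y = min 0 (w.length - y)) ∧
      ∀ y : ℝ, ζ m₁ y = -(y - w₁.length) / b :=
    ⟨fun x y => if x = m₁ then -(y - w₁.length) / b else min 0 (w.length - y),
      fun x y h => if_neg h, fun y => if_pos rfl⟩
  obtain ⟨R', hR', hRR'⟩ := isotopic_shorten (R := R) hb0 hl (by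
    intro e he
    rcases hRe e he with h1 | rfl | rfl | rfl
    · obtain ⟨p, q⟩ := e
      cases h1 with
      | core _ _ h2 h3 h4 => exact Or.inl ⟨h3, h4⟩
      | straight j k hj hk hk' => exact Or.inr (Or.inl ⟨hpad j k hk hk'.le, hpad1 j k hk hk'⟩)
      | down j hj => exact Or.inr (Or.inl ⟨hpad j _ h.length_le le_rfl, hpad' j⟩)
      | back j hj => exact Or.inr (Or.inr ⟨rfl, rfl⟩)
    · exact Or.inr (Or.inr ⟨rfl, rfl⟩)
    · exact Or.inr (Or.inl ⟨hPpad, hApad⟩)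
    · exact Or.inr (Or.inr ⟨rfl, rfl⟩))
    (ζ := ζ) (by
    intro v hv hv1 hv2
    obtain ⟨e, he, hve⟩ := mem_carrier.1 hv
    rw [segment_eq_image_lineMap] at hve
    obtain ⟨s, hs, rfl⟩ := hve
    have hjne : ∀ j : ℕ, j < m₁ → (1 - s) * (j : ℝ) + s * j ≠ m₁ := fun j hj h1 => by
      have h2 : (j : ℝ) = m₁ := by linarith
      exact hj.ne (by exact_mod_cast h2)
    have hval : ∀ x y z x' y' z' : ℝ,
        (1 - s) * z + s * z' = ζ ((1 - s) * x + s * x') ((1 - s) * y + s * y') →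
        (AffineMap.lineMap (pt x y z) (pt x' y' z') s : Space) 2 =
          ζ ((AffineMap.lineMap (pt x y z) (pt x' y' z') s : Space) 0)
            ((AffineMap.lineMap (pt x y z) (pt x' y' z') s : Space) 1) := by
      intro x y z x' y' z' h1
      rw [lineMap_coord, lineMap_coord, lineMap_coord]
      exact h1
    have hbot : ∀ x y x' y' : ℝ,
        ¬ -1 < (AffineMap.lineMap (pt x y (-1)) (pt x' y' (-1)) s : Space) 2 := by
      intro x y x' y' h1
      rw [lineMap_coord] at h1
      change -1 < (1 - s) * (-1) + s * (-1) at h1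
      linarith
    rcases hRe e he with h1 | rfl | rfl | rfl
    · obtain ⟨p, q⟩ := e
      cases h1 with
      | core _ _ h2 h3 h4 => exact (hv1.not_ge (h3.lineMap h4 hs).1).elim
      | straight j k hj hk hk' =>
        have h2 : (k : ℝ) + 1 ≤ w.length := by exact_mod_cast hk'
        refine hval j k 0 j (k + 1) 0 ?_
        rw [hζ₁ _ _ (hjne j hj), min_eq_left]
        · ring
        · linarith [hs.2]
      | down j hj =>
        refine hval j w.length 0 j (w.length + 1) (-1) ?_
        rw [hζ₁ _ _ (hjne j hj), min_eq_right]
        · ring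
        · linarith [hs.1]
      | back j hj => exact (hbot _ _ _ _ hv2).elim
    · exact (hbot _ _ _ _ hv2).elim
    · refine hval m₁ w₁.length 0 m₁ (w.length + 1) (-1) ?_
      rw [show (1 - s) * (m₁ : ℝ) + s * m₁ = m₁ by ring, hζ₂]
      field_simp
      rw [hb]; ring
    · exact (hbot _ _ _ _ hv2).elim)
  -- The padding and descent of a strand together become parts of one descending edge, and the
  -- pieces on the bottom become parts of one returning edge. The low far vertices of the closure of
  -- `w₁` are the images of those at level `w.length + 1`.
  refine Isotopic.trans (isotopic_of_refines ?_ ?_) (hLR.isotopic.trans hRR').symm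
  · rw [hR']
    rintro _ ⟨e, he, rfl⟩
    have hdown : ∀ j : ℕ, j < m₁ + 1 → (pt j w₁.length 0, pt j (w₁.length + 1) (-1)) ∈
        (closure w₁).edges := fun j hj => ClosureEdge.down (w := w₁) ⟨j, hj⟩
    have hback : ∀ j : ℕ, j < m₁ + 1 → (pt j (w₁.length + 1) (-1), pt j (-1) (-1)) ∈
        (closure w₁).edges := fun j hj => ClosureEdge.back (w := w₁) ⟨j, hj⟩
    have hpp : ∀ (j : ℕ) (y z y' z' : ℝ), j < m₁ + 1 → PadRegion w₁.length b (pt j y z) →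
        PadRegion w₁.length b (pt j y' z') → y < y' → ∃ g ∈ (closure w₁).edges, ∃ s t : ℝ, 0 ≤ s ∧
        s < t ∧ t ≤ 1 ∧ shorten w₁.length b (pt j y z) = AffineMap.lineMap g.1 g.2 s ∧
        shorten w₁.length b (pt j y' z') = AffineMap.lineMap g.1 g.2 t :=
      fun j y z y' z' hj h1 h2 h3 => ⟨_, hdown j hj, (y - w₁.length) / b, (y' - w₁.length) / b,
        div_nonneg (sub_nonneg.2 h1.1) hb0.le, by gcongr,
        (div_le_one hb0).2 (by have : y' ≤ w₁.length + b := h2.2.1; linarith),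
        shorten_pad_pt hb0 hl h1, shorten_pad_pt hb0 hl h2⟩
    have hbb : ∀ (j : ℕ) (y y' : ℝ), j < m₁ + 1 → y' < y → y ≤ w₁.length + b → -1 ≤ y' →
        ∃ g ∈ (closure w₁).edges, ∃ s t : ℝ, 0 ≤ s ∧
        s < t ∧ t ≤ 1 ∧ shorten w₁.length b (pt j y (-1)) = AffineMap.lineMap g.1 g.2 s ∧
        shorten w₁.length b (pt j y' (-1)) = AffineMap.lineMap g.1 g.2 t :=
      fun j y y' hj h1 h2 h3 => ⟨_, hback j hj, (w₁.length + b - y) / (w₁.length + 1 + b),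
        (w₁.length + b - y') / (w₁.length + 1 + b), div_nonneg (by linarith) (by linarith),
        by gcongr, (div_le_one (by linarith)).2 (by linarith),
        shorten_bottom_pt hb0 hl, shorten_bottom_pt hb0 hl⟩
    simp only [Prod.map_fst, Prod.map_snd]
    rcases hRe e he with h1 | rfl | rfl | rfl
    · obtain ⟨p, q⟩ := e
      cases h1 with
      | core _ _ h2 h3 h4 =>
        exact ⟨_, h2, 0, 1, le_rfl, one_pos, le_rfl, by rw [shorten_box h3]; simp,
          by rw [shorten_box h4]; simp⟩
      | straight j k hj hk hk' =>
        exact hpp j _ _ _ _ (by omega) (hpad j k hk hk'.le) (hpad1 j k hk hk') (by linarith)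
      | down j hj =>
        exact hpp j _ _ _ _ (by omega) (hpad j _ h.length_le le_rfl) (hpad' j) (by linarith)
      | back j hj => exact hbb j _ _ (by omega) (by linarith) (by linarith) le_rfl
    · exact hbb m₁ _ _ (by omega) (by linarith) (by linarith) le_rfl
    · exact hpp m₁ _ _ _ _ (by omega) hPpad hApad (by linarith)
    · exact hbb m₁ _ _ (by omega) (by linarith) (by linarith) (by linarith)
  · rintro _ ⟨⟨p, q⟩, hpq, rfl⟩
    have hRv : ∀ v ∈ R.verts, shorten w₁.length b v ∈ R'.verts := by
      rintro _ ⟨e, he, rfl⟩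
      exact ⟨_, hR' ▸ mem_image_of_mem _ he, rfl⟩
    have hCv : ∀ v v', ClosureEdge w v v' → f v < c → v ∈ R.verts := fun v v' h1 h2 => by
      have h3 : (v, v') ≠ (A, B) := fun h3 => by
        rw [show v = A from congrArg Prod.fst h3] at h2; linarith
      refine ⟨(v, v'), ?_, rfl⟩
      rw [hR, hL]
      refine Or.inl ⟨Or.inl ⟨h1, h3, h2.le, ?_⟩, fun h4 => ?_⟩
      · rcases h.edge_side h1 h3 with h4 | ⟨h4 | h4, -⟩
        · exact h4.2
        · rw [h4] at h2; exact (hfP.not_lt h2).elim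
        · exact (h4.not_gt h2).elim
      · rw [show v = P from congrArg Prod.fst h4] at h2; linarith
    have hPv : P ∈ R.verts := ⟨(P, A), by simp [hR], rfl⟩
    have hAv : A ∈ R.verts := ⟨(A, H), by simp [hR], rfl⟩
    have hjm : ∀ j : Fin (m₁ + 1), (j : ℕ) < m + 1 := fun j => by have := h.le; omega
    have hjl : ∀ j : Fin (m₁ + 1), (j : ℕ) ≠ m₁ → ((j : ℕ) : ℝ) ≤ m₁ - 1 := fun j hj => by
      have h1 : (j : ℕ) + 1 ≤ m₁ := by omega
      have : ((j : ℕ) : ℝ) + 1 ≤ m₁ := by exact_mod_cast h1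
      linarith
    have hbox : ∀ v, BoxRegion w₁.length v → v ∈ R.verts → v ∈ R'.verts := fun v h1 h2 => by
      rw [← shorten_box (b := b) h1]; exact hRv v h2
    rcases ClosureEdge.source_cases hpq with ⟨j, k, hk, h1⟩ | ⟨k, hk, h1⟩ | ⟨j, h1⟩ | ⟨j, h1⟩ <;>
      simp only at h1 ⊢ <;> rw [h1]
    · have hk1 : (k : ℝ) ≤ w₁.length := by exact_mod_cast hk
      refine hbox _ (boxRegion_of_nonneg hk1 le_rfl) ?_
      obtain ⟨v', hv'⟩ := exists_closureEdge w k (hk.trans h.length_le) ⟨j, hjm j⟩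
      by_cases hj : (j : ℕ) = m₁
      · rcases hk.eq_or_lt with hk2 | hk2
        · rw [hj, hk2]; exact hPv
        · exact hCv _ _ hv' (cutForm_lt hD (by simp [hj]) (by exact_mod_cast hk2))
      · exact hCv _ _ hv' (cutForm_lt_of_le_sub_one hD (hjl j hj) (by linarith))
    · have hk1 : (k : ℝ) + 1 ≤ w₁.length := by exact_mod_cast hk
      refine hbox _ (boxRegion_of_nonneg (by linarith) zero_le_one) ?_
      have h3 := ClosureEdge.overOut (w := w) k (hk.trans_le h.length_le)
      have h4 : ((w₁[k].1 : ℕ) : ℝ) + 1 ≤ m₁ := by exact_mod_cast (w₁[k].1).isLt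
      rw [← (h.left k hk).1] at h4 ⊢
      exact hCv _ _ h3 (cutForm_lt hD (by linarith) (by linarith))
    · have h2 : pt (j : ℕ) (w.length + 1) (-1) ∈ R.verts := by
        by_cases hj : (j : ℕ) = m₁
        · rw [hj]; exact hAv
        · exact hCv _ _ (ClosureEdge.back (w := w) ⟨j, hjm j⟩)
            (cutForm_lt_of_le_sub_one hD (hjl j hj) (by linarith))
      have h3 := hRv _ h2
      rw [shorten_bottom_pt hb0 hl] at h3
      have h4 : (w₁.length + b - (w.length + 1)) / (w₁.length + 1 + b) = 0 := by
        rw [hb, div_eq_zero_iff]; left; ring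
      rwa [h4, AffineMap.lineMap_apply_zero] at h3
    · refine hbox _ (boxRegion_low hl) (hCv _ _ (ClosureEdge.up (w := w) ⟨j, hjm j⟩) ?_)
      have h3 : ((j : ℕ) : ℝ) ≤ m₁ := by exact_mod_cast Nat.lt_succ_iff.1 j.isLt
      exact cutForm_lt hD h3 (by linarith)

end Braid

end

section

open Set

/-! ### The closure of a split word is a connected sum -/

namespace Braid

open PolygonalLink

variable {m m₁ m₂ : ℕ} {w₁ : ArtinWord m₁} {w : ArtinWord m} {p q : Space}

/-- The word read backwards with the strands numbered from right to left. -/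
def rotate (w : ArtinWord m) : ArtinWord m := (w.map fun a => (a.1.rev, a.2)).reverse

@[simp] theorem length_rotate (w : ArtinWord m) : (rotate w).length = w.length := by
  simp [rotate]

theorem rotate_rotate (w : ArtinWord m) : rotate (rotate w) = w := by
  simp [rotate, List.map_reverse, Function.comp_def]

theorem getElem_rotate (w : ArtinWord m) {k l : ℕ} (h : k + l + 1 = w.length) :
    (rotate w)[k]'(by rw [length_rotate]; omega) = ((w[l]).1.rev, (w[l]).2) := by
  have h1 : w.length - 1 - k = l := by omega
  simp [rotate, List.getElem_reverse, h1]

/-- The half-turn of space that maps the box `[0, a] × [0, b]` in the horizontal plane to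
itself. -/
noncomputable def halfTurn (a b : ℝ) (v : Space) : Space := pt (a - v 0) (b - v 1) (v 2)

variable {a b x y z : ℝ}

theorem halfTurn_pt : halfTurn a b (pt x y z) = pt (a - x) (b - y) z := rfl

theorem halfTurn_halfTurn (v : Space) : halfTurn a b (halfTurn a b v) = v := by
  conv_rhs => rw [← pt_eta v]
  rw [halfTurn, pt_inj]
  exact ⟨sub_sub_cancel _ _, sub_sub_cancel _ _, rfl⟩

theorem halfTurn_eq_iff {v u : Space} : halfTurn a b v = u ↔ v = halfTurn a b u :=
  ⟨fun h => by rw [← h, halfTurn_halfTurn], fun h => by rw [h, halfTurn_halfTurn]⟩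

theorem halfTurn_eq (v : Space) :
    halfTurn a b v = (Matrix.diagonal ![-1, -1, 1]).mulVec v + pt a b 0 := by
  ext i
  rw [Pi.add_apply, Matrix.mulVec_diagonal]
  fin_cases i <;> simp [halfTurn, pt] <;> ring

/-- A half-turn has determinant `1`, so its effect on a link is an isotopy. The reversal is included
because a half-turn about a vertical axis makes the strands of a braid run backwards. -/
theorem exists_isotopic_halfTurn (L : PolygonalLink) (a b : ℝ) : ∃ L' : PolygonalLink,
    (∀ p q, (p, q) ∈ L'.edges ↔ (halfTurn a b q, halfTurn a b p) ∈ L.edges) ∧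
      L'.carrier = halfTurn a b '' L.carrier ∧ Isotopic L.reverse L' := by
  have hseg : ∀ x y : Space,
      halfTurn a b '' segment ℝ x y = segment ℝ (halfTurn a b x) (halfTurn a b y) := fun x y => by
    refine image_segment_of_forall fun s _ => ?_
    simp only [halfTurn, lineMap_pt, lineMap_coord, pt_inj]
    exact ⟨by ring, by ring, trivial⟩
  obtain ⟨L', hL', hc⟩ := exists_map L.reverse (halfTurn a b)
    ((Function.LeftInverse.injective halfTurn_halfTurn).injOn) fun e _ => hseg e.1 e.2
  refine ⟨L', fun p q => ?_, by rw [hc, reverse_carrier], ?_⟩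
  · rw [hL', ← mem_reverse_edges]
    constructor
    · rintro ⟨⟨x, y⟩, h, h'⟩
      obtain ⟨rfl, rfl⟩ := Prod.mk.inj h'
      rwa [halfTurn_halfTurn, halfTurn_halfTurn]
    · intro h
      exact ⟨_, h, by rw [Prod.map_apply, halfTurn_halfTurn, halfTurn_halfTurn]⟩
  · refine IsPlaneSum.isotopic_of_affine (Φ := Matrix.diagonal ![-1, -1, 1]) ?_ halfTurn_eq hL'
    simp [Matrix.det_diagonal, Fin.prod_univ_three]

/-- Heights are kept, so an upper strand remains the upper one, and the half-turn followed by
reversal preserves the slope of every crossing strand. Hence the signs of the letters do not change,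
and the rising and falling halves of an upper strand are exchanged. -/
theorem ClosureEdge.rotate (h : ClosureEdge w p q) :
    ClosureEdge (Braid.rotate w) (halfTurn m w.length q) (halfTurn m w.length p) := by
  have hrev : ∀ j : Fin (m + 1), ((j.rev : ℕ) : ℝ) = m - (j : ℕ) := fun j => by
    rw [Fin.val_rev, Nat.cast_sub (by omega)]; push_cast; ring
  have hrev' : ∀ i : Fin m, ((i.rev : ℕ) : ℝ) = m - ((i : ℕ) + 1) := fun i => by
    rw [Fin.val_rev, Nat.cast_sub (by omega)]; push_cast; ring
  have hlen : ∀ k l : ℕ, l + k + 1 = w.length → (w.length : ℝ) = l + k + 1 := fun k l h => by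
    rw [← h]; push_cast; ring
  have hl : ∀ k, k < w.length → ∃ l, l + k + 1 = w.length := fun k hk =>
    ⟨w.length - 1 - k, by omega⟩
  have hite : ∀ b : Bool, (if b then 0 else 1 : ℝ) = 1 - if b then 1 else 0 := fun b => by
    cases b <;> simp
  cases h with
  | straight k hk j h₁ h₂ =>
    obtain ⟨l, hl⟩ := hl k hk
    have hk' : l < (Braid.rotate w).length := by rw [length_rotate]; omega
    have := ClosureEdge.straight (w := Braid.rotate w) l hk' j.rev
      (by
        rw [getElem_rotate w hl, Ne, ← Fin.rev_succ, Fin.rev_inj]; exact h₂)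
      (by
        rw [getElem_rotate w hl, Ne, ← Fin.rev_castSucc, Fin.rev_inj]; exact h₁)
    convert this using 1 <;> rw [halfTurn_pt, pt_inj, hrev, hlen k l hl] <;>
      refine ⟨?_, ?_, ?_⟩ <;> ring
  | overIn k hk =>
    obtain ⟨l, hl⟩ := hl k hk
    have hk' : l < (Braid.rotate w).length := by rw [length_rotate]; omega
    have := ClosureEdge.overOut (w := Braid.rotate w) l hk'
    rw [getElem_rotate w hl] at this
    simp only at this
    convert this using 1 <;> rw [halfTurn_pt, pt_inj, hrev', hlen k l hl] <;>
      refine ⟨?_, ?_, ?_⟩ <;> (try rw [hite]) <;> ring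
  | overOut k hk =>
    obtain ⟨l, hl⟩ := hl k hk
    have hk' : l < (Braid.rotate w).length := by rw [length_rotate]; omega
    have := ClosureEdge.overIn (w := Braid.rotate w) l hk'
    rw [getElem_rotate w hl] at this
    simp only at this
    convert this using 1 <;> rw [halfTurn_pt, pt_inj, hrev', hlen k l hl] <;>
      refine ⟨?_, ?_, ?_⟩ <;> (try rw [hite]) <;> ring
  | under k hk =>
    obtain ⟨l, hl⟩ := hl k hk
    have hk' : l < (Braid.rotate w).length := by rw [length_rotate]; omega
    have := ClosureEdge.under (w := Braid.rotate w) l hk'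
    rw [getElem_rotate w hl] at this
    simp only at this
    convert this using 1 <;> rw [halfTurn_pt, pt_inj, hrev', hlen k l hl] <;>
      refine ⟨?_, ?_, ?_⟩ <;> (try rw [hite]) <;> ring
  | down j =>
    convert ClosureEdge.up (w := Braid.rotate w) j.rev using 1 <;>
      rw [halfTurn_pt, pt_inj, hrev] <;> refine ⟨?_, ?_, ?_⟩ <;> ring
  | back j =>
    convert ClosureEdge.back (w := Braid.rotate w) j.rev using 1 <;>
      rw [halfTurn_pt, pt_inj, hrev] <;> (try rw [length_rotate]) <;> refine ⟨?_, ?_, ?_⟩ <;> ring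
  | up j =>
    convert ClosureEdge.down (w := Braid.rotate w) j.rev using 1 <;>
      rw [halfTurn_pt, pt_inj, hrev] <;> (try rw [length_rotate]) <;> refine ⟨?_, ?_, ?_⟩ <;> ring

theorem closureEdge_rotate_iff : ClosureEdge (rotate w) p q ↔
    ClosureEdge w (halfTurn m w.length q) (halfTurn m w.length p) := by
  constructor
  · intro h
    have := h.rotate
    rwa [rotate_rotate, length_rotate] at this
  · intro h
    have := h.rotate
    rwa [halfTurn_halfTurn, halfTurn_halfTurn] at this

theorem isotopic_closure_rotate (w : ArtinWord m) :
    Isotopic (closure w).reverse (closure (rotate w)) := by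
  obtain ⟨L', h1, -, h2⟩ := exists_isotopic_halfTurn (closure w) m w.length
  refine h2.trans (.of_edges_eq ?_)
  ext ⟨p, q⟩
  rw [h1]
  exact closureEdge_rotate_iff.symm

/-- The link closure of a word that splits into words on the first and last strands is a connected
sum. -/
theorem IsSplit.isConnectedSum {w₂ : ArtinWord m₂} (h₁ : IsSplit w₁ w)
    (h₂ : IsSplit (rotate w₂) (rotate w)) (hm : m₁ + m₂ = m)
    (hl : w₁.length + w₂.length = w.length) :
    IsConnectedSum (closure w₁) (closure w₂) (closure w) := by
  obtain ⟨C, L₁, L₂, hC, hL₁, hL₂, hs⟩ := h₁.exists_cut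
  refine isConnectedSum_iff.2 ⟨L₁, L₂, C, h₁.isotopic_left hL₁ hs.le hs.inter_left, ?_, hC,
    _, _, _, _, hs⟩
  -- The half-turn interchanges the two sides of the cutting plane, so the turned right half is the
  -- left half in the picture of the rotated word, and `isotopic_left` can be reused.
  obtain ⟨L', hL', hc, hi⟩ := exists_isotopic_halfTurn L₂ m w.length
  have hmR : (m : ℝ) = m₁ + m₂ := by rw [← hm]; push_cast; ring
  have hlR : (w.length : ℝ) = w₁.length + w₂.length := by rw [← hl]; push_cast; ring
  have hside : ∀ v, sideForm (rotate w) (halfTurn m w.length v) -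
      sideValue (rotate w₂) (rotate w) = sideValue w₁ w - sideForm w v := fun v => by
    rw [sideForm, sideForm, sideValue, sideValue, length_rotate, length_rotate, halfTurn,
      cutForm_pt, cutForm_apply, hmR, hlR]
    ring
  have hside' : ∀ v, sideForm (rotate w) v ≤ sideValue (rotate w₂) (rotate w) ↔
      sideValue w₁ w ≤ sideForm w (halfTurn m w.length v) := fun v => by
    have := hside (halfTurn m w.length v)
    rw [halfTurn_halfTurn] at this
    constructor <;> intro <;> linarith
  have hA : halfTurn m w.length (pt m₂ (-1) (-1)) = pt m₁ (w.length + 1) (-1) := by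
    rw [halfTurn_pt, pt_inj, hmR]; exact ⟨by ring, by ring, rfl⟩
  have hB : halfTurn m w.length (pt m₂ (w.length + 1) (-1)) = pt m₁ (-1) (-1) := by
    rw [halfTurn_pt, pt_inj, hmR]; exact ⟨by ring, by ring, rfl⟩
  have hP : ∀ z, halfTurn m w.length (pt m₂ w₂.length z) = pt m₁ w₁.length z := fun z => by
    rw [halfTurn_pt, pt_inj, hmR, hlR]; exact ⟨by ring, by ring, rfl⟩
  have key : Isotopic (closure (rotate w₂)) L' := by
    refine h₂.isotopic_left ?_ ?_ ?_
    · ext ⟨p, q⟩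
      rw [hL', hL₂]
      simp only [mem_union, mem_ofPred_eq, closureEdge_rotate_iff, hside', mem_insert_iff,
        mem_singleton_iff, Prod.mk.injEq, ne_eq, length_rotate, halfTurn_eq_iff,
        ← hA, ← hB, ← hP]
      simp only [halfTurn_halfTurn]
      tauto
    · rw [hc]
      rintro _ ⟨v, hv, rfl⟩
      rw [hside', halfTurn_halfTurn]
      exact hs.ge v hv
    · have : segment ℝ (pt m₂ (rotate w₂).length 0) (pt m₂ (rotate w₂).length (-1)) =
          halfTurn m w.length '' segment ℝ (pt m₁ w₁.length 0) (pt m₁ w₁.length (-1)) := by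
        rw [image_segment_of_forall, ← hP, ← hP, halfTurn_halfTurn, halfTurn_halfTurn,
          length_rotate]
        intro s _
        simp only [halfTurn, lineMap_pt, lineMap_coord, pt_inj]
        exact ⟨by ring, by ring, trivial⟩
      rw [this, hc, ← hs.inter_right]
      ext v
      constructor
      · rintro ⟨⟨u, hu, rfl⟩, hv⟩
        refine ⟨u, ⟨hu, ?_⟩, rfl⟩
        have := hside u
        simp only [mem_ofPred_eq] at hv ⊢
        linarith
      · rintro ⟨u, ⟨hu, hv⟩, rfl⟩
        refine ⟨⟨u, hu, rfl⟩, ?_⟩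
        have := hside u
        simp only [mem_ofPred_eq] at hv ⊢
        linarith
  have := ((isotopic_closure_rotate w₂).trans (key.trans hi.symm)).reverse
  rwa [reverse_reverse, reverse_reverse] at this

end Braid

end

section


/-! ### Shifting words to other strands -/

namespace Braid

open PolygonalLink

variable {m n m₁ m₂ : ℕ}

section shift

variable {c : ℕ} (f : Fin m → Fin n) (hf : ∀ i, (f i : ℕ) = c + i)

theorem lift_σ_eq_one (f : Fin m → Fin n) (hf : ∀ i, (f i : ℕ) = c + i) (r : FreeGroup (Fin m)) (hr : r ∈ {x | ArtinRel m x}) :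
    FreeGroup.lift (fun i => (σ (f i) : Braid n)) r = 1 := by
  have key : ∀ s ∈ {x | ArtinRel n x}, PresentedGroup.mk {x | ArtinRel n x} s = 1 :=
    fun s hs => PresentedGroup.one_of_mem hs
  cases hr with
  | far i j h =>
    have := key _ (ArtinRel.far (f i) (f j) (by rw [hf, hf]; omega))
    simp only [map_mul, map_inv, FreeGroup.lift_apply_of] at this ⊢
    exact this
  | braid i j h =>
    have := key _ (ArtinRel.braid (f i) (f j) (by rw [hf, hf]; omega))
    simp only [map_mul, map_inv, FreeGroup.lift_apply_of] at this ⊢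
    exact this

/-- The homomorphism of braid groups that shifts the generators. -/
def shift : Braid m →* Braid n := PresentedGroup.toGroup (lift_σ_eq_one f hf)

@[simp] theorem shift_σ (i : Fin m) : shift f hf (σ i) = σ (f i) := PresentedGroup.toGroup.of _

theorem ofArtinWord_map (w : ArtinWord m) :
    ofArtinWord (w.map fun a => (f a.1, a.2)) = shift f hf (ofArtinWord w) := by
  unfold ofArtinWord
  rw [map_list_prod, List.map_map, List.map_map]
  congr 2
  funext a
  simp only [Function.comp_apply]
  split_ifs <;> simp

theorem shift_band {g : Fin (m + 1) → Fin (n + 1)} (hg : ∀ i, (g i : ℕ) = c + i)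
    (i j : Fin (m + 1)) (h : i < j) (h' : g i < g j) :
    shift f hf (band i j h) = band (g i) (g j) h' := by
  -- Both lists are strictly increasing, so it suffices to compare their members.
  have hfil : (((List.finRange m).filter fun k : Fin m => (i : ℕ) ≤ k ∧ (k : ℕ) + 2 ≤ j).map f) =
      (List.finRange n).filter fun k : Fin n => (g i : ℕ) ≤ k ∧ (k : ℕ) + 2 ≤ g j := by
    refine List.Pairwise.eq_of_mem_iff (r := (· < ·)) ?_ ?_ fun k => ?_
    · rw [List.pairwise_map]
      refine ((List.pairwise_lt_finRange m).filter _).imp fun {a b} hab => ?_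
      rw [Fin.lt_def, hf, hf]
      exact Nat.add_lt_add_left hab c
    · exact (List.pairwise_lt_finRange n).filter _
    · simp only [List.mem_map, List.mem_filter, List.mem_finRange, true_and, decide_eq_true_eq, hg]
      constructor
      · rintro ⟨a, ha, rfl⟩
        rw [hf]; omega
      · rintro ⟨h1, h2⟩
        have hj := j.isLt
        refine ⟨⟨k - c, by omega⟩, ⟨?_, ?_⟩, Fin.ext ?_⟩
        · simp only; omega
        · simp only; omega
        · rw [hf]; simp only; omega
  have hlast : f ⟨(j : ℕ) - 1, by have := j.isLt; have : (i : ℕ) < j := h; omega⟩ =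
      ⟨(g j : ℕ) - 1, by have := (g j).isLt; have : (g i : ℕ) < g j := h'; omega⟩ := by
    refine Fin.ext ?_
    have : (i : ℕ) < j := h
    have h1 := hg j
    rw [hf]
    change c + ((j : ℕ) - 1) = (g j : ℕ) - 1
    omega
  simp only [band, map_mul, map_inv, map_list_prod, List.map_map, shift_σ]
  rw [← hlast, ← hfil, List.map_map]
  congr 3

/-- The shifted letter. -/
def BandLetter.shift {g : Fin (m + 1) → Fin (n + 1)} (hg : ∀ i, (g i : ℕ) = c + i)
    (a : BandLetter m) : BandLetter n :=
  ⟨g a.i, g a.j, by rw [Fin.lt_def, hg, hg]; exact Nat.add_lt_add_left a.lt c, a.positive⟩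

theorem ofBandWord_map {g : Fin (m + 1) → Fin (n + 1)} (hg : ∀ i, (g i : ℕ) = c + i)
    (w : List (BandLetter m)) :
    ofBandWord (w.map (BandLetter.shift hg)) = shift f hf (ofBandWord w) := by
  unfold ofBandWord
  rw [map_list_prod, List.map_map, List.map_map]
  congr 2
  funext a
  have h' := (a.shift hg).lt
  simp only [Function.comp_apply, BandLetter.shift, apply_ite (Braid.shift f hf), map_inv,
    shift_band f hf hg a.i a.j a.lt h']
  rfl

end shift

theorem isSplit_append {w₁ : ArtinWord m₁} {u v : ArtinWord m} (hm : m₁ ≤ m)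
    (hu : u.map (fun a => ((a.1 : ℕ), a.2)) = w₁.map fun a => ((a.1 : ℕ), a.2))
    (hv : ∀ a ∈ v, m₁ ≤ (a.1 : ℕ)) : IsSplit w₁ (u ++ v) := by
  have hl : u.length = w₁.length := by simpa using congrArg List.length hu
  refine ⟨hm, by simp [hl], fun k hk => ?_, fun k hk hk' => ?_⟩
  · have hk' : k < u.length := hl ▸ hk
    have h1 : (u.map fun a => ((a.1 : ℕ), a.2))[k]'(by simpa using hk') =
      (w₁.map fun a => ((a.1 : ℕ), a.2))[k]'(by simpa using hk) := by simp only [hu]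
    rw [List.getElem_map, List.getElem_map] at h1
    rw [List.getElem_append_left hk']
    exact Prod.mk.inj h1
  · rw [List.getElem_append_right (hl ▸ hk')]
    exact hv _ (List.getElem_mem _)

/-- Read backwards from right to left, the concatenation begins with the rotated second word, so the
splitting condition holds from both ends. -/
theorem isConnectedSum_closure_append (w₁ : ArtinWord m₁) (w₂ : ArtinWord m₂) :
    IsConnectedSum (closure w₁) (closure w₂) (closure
      (w₁.map (fun a => (Fin.castAdd m₂ a.1, a.2)) ++
        w₂.map fun a => (Fin.natAdd m₁ a.1, a.2))) := by
  refine IsSplit.isConnectedSum (isSplit_append (Nat.le_add_right _ _) ?_ ?_) ?_ rfl (by simp)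
  · simp
  · intro a ha
    obtain ⟨b, -, rfl⟩ := List.mem_map.1 ha
    exact Nat.le_add_right _ _
  · rw [rotate.eq_def (_ ++ _), List.map_append, List.reverse_append]
    refine isSplit_append (Nat.le_add_left _ _) ?_ ?_
    · simp only [rotate, List.map_reverse, List.map_map]
      congr 2
      funext a
      simp only [Function.comp_apply, Fin.val_rev, Fin.val_natAdd, Prod.mk.injEq, and_true]
      omega
    · intro a ha
      simp only [List.mem_reverse, List.mem_map, exists_exists_and_eq_and] at ha
      obtain ⟨b, -, rfl⟩ := ha
      have := b.1.isLt
      simp only [Fin.val_rev, Fin.val_castAdd]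
      omega

end Braid

end

section


/-! ### Vertex sums of espaliers -/

section vertexSum

variable {m₁ m₂ : ℕ} {T₁ : SimpleGraph (Fin (m₁ + 1))} {T₂ : SimpleGraph (Fin (m₂ + 1))}

/-- The inclusion of the vertices of the first summand. -/
def sumLeft (m₂ : ℕ) (i : Fin (m₁ + 1)) : Fin (m₁ + m₂ + 1) := ⟨i, by omega⟩

/-- The inclusion of the vertices of the second summand. -/
def sumRight (m₁ : ℕ) (i : Fin (m₂ + 1)) : Fin (m₁ + m₂ + 1) := ⟨m₁ + i, by omega⟩

theorem val_sumLeft (i : Fin (m₁ + 1)) : (sumLeft m₂ i : ℕ) = 0 + i := (Nat.zero_add _).symm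

theorem val_sumRight (i : Fin (m₂ + 1)) : (sumRight m₁ i : ℕ) = m₁ + i := rfl

theorem sumLeft_injective : Function.Injective (sumLeft (m₁ := m₁) m₂) := fun _ _ h =>
  Fin.ext (Fin.mk.inj h)

theorem sumRight_injective : Function.Injective (sumRight (m₂ := m₂) m₁) := fun _ _ h =>
  Fin.ext (Nat.add_left_cancel (congrArg Fin.val h))

theorem vertexSum_adj {i j : Fin (m₁ + m₂ + 1)} : (vertexSum T₁ T₂).Adj i j ↔
    (∃ a b, T₁.Adj a b ∧ sumLeft m₂ a = i ∧ sumLeft m₂ b = j) ∨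
      ∃ a b, T₂.Adj a b ∧ sumRight m₁ a = i ∧ sumRight m₁ b = j := by
  rw [vertexSum, SimpleGraph.sup_adj, SimpleGraph.map_adj, SimpleGraph.map_adj]
  rfl

theorem eq_sumLeft_or_sumRight (v : Fin (m₁ + m₂ + 1)) :
    (∃ a, sumLeft m₂ a = v) ∨ ∃ a, sumRight m₁ a = v := by
  rcases le_total (v : ℕ) m₁ with h | h
  · exact Or.inl ⟨⟨v, by omega⟩, rfl⟩
  · exact Or.inr ⟨⟨v - m₁, by omega⟩, Fin.ext (Nat.add_sub_cancel' h)⟩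

/-- Every vertex is connected with the shared one. The edges number at most as many as those of the
two trees together, which is the least a connected graph on `m₁ + m₂ + 1` vertices can have. -/
theorem vertexSum_isTree (h₁ : T₁.IsTree) (h₂ : T₂.IsTree) : (vertexSum T₁ T₂).IsTree := by
  have hconn : (vertexSum T₁ T₂).Connected := by
    let f : T₁ →g vertexSum T₁ T₂ :=
      ⟨sumLeft m₂, fun h => vertexSum_adj.2 (Or.inl ⟨_, _, h, rfl, rfl⟩)⟩
    let g : T₂ →g vertexSum T₁ T₂ :=
      ⟨sumRight m₁, fun h => vertexSum_adj.2 (Or.inr ⟨_, _, h, rfl, rfl⟩)⟩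
    have hr : ∀ v, (vertexSum T₁ T₂).Reachable v (sumRight m₁ 0) := by
      intro v
      rcases eq_sumLeft_or_sumRight v with ⟨a, rfl⟩ | ⟨a, rfl⟩
      · exact (h₁.connected.preconnected a (Fin.last m₁)).map f
      · exact (h₂.connected.preconnected a 0).map g
    exact ⟨fun u v => (hr u).trans (hr v).symm⟩
  refine SimpleGraph.isTree_iff_connected_and_card.2
    ⟨hconn, le_antisymm ?_ hconn.card_vert_le_card_edgeSet_add_one⟩
  have e₁ := (SimpleGraph.isTree_iff_connected_and_card.1 h₁).2
  have e₂ := (SimpleGraph.isTree_iff_connected_and_card.1 h₂).2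
  have hle : Nat.card (vertexSum T₁ T₂).edgeSet ≤ Nat.card T₁.edgeSet + Nat.card T₂.edgeSet := by
    simp only [Nat.card_coe_set_eq]
    rw [vertexSum, SimpleGraph.edgeSet_sup, SimpleGraph.edgeSet_map, SimpleGraph.edgeSet_map]
    exact (Set.ncard_union_le _ _).trans
      (add_le_add (Set.ncard_image_le (Set.toFinite _)) (Set.ncard_image_le (Set.toFinite _)))
  simp only [Nat.card_eq_fintype_card, Fintype.card_fin] at e₁ e₂ hle ⊢
  omega

/-- The map that pushes the lower half-plane to the left of the line `x = c`, fixing the boundary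
points to the left of `c`. -/
noncomputable def pushLeft (c : ℝ) (v : ℝ × ℝ) : ℝ × ℝ := (min v.1 c + v.2, v.2 - max (v.1 - c) 0)

/-- The map that pushes the lower half-plane to the right of the line `x = 1`, fixing the boundary
points to the right of `1`, followed by the translation by `d`. -/
noncomputable def pushRight (d : ℝ) (v : ℝ × ℝ) : ℝ × ℝ :=
  (max v.1 1 - v.2 + d, v.2 + min (v.1 - 1) 0)

/-- The difference of the two image coordinates is `min x c + max (x - c) 0`, which equals `x`. -/
theorem pushLeft_injective (c : ℝ) : Function.Injective (pushLeft c) := by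
  rintro ⟨x, y⟩ ⟨x', y'⟩ h
  obtain ⟨h1, h2⟩ := Prod.mk.inj h
  have key : ∀ t : ℝ, min t c + max (t - c) 0 = t := fun t => by
    rcases le_total t c with h | h
    · rw [min_eq_left h, max_eq_right (by linarith)]; ring
    · rw [min_eq_right h, max_eq_left (by linarith)]; ring
  have hx : x = x' := by linarith [key x, key x']
  subst hx
  exact Prod.ext rfl (by linarith)

theorem pushRight_injective (d : ℝ) : Function.Injective (pushRight d) := by
  rintro ⟨x, y⟩ ⟨x', y'⟩ h
  obtain ⟨h1, h2⟩ := Prod.mk.inj h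
  have key : ∀ t : ℝ, max t 1 + min (t - 1) 0 = t := fun t => by
    rcases le_total t 1 with h | h
    · rw [max_eq_right h, min_eq_left (by linarith)]; ring
    · rw [max_eq_left h, min_eq_right (by linarith)]; ring
  have hx : x = x' := by linarith [key x, key x']
  subst hx
  exact Prod.ext rfl (by linarith)

theorem continuous_pushLeft (c : ℝ) : Continuous (pushLeft c) := by unfold pushLeft; fun_prop

theorem continuous_pushRight (d : ℝ) : Continuous (pushRight d) := by unfold pushRight; fun_prop

theorem pushLeft_boundary {c x : ℝ} (h : x ≤ c) : pushLeft c (x, 0) = (x, 0) := by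
  simp [pushLeft, h]

theorem pushRight_boundary {d x : ℝ} (h : 1 ≤ x) : pushRight d (x, 0) = (x + d, 0) := by
  simp [pushRight, h]

theorem pushLeft_lt {c : ℝ} {v : ℝ × ℝ} (h : v.2 < 0) :
    (pushLeft c v).1 < c ∧ (pushLeft c v).2 < 0 := by
  have h1 := min_le_right v.1 c
  have h2 := le_max_right (v.1 - c) 0
  constructor <;> simp only [pushLeft] <;> linarith

theorem pushRight_lt {d : ℝ} {v : ℝ × ℝ} (h : v.2 < 0) :
    1 + d < (pushRight d v).1 ∧ (pushRight d v).2 < 0 := by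
  have h1 := le_max_right v.1 1
  have h2 := min_le_right (v.1 - 1) 0
  constructor <;> simp only [pushRight] <;> linarith

/-- Interiors of arcs go strictly to the left of the shared vertex for the first drawing and
strictly to the right for the second, so arcs of different summands are disjoint; within a summand,
disjointness is kept by injectivity. -/
theorem IsEspalier.vertexSum (h₁ : IsEspalier T₁) (h₂ : IsEspalier T₂) :
    IsEspalier (vertexSum T₁ T₂) := by
  obtain ⟨t₁, γ₁, a₁, d₁⟩ := h₁
  obtain ⟨t₂, γ₂, a₂, d₂⟩ := h₂
  obtain ⟨γ, hl, hr⟩ : ∃ γ : Fin (m₁ + m₂ + 1) → Fin (m₁ + m₂ + 1) → ℝ → ℝ × ℝ,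
      (∀ a b, γ (sumLeft m₂ a) (sumLeft m₂ b) = pushLeft (m₁ + 1) ∘ γ₁ a b) ∧
      ∀ a b, a < b → γ (sumRight m₁ a) (sumRight m₁ b) = pushRight m₁ ∘ γ₂ a b := by
    -- The shared vertex does not make the case distinction ambiguous: for `a < b` in the second
    -- graph, the larger vertex is mapped strictly beyond `m₁`.
    refine ⟨fun i j => if h : (i : ℕ) < m₁ + 1 ∧ (j : ℕ) < m₁ + 1 then
        pushLeft (m₁ + 1) ∘ γ₁ ⟨i, h.1⟩ ⟨j, h.2⟩ else
        pushRight m₁ ∘ γ₂ ⟨i - m₁, by omega⟩ ⟨j - m₁, by omega⟩, fun a b => ?_, fun a b h => ?_⟩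
    · exact dif_pos ⟨a.isLt, b.isLt⟩
    · have h' : (a : ℕ) < b := h
      refine (dif_neg fun hab => ?_).trans ?_
      · have h1 : m₁ + (b : ℕ) < m₁ + 1 := hab.2
        omega
      · simp [sumRight]
  have hcases : ∀ i j, i < j → (_root_.vertexSum T₁ T₂).Adj i j →
      (∃ a b, a < b ∧ T₁.Adj a b ∧ sumLeft m₂ a = i ∧ sumLeft m₂ b = j) ∨
        ∃ a b, a < b ∧ T₂.Adj a b ∧ sumRight m₁ a = i ∧ sumRight m₁ b = j := by
    intro i j hij h
    rcases vertexSum_adj.1 h with ⟨a, b, hab, rfl, rfl⟩ | ⟨a, b, hab, rfl, rfl⟩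
    · exact Or.inl ⟨a, b, hij, hab, rfl, rfl⟩
    · exact Or.inr ⟨a, b, Nat.lt_of_add_lt_add_left hij, hab, rfl, rfl⟩
  have hcross : ∀ a b a' b', a < b → T₁.Adj a b → a' < b' → T₂.Adj a' b' →
      Disjoint ((pushLeft (m₁ + 1) ∘ γ₁ a b) '' Set.Ioo 0 1)
        ((pushRight m₁ ∘ γ₂ a' b') '' Set.Ioo 0 1) := by
    intro a b a' b' hab h hab' h'
    rw [Set.disjoint_left]
    rintro _ ⟨s, hs, rfl⟩ ⟨t, ht, hst⟩
    have h1 := (pushLeft_lt (c := m₁ + 1) ((a₁ a b hab h).2.2.2.2 s hs)).1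
    have h2 := (pushRight_lt (d := m₁) ((a₂ a' b' hab' h').2.2.2.2 t ht)).1
    rw [Function.comp_apply, Function.comp_apply] at hst
    rw [hst] at h2
    linarith
  refine ⟨vertexSum_isTree t₁ t₂, γ, ?_, ?_⟩
  · intro i j hij hG
    rcases hcases i j hij hG with ⟨a, b, hab, h, rfl, rfl⟩ | ⟨a, b, hab, h, rfl, rfl⟩
    · obtain ⟨c1, c2, c3, c4, c5⟩ := a₁ a b hab h
      have hb : ∀ a : Fin (m₁ + 1), ((a : ℕ) : ℝ) + 1 ≤ m₁ + 1 := fun a => by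
        exact_mod_cast Nat.lt_succ_iff.1 (Nat.succ_lt_succ a.isLt)
      rw [hl]
      refine ⟨(continuous_pushLeft _).comp_continuousOn c1, (pushLeft_injective _).comp_injOn c2,
        ?_, ?_, fun t ht => (pushLeft_lt (c5 t ht)).2⟩
      · rw [Function.comp_apply, c3, pushLeft_boundary (hb a)]; rfl
      · rw [Function.comp_apply, c4, pushLeft_boundary (hb b)]; rfl
    · obtain ⟨c1, c2, c3, c4, c5⟩ := a₂ a b hab h
      have hb : ∀ a : Fin (m₂ + 1), (1 : ℝ) ≤ ((a : ℕ) : ℝ) + 1 := fun a => by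
        linarith [Nat.cast_nonneg (α := ℝ) (a : ℕ)]
      have hv : ∀ a : Fin (m₂ + 1), ((a : ℕ) : ℝ) + 1 + m₁ = ((sumRight m₁ a : ℕ) : ℝ) + 1 :=
        fun a => by rw [val_sumRight]; push_cast; ring
      rw [hr a b hab]
      refine ⟨(continuous_pushRight _).comp_continuousOn c1, (pushRight_injective _).comp_injOn c2,
        ?_, ?_, fun t ht => (pushRight_lt (c5 t ht)).2⟩
      · rw [Function.comp_apply, c3, pushRight_boundary (hb a), hv]
      · rw [Function.comp_apply, c4, pushRight_boundary (hb b), hv]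
  · intro i j k l hij hG hkl hG' hne
    rcases hcases i j hij hG with ⟨a, b, hab, h, rfl, rfl⟩ | ⟨a, b, hab, h, rfl, rfl⟩ <;>
      rcases hcases k l hkl hG' with ⟨a', b', hab', h', rfl, rfl⟩ | ⟨a', b', hab', h', rfl, rfl⟩
    · rw [hl, hl, Set.image_comp, Set.image_comp, Set.disjoint_image_iff (pushLeft_injective _)]
      refine d₁ a b a' b' hab h hab' h' fun he => hne ?_
      obtain ⟨rfl, rfl⟩ := Prod.mk.inj he
      rfl
    · rw [hl, hr a' b' hab']
      exact hcross a b a' b' hab h hab' h'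
    · rw [hl, hr a b hab]
      exact (hcross a' b' a b hab' h' hab h).symm
    · rw [hr a b hab, hr a' b' hab', Set.image_comp, Set.image_comp,
        Set.disjoint_image_iff (pushRight_injective _)]
      refine d₂ a b a' b' hab h hab' h' fun he => hne ?_
      obtain ⟨rfl, rfl⟩ := Prod.mk.inj he
      rfl

/-! ### Homogeneous words and closures for vertex sums. -/

namespace Braid

/-- The product of words in the generators of two summands. -/
def sumWord (w₁ : List (BandLetter m₁)) (w₂ : List (BandLetter m₂)) :
    List (BandLetter (m₁ + m₂)) :=
  w₁.map (BandLetter.shift (val_sumLeft (m₂ := m₂))) ++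
    w₂.map (BandLetter.shift (val_sumRight (m₁ := m₁)))

variable {w₁ : List (BandLetter m₁)} {w₂ : List (BandLetter m₂)}

theorem mem_sumWord {a : BandLetter (m₁ + m₂)} : a ∈ sumWord w₁ w₂ ↔
    (∃ b ∈ w₁, b.shift (val_sumLeft (m₂ := m₂)) = a) ∨
      ∃ b ∈ w₂, b.shift (val_sumRight (m₁ := m₁)) = a := by
  rw [sumWord, List.mem_append, List.mem_map, List.mem_map]

theorem IsHomogeneousWord.sumWord (h₁ : IsHomogeneousWord T₁ w₁) (h₂ : IsHomogeneousWord T₂ w₂) :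
    IsHomogeneousWord (vertexSum T₁ T₂) (sumWord w₁ w₂) := by
  obtain ⟨a₁, e₁, s₁⟩ := h₁
  obtain ⟨a₂, e₂, s₂⟩ := h₂
  refine ⟨fun a ha => ?_, fun i j hij h => ?_, fun a ha b hb hi hj => ?_⟩
  · rcases mem_sumWord.1 ha with ⟨b, hb, rfl⟩ | ⟨b, hb, rfl⟩
    · exact vertexSum_adj.2 (Or.inl ⟨_, _, a₁ b hb, rfl, rfl⟩)
    · exact vertexSum_adj.2 (Or.inr ⟨_, _, a₂ b hb, rfl, rfl⟩)
  · rcases vertexSum_adj.1 h with ⟨a, b, hab, rfl, rfl⟩ | ⟨a, b, hab, rfl, rfl⟩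
    · obtain ⟨l, hl, rfl, rfl⟩ := e₁ a b hij hab
      exact ⟨_, mem_sumWord.2 (Or.inl ⟨l, hl, rfl⟩), rfl, rfl⟩
    · obtain ⟨l, hl, rfl, rfl⟩ := e₂ a b (Nat.lt_of_add_lt_add_left hij) hab
      exact ⟨_, mem_sumWord.2 (Or.inr ⟨l, hl, rfl⟩), rfl, rfl⟩
  -- The larger index of a letter is at most `m₁` in the first summand and exceeds `m₁` in the
  -- second, so no generator occurs in both and their signs cannot conflict.
  · have hne : ∀ (c : BandLetter m₁) (d : BandLetter m₂), sumLeft m₂ c.j ≠ sumRight m₁ d.j := by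
      intro c d h
      have h1 : (c.j : ℕ) = m₁ + d.j := congrArg Fin.val h
      have h2 := c.j.isLt
      have h3 : (d.i : ℕ) < d.j := d.lt
      omega
    rcases mem_sumWord.1 ha with ⟨c, hc, rfl⟩ | ⟨c, hc, rfl⟩ <;>
      rcases mem_sumWord.1 hb with ⟨d, hd, rfl⟩ | ⟨d, hd, rfl⟩
    · exact s₁ c hc d hd (sumLeft_injective hi) (sumLeft_injective hj)
    · exact (hne c d hj).elim
    · exact (hne d c hj.symm).elim
    · exact s₂ c hc d hd (sumRight_injective hi) (sumRight_injective hj)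

/-- The geometry concerns Artin words while homogeneity concerns band words. The two meet because
shifting strands is a homomorphism of braid groups that carries band generators to band generators.
-/
theorem exists_isConnectedSum {K₁ K₂ : PolygonalLink} (h₁ : IsClosure (ofBandWord w₁) K₁)
    (h₂ : IsClosure (ofBandWord w₂) K₂) :
    ∃ K, PolygonalLink.IsConnectedSum K₁ K₂ K ∧ IsClosure (ofBandWord (sumWord w₁ w₂)) K := by
  obtain ⟨u₁, hu₁, i₁⟩ := h₁
  obtain ⟨u₂, hu₂, i₂⟩ := h₂
  obtain ⟨L₁, L₂, L, k₁, k₂, k, hs⟩ := isConnectedSum_closure_append u₁ u₂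
  refine ⟨_, ⟨L₁, L₂, L, i₁.trans k₁, i₂.trans k₂, k, hs⟩, _, ?_, .refl _⟩
  have e₁ := ofArtinWord_map (Fin.castAdd m₂) (c := 0) (fun i => (Nat.zero_add _).symm) u₁
  have e₂ := ofArtinWord_map (Fin.natAdd m₁) (fun i => Fin.val_natAdd m₁ i) u₂
  rw [hu₁, ← ofBandWord_map _ _ (val_sumLeft (m₂ := m₂))] at e₁
  rw [hu₂, ← ofBandWord_map _ _ (val_sumRight (m₁ := m₁))] at e₂
  rw [sumWord, ofArtinWord, List.map_append, List.prod_append, ofBandWord, List.map_append,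
    List.prod_append]
  exact congrArg₂ (· * ·) e₁ e₂

theorem IsClosure.of_isotopic {m : ℕ} {β : Braid m} {K L : PolygonalLink} (h : IsClosure β L)
    (hKL : PolygonalLink.Isotopic K L) : IsClosure β K := by
  obtain ⟨w, hw, hi⟩ := h
  exact ⟨w, hw, hKL.trans hi⟩

end Braid

end vertexSum

theorem mainTheorem7 (m₁ m₂ : ℕ) (T₁ : SimpleGraph (Fin (m₁ + 1)))
    (T₂ : SimpleGraph (Fin (m₂ + 1))) (hT₁ : IsEspalier T₁) (hT₂ : IsEspalier T₂) :
    IsEspalier (vertexSum T₁ T₂) ∧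
    ∀ K₁ K₂ : PolygonalLink, K₁.IsKnot → K₂.IsKnot →
      ((∃ β₁, Braid.IsHomogeneous T₁ β₁ ∧ Braid.IsClosure β₁ K₁) →
        (∃ β₂, Braid.IsHomogeneous T₂ β₂ ∧ Braid.IsClosure β₂ K₂) →
        (∃ K, PolygonalLink.IsConnectedSum K₁ K₂ K) ∧
        ∀ K, PolygonalLink.IsConnectedSum K₁ K₂ K →
          ∃ β, Braid.IsHomogeneous (vertexSum T₁ T₂) β ∧ Braid.IsClosure β K) ∧
      ((∃ β₁, Braid.IsPositive T₁ β₁ ∧ Braid.IsClosure β₁ K₁) →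
        (∃ β₂, Braid.IsPositive T₂ β₂ ∧ Braid.IsClosure β₂ K₂) →
        (∃ K, PolygonalLink.IsConnectedSum K₁ K₂ K) ∧
        ∀ K, PolygonalLink.IsConnectedSum K₁ K₂ K →
          ∃ β, Braid.IsPositive (vertexSum T₁ T₂) β ∧ Braid.IsClosure β K) := by
  refine ⟨hT₁.vertexSum hT₂, fun K₁ K₂ hK₁ hK₂ => ⟨?_, ?_⟩⟩
  · rintro ⟨_, ⟨w₁, h₁, rfl⟩, c₁⟩ ⟨_, ⟨w₂, h₂, rfl⟩, c₂⟩
    -- One connected sum has been constructed; any other is isotopic to it, and being a closure of a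
    -- given braid is invariant under isotopy.
    obtain ⟨K, hK, hc⟩ := Braid.exists_isConnectedSum c₁ c₂
    exact ⟨⟨K, hK⟩, fun L hL => ⟨_, ⟨_, h₁.sumWord h₂, rfl⟩,
      hc.of_isotopic (hL.isotopic hK₁ hK₂ hK)⟩⟩
  · rintro ⟨_, ⟨w₁, h₁, p₁, rfl⟩, c₁⟩ ⟨_, ⟨w₂, h₂, p₂, rfl⟩, c₂⟩
    obtain ⟨K, hK, hc⟩ := Braid.exists_isConnectedSum c₁ c₂
    refine ⟨⟨K, hK⟩, fun L hL => ⟨_, ⟨_, h₁.sumWord h₂, fun a ha => ?_, rfl⟩,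
      hc.of_isotopic (hL.isotopic hK₁ hK₂ hK)⟩⟩
    rcases Braid.mem_sumWord.1 ha with ⟨b, hb, rfl⟩ | ⟨b, hb, rfl⟩
    exacts [p₁ b hb, p₂ b hb]

end
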